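/- Let $\mathbb{R}_\tau=\{x+\tau y\}$, $\tau^2=1$, be the algebra of para-complex numbers, $\mathbf q(z,w)=\sum_{i=1}^{2m+1} z_i\,\overline{w_{2m+2-i}}$ on $\mathbb{R}_\tau^{2m+1}$ ($m\ge1$), and let $\mathbb{H}^{2m}_\tau$ be the quotient of $\{\mathbf q(z,z)=-1\}$ by the para-complex numbers of absolute value one. It carries the neutral metric $\mathbf g=\mathrm{Re}\,\mathbf q$ (para-holomorphic sectional curvature $-4$), the para-complex structure $\mathbf P$ (multiplication by $\tau$), the form $\boldsymbol\omega=\mathbf g(\cdot,\mathbf P\cdot)$, and an isometric action of $\mathrm{SL}(2m+1,\mathbb{R})$. Let $\Sigma$ be a closed connected oriented surface of genus at least $2$ with universal cover $\widetilde\Sigma$, let $\rho:\pi_1(\Sigma)\to\mathrm{SL}(2m+1,\mathbb{R})$ be a representation, and let $\sigma:\widetilde\Sigma\to\mathbb{H}^{2m}_\tau$ be a smooth $\rho$-equivariant immersion which is *isotropic $\mathbf P$-alternating*. This means that $\sigma^*T\mathbb{H}^{2m}_\tau$ is an orthogonal direct sum of smooth rank-two subbundles $\mathscr L_1=d\sigma(T\widetilde\Sigma),\mathscr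 L_2,\dots,\mathscr L_{2m}$, on each of which $\mathbf g$ is definite, such that - for the pulled-back Levi-Civita connection $\nabla$ and a section $\nu$ of $\mathscr L_j$, the $\mathscr L_i$-component of $\nabla_X\nu$ vanishes if $|i-j|\ge2$; - for $2\le i\le 2m$ and every tangent vector $X$, the map $\eta_i(X):\mathscr L_{i-1}\to\mathscr L_i$, where $\eta_i(X)\nu$ is the $\mathscr L_i$-component of $\nabla_X\nu$, is conformal (possibly zero); - $\mathbf g$ is positive definite on $\mathscr L_i$ for $i$ odd, $\mathbf P(\mathscr L_{2k-1})=\mathscr L_{2m-2(k-1)}$ for $1\le k\le m$, and $\boldsymbol\omega$ vanishes on each $\mathscr L_i$. Assume that $\sigma(\widetilde\Sigma)$ is not contained in any para-complex hyperbolic subspace of $\mathbb{H}^{2m}_\tau$ of real codimension $4$, and that the divisors satisfy $(\eta_2)\prec(\eta_3)\prec\cdots\prec(\eta_{m+1})$. Here $(\eta_i)$ assigns to a point the multiplicity of the zero of $\eta_i$ there ($\eta_i$ being a holomorphic form in holomorphic frames, this is its order of vanishing, equal to $\infty$ if $\eta_i\equiv0$), and $(\alpha)\prec(\beta)$ means that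 $(\alpha)$ is strictly smaller than $(\beta)$ at every point where $\alpha$ vanishes. Put $\mathcal N^+=\mathscr L_3\oplus\mathscr L_5\oplus\cdots\oplus\mathscr L_{2m-1}$ and $\mathcal N^-=\mathscr L_2\oplus\mathscr L_4\oplus\cdots\oplus\mathscr L_{2m}$. Then: 1. For every smooth variation $(\sigma_t)_{|t|<\varepsilon}$ of $\sigma=\sigma_0$ by immersions into $\mathbb{H}^{2m}_\tau$ with $\sigma_t=\sigma$ outside a compact set $K$, and with variational field $\dot\sigma$ not identically zero: if $\dot\sigma$ is a section of $\mathcal N^+$, then $t\mapsto\mathrm{Area}(\sigma_t|_K)$ is twice continuously differentiable near $t=0$ with positive second derivative at $t=0$; if $\dot\sigma$ is a section of $\mathcal N^-$, the same holds with negative second derivative. 2. $\sigma$ has no non-zero compactly supported Jacobi field: if $\xi$ is a smooth compactly supported section of the normal bundle $\mathcal N$ with $$L\xi=\Delta^{\mathcal N}\xi+\sum_{i,j}\mathbf g(\mathrm{II}(e_i,e_j),\xi)\,\mathrm{II}(e_i,e_j)-\mathrm{tr}\,R^\nabla(\cdot,\xi)\,\cdot\;=0,$$ where $e_1,e_2$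 is an orthonormal tangent frame and $R^\nabla(X,Y)Z=\nabla_X\nabla_YZ-\nabla_Y\nabla_XZ-\nabla_{[X,Y]}Z$ is the ambient curvature, then $\xi=0$. -/

import Mathlib

open scoped ContDiff

/-! Matrices carry the operator norm associated with the sup norm; in finite dimension the choice
of the norm does not matter, it only serves to speak of smooth matrix-valued maps. -/

attribute [local instance] Matrix.linftyOpNormedRing Matrix.linftyOpNormedAlgebra

noncomputable section

namespace ParaHyp

/-! ### Para-complex numbers and the hyperboloid -/

/-- The algebra `ℝ_τ` of para-complex numbers `x + τ y`, `τ ^ 2 = 1`; `star` is the conjugation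
`x + τ y ↦ x - τ y`. -/
abbrev PC : Type := QuadraticAlgebra ℝ 1 0

/-- The unit `τ`. -/
def tau : PC := ⟨0, 1⟩

/-- The para-Hermitian form `q (z, w) = zᵗ Q w̄` on `ℝ_τ ^ (n+1)`, where `Q` is the antidiagonal
matrix with entries `1`. -/
def qform {n : ℕ} (z w : Fin (n + 1) → PC) : PC := ∑ i, z i * star (w i.rev)

/-- The quadric `{z | q (z, z) = -1}`. -/
def hyperboloid (n : ℕ) : Set (Fin (n + 1) → PC) := {z | qform z z = -1}

/-- Real `(n+1) × (n+1)` matrices. -/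
abbrev Mat (n : ℕ) : Type := Matrix (Fin (n + 1)) (Fin (n + 1)) ℝ

/-- The component `z⁺ = x + y` of `z = x + τ y = z⁺ e₊ + z⁻ e₋`. -/
def plus (z : PC) : ℝ := z.re + z.im

/-- The component `z⁻ = x - y` of `z = x + τ y = z⁺ e₊ + z⁻ e₋`. -/
def minus (z : PC) : ℝ := z.re - z.im

/-- The real bilinear map `(z, w) ↦ - z⁺ (Q w⁻)ᵗ`, that is, the `e₊`-component of the
para-complex matrix `- z w̄ᵗ Q`. -/
def projBilin {n : ℕ} (z w : Fin (n + 1) → PC) : Mat n :=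
  Matrix.of fun i j => -(plus (z i) * minus (w j.rev))

/-- For `z` in the quadric, the matrix of the projection of `ℝ ^ (n+1)` onto the line spanned
by `z⁺` along the hyperplane annihilated by `(Q z⁻)ᵗ`. It determines `z` exactly up to
multiplication by para-complex numbers of absolute value one (`projMat_eq_iff`). -/
def projMat {n : ℕ} (z : Fin (n + 1) → PC) : Mat n := projBilin z z

/-- The differential of `projMat` at `z` in the direction `v`. -/
def dprojMat {n : ℕ} (z v : Fin (n + 1) → PC) : Mat n := projBilin z v + projBilin v z

/-! ### The para-complex hyperbolic space

The para-complex hyperbolic space is the quotient of the quadric by the group of para-complex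
numbers of absolute value one. The map `projMat` is constant on the orbits of this group and
separates them, and `dprojMat z` is injective on the `q`-orthogonal complement of `z`. We
use it to realise the quotient as a submanifold of the space of matrices: a point is the
corresponding rank one projection `M` of `ℝ ^ (n+1)` (equivalently, a line and a transverse
hyperplane). The facts proved below say that in this realisation the tangent space, the metric
`Re q` and the multiplication by `τ` are `tangentSpace`, `metric` and `paraCx`. -/

/-- The para-complex hyperbolic space of para-complex dimension `n`. -/
def paraHyp (n : ℕ) : Set (Mat n) := projMat '' hyperboloid n

/-- The tangent space of the para-complex hyperbolic space at `M`. -/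
def tangentSpace {n : ℕ} (M : Mat n) : Submodule ℝ (Mat n) where
  carrier := {X | M * X + X * M = X}
  add_mem' := by
    intro X Y hX hY
    change M * X + X * M = X at hX
    change M * Y + Y * M = Y at hY
    change M * (X + Y) + (X + Y) * M = X + Y
    rw [mul_add, add_mul, add_add_add_comm, hX, hY]
  zero_mem' := by simp
  smul_mem' := by
    intro c X hX
    change M * X + X * M = X at hX
    change M * (c • X) + (c • X) * M = c • X
    rw [mul_smul_comm, smul_mul_assoc, ← smul_add, hX]

/-- The pseudo-Riemannian metric `g`, defined on all of the space of matrices. On tangent vectors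
it is `Re q`, and its para-holomorphic sectional curvature is `-4`. -/
def metric {n : ℕ} (X Y : Mat n) : ℝ := -(1 / 2) * (X * Y).trace

/-- The para-complex structure `P` at the point `M`, multiplication by `τ`. -/
def paraCx {n : ℕ} (M : Mat n) : Mat n →ₗ[ℝ] Mat n where
  toFun X := X * M - M * X
  map_add' X Y := by noncomm_ring
  map_smul' c X := by simp [smul_sub]

/-- The symplectic form `ω = g (·, P ·)` at the point `M`. -/
def omega {n : ℕ} (M X Y : Mat n) : ℝ := metric X (paraCx M Y)

/-- The orthogonal projection of the space of matrices onto the tangent space at `M`. -/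
def tanProj {n : ℕ} (M X : Mat n) : Mat n := M * X * (1 - M) + (1 - M) * X * M

/-! Comparison with the hyperboloid. -/

lemma plus_add_qform {n : ℕ} (z w : Fin (n + 1) → PC) :
    plus (qform z w) = ∑ i, plus (z i) * minus (w i.rev) := by
  have h1 : (qform z w).re = ∑ i, (z i * star (w i.rev)).re := by
    unfold qform
    exact map_sum (⟨⟨fun x : PC => x.re, rfl⟩, fun _ _ => rfl⟩ : PC →+ ℝ) _ _
  have h2 : (qform z w).im = ∑ i, (z i * star (w i.rev)).im := by
    unfold qform
    exact map_sum (⟨⟨fun x : PC => x.im, rfl⟩, fun _ _ => rfl⟩ : PC →+ ℝ) _ _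
  simp only [plus, minus, h1, h2, ← Finset.sum_add_distrib]
  refine Finset.sum_congr rfl fun i _ => ?_
  simp
  ring

lemma minus_qform {n : ℕ} (z w : Fin (n + 1) → PC) :
    minus (qform z w) = ∑ i, minus (z i) * plus (w i.rev) := by
  have h1 : (qform z w).re = ∑ i, (z i * star (w i.rev)).re := by
    unfold qform
    exact map_sum (⟨⟨fun x : PC => x.re, rfl⟩, fun _ _ => rfl⟩ : PC →+ ℝ) _ _
  have h2 : (qform z w).im = ∑ i, (z i * star (w i.rev)).im := by
    unfold qform
    exact map_sum (⟨⟨fun x : PC => x.im, rfl⟩, fun _ _ => rfl⟩ : PC →+ ℝ) _ _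
  simp only [plus, minus, h1, h2, ← Finset.sum_sub_distrib]
  refine Finset.sum_congr rfl fun i _ => ?_
  simp
  ring

lemma plus_neg_one : plus (-1) = -1 := by
  change -(1 : ℝ) + -(0 : ℝ) = -1
  norm_num

lemma minus_neg_one : minus (-1) = -1 := by
  change -(1 : ℝ) - -(0 : ℝ) = -1
  norm_num

/-- The para-complex number `p e₊ + r e₋`. -/
def ofParts (p r : ℝ) : PC := ⟨(p + r) / 2, (p - r) / 2⟩

lemma plus_ofParts (p r : ℝ) : plus (ofParts p r) = p := by
  simp only [plus, ofParts]; ring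

lemma minus_ofParts (p r : ℝ) : minus (ofParts p r) = r := by
  simp only [minus, ofParts]; ring

lemma plus_one : plus 1 = 1 := by
  change (1 : ℝ) + 0 = 1
  norm_num

lemma minus_one : minus 1 = 1 := by
  change (1 : ℝ) - 0 = 1
  norm_num

lemma plus_star (z : PC) : plus (star z) = minus z := by
  simp [plus, minus]; ring

lemma minus_star (z : PC) : minus (star z) = plus z := by
  simp [plus, minus]

lemma plus_mul (z w : PC) : plus (z * w) = plus z * plus w := by
  simp [plus]; ring

lemma minus_mul (z w : PC) : minus (z * w) = minus z * minus w := by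
  simp [minus]; ring

lemma pc_ext {z w : PC} (h1 : plus z = plus w) (h2 : minus z = minus w) : z = w := by
  unfold plus at h1
  unfold minus at h2
  ext <;> linarith

lemma sum_minus_plus {n : ℕ} (z w : Fin (n + 1) → PC) :
    ∑ i, minus (z i.rev) * plus (w i) = minus (qform z w) := by
  rw [minus_qform, ← Equiv.sum_comp Fin.revPerm]
  simp

lemma mem_hyperboloid_iff {n : ℕ} (z : Fin (n + 1) → PC) :
    z ∈ hyperboloid n ↔ ∑ i, minus (z i.rev) * plus (z i) = -1 := by
  have key : plus (qform z z) = minus (qform z z) := by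
    rw [← sum_minus_plus, plus_add_qform]
    exact Finset.sum_congr rfl fun i _ => mul_comm _ _
  rw [sum_minus_plus]
  constructor
  · intro h
    have h' : qform z z = -1 := h
    rw [h', minus_neg_one]
  · intro h
    apply pc_ext
    · rw [key, h, plus_neg_one]
    · rw [h, minus_neg_one]

/-- `projBilin a b * projBilin c d = - (Q b⁻ · c⁺) projBilin a d`. -/
lemma projBilin_mul {n : ℕ} (a b c d : Fin (n + 1) → PC) :
    projBilin a b * projBilin c d = -(minus (qform b c)) • projBilin a d := by
  ext i j
  rw [← sum_minus_plus, Matrix.mul_apply]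
  simp only [projBilin, Matrix.of_apply, Matrix.smul_apply, smul_eq_mul]
  rw [neg_mul_neg, Finset.sum_mul]
  refine Finset.sum_congr rfl fun k _ => ?_
  ring

lemma trace_projBilin {n : ℕ} (a b : Fin (n + 1) → PC) :
    (projBilin a b).trace = -(minus (qform b a)) := by
  rw [← sum_minus_plus, Matrix.trace, ← Finset.sum_neg_distrib]
  refine Finset.sum_congr rfl fun k _ => ?_
  simp [projBilin, mul_comm]

lemma minus_qform_self {n : ℕ} {z : Fin (n + 1) → PC} (hz : z ∈ hyperboloid n) :
    minus (qform z z) = -1 := by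
  have h' : qform z z = -1 := hz
  rw [h', minus_neg_one]

lemma qform_swap {n : ℕ} (z w : Fin (n + 1) → PC) :
    minus (qform z w) = plus (qform w z) := by
  rw [← sum_minus_plus, plus_add_qform]
  exact Finset.sum_congr rfl fun i _ => mul_comm _ _

/-- The points of the para-complex hyperbolic space are the rank one projections. -/
theorem mem_paraHyp_iff {n : ℕ} (M : Mat n) : M ∈ paraHyp n ↔ M * M = M ∧ M.trace = 1 := by
  constructor
  · rintro ⟨z, hz, rfl⟩
    unfold projMat
    rw [projBilin_mul, trace_projBilin, minus_qform_self hz]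
    simp
  · rintro ⟨hM, ht⟩
    have hid : IsIdempotentElem (Matrix.toLin' M) := by
      change Matrix.toLin' M * Matrix.toLin' M = Matrix.toLin' M
      rw [Module.End.mul_eq_comp, ← Matrix.toLin'_mul, hM]
    have htr := (LinearMap.IsIdempotentElem.isProj_range (Matrix.toLin' M) hid).trace
    rw [Matrix.trace_toLin'_eq, ht] at htr
    have hr : Module.finrank ℝ (LinearMap.range (Matrix.toLin' M)) = 1 := by
      exact_mod_cast htr.symm
    obtain ⟨u, -, hu⟩ := finrank_eq_one_iff'.mp hr
    have hc : ∀ j, ∃ c : ℝ, ∀ i, M i j = c * (u : Fin (n + 1) → ℝ) i := by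
      intro j
      obtain ⟨c, hc⟩ := hu ⟨Matrix.toLin' M (Pi.single j 1), LinearMap.mem_range_self _ _⟩
      refine ⟨c, fun i => ?_⟩
      have := congrFun (congrArg Subtype.val hc) i
      simpa using this.symm
    choose c hc using hc
    refine ⟨fun i => ofParts ((u : Fin (n + 1) → ℝ) i) (-c i.rev), ?_, ?_⟩
    · rw [mem_hyperboloid_iff]
      have h1 : M.trace = ∑ i, M i i := rfl
      rw [← neg_inj, neg_neg, ← Finset.sum_neg_distrib, ← ht, h1]
      refine Finset.sum_congr rfl fun i _ => ?_
      rw [plus_ofParts, minus_ofParts, Fin.rev_rev, hc]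
      ring
    · ext i j
      simp only [projMat, projBilin, plus_ofParts, minus_ofParts, Fin.rev_rev, Matrix.of_apply, hc]
      ring

/-- The fibres of `projMat` on the quadric are the orbits of the group of para-complex numbers of
absolute value one. -/
theorem projMat_eq_iff {n : ℕ} {z w : Fin (n + 1) → PC} (hz : z ∈ hyperboloid n)
    (hw : w ∈ hyperboloid n) :
    projMat z = projMat w ↔ ∃ l : PC, l * star l = 1 ∧ w = l • z := by
  have hz' := (mem_hyperboloid_iff z).1 hz
  have hw' := (mem_hyperboloid_iff w).1 hw
  constructor
  · intro h
    have hij : ∀ i j : Fin (n + 1), plus (z i) * minus (z j.rev) = plus (w i) * minus (w j.rev) := by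
      intro i j
      have := congrFun (congrFun h i) j
      simpa [projMat, projBilin] using this
    have hp : ∀ i, plus (w i) = -(∑ j, minus (z j.rev) * plus (w j)) * plus (z i) := by
      intro i
      have : -(∑ j, minus (z j.rev) * plus (w j)) * plus (z i)
          = -(∑ j, minus (w j.rev) * plus (w j)) * plus (w i) := by
        rw [neg_mul, neg_mul, Finset.sum_mul, Finset.sum_mul]
        congr 1
        refine Finset.sum_congr rfl fun j _ => ?_
        linear_combination plus (w j) * hij i j
      rw [this, hw']; ring
    have hm : ∀ i, minus (w i) = -(∑ j, minus (w j.rev) * plus (z j)) * minus (z i) := by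
      intro i
      have : -(∑ j, minus (w j.rev) * plus (z j)) * minus (z i)
          = -(∑ j, minus (z j.rev) * plus (z j)) * minus (w i) := by
        rw [neg_mul, neg_mul, Finset.sum_mul, Finset.sum_mul]
        congr 1
        refine Finset.sum_congr rfl fun j _ => ?_
        have h2 : ∀ k, plus (z j) * minus (z k) = plus (w j) * minus (w k) := by
          intro k
          have := hij j k.rev
          simpa only [Fin.rev_rev] using this
        have h3 := hp j
        set s := -(∑ j, minus (z j.rev) * plus (w j)) with hs
        have hs0 : s ≠ 0 := by
          intro h0
          have : ∀ k, plus (w k) = 0 := fun k => by rw [hp k, h0, zero_mul]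
          simp [this] at hw'
        rcases eq_or_ne (plus (z j)) 0 with h0 | h0
        · simp [h0]
        · have e1 : ∀ k, minus (z k) = s * minus (w k) := by
            intro k
            have := h2 k
            rw [h3] at this
            apply mul_left_cancel₀ h0
            linear_combination this
          rw [e1 i, e1 j.rev]
          ring
      rw [this, hz']; ring
    set a := -(∑ j, minus (z j.rev) * plus (w j)) with ha
    set b := -(∑ j, minus (w j.rev) * plus (z j)) with hb
    have hab : a * b = 1 := by
      have : ∑ i, minus (w i.rev) * plus (w i)
          = b * a * ∑ i, minus (z i.rev) * plus (z i) := by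
        rw [Finset.mul_sum]
        refine Finset.sum_congr rfl fun i _ => ?_
        rw [hp i, hm i.rev]; ring
      rw [hw', hz'] at this
      linarith
    refine ⟨ofParts a b, ?_, ?_⟩
    · apply pc_ext
      · rw [plus_mul, plus_star, plus_ofParts, minus_ofParts, plus_one, hab]
      · rw [minus_mul, minus_star, plus_ofParts, minus_ofParts, minus_one, mul_comm, hab]
    · funext i
      apply pc_ext
      · rw [hp i, Pi.smul_apply, smul_eq_mul, plus_mul, plus_ofParts]
      · rw [hm i, Pi.smul_apply, smul_eq_mul, minus_mul, minus_ofParts]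
  · rintro ⟨l, hl, rfl⟩
    have h1 : plus l * minus l = 1 := by
      have h2 : (l * star l).re = 1 := congrArg QuadraticAlgebra.re hl
      simp at h2
      simp only [plus, minus]
      linear_combination h2
    ext i j
    simp only [projMat, projBilin, Matrix.of_apply, Pi.smul_apply, smul_eq_mul, plus_mul, minus_mul]
    linear_combination (plus (z i) * minus (z j.rev)) * h1

/-- The tangent space at `projMat z` is the image of the `q`-orthogonal complement of `z`. -/
theorem mem_tangentSpace_iff {n : ℕ} {z : Fin (n + 1) → PC} (hz : z ∈ hyperboloid n) (X : Mat n) :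
    X ∈ tangentSpace (projMat z) ↔ ∃ v, qform z v = 0 ∧ dprojMat z v = X := by
  constructor
  · intro hX
    have hX' : projMat z * X + X * projMat z = X := hX
    have hMM : projMat z * projMat z = projMat z :=
      ((mem_paraHyp_iff _).1 ⟨z, hz, rfl⟩).1
    have h0 : projMat z * X * projMat z = 0 := by
      have := congrArg (fun Y => projMat z * Y) hX'
      simp only [mul_add, ← mul_assoc, hMM] at this
      simpa using this
    let p : Fin (n + 1) → ℝ := fun i => ∑ k, X i k * plus (z k)
    let r : Fin (n + 1) → ℝ := fun j => ∑ k, minus (z k.rev) * X k j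
    have hz' := (mem_hyperboloid_iff z).1 hz
    have hs : ∑ k, minus (z k.rev) * p k = 0 := by
      have htr := congrArg Matrix.trace h0
      rw [Matrix.mul_assoc, Matrix.trace_mul_comm, Matrix.mul_assoc, hMM, Matrix.trace_zero] at htr
      rw [Matrix.trace] at htr
      have : ∑ k, minus (z k.rev) * p k = -∑ i, (X * projMat z).diag i := by
        rw [← Finset.sum_neg_distrib]
        simp only [p, Matrix.diag_apply, Matrix.mul_apply, projMat, projBilin, Matrix.of_apply,
          Finset.mul_sum, ← Finset.sum_neg_distrib]
        refine Finset.sum_congr rfl fun i _ => Finset.sum_congr rfl fun k _ => ?_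
        ring
      rw [this, htr, neg_zero]
    have hs' : ∑ k, r k * plus (z k) = 0 := by
      rw [← hs]
      simp only [r, p, Finset.sum_mul, Finset.mul_sum]
      rw [Finset.sum_comm]
      refine Finset.sum_congr rfl fun i _ => Finset.sum_congr rfl fun k _ => ?_
      ring
    refine ⟨fun i => ofParts (p i) (r i.rev), ?_, ?_⟩
    · apply pc_ext
      · rw [plus_add_qform]
        simp only [minus_ofParts, Fin.rev_rev]
        rw [show plus (0 : PC) = 0 by simp [plus], ← hs']
        exact Finset.sum_congr rfl fun i _ => mul_comm _ _
      · rw [← sum_minus_plus]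
        simp only [plus_ofParts]
        rw [hs]; simp [minus]
    · conv_rhs => rw [← hX']
      ext i j
      simp only [dprojMat, projBilin, Matrix.add_apply, Matrix.of_apply, plus_ofParts,
        minus_ofParts, Fin.rev_rev, Matrix.mul_apply, projMat]
      simp only [r, p, Finset.mul_sum, Finset.sum_mul, ← Finset.sum_neg_distrib]
      congr 1 <;> refine Finset.sum_congr rfl fun k _ => ?_ <;> ring
  · rintro ⟨v, hv, rfl⟩
    change projMat z * dprojMat z v + dprojMat z v * projMat z = dprojMat z v
    have h1 : minus (qform z v) = 0 := by rw [hv]; simp [minus]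
    have h2 : minus (qform v z) = 0 := by rw [qform_swap, hv]; simp [plus]
    simp only [projMat, dprojMat, mul_add, add_mul, projBilin_mul, minus_qform_self hz, h1, h2]
    simp

/-- On tangent vectors the metric is `Re q`. -/
theorem metric_dprojMat {n : ℕ} {z v w : Fin (n + 1) → PC} (hz : z ∈ hyperboloid n)
    (hv : qform z v = 0) (hw : qform z w = 0) :
    metric (dprojMat z v) (dprojMat z w) = (qform v w).re := by
  have h1 : minus (qform z v) = 0 := by rw [hv]; simp [minus]
  have h2 : minus (qform v z) = 0 := by rw [qform_swap, hv]; simp [plus]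
  have h3 : minus (qform z w) = 0 := by rw [hw]; simp [minus]
  have h5 : minus (qform w v) = plus (qform v w) := qform_swap w v
  simp only [metric, dprojMat, mul_add, add_mul, projBilin_mul, Matrix.trace_add,
    Matrix.trace_smul, trace_projBilin, minus_qform_self hz, h1, h2, h3, h5, smul_eq_mul]
  simp only [plus, minus]
  ring

/-- On tangent vectors `paraCx` is the multiplication by `τ`. -/
theorem paraCx_dprojMat {n : ℕ} {z v : Fin (n + 1) → PC} (hz : z ∈ hyperboloid n)
    (hv : qform z v = 0) :
    paraCx (projMat z) (dprojMat z v) = dprojMat z (tau • v) := by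
  have h1 : minus (qform z v) = 0 := by rw [hv]; simp [minus]
  have h2 : minus (qform v z) = 0 := by rw [qform_swap, hv]; simp [plus]
  change dprojMat z v * projMat z - projMat z * dprojMat z v = _
  simp only [projMat, dprojMat, mul_add, add_mul, projBilin_mul, minus_qform_self hz, h1, h2]
  ext i j
  simp [projBilin, plus, minus, tau]
  ring

/-- The action of `A ∈ SL (n+1, ℝ)` on `ℝ_τ ^ (n+1)` through the unitary matrix
`A e₊ + Q (A⁻¹)ᵗ Q e₋`. -/
def act {n : ℕ} (A : Matrix.SpecialLinearGroup (Fin (n + 1)) ℝ) (z : Fin (n + 1) → PC) :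
    Fin (n + 1) → PC :=
  fun i => ofParts (∑ k, (A : Mat n) i k * plus (z k))
    (∑ k, ((A⁻¹ : Matrix.SpecialLinearGroup _ ℝ) : Mat n).transpose i.rev k * minus (z k.rev))

/-- In terms of projections, `SL (n+1, ℝ)` acts by conjugation. -/
theorem projMat_act {n : ℕ} (A : Matrix.SpecialLinearGroup (Fin (n + 1)) ℝ)
    (z : Fin (n + 1) → PC) :
    projMat (act A z) =
      (A : Mat n) * projMat z * ((A⁻¹ : Matrix.SpecialLinearGroup _ ℝ) : Mat n) := by
  ext i j
  simp only [projMat, projBilin, act, plus_ofParts, minus_ofParts, Fin.rev_rev, Matrix.of_apply,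
    Matrix.mul_apply, Matrix.transpose_apply]
  rw [Finset.mul_sum, ← Finset.sum_neg_distrib]
  refine Finset.sum_congr rfl fun k _ => ?_
  rw [Finset.sum_mul, Finset.sum_mul, ← Finset.sum_neg_distrib]
  refine Finset.sum_congr rfl fun l _ => ?_
  ring

/-! ### The curvature of the para-complex hyperbolic space

As the space is a submanifold of a pseudo-Euclidean space with nondegenerate tangent spaces,
its Levi-Civita connection is the tangential part of the directional derivative. -/

/-- The vector field extending a tangent vector `X` by tangential projection. -/
def extend {n : ℕ} (X : Mat n) : Mat n → Mat n := fun N => tanProj N X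

/-- The covariant derivative `∇_V W` of vector fields on the para-complex hyperbolic space. -/
def covField {n : ℕ} (V W : Mat n → Mat n) : Mat n → Mat n :=
  fun N => tanProj N (fderiv ℝ W N (V N))

/-- The Lie bracket `[V, W]` of vector fields. -/
def bracket {n : ℕ} (V W : Mat n → Mat n) : Mat n → Mat n :=
  fun N => fderiv ℝ W N (V N) - fderiv ℝ V N (W N)

/-- The Riemann tensor `R (X, Y) Z = ∇_X ∇_Y Z - ∇_Y ∇_X Z - ∇_[X,Y] Z` at the point `M`. -/
def curvature {n : ℕ} (M X Y Z : Mat n) : Mat n :=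
  covField (extend X) (covField (extend Y) (extend Z)) M
    - covField (extend Y) (covField (extend X) (extend Z)) M
    - covField (bracket (extend X) (extend Y)) (extend Z) M

/-! ### Universal coverings of closed surfaces -/

/-- The plane `ℝ ^ 2`, the universal covering of every closed oriented surface of positive
genus. -/
abbrev Plane : Type := EuclideanSpace ℝ (Fin 2)

/-- `Γ` acts on the plane as the group of deck transformations of the universal covering of a
closed oriented surface: the action is smooth, orientation preserving, free and properly
discontinuous, and the orbit space, which is the surface, is compact. -/
structure IsDeckAction (Γ : Type*) [Group Γ] [MulAction Γ Plane] : Prop where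
  smooth : ∀ γ : Γ, ContDiff ℝ ∞ fun x : Plane => γ • x
  orientation : ∀ (γ : Γ) (x : Plane), 0 < (fderiv ℝ (fun y : Plane => γ • y) x).det
  free : ∀ (γ : Γ) (x : Plane), γ • x = x → γ = 1
  properlyDiscontinuous : ProperlyDiscontinuousSMul Γ Plane
  compact_quotient : CompactSpace (MulAction.orbitRel.Quotient Γ Plane)

/-- The genus of a closed oriented surface with fundamental group `Γ`: half of the first Betti
number, that is, of the rank of the abelianization of `Γ`. -/
def genus (Γ : Type*) [Group Γ] : ℕ := Module.finrank ℤ (Additive (Abelianization Γ)) / 2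

/-! ### Immersed surfaces -/

/-- The vector field `∂_i σ` along `σ`. -/
def coordField {n : ℕ} (σ : Plane → Mat n) (i : Fin 2) : Plane → Mat n :=
  fun x => fderiv ℝ σ x (EuclideanSpace.single i 1)

/-- The first fundamental form of `σ` in the coordinates of the plane. -/
def gram {n : ℕ} (σ : Plane → Mat n) (x : Plane) : Matrix (Fin 2) (Fin 2) ℝ :=
  Matrix.of fun i j => metric (coordField σ i x) (coordField σ j x)

/-- The area of `σ` over the set `K`, for the first fundamental form. -/
def areaOn {n : ℕ} (K : Set Plane) (σ : Plane → Mat n) : ℝ := ∫ x in K, √((gram σ x).det)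

/-- The pull-back of the Levi-Civita connection: `∇_X ξ` at `x`, for a section `ξ` of the
pull-back by `σ` of the tangent bundle and a tangent vector `X` of the surface at `x`. -/
def cov {n : ℕ} (σ : Plane → Mat n) (ξ : Plane → Mat n) (x X : Plane) : Mat n :=
  tanProj (σ x) (fderiv ℝ ξ x X)

/-- `ξ` is a smooth section of the family of subspaces `V`. -/
def IsSection {n : ℕ} (V : Plane → Submodule ℝ (Mat n)) (ξ : Plane → Mat n) : Prop :=
  ContDiff ℝ ∞ ξ ∧ ∀ x, ξ x ∈ V x

/-- The `g`-orthogonal projection of `Z` onto a subspace `V` on which `g` is nondegenerate: the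
unique `W ∈ V` with `Z - W` orthogonal to `V`. -/
def orthProj {n : ℕ} (V : Submodule ℝ (Mat n)) (Z : Mat n) : Mat n :=
  Classical.epsilon fun W => W ∈ V ∧ ∀ Y ∈ V, metric (Z - W) Y = 0

/-! ### Isotropic `P`-alternating surfaces

The subbundles `ℒ_1, …, ℒ_{2m}` are given by a family `L i x`; only the indices `1 ≤ i ≤ 2m`
matter. -/

/-- A smooth subbundle of rank two of the trivial bundle of matrices. -/
structure IsRankTwoSubbundle {n : ℕ} (V : Plane → Submodule ℝ (Mat n)) : Prop where
  finrank_eq : ∀ x, Module.finrank ℝ (V x) = 2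
  locally_spanned : ∀ x, ∃ U : Set Plane, IsOpen U ∧ x ∈ U ∧ ∃ u v : Plane → Mat n,
    ContDiffOn ℝ ∞ u U ∧ ContDiffOn ℝ ∞ v U ∧ ∀ y ∈ U, V y = Submodule.span ℝ {u y, v y}

/-- `L 1, …, L (2m)` is a Frenet splitting of the pull-back by `σ` of the tangent bundle. -/
structure IsFrenetSplitting {m : ℕ} (σ : Plane → Mat (2 * m))
    (L : ℕ → Plane → Submodule ℝ (Mat (2 * m))) : Prop where
  subbundle : ∀ i ∈ Finset.Icc 1 (2 * m), IsRankTwoSubbundle (L i)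
  orthogonal : ∀ i ∈ Finset.Icc 1 (2 * m), ∀ j ∈ Finset.Icc 1 (2 * m), i ≠ j →
    ∀ x, ∀ Y ∈ L i x, ∀ Z ∈ L j x, metric Y Z = 0
  sum_eq : ∀ x, ⨆ i ∈ Finset.Icc 1 (2 * m), L i x = tangentSpace (σ x)
  tangent : ∀ x, L 1 x = LinearMap.range (fderiv ℝ σ x).toLinearMap
  definite : ∀ i ∈ Finset.Icc 1 (2 * m),
    (∀ x, ∀ Y ∈ L i x, Y ≠ 0 → 0 < metric Y Y) ∨ (∀ x, ∀ Y ∈ L i x, Y ≠ 0 → metric Y Y < 0)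
  tridiagonal : ∀ i ∈ Finset.Icc 1 (2 * m), ∀ j ∈ Finset.Icc 1 (2 * m), (i + 2 ≤ j ∨ j + 2 ≤ i) →
    ∀ ν, IsSection (L j) ν → ∀ x X, orthProj (L i x) (cov σ ν x X) = 0

/-- The form `η_i` with values in `Hom (ℒ_{i-1}, ℒ_i)`: the value `η_i (X) ν` at `x`, for a
section `ν` of `ℒ_{i-1}`, is the component in `ℒ_i` of `∇_X ν`. -/
def eta {n : ℕ} (σ : Plane → Mat n) (L : ℕ → Plane → Submodule ℝ (Mat n)) (i : ℕ)
    (ν : Plane → Mat n) (x X : Plane) : Mat n :=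
  orthProj (L i x) (cov σ ν x X)

/-- `σ` is superconformal: `η_i (X)` is conformal, i.e. it multiplies the norm of vectors by a
constant, for all `i = 2, …, 2m` and every tangent vector `X`. -/
def IsSuperconformal {m : ℕ} (σ : Plane → Mat (2 * m))
    (L : ℕ → Plane → Submodule ℝ (Mat (2 * m))) : Prop :=
  ∀ i ∈ Finset.Icc 2 (2 * m), ∀ x X, ∃ c : ℝ, 0 ≤ c ∧ ∀ ν, IsSection (L (i - 1)) ν →
    |metric (eta σ L i ν x X) (eta σ L i ν x X)| = c * |metric (ν x) (ν x)|

/-- `σ` is an isotropic `P`-alternating surface in the para-complex hyperbolic space of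
para-complex dimension `2m`, with Frenet splitting `L`. -/
structure IsIsotropicPAlternating {m : ℕ} (σ : Plane → Mat (2 * m))
    (L : ℕ → Plane → Submodule ℝ (Mat (2 * m))) : Prop where
  mem : ∀ x, σ x ∈ paraHyp (2 * m)
  smooth : ContDiff ℝ ∞ σ
  immersion : ∀ x, Function.Injective (fderiv ℝ σ x)
  frenet : IsFrenetSplitting σ L
  superconformal : IsSuperconformal σ L
  pos_odd : ∀ i ∈ Finset.Icc 1 (2 * m), Odd i → ∀ x, ∀ Y ∈ L i x, Y ≠ 0 → 0 < metric Y Y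
  alternating : ∀ k ∈ Finset.Icc 1 m, ∀ x,
    (L (2 * k - 1) x).map (paraCx (σ x)) = L (2 * m - 2 * (k - 1)) x
  isotropic : ∀ i ∈ Finset.Icc 1 (2 * m), ∀ x, ∀ Y ∈ L i x, ∀ Z ∈ L i x, omega (σ x) Y Z = 0

/-- The surface lies in a para-complex hyperbolic subspace of real codimension four. Such a
subspace comes from a nondegenerate `ℝ_τ`-submodule of rank `2m - 1` of `ℝ_τ ^ (2m+1)`, that is,
from a decomposition `ℝ ^ (2m+1) = V ⊕ W` with `dim V = 2m - 1`, and consists of the rank one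
projections whose image lies in `V` and whose kernel contains `W`. -/
def IsInCodimFour {m : ℕ} (σ : Plane → Mat (2 * m)) : Prop :=
  ∃ V W : Submodule ℝ (Fin (2 * m + 1) → ℝ), IsCompl V W ∧ Module.finrank ℝ V = 2 * m - 1 ∧
    ∀ x, LinearMap.range (Matrix.toLin' (σ x)) ≤ V ∧ W ≤ LinearMap.ker (Matrix.toLin' (σ x))

/-! ### The divisor condition -/

/-- `η_i` vanishes at least to order `k` at `p`, i.e. all of its components in smooth local frames
are `O (|x - p| ^ k)`. -/
def EtaVanishes {n : ℕ} (σ : Plane → Mat n) (L : ℕ → Plane → Submodule ℝ (Mat n)) (i : ℕ)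
    (p : Plane) (k : ℕ) : Prop :=
  ∀ ν, IsSection (L (i - 1)) ν → ∀ X : Plane,
    (fun x => eta σ L i ν x X) =O[nhds p] fun x => ‖x - p‖ ^ k

/-- The divisor of `η_i`: the multiplicity of the zero of `η_i` at `p`. As `η_i` is a holomorphic
form in holomorphic local frames, this is its order of vanishing (infinite if `η_i` vanishes
identically). -/
def etaDivisor {n : ℕ} (σ : Plane → Mat n) (L : ℕ → Plane → Submodule ℝ (Mat n)) (i : ℕ)
    (p : Plane) : ℕ∞ :=
  ⨆ (k : ℕ) (_ : EtaVanishes σ L i p k), (k : ℕ∞)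

/-- `a ≺ b` for divisors: `a` is strictly smaller than `b` at every point of the support of
`a`. -/
def DivisorPrec (a b : Plane → ℕ∞) : Prop := ∀ p, a p ≠ 0 → a p < b p

/-- The condition `(η_2) ≺ (η_3) ≺ ⋯ ≺ (η_{m+1})`. -/
def DivisorCondition {m : ℕ} (σ : Plane → Mat (2 * m))
    (L : ℕ → Plane → Submodule ℝ (Mat (2 * m))) : Prop :=
  ∀ i ∈ Finset.Icc 2 m, DivisorPrec (etaDivisor σ L i) (etaDivisor σ L (i + 1))

/-! ### Variations of area -/

/-- The spacelike part `𝒩⁺ = ℒ_3 ⊕ ℒ_5 ⊕ ⋯ ⊕ ℒ_{2m-1}` of the normal bundle. -/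
def normalPos (m : ℕ) (L : ℕ → Plane → Submodule ℝ (Mat (2 * m))) (x : Plane) :
    Submodule ℝ (Mat (2 * m)) :=
  ⨆ k ∈ Finset.Icc 2 m, L (2 * k - 1) x

/-- The timelike part `𝒩⁻ = ℒ_2 ⊕ ℒ_4 ⊕ ⋯ ⊕ ℒ_{2m}` of the normal bundle. -/
def normalNeg (m : ℕ) (L : ℕ → Plane → Submodule ℝ (Mat (2 * m))) (x : Plane) :
    Submodule ℝ (Mat (2 * m)) :=
  ⨆ k ∈ Finset.Icc 1 m, L (2 * k) x

/-- `F t`, for `|t| < ε`, is a smooth one-parameter family of immersions into the para-complex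
hyperbolic space with `F 0 = σ` and `F t = σ` outside the compact set `K`. -/
structure IsVariation {n : ℕ} (σ : Plane → Mat n) (F : ℝ → Plane → Mat n) (ε : ℝ)
    (K : Set Plane) : Prop where
  pos : 0 < ε
  compact : IsCompact K
  smooth : ContDiffOn ℝ ∞ (Function.uncurry F) (Set.Ioo (-ε) ε ×ˢ Set.univ)
  mem : ∀ t ∈ Set.Ioo (-ε) ε, ∀ x, F t x ∈ paraHyp n
  immersion : ∀ t ∈ Set.Ioo (-ε) ε, ∀ x, Function.Injective (fderiv ℝ (F t) x)
  zero : F 0 = σ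
  eq_off : ∀ t ∈ Set.Ioo (-ε) ε, ∀ x, x ∉ K → F t x = σ x

/-- The variational vector field. -/
def variationField {n : ℕ} (F : ℝ → Plane → Mat n) (x : Plane) : Mat n :=
  deriv (fun t => F t x) 0

/-! ### Jacobi fields -/

/-- The fibre at `x` of the normal bundle of `σ`. -/
def IsNormalAt {n : ℕ} (σ : Plane → Mat n) (x : Plane) (Z : Mat n) : Prop :=
  Z ∈ tangentSpace (σ x) ∧ ∀ X, metric Z (fderiv ℝ σ x X) = 0

/-- The component of `Z` normal to the surface, at the point `x`. -/
def normalPart {n : ℕ} (σ : Plane → Mat n) (x : Plane) (Z : Mat n) : Mat n :=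
  Z - ∑ i, ∑ j, ((gram σ x)⁻¹ i j * metric Z (coordField σ i x)) • coordField σ j x

/-- The normal connection `∇^𝒩_{∂_i} ξ`. -/
def normalCov {n : ℕ} (σ : Plane → Mat n) (ξ : Plane → Mat n) (i : Fin 2) : Plane → Mat n :=
  fun x => normalPart σ x (cov σ ξ x (EuclideanSpace.single i 1))

/-- The Laplacian of the normal bundle in coordinates,
`(det h)^(-1/2) ∑ ∇^𝒩_i ((det h)^(1/2) h^{ij} ∇^𝒩_j ξ)`. -/
def normalLaplacian {n : ℕ} (σ : Plane → Mat n) (ξ : Plane → Mat n) (x : Plane) : Mat n :=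
  (√((gram σ x).det))⁻¹ • ∑ i, ∑ j,
    normalCov σ (fun y => (√((gram σ y).det) * (gram σ y)⁻¹ i j) • normalCov σ ξ j y) i x

/-- The second fundamental form `II (∂_i, ∂_j)`. -/
def secondFF {n : ℕ} (σ : Plane → Mat n) (x : Plane) (i j : Fin 2) : Mat n :=
  normalCov σ (coordField σ j) i x

/-- The Jacobi operator
`L ξ = Δ^𝒩 ξ + ∑ h (II (e_i, e_j), ξ) II (e_i, e_j) - tr_h (R (·, ξ) ·)`, the traces being written
in coordinates. -/
def jacobiOp {n : ℕ} (σ : Plane → Mat n) (ξ : Plane → Mat n) (x : Plane) : Mat n :=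
  normalLaplacian σ ξ x
    + ∑ i, ∑ j, ∑ k, ∑ l, ((gram σ x)⁻¹ i k * (gram σ x)⁻¹ j l
        * metric (secondFF σ x i j) (ξ x)) • secondFF σ x k l
    - normalPart σ x (∑ i, ∑ j, (gram σ x)⁻¹ i j •
        curvature (σ x) (coordField σ i x) (ξ x) (coordField σ j x))

/-- `ξ` is a Jacobi field of `σ`: a smooth section of the normal bundle in the kernel of the
Jacobi operator. -/
structure IsJacobiField {n : ℕ} (σ : Plane → Mat n) (ξ : Plane → Mat n) : Prop where
  smooth : ContDiff ℝ ∞ ξ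
  normal : ∀ x, IsNormalAt σ x (ξ x)
  jacobi : ∀ x, jacobiOp σ ξ x = 0

end ParaHyp

end

noncomputable section
namespace ParaHyp

/-! ### Leading terms of smooth functions -/

lemma two_le_smooth : (2 : WithTop ℕ∞) ≤ ∞ :=
  WithTop.coe_le_coe.2 (le_top : (2 : ℕ∞) ≤ ⊤)

lemma exists_derivative_weights (N : ℕ) :
    ∃ w : ℕ → ℝ, ∀ j ≤ N, ∑ i ∈ Finset.range (N + 1), w i * ((i : ℝ) / (N + 1)) ^ j =
      if j = 1 then 1 else 0 := by
  let s := Finset.range (N + 1)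
  let v : ℕ → ℝ := fun i => (i : ℝ) / (N + 1)
  have hN : (N : ℝ) + 1 ≠ 0 := by positivity
  have hv : Set.InjOn v s := by
    intro a _ b _ hab
    have : (a : ℝ) = b := by
      simp only [v] at hab
      field_simp at hab
      exact hab
    exact_mod_cast this
  refine ⟨fun i => (Polynomial.derivative (Lagrange.basis s v i)).eval 0, fun j hj => ?_⟩
  have h := Lagrange.eq_interpolate (f := (Polynomial.X ^ j : Polynomial ℝ)) hv
    (by
      rw [Polynomial.degree_X_pow]
      simp only [s, Finset.card_range]
      exact_mod_cast Nat.lt_succ_of_le hj)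
  have h2 := congrArg (fun q => (Polynomial.derivative q).eval 0) h
  simp only [Lagrange.interpolate_apply, Polynomial.derivative_sum, Polynomial.eval_finsetSum,
    Polynomial.derivative_C_mul, Polynomial.eval_mul, Polynomial.eval_C, Polynomial.eval_pow,
    Polynomial.eval_X, Polynomial.derivative_X_pow] at h2
  calc _ = ∑ x ∈ s, v x ^ j * (Polynomial.derivative (Lagrange.basis s v x)).eval 0 :=
        Finset.sum_congr rfl fun i _ => mul_comm _ _
    _ = _ := by
        rw [← h2]
        rcases j with _ | _ | j <;> simp

variable {E F : Type*} [NormedAddCommGroup E] [NormedSpace ℝ E]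
  [NormedAddCommGroup F] [NormedSpace ℝ F]

/-- The iterated derivative in the direction `v`. -/
def iterDir (f : E → F) (v : E) : ℕ → E → F
  | 0 => f
  | j + 1 => fun x => fderiv ℝ (iterDir f v j) x v

lemma contDiff_iterDir {f : E → F} (hf : ContDiff ℝ ∞ f) (v : E) (j : ℕ) :
    ContDiff ℝ ∞ (iterDir f v j) := by
  induction j with
  | zero => exact hf
  | succ j ih =>
    exact (ih.fderiv_right (m := ∞) (by simp)).clm_apply contDiff_const

lemma iteratedDeriv_line {f : E → F} (hf : ContDiff ℝ ∞ f) (x v : E) (j : ℕ) :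
    iteratedDeriv j (fun s : ℝ => f (x + s • v)) = fun s => iterDir f v j (x + s • v) := by
  induction j with
  | zero => simp [iterDir]
  | succ j ih =>
    rw [iteratedDeriv_succ, ih]
    funext s
    have h1 : HasDerivAt (fun s : ℝ => x + s • v) v s := by
      simpa using ((hasDerivAt_id s).smul_const v).const_add x
    exact (((contDiff_iterDir hf v j).differentiable (by simp)).differentiableAt.hasFDerivAt
      |>.comp_hasDerivAt s h1).deriv

lemma isBigO_fderiv_of_isBigO_pow {f : E → F} (hf : ContDiff ℝ ∞ f) {p : E} {k : ℕ}
    (h : f =O[nhds p] fun x => ‖x - p‖ ^ (k + 1)) (v : E) :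
    (fun x => fderiv ℝ f x v) =O[nhds p] fun x => ‖x - p‖ ^ k := by
  rcases Nat.eq_zero_or_pos k with rfl | hk
  · simp only [pow_zero]
    exact ((contDiff_iterDir hf v 1).continuous.tendsto p).isBigO_one ℝ
  set N := k + 1 with hNdef
  obtain ⟨w, hw⟩ := exists_derivative_weights N
  obtain ⟨C1, hC1⟩ := h.bound
  obtain ⟨C2, hC2⟩ : ∃ C2, ∀ᶠ y in nhds p, ‖iterDir f v (N + 1) y‖ ≤ C2 :=
    ((contDiff_iterDir hf v (N + 1)).continuous.tendsto p).norm.isBoundedUnder_le.eventually_le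
      |>.elim fun C hC => ⟨C, hC⟩
  obtain ⟨δ, hδ, hball⟩ := Metric.eventually_nhds_iff_ball.1 (hC1.and hC2)
  have hv1 : 0 < 1 + ‖v‖ := by positivity
  set B : ℝ := ∑ i ∈ Finset.range (N + 1), |w i| * (|C1| * (1 + ‖v‖) ^ N + |C2|) with hB
  refine Asymptotics.IsBigO.of_bound B ?_
  have hnear : ∀ᶠ x in nhds p, ‖x - p‖ < min 1 (δ / (1 + ‖v‖)) := by
    have : Filter.Tendsto (fun x => ‖x - p‖) (nhds p) (nhds 0) := by
      have : Continuous fun x => ‖x - p‖ := by fun_prop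
      simpa using this.tendsto p
    exact this.eventually (gt_mem_nhds (by positivity))
  have hzero : f p = 0 := by
    have := (hball p (Metric.mem_ball_self hδ)).1
    simpa [hNdef] using this
  filter_upwards [hnear] with x hx
  rcases eq_or_ne x p with rfl | hxp
  · have : fderiv ℝ f x v = 0 := by
      have hO : f =o[nhds x] fun y => y - x := by
        refine h.trans_isLittleO ?_
        have := Asymptotics.isLittleO_norm_pow_id (E' := E) (n := N) (by omega)
        have h2 := this.comp_tendsto (k := fun y => y - x) (l' := nhds x) (by
          have : Continuous fun y => y - x := by fun_prop
          simpa using this.tendsto x)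
        exact h2
      have hd : HasFDerivAt f (0 : E →L[ℝ] F) x := by
        rw [hasFDerivAt_iff_isLittleO]
        simpa [hzero] using hO
      rw [hd.fderiv]; simp
    rw [this]; simp; positivity
  have hr0 : 0 < ‖x - p‖ := norm_pos_iff.2 (sub_ne_zero.2 hxp)
  set r := ‖x - p‖ with hr
  have hr1 : r < 1 := hx.trans_le (min_le_left _ _)
  have hrδ : r * (1 + ‖v‖) < δ := by
    have := hx.trans_le (min_le_right _ _)
    rwa [lt_div_iff₀ hv1] at this
  have hin : ∀ s ∈ Set.Icc (0 : ℝ) r, x + s • v ∈ Metric.ball p δ ∧ ‖x + s • v - p‖ ≤ r * (1 + ‖v‖) := by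
    intro s hs
    have : ‖x + s • v - p‖ ≤ r * (1 + ‖v‖) := by
      calc ‖x + s • v - p‖ = ‖(x - p) + s • v‖ := by congr 1; abel
        _ ≤ r + s * ‖v‖ := by
            refine (norm_add_le _ _).trans ?_
            rw [norm_smul, Real.norm_of_nonneg hs.1]
        _ ≤ r + r * ‖v‖ := by gcongr; exact hs.2
        _ = _ := by ring
    exact ⟨by rw [mem_ball_iff_norm]; exact this.trans_lt hrδ, this⟩
  have hφ : ContDiff ℝ ∞ (fun s : ℝ => f (x + s • v)) := hf.comp (by fun_prop)
  have hIcc : UniqueDiffOn ℝ (Set.Icc (0 : ℝ) r) := uniqueDiffOn_Icc hr0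
  have hid : ∀ j : ℕ, ∀ s ∈ Set.Icc (0 : ℝ) r,
      iteratedDerivWithin j (fun s : ℝ => f (x + s • v)) (Set.Icc 0 r) s
        = iterDir f v j (x + s • v) := by
    intro j s hs
    rw [iteratedDerivWithin_eq_iteratedDeriv hIcc (hφ.contDiffAt.of_le (by exact_mod_cast le_top)) hs,
      iteratedDeriv_line hf]
  have htay : ∀ s ∈ Set.Icc (0 : ℝ) r, ‖f (x + s • v) -
      ∑ j ∈ Finset.range (N + 1), ((j.factorial : ℝ)⁻¹ * s ^ j) • iterDir f v j x‖
        ≤ |C2| * r ^ (N + 1) := by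
    intro s hs
    have := taylor_mean_remainder_bound (f := fun s : ℝ => f (x + s • v)) (n := N) (C := |C2|) hr0.le
      ((hφ.of_le (by exact_mod_cast le_top)).contDiffOn) hs (fun y hy => by
        rw [hid _ y hy]
        exact ((hball _ (hin y hy).1).2).trans (le_abs_self _))
    rw [taylor_within_apply] at this
    have h0 : (0 : ℝ) ∈ Set.Icc (0 : ℝ) r := ⟨le_rfl, hr0.le⟩
    simp only [hid _ 0 h0, zero_smul, add_zero, sub_zero] at this
    refine this.trans ?_
    rw [div_le_iff₀ (by positivity)]
    have h3 : s ^ (N + 1) ≤ r ^ (N + 1) := pow_le_pow_left₀ hs.1 hs.2 _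
    have h4 : (1 : ℝ) ≤ (N.factorial : ℝ) := by exact_mod_cast Nat.succ_le_of_lt N.factorial_pos
    calc |C2| * s ^ (N + 1) ≤ |C2| * r ^ (N + 1) := by gcongr
      _ = |C2| * r ^ (N + 1) * 1 := (mul_one _).symm
      _ ≤ _ := by gcongr
  have hnode : ∀ i ∈ Finset.range (N + 1), (i : ℝ) / (N + 1) * r ∈ Set.Icc (0 : ℝ) r := by
    intro i hi
    have hi' : (i : ℝ) / (N + 1) ≤ 1 := by
      rw [div_le_one (by positivity)]
      have := Finset.mem_range.1 hi
      exact_mod_cast this.le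
    exact ⟨by positivity, by nlinarith⟩
  have hkey : r • fderiv ℝ f x v = ∑ i ∈ Finset.range (N + 1), w i •
      ∑ j ∈ Finset.range (N + 1), ((j.factorial : ℝ)⁻¹ * ((i : ℝ) / (N + 1) * r) ^ j) •
        iterDir f v j x := by
    simp only [Finset.smul_sum, smul_smul]
    rw [Finset.sum_comm]
    have : ∀ j ∈ Finset.range (N + 1), ∑ i ∈ Finset.range (N + 1),
        (w i * ((j.factorial : ℝ)⁻¹ * ((i : ℝ) / (N + 1) * r) ^ j)) • iterDir f v j x
        = if j = 1 then r • iterDir f v 1 x else 0 := by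
      intro j hj
      rw [← Finset.sum_smul]
      have : ∑ i ∈ Finset.range (N + 1), w i * ((j.factorial : ℝ)⁻¹ * ((i : ℝ) / (N + 1) * r) ^ j)
          = ((j.factorial : ℝ)⁻¹ * r ^ j) *
            ∑ i ∈ Finset.range (N + 1), w i * ((i : ℝ) / (N + 1)) ^ j := by
        rw [Finset.mul_sum]
        refine Finset.sum_congr rfl fun i _ => ?_
        rw [mul_pow]; ring
      rw [this, hw j (Nat.lt_succ_iff.1 (Finset.mem_range.1 hj))]
      split_ifs with h1
      · subst h1; simp
      · simp
    rw [Finset.sum_congr rfl this, Finset.sum_ite_eq' ]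
    rw [if_pos (Finset.mem_range.2 (by omega))]
    rfl
  have hbound : ‖r • fderiv ℝ f x v‖ ≤ B * r ^ N := by
    rw [hkey, hB, Finset.sum_mul]
    refine (norm_sum_le _ _).trans (Finset.sum_le_sum fun i hi => ?_)
    rw [norm_smul, Real.norm_eq_abs, mul_assoc]
    gcongr
    set P := ∑ j ∈ Finset.range (N + 1), ((j.factorial : ℝ)⁻¹ * ((i : ℝ) / (N + 1) * r) ^ j) •
        iterDir f v j x
    have h1 := htay _ (hnode i hi)
    have h2 : ‖f (x + ((i : ℝ) / (N + 1) * r) • v)‖ ≤ |C1| * (1 + ‖v‖) ^ N * r ^ N := by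
      have h3 := (hball _ (hin _ (hnode i hi)).1).1
      refine h3.trans ?_
      rw [norm_pow, norm_norm, mul_assoc, ← mul_pow, mul_comm (1 + ‖v‖)]
      gcongr
      · exact le_abs_self _
      · exact (hin _ (hnode i hi)).2
    have h4 : r ^ (N + 1) ≤ r ^ N := pow_le_pow_of_le_one hr0.le hr1.le (Nat.le_succ _)
    calc ‖P‖ = ‖f (x + ((i : ℝ) / (N + 1) * r) • v) -
          (f (x + ((i : ℝ) / (N + 1) * r) • v) - P)‖ := by congr 1; abel
      _ ≤ |C1| * (1 + ‖v‖) ^ N * r ^ N + |C2| * r ^ (N + 1) := (norm_sub_le _ _).trans (add_le_add h2 h1)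
      _ ≤ |C1| * (1 + ‖v‖) ^ N * r ^ N + |C2| * r ^ N := by gcongr
      _ = _ := by ring
  rw [norm_smul, Real.norm_of_nonneg hr0.le, hNdef, pow_succ] at hbound
  rw [norm_pow, norm_norm]
  refine le_of_mul_le_mul_left ?_ hr0
  calc _ ≤ _ := hbound
    _ = _ := by rw [← hr]; ring

/-- A smooth function of order `k` at `p` which is holomorphic up to order `k` is a multiple of
`z ^ k` up to order `k + 1`, for the linear coordinate `z = ℓ (x - p)`. -/
lemma exists_leading_coeff {E : Type*} [NormedAddCommGroup E] [NormedSpace ℝ E]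
    [FiniteDimensional ℝ E] {v₁ v₂ p : E}
    (hspan : ∀ x : E, ∃ a b : ℝ, x = a • v₁ + b • v₂) (ℓ : E →L[ℝ] ℂ) {μ : ℂ}
    (h1 : ℓ v₁ = 1) (h2 : ℓ v₂ = μ) (k : ℕ) :
    ∀ S : E → ℂ, ContDiff ℝ ∞ S → S =O[nhds p] (fun x => ‖x - p‖ ^ k) →
      (fun x => fderiv ℝ S x v₂ - μ * fderiv ℝ S x v₁) =O[nhds p] (fun x => ‖x - p‖ ^ k) →
      ∃ c : ℂ, (fun x => S x - c * ℓ (x - p) ^ k) =O[nhds p] fun x => ‖x - p‖ ^ (k + 1) := by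
  induction k with
  | zero =>
    intro S hS _ _
    refine ⟨S p, ?_⟩
    have := ((hS.differentiable (by simp)).differentiableAt (x := p)).isBigO_sub
    simpa using this
  | succ k ih =>
    intro S hS hO hW
    have hS1 : ContDiff ℝ ∞ (fun x => fderiv ℝ S x v₁) := contDiff_iterDir hS v₁ 1
    have hS2 : ContDiff ℝ ∞ (fun x => fderiv ℝ S x v₂) := contDiff_iterDir hS v₂ 1
    have hd2 : Differentiable ℝ (fderiv ℝ S) :=
      (hS.fderiv_right (m := ∞) (by simp)).differentiable (by simp)
    have hWs : ContDiff ℝ ∞ (fun x => fderiv ℝ S x v₂ - μ * fderiv ℝ S x v₁) :=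
      hS2.sub (contDiff_const.mul hS1)
    obtain ⟨c, hc⟩ := ih (fun x => fderiv ℝ S x v₁) hS1 (isBigO_fderiv_of_isBigO_pow hS hO v₁) (by
      refine (isBigO_fderiv_of_isBigO_pow hWs hW v₁).congr_left fun x => ?_
      have hsym : fderiv ℝ (fun y => fderiv ℝ S y v₂) x v₁
          = fderiv ℝ (fun y => fderiv ℝ S y v₁) x v₂ := by
        have h := (hS.contDiffAt (x := x)).isSymmSndFDerivAt (by simpa using two_le_smooth)
        rw [fderiv_clm_apply hd2.differentiableAt (by fun_prop),
          fderiv_clm_apply hd2.differentiableAt (by fun_prop)]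
        simpa using h.eq v₁ v₂
      have hda := hS1.differentiable (by simp) x
      rw [fderiv_fun_sub (hS2.differentiable (by simp) x) (hda.const_mul μ),
        fderiv_const_mul hda]
      simp [hsym])
    refine ⟨c / (k + 1), ?_⟩
    set R : E → ℂ := fun x => S x - c / (k + 1) * ℓ (x - p) ^ (k + 1) with hR
    have hRd : Differentiable ℝ R := by
      refine (hS.differentiable (by simp)).sub ?_
      fun_prop
    have hk : (k : ℂ) + 1 ≠ 0 := by exact_mod_cast Nat.succ_ne_zero k
    have hRv : ∀ x v, fderiv ℝ R x v = fderiv ℝ S x v - c * ℓ (x - p) ^ k * ℓ v := by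
      intro x v
      have hl : HasFDerivAt (fun x => ℓ (x - p)) ℓ x := by
        have := ℓ.hasFDerivAt.comp x ((hasFDerivAt_id x).sub_const p)
        rwa [ContinuousLinearMap.comp_id] at this
      have := ((hS.differentiable (by simp) x).hasFDerivAt).sub ((hl.pow (k + 1)).const_mul (c / (k + 1)))
      rw [show R = _ from rfl]
      erw [this.fderiv]
      simp
      field_simp
    have hR1 : (fun x => fderiv ℝ R x v₁) =O[nhds p] fun x => ‖x - p‖ ^ (k + 1) := by
      refine hc.congr_left fun x => ?_
      rw [hRv, h1, mul_one]
    have hR2 : (fun x => fderiv ℝ R x v₂) =O[nhds p] fun x => ‖x - p‖ ^ (k + 1) := by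
      refine (hW.add (hc.const_mul_left μ)).congr_left fun x => ?_
      rw [hRv, h2]; ring
    have hRf : (fun x => fderiv ℝ R x) =O[nhds p] fun x => ‖x - p‖ ^ (k + 1) := by
      have hv1 : v₁ ≠ 0 := by rintro rfl; simp at h1
      have hpt : ∀ v, (fun x => fderiv ℝ R x v) =O[nhds p] fun x => ‖x - p‖ ^ (k + 1) := by
        intro v
        obtain ⟨a, b, rfl⟩ := hspan v
        simpa using (hR1.const_smul_left a).add (hR2.const_smul_left b)
      let bs := Module.finBasis ℝ E
      obtain ⟨C, hC0, hC⟩ := bs.exists_opNorm_le (F := ℂ)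
      have hsum : (fun x => ∑ i, ‖fderiv ℝ R x (bs i)‖) =O[nhds p] fun x => ‖x - p‖ ^ (k + 1) :=
        Asymptotics.IsBigO.fun_sum fun i _ => (hpt (bs i)).norm_left
      refine Asymptotics.IsBigO.trans (Asymptotics.IsBigO.of_bound C ?_) hsum
      filter_upwards with x
      have h0 : 0 ≤ ∑ i, ‖fderiv ℝ R x (bs i)‖ := Finset.sum_nonneg fun _ _ => norm_nonneg _
      rw [Real.norm_of_nonneg h0]
      exact hC h0 fun i => Finset.single_le_sum (f := fun i => ‖fderiv ℝ R x (bs i)‖)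
        (fun _ _ => norm_nonneg _) (Finset.mem_univ i)
    have hRp : R p = 0 := by
      obtain ⟨C, hC⟩ := hO.bound
      have := hC.self_of_nhds
      have h0 : S p = 0 := by simpa using this
      simp [hR, h0]
    obtain ⟨C, hC⟩ := hRf.bound
    obtain ⟨δ, hδ, hball⟩ := Metric.eventually_nhds_iff_ball.1 hC
    refine Asymptotics.IsBigO.of_bound C ?_
    filter_upwards [Metric.ball_mem_nhds p hδ] with x hx
    rw [mem_ball_iff_norm] at hx
    have hseg : ∀ y ∈ segment ℝ p x, ‖fderiv ℝ R y‖ ≤ C * ‖x - p‖ ^ (k + 1) := by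
      intro y hy
      have hy' : ‖y - p‖ ≤ ‖x - p‖ := by
        have := (convex_closedBall p ‖x - p‖).segment_subset (Metric.mem_closedBall_self (norm_nonneg _))
          (by simp [dist_eq_norm] : x ∈ Metric.closedBall p ‖x - p‖) hy
        simpa [dist_eq_norm] using this
      have h3 := hball y (by rw [mem_ball_iff_norm]; exact hy'.trans_lt hx)
      rw [norm_pow, norm_norm] at h3
      rcases (norm_nonneg (y - p)).eq_or_lt with h0 | h0
      · rw [← h0] at h3
        have hC' : 0 ≤ C ∨ x = p := by
          by_contra hcon
          push Not at hcon
          have h4 := hball x (mem_ball_iff_norm.2 hx)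
          have h5 : 0 < ‖x - p‖ := norm_pos_iff.2 (sub_ne_zero.2 hcon.2)
          have : C * ‖‖x - p‖ ^ (k + 1)‖ < 0 := mul_neg_of_neg_of_pos hcon.1 (norm_pos_iff.2 (pow_pos h5 _).ne')
          linarith [norm_nonneg (fderiv ℝ R x)]
        rcases hC' with h | h
        · simp only [ne_eq, Nat.add_eq_zero_iff, one_ne_zero, and_false, not_false_eq_true,
            zero_pow, mul_zero] at h3
          exact h3.trans (by positivity)
        · subst h; simpa using h3
      · have hC0 : 0 ≤ C := by
          by_contra hcon
          push Not at hcon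
          have : C * ‖y - p‖ ^ (k + 1) < 0 := mul_neg_of_neg_of_pos hcon (by positivity)
          linarith [norm_nonneg (fderiv ℝ R y)]
        exact h3.trans (by gcongr)
    have := (convex_segment p x).norm_image_sub_le_of_norm_fderiv_le
      (fun y _ => hRd.differentiableAt) hseg (left_mem_segment ℝ p x) (right_mem_segment ℝ p x)
    rw [hRp, sub_zero] at this
    rw [norm_pow, norm_norm, pow_succ, ← mul_assoc]
    exact this

lemma eventually_le_norm_of_leading {E : Type*} [NormedAddCommGroup E] [NormedSpace ℝ E]
    {p : E} (ℓ : E →L[ℝ] ℂ) {δ : ℝ} (hδ : 0 < δ) (hℓ : ∀ x, δ * ‖x‖ ≤ ‖ℓ x‖)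
    {k : ℕ} {S : E → ℂ} {c : ℂ} (hc : c ≠ 0)
    (h : (fun x => S x - c * ℓ (x - p) ^ k) =O[nhds p] fun x => ‖x - p‖ ^ (k + 1)) :
    ∃ a : ℝ, 0 < a ∧ ∀ᶠ x in nhds p, a * ‖x - p‖ ^ k ≤ ‖S x‖ := by
  obtain ⟨C, hC0, hC⟩ := h.exists_pos
  have hc' : 0 < ‖c‖ := norm_pos_iff.2 hc
  refine ⟨‖c‖ * δ ^ k / 2, by positivity, ?_⟩
  have hnear : ∀ᶠ x in nhds p, ‖x - p‖ < ‖c‖ * δ ^ k / 2 / C := by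
    have : Filter.Tendsto (fun x => ‖x - p‖) (nhds p) (nhds 0) := by
      have : Continuous fun x => ‖x - p‖ := by fun_prop
      simpa using this.tendsto p
    exact this.eventually (gt_mem_nhds (by positivity))
  filter_upwards [hnear, hC.bound] with x hx hb
  rw [lt_div_iff₀ hC0] at hx
  rw [norm_pow, norm_norm] at hb
  have h1 : ‖c * ℓ (x - p) ^ k‖ ≤ ‖S x‖ + ‖S x - c * ℓ (x - p) ^ k‖ := by
    have := norm_sub_le (S x) (S x - c * ℓ (x - p) ^ k)
    simpa using this
  have h2 : ‖c‖ * (δ ^ k * ‖x - p‖ ^ k) ≤ ‖c * ℓ (x - p) ^ k‖ := by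
    rw [norm_mul, norm_pow, ← mul_pow]
    gcongr
    exact hℓ _
  have h3 : C * ‖x - p‖ ^ (k + 1) ≤ ‖c‖ * δ ^ k / 2 * ‖x - p‖ ^ k := by
    rw [pow_succ, mul_comm (‖x - p‖ ^ k), ← mul_assoc]
    gcongr
    linarith
  nlinarith

/-- If a product vanishes near a point then one of the differentials vanishes there. -/
lemma fderiv_eq_zero_or_of_mul_eq_zero {E : Type*} [NormedAddCommGroup E] [NormedSpace ℝ E]
    {S T : E → ℂ} {x : E} (hS : DifferentiableAt ℝ S x) (hT : DifferentiableAt ℝ T x)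
    (h : ∀ᶠ y in nhds x, S y * T y = 0) : fderiv ℝ S x = 0 ∨ fderiv ℝ T x = 0 := by
  by_cases hSx : S x = 0
  swap
  · right
    have : T =ᶠ[nhds x] fun _ => 0 := by
      filter_upwards [h, hS.continuousAt.eventually_ne hSx] with y hy hy'
      exact (mul_eq_zero.1 hy).resolve_left hy'
    rw [this.fderiv_eq]; simp
  by_cases hTx : T x = 0
  swap
  · left
    have : S =ᶠ[nhds x] fun _ => 0 := by
      filter_upwards [h, hT.continuousAt.eventually_ne hTx] with y hy hy'
      exact (mul_eq_zero.1 hy).resolve_right hy'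
    rw [this.fderiv_eq]; simp
  have hdiag : ∀ v, fderiv ℝ S x v * fderiv ℝ T x v = 0 := by
    intro v
    have hline : ∀ {R : E → ℂ}, DifferentiableAt ℝ R x → R x = 0 →
        Filter.Tendsto (fun t : ℝ => t⁻¹ • R (x + t • v)) (nhdsWithin 0 {0}ᶜ)
          (nhds (fderiv ℝ R x v)) := by
      intro R hR hR0
      have h1 : HasDerivAt (fun s : ℝ => x + s • v) v 0 := by
        simpa using ((hasDerivAt_id (0 : ℝ)).smul_const v).const_add x
      have h0 : HasFDerivAt R (fderiv ℝ R x) (x + (0 : ℝ) • v) := by simpa using hR.hasFDerivAt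
      have h2 := (h0.comp_hasDerivAt (0 : ℝ) h1).tendsto_slope_zero
      simpa [hR0] using h2
    have hmul := (hline hS hSx).mul (hline hT hTx)
    refine tendsto_nhds_unique hmul ?_
    refine (tendsto_const_nhds (x := (0 : ℂ))).congr' ?_
    have hc : Filter.Tendsto (fun r : ℝ => x + r • v) (nhdsWithin 0 {0}ᶜ) (nhds x) := by
      have : Continuous fun r : ℝ => x + r • v := by fun_prop
      have := (this.tendsto 0).mono_left (nhdsWithin_le_nhds (s := {0}ᶜ))
      simpa using this
    filter_upwards [hc.eventually h] with t ht
    rw [smul_mul_smul_comm, ht, smul_zero]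
  by_contra hcon
  push Not at hcon
  obtain ⟨v, hv⟩ : ∃ v, fderiv ℝ S x v ≠ 0 := by
    by_contra h0
    push Not at h0
    exact hcon.1 (ContinuousLinearMap.ext h0)
  obtain ⟨w, hw⟩ : ∃ v, fderiv ℝ T x v ≠ 0 := by
    by_contra h0
    push Not at h0
    exact hcon.2 (ContinuousLinearMap.ext h0)
  have h1 := (mul_eq_zero.1 (hdiag v)).resolve_left hv
  have h2 := (mul_eq_zero.1 (hdiag w)).resolve_right hw
  have h3 := hdiag (v + w)
  simp [h1, h2, hv, hw] at h3

/-- A conformal solution of the closedness equation up to order `k`, of order exactly `k` at `p`, is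
bounded below by `‖x - p‖ ^ k`. -/
lemma eventually_le_norm_of_conformal {E : Type*} [NormedAddCommGroup E] [NormedSpace ℝ E]
    [FiniteDimensional ℝ E] {v₁ v₂ p : E} (hspan : ∀ x : E, ∃ a b : ℝ, x = a • v₁ + b • v₂)
    (ℓ : E →L[ℝ] ℂ) (h1 : ℓ v₁ = 1) (h2 : ℓ v₂ = Complex.I)
    {δ : ℝ} (hδ : 0 < δ) (hℓ : ∀ x, δ * ‖x‖ ≤ ‖ℓ x‖) {k : ℕ} {A B : E → ℂ}
    (hA : ContDiff ℝ ∞ A) (hB : ContDiff ℝ ∞ B)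
    (hAO : A =O[nhds p] fun x => ‖x - p‖ ^ k) (hBO : B =O[nhds p] fun x => ‖x - p‖ ^ k)
    (hAB : ∀ᶠ x in nhds p, A x ^ 2 + B x ^ 2 = 0)
    (hW : (fun x => fderiv ℝ B x v₁ - fderiv ℝ A x v₂) =O[nhds p] fun x => ‖x - p‖ ^ k)
    (hnot : ¬ A =O[nhds p] fun x => ‖x - p‖ ^ (k + 1)) :
    ∃ a : ℝ, 0 < a ∧ ∀ᶠ x in nhds p, a * ‖x - p‖ ^ k ≤ ‖A x‖ := by
  set S : E → ℂ := fun x => A x + Complex.I * B x with hS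
  set T : E → ℂ := fun x => A x - Complex.I * B x with hT
  have hSs : ContDiff ℝ ∞ S := hA.add (contDiff_const.mul hB)
  have hTs : ContDiff ℝ ∞ T := hA.sub (contDiff_const.mul hB)
  have hST : ∀ᶠ x in nhds p, S x * T x = 0 := by
    filter_upwards [hAB] with x hx
    simp only [hS, hT]
    linear_combination hx - B x ^ 2 * Complex.I_sq
  have hdA : ∀ x, DifferentiableAt ℝ A x := hA.differentiable (by simp)
  have hdB : ∀ x, DifferentiableAt ℝ B x := hB.differentiable (by simp)
  have hdS : ∀ x v, fderiv ℝ S x v = fderiv ℝ A x v + Complex.I * fderiv ℝ B x v := by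
    intro x v
    simp only [hS]
    rw [fderiv_fun_add (hdA x) ((hdB x).const_mul _), fderiv_const_mul (hdB x)]
    simp
  have hdT : ∀ x v, fderiv ℝ T x v = fderiv ℝ A x v - Complex.I * fderiv ℝ B x v := by
    intro x v
    simp only [hT]
    rw [fderiv_fun_sub (hdA x) ((hdB x).const_mul _), fderiv_const_mul (hdB x)]
    simp
  have halt : ∀ᶠ x in nhds p, fderiv ℝ S x = 0 ∨ fderiv ℝ T x = 0 := by
    filter_upwards [eventually_eventually_nhds.2 hST] with x hx
    exact fderiv_eq_zero_or_of_mul_eq_zero (hSs.differentiable (by simp) x)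
      (hTs.differentiable (by simp) x) hx
  have hIsq := Complex.I_sq
  have hWS : (fun x => fderiv ℝ S x v₂ - (-Complex.I) * fderiv ℝ S x v₁)
      =O[nhds p] fun x => ‖x - p‖ ^ k := by
    refine Asymptotics.IsBigO.trans (Asymptotics.IsBigO.of_bound 2 ?_) hW
    filter_upwards [halt] with x hx
    rcases hx with hx | hx
    · simp only [hx]; simp
    · have e1 := hdT x v₁
      have e2 := hdT x v₂
      rw [hx] at e1 e2
      simp only [zero_apply] at e1 e2
      have : fderiv ℝ S x v₂ - (-Complex.I) * fderiv ℝ S x v₁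
          = -2 * (fderiv ℝ B x v₁ - fderiv ℝ A x v₂) := by
        rw [hdS, hdS]
        linear_combination e2 - Complex.I * e1 + 2 * hIsq * fderiv ℝ B x v₁
      rw [this]; simp
  have hWT : (fun x => fderiv ℝ T x v₂ - Complex.I * fderiv ℝ T x v₁)
      =O[nhds p] fun x => ‖x - p‖ ^ k := by
    refine Asymptotics.IsBigO.trans (Asymptotics.IsBigO.of_bound 2 ?_) hW
    filter_upwards [halt] with x hx
    rcases hx with hx | hx
    · have e1 := hdS x v₁
      have e2 := hdS x v₂
      rw [hx] at e1 e2
      simp only [zero_apply] at e1 e2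
      have : fderiv ℝ T x v₂ - Complex.I * fderiv ℝ T x v₁
          = -2 * (fderiv ℝ B x v₁ - fderiv ℝ A x v₂) := by
        rw [hdT, hdT]
        linear_combination e2 + Complex.I * e1 + 2 * hIsq * fderiv ℝ B x v₁
      rw [this]; simp
    · simp only [hx]; simp
  have hSO : S =O[nhds p] fun x => ‖x - p‖ ^ k := hAO.add (hBO.const_mul_left _)
  have hTO : T =O[nhds p] fun x => ‖x - p‖ ^ k := hAO.sub (hBO.const_mul_left _)
  let ℓ' : E →L[ℝ] ℂ := (Complex.conjCLE : ℂ →L[ℝ] ℂ).comp ℓ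
  obtain ⟨c, hc⟩ := exists_leading_coeff hspan ℓ' (μ := -Complex.I) (by simp [ℓ', h1])
    (by simp [ℓ', h2]) k S hSs hSO hWS
  obtain ⟨d, hd⟩ := exists_leading_coeff hspan ℓ h1 h2 k T hTs hTO hWT
  have hpos : ∀ {a : ℝ} {x : E} {R Q : ℂ}, 0 < a → a * ‖x - p‖ ^ k ≤ ‖R‖ → R * Q = 0 →
      a / 2 * ‖x - p‖ ^ k ≤ ‖(R + Q) / 2‖ := by
    intro a x R Q ha hR hRQ
    rcases (mul_eq_zero.1 hRQ) with h | h
    · rw [h, norm_zero] at hR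
      have := norm_nonneg ((R + Q) / 2)
      linarith
    · rw [h, add_zero, norm_div]
      simp; linarith
  by_cases hc0 : c = 0
  · by_cases hd0 : d = 0
    · exfalso
      apply hnot
      subst hc0 hd0
      simp only [zero_mul, sub_zero] at hc hd
      refine ((hc.add hd).const_mul_left (1 / 2)).congr_left fun x => ?_
      simp only [hS, hT]; ring
    · obtain ⟨a, ha, hb⟩ := eventually_le_norm_of_leading ℓ hδ hℓ hd0 hd
      refine ⟨a / 2, by positivity, ?_⟩
      filter_upwards [hb, hST] with x hx hx'
      have := hpos ha hx (by rw [mul_comm]; exact hx')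
      refine this.trans_eq ?_
      congr 1
      simp only [hS, hT]; ring
  · obtain ⟨a, ha, hb⟩ := eventually_le_norm_of_leading ℓ' hδ (by simpa [ℓ'] using hℓ) hc0 hc
    refine ⟨a / 2, by positivity, ?_⟩
    filter_upwards [hb, hST] with x hx hx'
    have := hpos ha hx hx'
    refine this.trans_eq ?_
    congr 1
    simp only [hS, hT]; ring

end ParaHyp
end

noncomputable section
namespace ParaHyp

/-! ### Algebra of the metric -/

section Algebra

variable {n : ℕ}

lemma metric_comm (X Y : Mat n) : metric X Y = metric Y X := by
  simp only [metric, Matrix.trace_mul_comm X Y]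

lemma metric_add_left (X Y Z : Mat n) : metric (X + Y) Z = metric X Z + metric Y Z := by
  simp only [metric, add_mul, Matrix.trace_add]; ring

lemma metric_sub_left (X Y Z : Mat n) : metric (X - Y) Z = metric X Z - metric Y Z := by
  simp only [metric, sub_mul, Matrix.trace_sub]; ring

lemma metric_neg_left (X Z : Mat n) : metric (-X) Z = -metric X Z := by
  simp only [metric, neg_mul, Matrix.trace_neg]; ring

lemma metric_smul_left (c : ℝ) (X Z : Mat n) : metric (c • X) Z = c * metric X Z := by
  simp only [metric, smul_mul_assoc, Matrix.trace_smul, smul_eq_mul]; ring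

lemma metric_zero_left (Z : Mat n) : metric 0 Z = 0 := by
  simp [metric]

lemma metric_add_right (X Y Z : Mat n) : metric X (Y + Z) = metric X Y + metric X Z := by
  simp only [metric, mul_add, Matrix.trace_add]

lemma metric_sub_right (X Y Z : Mat n) : metric X (Y - Z) = metric X Y - metric X Z := by
  simp only [metric, mul_sub, Matrix.trace_sub]

lemma metric_neg_right (X Z : Mat n) : metric X (-Z) = -metric X Z := by
  simp only [metric, mul_neg, Matrix.trace_neg]

lemma metric_smul_right (c : ℝ) (X Z : Mat n) : metric X (c • Z) = c * metric X Z := by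
  rw [metric_comm, metric_smul_left, metric_comm]

lemma metric_zero_right (Z : Mat n) : metric Z 0 = 0 := by
  simp [metric]

lemma metric_sum_left {ι : Type*} (s : Finset ι) (f : ι → Mat n) (Z : Mat n) :
    metric (∑ i ∈ s, f i) Z = ∑ i ∈ s, metric (f i) Z := by
  simp only [metric, Finset.sum_mul, Matrix.trace_sum, Finset.mul_sum]

lemma metric_sum_right {ι : Type*} (s : Finset ι) (f : ι → Mat n) (Z : Mat n) :
    metric Z (∑ i ∈ s, f i) = ∑ i ∈ s, metric Z (f i) := by
  simp only [metric, Finset.mul_sum, Matrix.trace_sum]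

lemma metric_nondegenerate {X : Mat n} (h : ∀ Y, metric X Y = 0) : X = 0 := by
  ext i j
  have := h (Matrix.single j i 1)
  simpa [metric, Matrix.trace_mul_single] using this

/-- The bilinear form `(X, Y) ↦ tr (M X Y)`, which is `-(g + ω)` on tangent vectors. -/
def traceForm (M X Y : Mat n) : ℝ := (M * X * Y).trace

variable {M : Mat n}

lemma paraHyp_mul_self (hM : M ∈ paraHyp n) : M * M = M := ((mem_paraHyp_iff M).1 hM).1

lemma paraHyp_sandwich (hM : M ∈ paraHyp n) (A : Mat n) : M * A * M = (M * A).trace • M := by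
  obtain ⟨z, -, rfl⟩ := hM
  ext i j
  simp only [projMat, projBilin, Matrix.mul_apply, Matrix.of_apply, Matrix.smul_apply, smul_eq_mul,
    Matrix.trace, Matrix.diag_apply, Finset.sum_mul]
  refine Finset.sum_congr rfl fun k _ => Finset.sum_congr rfl fun l _ => ?_
  ring

lemma mem_tangentSpace {X : Mat n} : X ∈ tangentSpace M ↔ M * X + X * M = X := Iff.rfl

lemma tangent_mul {X : Mat n} (hX : X ∈ tangentSpace M) : X * M = X - M * X :=
  eq_sub_of_add_eq' hX

lemma tangent_mul_assoc {X : Mat n} (hX : X ∈ tangentSpace M) (A : Mat n) :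
    X * (M * A) = X * A - M * (X * A) := by
  rw [← mul_assoc, tangent_mul hX, sub_mul, mul_assoc]

lemma mul_self_assoc (h : M * M = M) (A : Mat n) : M * (M * A) = M * A := by
  rw [← mul_assoc, h]

lemma tangent_sandwich (h : M * M = M) {X : Mat n} (hX : X ∈ tangentSpace M) :
    M * X * M = 0 := by
  rw [mul_assoc, tangent_mul hX, mul_sub, mul_self_assoc h, sub_self]

lemma commute_mul_tangent {X Y : Mat n} (hX : X ∈ tangentSpace M)
    (hY : Y ∈ tangentSpace M) : M * (X * Y) = X * Y * M := by
  simp only [mul_assoc, mul_sub, tangent_mul hY, tangent_mul_assoc hX]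
  abel

lemma metric_eq_traceForm {X Y : Mat n} (hX : X ∈ tangentSpace M) :
    metric X Y = -(1 / 2) * (traceForm M X Y + traceForm M Y X) := by
  have h1 : (X * Y).trace = (M * X * Y).trace + (X * M * Y).trace := by
    rw [← Matrix.trace_add, ← add_mul, mem_tangentSpace.1 hX]
  have h2 : (X * M * Y).trace = (M * Y * X).trace := by
    rw [mul_assoc, Matrix.trace_mul_comm]
  rw [metric, traceForm, traceForm, h1, h2]

lemma omega_eq_traceForm {X Y : Mat n} :
    omega M X Y = -(1 / 2) * (traceForm M X Y - traceForm M Y X) := by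
  have h1 : (X * (Y * M)).trace = (M * X * Y).trace := by
    rw [← mul_assoc, Matrix.trace_mul_comm, mul_assoc]
  have h2 : (X * (M * Y)).trace = (M * Y * X).trace := Matrix.trace_mul_comm _ _
  rw [omega, metric, traceForm, traceForm]
  change -(1 / 2) * (X * (Y * M - M * Y)).trace = _
  rw [mul_sub, Matrix.trace_sub, h1, h2]

lemma traceForm_eq {X Y : Mat n} (hX : X ∈ tangentSpace M) : traceForm M X Y = -(metric X Y + omega M X Y) := by
  rw [metric_eq_traceForm hX, omega_eq_traceForm]; ring

lemma omega_swap {X Y : Mat n} : omega M Y X = -omega M X Y := by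
  rw [omega_eq_traceForm, omega_eq_traceForm]; ring

/-- The trace of a product of four tangent vectors. -/
lemma trace_mul_four (hM : M ∈ paraHyp n) {X Y Z W : Mat n} (hX : X ∈ tangentSpace M)
    (hY : Y ∈ tangentSpace M) (hZ : Z ∈ tangentSpace M) :
    (X * Y * (Z * W)).trace =
      traceForm M X Y * traceForm M Z W + traceForm M Y Z * traceForm M W X := by
  have h := paraHyp_mul_self hM
  have key : ∀ {A B C D : Mat n}, A ∈ tangentSpace M → B ∈ tangentSpace M →
      (M * (A * B) * (C * D)).trace = traceForm M A B * traceForm M C D := by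
    intro A B C D hA hB
    have h1 : M * (A * B) = M * (A * B) * M := by
      rw [mul_assoc, ← commute_mul_tangent hA hB, mul_self_assoc h]
    rw [h1, paraHyp_sandwich hM, smul_mul_assoc, Matrix.trace_smul, smul_eq_mul, traceForm,
      traceForm, mul_assoc M C D, mul_assoc M A B]
  have h2 : X * Y * (Z * W) = M * (X * Y) * (Z * W) + X * (M * (Y * Z)) * W := by
    have : X * Y * (Z * W) = (M * X + X * M) * Y * (Z * W) := by rw [mem_tangentSpace.1 hX]
    rw [this]; noncomm_ring
  have h3 : (X * (M * (Y * Z)) * W).trace = (M * (Y * Z) * (W * X)).trace := by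
    rw [mul_assoc, Matrix.trace_mul_comm, mul_assoc]
  rw [h2, Matrix.trace_add, h3, key hX hY, key hY hZ]

lemma tanProj_apply (X : Mat n) : tanProj M X = M * X + X * M - 2 • (M * X * M) := by
  unfold tanProj; noncomm_ring

lemma tanProj_mem (h : M * M = M) (X : Mat n) : tanProj M X ∈ tangentSpace M := by
  rw [mem_tangentSpace, tanProj]
  have e : M * (1 - M) = 0 := by rw [mul_sub, mul_one, h, sub_self]
  have e' : (1 - M) * M = 0 := by rw [sub_mul, one_mul, h, sub_self]
  have h1 : M * (M * X * (1 - M) + (1 - M) * X * M) = M * X * (1 - M) := by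
    rw [mul_add, ← mul_assoc, ← mul_assoc, h, ← mul_assoc, ← mul_assoc, e]; simp
  have h2 : (M * X * (1 - M) + (1 - M) * X * M) * M = (1 - M) * X * M := by
    rw [add_mul, mul_assoc (M * X), e', mul_assoc ((1 - M) * X), h]; simp
  rw [h1, h2]

lemma tanProj_of_mem (h : M * M = M) {X : Mat n} (hX : X ∈ tangentSpace M) : tanProj M X = X := by
  rw [tanProj_apply, tangent_sandwich h hX, smul_zero, sub_zero]; exact hX

lemma tanProj_of_commute (h : M * M = M) {X : Mat n} (hX : M * X = X * M) : tanProj M X = 0 := by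
  rw [tanProj_apply, hX, mul_assoc, h]; noncomm_ring

lemma tanProj_add (X Y : Mat n) : tanProj M (X + Y) = tanProj M X + tanProj M Y := by
  unfold tanProj; noncomm_ring

lemma tanProj_sub (X Y : Mat n) : tanProj M (X - Y) = tanProj M X - tanProj M Y := by
  unfold tanProj; noncomm_ring

lemma tanProj_smul (c : ℝ) (X : Mat n) : tanProj M (c • X) = c • tanProj M X := by
  simp [tanProj, smul_add]

lemma metric_tanProj (X Y : Mat n) : metric (tanProj M X) Y = metric X (tanProj M Y) := by
  have h1 : (M * X * Y).trace = (X * (Y * M)).trace := by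
    rw [mul_assoc, Matrix.trace_mul_comm, mul_assoc]
  have h2 : (M * X * M * Y).trace = (X * (M * Y * M)).trace := by
    rw [mul_assoc (M * X), mul_assoc M, Matrix.trace_mul_comm, mul_assoc]
  rw [metric, metric, tanProj_apply, tanProj_apply, sub_mul, add_mul, mul_sub, mul_add,
    Matrix.trace_sub, Matrix.trace_add, Matrix.trace_sub, Matrix.trace_add, h1, smul_mul_assoc,
    mul_smul_comm, Matrix.trace_smul, Matrix.trace_smul, h2, mul_assoc X M Y]
  ring

lemma metric_tanProj_left (h : M * M = M) {X Y : Mat n} (hY : Y ∈ tangentSpace M) :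
    metric (tanProj M X) Y = metric X Y := by
  rw [metric_tanProj, tanProj_of_mem h hY]

lemma metric_tanProj_right (h : M * M = M) {X Y : Mat n} (hY : Y ∈ tangentSpace M) :
    metric Y (tanProj M X) = metric Y X := by
  rw [← metric_tanProj, tanProj_of_mem h hY]

lemma metric_split (h : M * M = M) (X Y : Mat n) :
    metric X Y = metric (tanProj M X) (tanProj M Y)
      + metric (X - tanProj M X) (Y - tanProj M Y) := by
  rw [metric_sub_left, metric_sub_right, metric_sub_right,
    metric_tanProj_left h (tanProj_mem h Y), metric_tanProj X Y]
  ring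

lemma paraCx_apply (X : Mat n) : paraCx M X = X * M - M * X := rfl

lemma paraCx_mem (h : M * M = M) {X : Mat n} (hX : X ∈ tangentSpace M) :
    paraCx M X ∈ tangentSpace M := by
  rw [mem_tangentSpace, paraCx_apply]
  simp only [mul_sub, sub_mul, tangent_mul hX, mul_self_assoc h, mul_assoc]
  abel

lemma paraCx_paraCx (h : M * M = M) {X : Mat n} (hX : X ∈ tangentSpace M) :
    paraCx M (paraCx M X) = X := by
  rw [paraCx_apply, paraCx_apply]
  simp only [mul_sub, sub_mul, tangent_mul hX, mul_self_assoc h, mul_assoc]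
  abel

lemma metric_paraCx_left (X Y : Mat n) : metric (paraCx M X) Y = -metric X (paraCx M Y) := by
  have h := omega_swap (M := M) (X := X) (Y := Y)
  rw [omega, omega] at h
  rw [metric_comm, h]

lemma metric_paraCx_paraCx (h : M * M = M) {X Y : Mat n} (hY : Y ∈ tangentSpace M) :
    metric (paraCx M X) (paraCx M Y) = -metric X Y := by
  rw [metric_paraCx_left, paraCx_paraCx h hY]

end Algebra

/-! ### Differentiation of the metric and of tangent fields -/

section Calculus

variable {n : ℕ} {G : Type*} [NormedAddCommGroup G] [NormedSpace ℝ G]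

/-- The trace as a continuous linear map. -/
def traceL (n : ℕ) : Mat n →L[ℝ] ℝ :=
  LinearMap.toContinuousLinearMap (Matrix.traceLinearMap (Fin (n + 1)) ℝ ℝ)

lemma fderiv_mul_mat {A B : G → Mat n} {x : G} (hA : DifferentiableAt ℝ A x)
    (hB : DifferentiableAt ℝ B x) (v : G) :
    fderiv ℝ (fun y => A y * B y) x v = fderiv ℝ A x v * B x + A x * fderiv ℝ B x v := by
  have h := congrArg (fun φ => φ v) (hA.hasFDerivAt.mul' hB.hasFDerivAt).fderiv
  have h2 : fderiv ℝ (fun y => A y * B y) x v = A x * fderiv ℝ B x v + fderiv ℝ A x v * B x := h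
  exact h2.trans (add_comm _ _)

lemma fderiv_add_mat {A B : G → Mat n} {x : G} (hA : DifferentiableAt ℝ A x)
    (hB : DifferentiableAt ℝ B x) (v : G) :
    fderiv ℝ (fun y => A y + B y) x v = fderiv ℝ A x v + fderiv ℝ B x v :=
  congrArg (fun φ => φ v) (fderiv_fun_add hA hB)

lemma fderiv_sub_mat {A B : G → Mat n} {x : G} (hA : DifferentiableAt ℝ A x)
    (hB : DifferentiableAt ℝ B x) (v : G) :
    fderiv ℝ (fun y => A y - B y) x v = fderiv ℝ A x v - fderiv ℝ B x v :=
  congrArg (fun φ => φ v) (fderiv_fun_sub hA hB)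

lemma fderiv_smul_mat {c : G → ℝ} {B : G → Mat n} {x : G} (hc : DifferentiableAt ℝ c x)
    (hB : DifferentiableAt ℝ B x) (v : G) :
    fderiv ℝ (fun y => c y • B y) x v = fderiv ℝ c x v • B x + c x • fderiv ℝ B x v := by
  have h : fderiv ℝ (fun y => c y • B y) x v = c x • fderiv ℝ B x v + fderiv ℝ c x v • B x :=
    congrArg (fun φ => φ v) (fderiv_fun_smul hc hB)
  exact h.trans (add_comm _ _)

lemma fderiv_const_smul_mat (c : ℝ) {B : G → Mat n} {x : G} (hB : DifferentiableAt ℝ B x) (v : G) :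
    fderiv ℝ (fun y => c • B y) x v = c • fderiv ℝ B x v :=
  congrArg (fun φ => φ v) (fderiv_fun_const_smul hB c)

lemma fderiv_const_mat (B : Mat n) (x v : G) : fderiv ℝ (fun _ : G => B) x v = 0 :=
  congrArg (fun φ : G →L[ℝ] Mat n => φ v) (hasFDerivAt_const B x).fderiv

lemma fderiv_id_mat (x v : Mat n) : fderiv ℝ (fun y : Mat n => y) x v = v :=
  congrArg (fun φ => φ v) (fderiv_fun_id (𝕜 := ℝ) (x := x))

lemma fderiv_congr_mat {A B : G → Mat n} {x : G} (h : A =ᶠ[nhds x] B) (v : G) :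
    fderiv ℝ A x v = fderiv ℝ B x v :=
  congrArg (fun φ : G →L[ℝ] Mat n => φ v) h.fderiv_eq

lemma differentiableAt_const_smul_mat (c : ℝ) {B : G → Mat n} {x : G}
    (hB : DifferentiableAt ℝ B x) : DifferentiableAt ℝ (fun y => c • B y) x := hB.const_smul c

lemma differentiableAt_add_mat {A B : G → Mat n} {x : G} (hA : DifferentiableAt ℝ A x)
    (hB : DifferentiableAt ℝ B x) : DifferentiableAt ℝ (fun y => A y + B y) x := hA.add hB

lemma differentiableAt_sub_mat {A B : G → Mat n} {x : G} (hA : DifferentiableAt ℝ A x)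
    (hB : DifferentiableAt ℝ B x) : DifferentiableAt ℝ (fun y => A y - B y) x := hA.sub hB

lemma differentiableAt_smul_mat {c : G → ℝ} {B : G → Mat n} {x : G} (hc : DifferentiableAt ℝ c x)
    (hB : DifferentiableAt ℝ B x) : DifferentiableAt ℝ (fun y => c y • B y) x := hc.smul hB

lemma differentiableAt_mul_mat {A B : G → Mat n} {x : G} (hA : DifferentiableAt ℝ A x)
    (hB : DifferentiableAt ℝ B x) : DifferentiableAt ℝ (fun y => A y * B y) x := hA.mul hB

lemma contDiffAt_metric {k : WithTop ℕ∞} {A B : G → Mat n} {x : G} (hA : ContDiffAt ℝ k A x)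
    (hB : ContDiffAt ℝ k B x) : ContDiffAt ℝ k (fun y => metric (A y) (B y)) x := by
  have : (fun y => metric (A y) (B y)) = fun y => -(1 / 2) * traceL n (A y * B y) := rfl
  rw [this]
  exact contDiffAt_const.mul ((traceL n).contDiff.contDiffAt.comp x (hA.mul hB))

lemma contDiff_metric {k : WithTop ℕ∞} {A B : G → Mat n} (hA : ContDiff ℝ k A)
    (hB : ContDiff ℝ k B) : ContDiff ℝ k (fun y => metric (A y) (B y)) :=
  contDiff_iff_contDiffAt.2 fun _ => contDiffAt_metric hA.contDiffAt hB.contDiffAt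

lemma fderiv_metric {A B : G → Mat n} {x : G} (hA : DifferentiableAt ℝ A x)
    (hB : DifferentiableAt ℝ B x) (v : G) :
    fderiv ℝ (fun y => metric (A y) (B y)) x v
      = metric (fderiv ℝ A x v) (B x) + metric (A x) (fderiv ℝ B x v) := by
  have : (fun y => metric (A y) (B y)) = fun y => -(1 / 2) * traceL n (A y * B y) := rfl
  have h1 : HasFDerivAt (fun y => traceL n (A y * B y))
      ((traceL n).comp (fderiv ℝ (fun y => A y * B y) x)) x :=
    (traceL n).hasFDerivAt.comp x (differentiableAt_mul_mat hA hB).hasFDerivAt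
  have h2 : fderiv ℝ (fun y => metric (A y) (B y)) x v
      = -(1 / 2) * (fderiv ℝ (fun y => A y * B y) x v).trace :=
    congrArg (fun φ => φ v) (h1.const_mul (-(1 / 2))).fderiv
  rw [h2, fderiv_mul_mat hA hB, Matrix.trace_add, metric, metric, mul_add]

lemma continuous_metric {T : Type*} [TopologicalSpace T] {A B : T → Mat n} (hA : Continuous A)
    (hB : Continuous B) : Continuous fun y => metric (A y) (B y) :=
  continuous_const.mul ((traceL n).continuous.comp (hA.mul hB))

lemma contDiffAt_tanProj {k : WithTop ℕ∞} {A B : G → Mat n} {x : G} (hA : ContDiffAt ℝ k A x)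
    (hB : ContDiffAt ℝ k B x) : ContDiffAt ℝ k (fun y => tanProj (A y) (B y)) x := by
  unfold tanProj
  exact ((hA.mul hB).mul (contDiffAt_const.sub hA)).add
    (((contDiffAt_const.sub hA).mul hB).mul hA)

lemma fderiv_mem_tangentSpace {σ : G → Mat n} {x : G} (hσ : DifferentiableAt ℝ σ x)
    (h : ∀ᶠ y in nhds x, σ y * σ y = σ y) (v : G) : fderiv ℝ σ x v ∈ tangentSpace (σ x) := by
  have h2 : (fun y => σ y * σ y) =ᶠ[nhds x] σ := h
  have := fderiv_congr_mat h2 v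
  rw [fderiv_mul_mat hσ hσ] at this
  exact (add_comm _ _).trans this

/-- The component normal to the para-complex hyperbolic space of the derivative of a tangent
field. -/
lemma fderiv_sub_tanProj {σ ν : G → Mat n} {x : G} (hσ : DifferentiableAt ℝ σ x)
    (hν : DifferentiableAt ℝ ν x) (h : σ x * σ x = σ x)
    (hT : ∀ᶠ y in nhds x, ν y ∈ tangentSpace (σ y)) (v : G) :
    fderiv ℝ ν x v - tanProj (σ x) (fderiv ℝ ν x v)
      = (1 - 2 • σ x) * (fderiv ℝ σ x v * ν x + ν x * fderiv ℝ σ x v) := by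
  have h2 : (fun y => σ y * ν y + ν y * σ y) =ᶠ[nhds x] ν := hT
  have h3 := fderiv_congr_mat h2 v
  rw [fderiv_add_mat (differentiableAt_mul_mat hσ hν) (differentiableAt_mul_mat hν hσ),
    fderiv_mul_mat hσ hν, fderiv_mul_mat hν hσ] at h3
  set a := fderiv ℝ σ x v
  set d := fderiv ℝ ν x v
  set M := σ x
  set N := ν x
  have h4 : a * N + N * a = d - M * d - d * M := by
    rw [← sub_eq_zero]
    have := sub_eq_zero.2 h3
    rw [← this]; abel
  rw [h4, tanProj_apply]
  simp only [two_smul, sub_mul, add_mul, one_mul, mul_sub, mul_assoc, mul_self_assoc h]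
  abel

lemma metric_reflect {M A B : Mat n} (h : M * M = M) (hA : M * A = A * M) :
    metric ((1 - 2 • M) * A) ((1 - 2 • M) * B) = metric A B := by
  have : (1 - 2 • M) * A * ((1 - 2 • M) * B) = A * B := by
    have hc : (1 - 2 • M) * A = A * (1 - 2 • M) := by
      simp only [two_smul, sub_mul, add_mul, one_mul, mul_sub, mul_add, mul_one, hA]
    rw [hc, mul_assoc, ← mul_assoc (1 - 2 • M)]
    have : (1 - 2 • M) * (1 - 2 • M) = 1 := by
      simp only [two_smul, sub_mul, add_mul, one_mul, mul_sub, mul_add, mul_one, h]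
      abel
    rw [this, one_mul]
  rw [metric, metric, this]

/-- The inner product of the normal components of the derivatives of two tangent fields. -/
def normalTerm (M a N b K : Mat n) : ℝ :=
  -(1 / 2) * (traceForm M a N * traceForm M b K + traceForm M N b * traceForm M K a
    + (traceForm M a N * traceForm M K b + traceForm M N K * traceForm M b a)
    + (traceForm M N a * traceForm M b K + traceForm M a b * traceForm M K N)
    + (traceForm M N a * traceForm M K b + traceForm M a K * traceForm M b N))

lemma metric_anticomm {M a N b K : Mat n} (hM : M ∈ paraHyp n) (ha : a ∈ tangentSpace M)
    (hN : N ∈ tangentSpace M) (hb : b ∈ tangentSpace M) (hK : K ∈ tangentSpace M) :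
    metric (a * N + N * a) (b * K + K * b) = normalTerm M a N b K := by
  rw [metric, normalTerm]
  congr 1
  rw [add_mul, mul_add, mul_add, Matrix.trace_add, Matrix.trace_add, Matrix.trace_add,
    trace_mul_four hM ha hN hb, trace_mul_four hM ha hN hK,
    trace_mul_four hM hN ha hb, trace_mul_four hM hN ha hK]
  ring

lemma metric_fderiv_split {σ ν μ : G → Mat n} {x : G} (hσ : DifferentiableAt ℝ σ x)
    (hmem : ∀ᶠ y in nhds x, σ y ∈ paraHyp n)
    (hν : DifferentiableAt ℝ ν x) (hμ : DifferentiableAt ℝ μ x)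
    (hνT : ∀ᶠ y in nhds x, ν y ∈ tangentSpace (σ y))
    (hμT : ∀ᶠ y in nhds x, μ y ∈ tangentSpace (σ y)) (v w : G) :
    metric (fderiv ℝ ν x v) (fderiv ℝ μ x w)
      = metric (tanProj (σ x) (fderiv ℝ ν x v)) (tanProj (σ x) (fderiv ℝ μ x w))
        + normalTerm (σ x) (fderiv ℝ σ x v) (ν x) (fderiv ℝ σ x w) (μ x) := by
  have hM := hmem.self_of_nhds
  have h := paraHyp_mul_self hM
  have hsq : ∀ᶠ y in nhds x, σ y * σ y = σ y := hmem.mono fun y hy => paraHyp_mul_self hy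
  have hN := hνT.self_of_nhds
  have hK := hμT.self_of_nhds
  have hv := fderiv_mem_tangentSpace hσ hsq v
  have hw := fderiv_mem_tangentSpace hσ hsq w
  rw [metric_split h, fderiv_sub_tanProj hσ hν h hνT, fderiv_sub_tanProj hσ hμ h hμT,
    metric_reflect h, metric_anticomm hM hv hN hw hK]
  rw [mul_add, add_mul, commute_mul_tangent hv hN, commute_mul_tangent hN hv]

/-- The para-complex structure is parallel. -/
lemma tanProj_fderiv_paraCx {σ ν : G → Mat n} {x : G} (hσ : DifferentiableAt ℝ σ x)
    (hsq : ∀ᶠ y in nhds x, σ y * σ y = σ y)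
    (hν : DifferentiableAt ℝ ν x) (hN : ν x ∈ tangentSpace (σ x)) (v : G) :
    tanProj (σ x) (fderiv ℝ (fun y => paraCx (σ y) (ν y)) x v)
      = paraCx (σ x) (tanProj (σ x) (fderiv ℝ ν x v)) := by
  have h := hsq.self_of_nhds
  have hv := fderiv_mem_tangentSpace hσ hsq v
  have h1 : fderiv ℝ (fun y => paraCx (σ y) (ν y)) x v
      = paraCx (σ x) (fderiv ℝ ν x v) + (ν x * fderiv ℝ σ x v - fderiv ℝ σ x v * ν x) := by
    simp only [paraCx_apply]
    rw [fderiv_sub_mat (differentiableAt_mul_mat hν hσ) (differentiableAt_mul_mat hσ hν),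
      fderiv_mul_mat hσ hν, fderiv_mul_mat hν hσ]
    abel
  have h2 : tanProj (σ x) (ν x * fderiv ℝ σ x v - fderiv ℝ σ x v * ν x) = 0 := by
    apply tanProj_of_commute h
    rw [mul_sub, sub_mul, commute_mul_tangent hv hN, commute_mul_tangent hN hv]
  rw [h1, tanProj_add, h2, add_zero, tanProj_apply, tanProj_apply, paraCx_apply, paraCx_apply]
  set M := σ x
  set d := fderiv ℝ ν x v
  simp only [two_smul, sub_mul, add_mul, mul_sub, mul_add, mul_assoc, mul_self_assoc h, h]
  abel

/-! The same rules for maps between matrix spaces. -/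

lemma fderiv_mul_matEnd {A B : Mat n → Mat n} {x : Mat n} (hA : DifferentiableAt ℝ A x)
    (hB : DifferentiableAt ℝ B x) (v : Mat n) :
    fderiv ℝ (fun y => A y * B y) x v = fderiv ℝ A x v * B x + A x * fderiv ℝ B x v :=
  fderiv_mul_mat hA hB v

lemma fderiv_add_matEnd {A B : Mat n → Mat n} {x : Mat n} (hA : DifferentiableAt ℝ A x)
    (hB : DifferentiableAt ℝ B x) (v : Mat n) :
    fderiv ℝ (fun y => A y + B y) x v = fderiv ℝ A x v + fderiv ℝ B x v :=
  fderiv_add_mat hA hB v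

lemma fderiv_sub_matEnd {A B : Mat n → Mat n} {x : Mat n} (hA : DifferentiableAt ℝ A x)
    (hB : DifferentiableAt ℝ B x) (v : Mat n) :
    fderiv ℝ (fun y => A y - B y) x v = fderiv ℝ A x v - fderiv ℝ B x v :=
  fderiv_sub_mat hA hB v

lemma fderiv_const_smul_matEnd (c : ℝ) {B : Mat n → Mat n} {x : Mat n}
    (hB : DifferentiableAt ℝ B x) (v : Mat n) :
    fderiv ℝ (fun y => c • B y) x v = c • fderiv ℝ B x v :=
  fderiv_const_smul_mat c hB v

lemma fderiv_const_matEnd (B x v : Mat n) : fderiv ℝ (fun _ : Mat n => B) x v = 0 :=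
  fderiv_const_mat B x v

lemma tangent_reflect_one {M X S : Mat n} (h : M * M = M) (hX : X ∈ tangentSpace M)
    (hS : M * S = S * M) :
    X * (S - (2 : ℕ) • (M * S)) + (S - (2 : ℕ) • (M * S)) * X
      - 2 • (X * (S - (2 : ℕ) • (M * S)) * M) - 2 • (M * (S - (2 : ℕ) • (M * S)) * X)
      = X * S + S * X := by
  have h1 : S * (M * X) = M * (S * X) := by rw [← mul_assoc, ← hS, mul_assoc]
  simp only [two_smul, sub_mul, add_mul, mul_sub, mul_add, mul_assoc, tangent_mul_assoc hX,
    mul_self_assoc h, ← hS]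
  abel

lemma tangent_reflect_two {M Z Q : Mat n} (h : M * M = M) (hZ : Z ∈ tangentSpace M)
    (hQ : M * Q = Q * M) :
    (Q - (2 : ℕ) • (M * Q)) * Z + Z * (Q - (2 : ℕ) • (M * Q))
      - (2 : ℝ) • ((Q - (2 : ℕ) • (M * Q)) * Z * M + M * Z * (Q - (2 : ℕ) • (M * Q)))
      = -(Q * Z + Z * Q) := by
  have h1 : ∀ A, Q * (M * A) = M * (Q * A) := fun A => by rw [← mul_assoc, ← hQ, mul_assoc]
  simp only [two_smul, sub_mul, add_mul, mul_sub, mul_add, mul_assoc, tangent_mul_assoc hZ,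
    tangent_mul hZ, mul_self_assoc h, h1]
  abel

lemma tangent_mul_commute {M Z Q : Mat n} (hZ : Z ∈ tangentSpace M) (hQ : M * Q = Q * M) :
    Q * Z ∈ tangentSpace M ∧ Z * Q ∈ tangentSpace M := by
  constructor
  · rw [mem_tangentSpace, ← mul_assoc, hQ, mul_assoc, mul_assoc, ← mul_add, mem_tangentSpace.1 hZ]
  · rw [mem_tangentSpace, mul_assoc, ← hQ, ← mul_assoc, ← mul_assoc, ← add_mul,
      mem_tangentSpace.1 hZ]

/-- The curvature of the para-complex hyperbolic space. -/
lemma curvature_eq {M X Y Z : Mat n} (hM : M ∈ paraHyp n) (hX : X ∈ tangentSpace M)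
    (hY : Y ∈ tangentSpace M) (hZ : Z ∈ tangentSpace M) :
    curvature M X Y Z = (X * Y - Y * X) * Z - Z * (X * Y - Y * X) := by
  have h := paraHyp_mul_self hM
  have hdt : ∀ {H : Mat n → Mat n} {N : Mat n}, DifferentiableAt ℝ H N → ∀ V,
      fderiv ℝ (fun K => tanProj K (H K)) N V
        = V * H N + H N * V - 2 • (V * H N * N) - 2 • (N * H N * V) + tanProj N (fderiv ℝ H N V) := by
    intro H N hH V
    have hid : DifferentiableAt ℝ (fun K : Mat n => K) N := differentiableAt_id
    have e1 := differentiableAt_mul_mat hid hH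
    have e2 := differentiableAt_mul_mat hH hid
    have e3 := differentiableAt_mul_mat e1 hid
    have e : (fun K => tanProj K (H K)) = fun K => (K * H K + H K * K) - (2 : ℝ) • (K * H K * K) := by
      funext K; rw [tanProj_apply, two_smul, two_smul]
    rw [e, fderiv_sub_matEnd (differentiableAt_add_mat e1 e2) (differentiableAt_const_smul_mat (2 : ℝ) e3),
      fderiv_add_matEnd e1 e2, fderiv_const_smul_matEnd _ e3, fderiv_mul_matEnd e1 hid,
      fderiv_mul_matEnd hid hH, fderiv_mul_matEnd hH hid, fderiv_id_mat, tanProj_apply, two_smul ℝ]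
    noncomm_ring
  have hext : ∀ (W N V : Mat n), fderiv ℝ (extend W) N V
      = V * W + W * V - 2 • (V * W * N) - 2 • (N * W * V) := by
    intro W N V
    have := hdt (H := fun _ => W) (N := N) (differentiableAt_const W) V
    rw [show extend W = fun K => tanProj K W from rfl, this, fderiv_const_matEnd]
    simp [tanProj]
  have hextd : ∀ W : Mat n, Differentiable ℝ (extend W) := by
    intro W
    unfold extend tanProj
    fun_prop
  have hcov : ∀ {X Y Z : Mat n}, X ∈ tangentSpace M → Y ∈ tangentSpace M → Z ∈ tangentSpace M →
      covField (extend X) (covField (extend Y) (extend Z)) M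
        = -(X * Z * Y) - Y * Z * X - Y * X * Z - Z * X * Y := by
    intro X Y Z hX hY hZ
    have e0 : covField (extend Y) (extend Z) = fun K => tanProj K
        ((extend Y K * Z + Z * extend Y K) - (2 : ℝ) • (extend Y K * Z * K + K * Z * extend Y K)) := by
      funext K
      rw [covField, hext, two_smul, two_smul, two_smul]
      congr 1
      abel
    have hid : DifferentiableAt ℝ (fun K : Mat n => K) M := differentiableAt_id
    have hc : DifferentiableAt ℝ (fun _ : Mat n => Z) M := differentiableAt_const Z
    have hE := hextd Y M
    have d1 := differentiableAt_mul_mat hE hc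
    have d2 := differentiableAt_mul_mat hc hE
    have d3 := differentiableAt_mul_mat d1 hid
    have d4 := differentiableAt_mul_mat (differentiableAt_mul_mat hid hc) hE
    have d5 := differentiableAt_add_mat d3 d4
    have d6 := differentiableAt_add_mat d1 d2
    have d7 := differentiableAt_sub_mat d6 (differentiableAt_const_smul_mat (2 : ℝ) d5)
    have hEX : extend Y M = Y := tanProj_of_mem h hY
    have hXX : extend X M = X := tanProj_of_mem h hX
    have hdH : fderiv ℝ (fun K => (extend Y K * Z + Z * extend Y K) -
        (2 : ℝ) • (extend Y K * Z * K + K * Z * extend Y K)) M X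
        = fderiv ℝ (extend Y) M X * Z + Z * fderiv ℝ (extend Y) M X
          - (2 : ℝ) • (fderiv ℝ (extend Y) M X * Z * M + Y * Z * X
            + (X * Z * Y + M * Z * fderiv ℝ (extend Y) M X)) := by
      rw [fderiv_sub_matEnd d6 (differentiableAt_const_smul_mat (2 : ℝ) d5), fderiv_const_smul_matEnd _ d5,
        fderiv_add_matEnd d3 d4, fderiv_add_matEnd d1 d2, fderiv_mul_matEnd d1 hid,
        fderiv_mul_matEnd (differentiableAt_mul_mat hid hc) hE, fderiv_mul_matEnd hid hc,
        fderiv_mul_matEnd hE hc, fderiv_mul_matEnd hc hE, fderiv_id_mat, fderiv_const_matEnd, hEX]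
      simp
    rw [e0, covField, hXX, hdt d7, hdH, hEX, hext]
    have cS : M * (Y * Z + Z * Y) = (Y * Z + Z * Y) * M := by
      rw [mul_add, add_mul, commute_mul_tangent hY hZ, commute_mul_tangent hZ hY]
    have cQ : M * (X * Y + Y * X) = (X * Y + Y * X) * M := by
      rw [mul_add, add_mul, commute_mul_tangent hX hY, commute_mul_tangent hY hX]
    have eH : Y * Z + Z * Y - (2 : ℝ) • (Y * Z * M + M * Z * Y)
        = (Y * Z + Z * Y) - (2 : ℕ) • (M * (Y * Z + Z * Y)) := by
      rw [two_smul, mul_assoc M, commute_mul_tangent hZ hY, cS]; noncomm_ring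
    have eC : X * Y + Y * X - 2 • (X * Y * M) - 2 • (M * Y * X)
        = (X * Y + Y * X) - (2 : ℕ) • (M * (X * Y + Y * X)) := by
      rw [mul_assoc M, commute_mul_tangent hY hX, cQ]; noncomm_ring
    have eT : (X * Y + Y * X - (2 : ℕ) • (M * (X * Y + Y * X))) * Z
          + Z * (X * Y + Y * X - (2 : ℕ) • (M * (X * Y + Y * X)))
          - (2 : ℝ) • ((X * Y + Y * X - (2 : ℕ) • (M * (X * Y + Y * X))) * Z * M + Y * Z * X
            + (X * Z * Y + M * Z * (X * Y + Y * X - (2 : ℕ) • (M * (X * Y + Y * X)))))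
        = -((X * Y + Y * X) * Z + Z * (X * Y + Y * X)) - (2 : ℝ) • (Y * Z * X + X * Z * Y) := by
      rw [← tangent_reflect_two h hZ cQ, sub_sub, ← smul_add]
      congr 2
      abel
    have t1 := tangent_mul_commute hZ cQ
    have t2 := tangent_mul_commute hX cS
    have t3 := (tangent_mul_commute hX (commute_mul_tangent hY hZ)).1
    have t4 := (tangent_mul_commute hX (commute_mul_tangent hZ hY)).2
    have t5 : -((X * Y + Y * X) * Z + Z * (X * Y + Y * X)) - (2 : ℝ) • (Y * Z * X + X * Z * Y)
        ∈ tangentSpace M := by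
      rw [mul_assoc X Z Y]
      exact (tangentSpace M).sub_mem ((tangentSpace M).neg_mem ((tangentSpace M).add_mem t1.1 t1.2))
        ((tangentSpace M).smul_mem (2 : ℝ) ((tangentSpace M).add_mem t3 t4))
    rw [eH, eC, tangent_reflect_one h hX cS, eT, tanProj_of_mem h t5,
      tanProj_of_mem h ((tangentSpace M).add_mem ((tangentSpace M).add_mem t2.2 t2.1) t5), two_smul]
    simp only [mul_add, add_mul, mul_assoc]
    abel
  have hbr : covField (bracket (extend X) (extend Y)) (extend Z) M = 0 := by
    have hXX : extend X M = X := tanProj_of_mem h hX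
    have hYY : extend Y M = Y := tanProj_of_mem h hY
    have : bracket (extend X) (extend Y) M = 0 := by
      rw [bracket, hXX, hYY, hext, hext]
      simp only [two_smul, mul_sub, mul_assoc,
        tangent_mul hX, tangent_mul hY, tangent_mul_assoc hX, tangent_mul_assoc hY]
      abel
    rw [covField, this]
    simp [tanProj]
  rw [curvature, hbr, hcov hX hY hZ, hcov hY hX hZ]
  noncomm_ring

end Calculus

end ParaHyp
end

noncomputable section
namespace ParaHyp

/-! ### Definite planes and orthonormal frames -/

section Planes

variable {n : ℕ}

/-- A plane on which the metric is definite of sign `ε`. -/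
structure IsDefPlane (V : Submodule ℝ (Mat n)) (ε : ℝ) : Prop where
  sign : ε * ε = 1
  finrank_eq : Module.finrank ℝ V = 2
  pos : ∀ Y ∈ V, Y ≠ 0 → 0 < ε * metric Y Y

/-- An orthonormal frame of a plane of sign `ε`. -/
structure IsFrame (V : Submodule ℝ (Mat n)) (ε : ℝ) (u v : Mat n) : Prop where
  sign : ε * ε = 1
  mem_left : u ∈ V
  mem_right : v ∈ V
  left : metric u u = ε
  right : metric v v = ε
  ortho : metric u v = 0
  expand : ∀ Y ∈ V, Y = (ε * metric Y u) • u + (ε * metric Y v) • v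

/-- The first step of the Gram-Schmidt process. -/
def gsLeft (ε : ℝ) (a : Mat n) : Mat n := (√(ε * metric a a))⁻¹ • a

/-- The component of `b` orthogonal to `a`. -/
def gsPerp (ε : ℝ) (a b : Mat n) : Mat n := b - (ε * metric b (gsLeft ε a)) • gsLeft ε a

/-- The second step of the Gram-Schmidt process. -/
def gsRight (ε : ℝ) (a b : Mat n) : Mat n := gsLeft ε (gsPerp ε a b)

lemma metric_gsLeft {ε : ℝ} (hε : ε * ε = 1) {a : Mat n} (ha : 0 < ε * metric a a) :
    metric (gsLeft ε a) (gsLeft ε a) = ε := by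
  rw [gsLeft, metric_smul_left, metric_smul_right]
  have h1 : √(ε * metric a a) ≠ 0 := (Real.sqrt_pos.2 ha).ne'
  have h2 := Real.mul_self_sqrt ha.le
  have h3 : metric a a = ε * (√(ε * metric a a) * √(ε * metric a a)) := by
    rw [h2, ← mul_assoc, hε, one_mul]
  generalize √(ε * metric a a) = s at *
  rw [h3]
  field_simp

lemma gs_spec {V : Submodule ℝ (Mat n)} {ε : ℝ} (hV : IsDefPlane V ε) {a b : Mat n}
    (hab : V = Submodule.span ℝ {a, b}) :
    0 < ε * metric a a ∧ 0 < ε * metric (gsPerp ε a b) (gsPerp ε a b) ∧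
      IsFrame V ε (gsLeft ε a) (gsRight ε a b) := by
  have hε := hV.sign
  have haV : a ∈ V := hab ▸ Submodule.subset_span (by simp)
  have hbV : b ∈ V := hab ▸ Submodule.subset_span (by simp)
  have hli : LinearIndependent ℝ ![a, b] := by
    rw [linearIndependent_iff_card_eq_finrank_span]
    have : Set.range ![a, b] = {a, b} := by simp [Set.pair_comm]
    rw [Set.finrank, this, ← hab, hV.finrank_eq]
    simp
  have ha0 : a ≠ 0 := hli.ne_zero 0
  have ha := hV.pos a haV ha0
  have hu := metric_gsLeft hε ha
  have huV : gsLeft ε a ∈ V := V.smul_mem _ haV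
  have hpV : gsPerp ε a b ∈ V := V.sub_mem hbV (V.smul_mem _ huV)
  have hp0 : gsPerp ε a b ≠ 0 := by
    intro h0
    have := (LinearIndependent.pair_iff.1 hli) (-((ε * metric b (gsLeft ε a)) * (√(ε * metric a a))⁻¹)) 1
    have h1 := this (by
      rw [one_smul, neg_smul, mul_smul, add_comm, ← sub_eq_add_neg]
      exact h0)
    simp at h1
  have hp := hV.pos _ hpV hp0
  have hv : metric (gsRight ε a b) (gsRight ε a b) = ε := metric_gsLeft hε hp
  have hvV : gsRight ε a b ∈ V := V.smul_mem _ hpV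
  have huv : metric (gsLeft ε a) (gsRight ε a b) = 0 := by
    change metric (gsLeft ε a) ((√(ε * metric (gsPerp ε a b) (gsPerp ε a b)))⁻¹ • gsPerp ε a b) = 0
    rw [metric_smul_right]
    change _ * metric (gsLeft ε a) (b - (ε * metric b (gsLeft ε a)) • gsLeft ε a) = 0
    rw [metric_sub_right, metric_smul_right]
    rw [hu, metric_comm b]
    linear_combination (-(√(ε * metric (gsPerp ε a b) (gsPerp ε a b)))⁻¹ * metric (gsLeft ε a) b) * hε
  refine ⟨ha, hp, hε, huV, hvV, hu, hv, huv, ?_⟩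
  have hsa : √(ε * metric a a) ≠ 0 := (Real.sqrt_pos.2 ha).ne'
  have hsp : √(ε * metric (gsPerp ε a b) (gsPerp ε a b)) ≠ 0 := (Real.sqrt_pos.2 hp).ne'
  have ea : a = √(ε * metric a a) • gsLeft ε a := by rw [gsLeft, smul_inv_smul₀ hsa]
  have eb : b = (ε * metric b (gsLeft ε a)) • gsLeft ε a
      + √(ε * metric (gsPerp ε a b) (gsPerp ε a b)) • gsRight ε a b := by
    have h1 : √(ε * metric (gsPerp ε a b) (gsPerp ε a b)) • gsRight ε a b = gsPerp ε a b :=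
      smul_inv_smul₀ hsp _
    rw [h1]
    exact (add_sub_cancel _ _).symm
  have key : ∀ s t : ℝ, ∀ Y, Y = s • gsLeft ε a + t • gsRight ε a b →
      Y = (ε * metric Y (gsLeft ε a)) • gsLeft ε a + (ε * metric Y (gsRight ε a b)) • gsRight ε a b := by
    intro s t Y hY
    have h1 : ε * metric Y (gsLeft ε a) = s := by
      rw [hY, metric_add_left, metric_smul_left, metric_smul_left, hu, metric_comm (gsRight ε a b), huv]
      linear_combination s * hε
    have h2 : ε * metric Y (gsRight ε a b) = t := by
      rw [hY, metric_add_left, metric_smul_left, metric_smul_left, hv, huv]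
      linear_combination t * hε
    rw [h1, h2]
    exact hY
  intro Y hY
  rw [hab, Submodule.mem_span_pair] at hY
  obtain ⟨s, t, rfl⟩ := hY
  refine key (s * √(ε * metric a a) + t * (ε * metric b (gsLeft ε a)))
    (t * √(ε * metric (gsPerp ε a b) (gsPerp ε a b))) _ ?_
  have e1 : s • a = (s * √(ε * metric a a)) • gsLeft ε a := by rw [mul_smul, ← ea]
  have e2 : t • b = (t * (ε * metric b (gsLeft ε a))) • gsLeft ε a
      + (t * √(ε * metric (gsPerp ε a b) (gsPerp ε a b))) • gsRight ε a b := by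
    rw [mul_smul t, mul_smul t, ← smul_add, ← eb]
  rw [e1, e2, add_smul]
  abel

lemma exists_frame {V : Submodule ℝ (Mat n)} {ε : ℝ} (hV : IsDefPlane V ε) :
    ∃ u v, IsFrame V ε u v := by
  have : FiniteDimensional ℝ V := FiniteDimensional.of_finrank_pos (by rw [hV.finrank_eq]; norm_num)
  let b := Module.finBasisOfFinrankEq ℝ V hV.finrank_eq
  have : V = Submodule.span ℝ {(b 0 : Mat n), (b 1 : Mat n)} := by
    have h1 := b.span_eq
    have h2 := congrArg (Submodule.map V.subtype) h1
    rw [Submodule.map_span, Submodule.map_top, Submodule.range_subtype] at h2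
    refine h2.symm.trans (congrArg (Submodule.span ℝ) ?_)
    ext Y
    simp [Fin.exists_fin_two, eq_comm]
  exact ⟨_, _, (gs_spec hV this).2.2⟩

lemma orthProj_unique {V : Submodule ℝ (Mat n)} {ε : ℝ} (hV : IsDefPlane V ε) {Z W : Mat n}
    (hW : W ∈ V) (h : ∀ Y ∈ V, metric (Z - W) Y = 0) : orthProj V Z = W := by
  have hex : ∃ W, W ∈ V ∧ ∀ Y ∈ V, metric (Z - W) Y = 0 := ⟨W, hW, h⟩
  have h1 : orthProj V Z ∈ V := (Classical.epsilon_spec hex).1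
  have h2 : ∀ Y ∈ V, metric (Z - orthProj V Z) Y = 0 := (Classical.epsilon_spec hex).2
  by_contra hne
  have hd : orthProj V Z - W ≠ 0 := sub_ne_zero.2 hne
  have hdV : orthProj V Z - W ∈ V := V.sub_mem h1 hW
  have h3 := hV.pos _ hdV hd
  have h4 : metric (orthProj V Z - W) (orthProj V Z - W) = 0 := by
    have e : orthProj V Z - W = (Z - W) - (Z - orthProj V Z) := by abel
    conv_lhs => rw [e]
    rw [metric_sub_left, ← e, h _ hdV, h2 _ hdV, sub_zero]
  rw [h4, mul_zero] at h3
  exact lt_irrefl _ h3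

lemma IsFrame.orthProj_eq {V : Submodule ℝ (Mat n)} {ε : ℝ} (hV : IsDefPlane V ε) {u v : Mat n}
    (h : IsFrame V ε u v) (Z : Mat n) :
    orthProj V Z = (ε * metric Z u) • u + (ε * metric Z v) • v := by
  refine orthProj_unique hV (V.add_mem (V.smul_mem _ h.mem_left) (V.smul_mem _ h.mem_right)) ?_
  intro Y hY
  rw [h.expand Y hY]
  simp only [metric_sub_left, metric_add_left, metric_add_right, metric_smul_left,
    metric_smul_right, h.left, h.right, h.ortho, metric_comm v u]
  linear_combination (-(metric Z u * (ε * metric Y u)) - (metric Z v * (ε * metric Y v))) * h.sign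

section Proj

variable {V : Submodule ℝ (Mat n)} {ε : ℝ} (hV : IsDefPlane V ε)
include hV

lemma orthProj_mem (Z : Mat n) : orthProj V Z ∈ V := by
  obtain ⟨u, v, h⟩ := exists_frame hV
  rw [h.orthProj_eq hV]
  exact V.add_mem (V.smul_mem _ h.mem_left) (V.smul_mem _ h.mem_right)

lemma orthProj_of_mem {Z : Mat n} (hZ : Z ∈ V) : orthProj V Z = Z :=
  orthProj_unique hV hZ fun Y _ => by rw [sub_self, metric_zero_left]

lemma metric_orthProj_left (Z : Mat n) {Y : Mat n} (hY : Y ∈ V) :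
    metric (orthProj V Z) Y = metric Z Y := by
  obtain ⟨u, v, h⟩ := exists_frame hV
  rw [h.orthProj_eq hV, h.expand Y hY]
  simp only [metric_add_left, metric_add_right, metric_smul_left,
    metric_smul_right, h.left, h.right, h.ortho, metric_comm v u]
  linear_combination ((metric Z u * (ε * metric Y u)) + (metric Z v * (ε * metric Y v))) * h.sign

lemma metric_orthProj_right (Z : Mat n) {Y : Mat n} (hY : Y ∈ V) :
    metric Y (orthProj V Z) = metric Y Z := by
  rw [metric_comm, metric_orthProj_left hV Z hY, metric_comm]

lemma orthProj_add (Z W : Mat n) : orthProj V (Z + W) = orthProj V Z + orthProj V W := by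
  refine orthProj_unique hV (V.add_mem (orthProj_mem hV Z) (orthProj_mem hV W)) fun Y hY => ?_
  rw [metric_sub_left, metric_add_left, metric_add_left, metric_orthProj_left hV Z hY,
    metric_orthProj_left hV W hY, sub_self]

lemma orthProj_smul (c : ℝ) (Z : Mat n) : orthProj V (c • Z) = c • orthProj V Z := by
  refine orthProj_unique hV (V.smul_mem _ (orthProj_mem hV Z)) fun Y hY => ?_
  rw [metric_sub_left, metric_smul_left, metric_smul_left, metric_orthProj_left hV Z hY, sub_self]

lemma orthProj_zero : orthProj V 0 = 0 := orthProj_of_mem hV V.zero_mem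

lemma orthProj_neg (Z : Mat n) : orthProj V (-Z) = -orthProj V Z := by
  have := orthProj_smul hV (-1) Z
  rwa [neg_one_smul, neg_one_smul] at this

lemma orthProj_sum {ι : Type*} (s : Finset ι) (f : ι → Mat n) :
    orthProj V (∑ i ∈ s, f i) = ∑ i ∈ s, orthProj V (f i) := by
  classical
  induction s using Finset.induction_on with
  | empty => simpa using orthProj_zero hV
  | insert a s ha ih => rw [Finset.sum_insert ha, Finset.sum_insert ha, orthProj_add hV, ih]

lemma orthProj_eq_zero {Z : Mat n} (h : ∀ Y ∈ V, metric Z Y = 0) : orthProj V Z = 0 :=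
  orthProj_unique hV V.zero_mem fun Y hY => by rw [sub_zero, h Y hY]

lemma eq_of_metric_eq {Z W : Mat n} (hZ : Z ∈ V) (hW : W ∈ V)
    (h : ∀ Y ∈ V, metric Z Y = metric W Y) : Z = W := by
  rw [← orthProj_of_mem hV hZ]
  exact orthProj_unique hV hW fun Y hY => by rw [metric_sub_left, h Y hY, sub_self]

lemma IsDefPlane.eq_zero {Y : Mat n} (hY : Y ∈ V) (h : metric Y Y = 0) : Y = 0 := by
  by_contra h0
  have := hV.pos Y hY h0
  rw [h, mul_zero] at this
  exact lt_irrefl _ this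

lemma IsDefPlane.nonneg {Y : Mat n} (hY : Y ∈ V) : 0 ≤ ε * metric Y Y := by
  rcases eq_or_ne Y 0 with rfl | h
  · rw [metric_zero_left, mul_zero]
  · exact (hV.pos Y hY h).le

end Proj

section Smooth

variable {G : Type*} [NormedAddCommGroup G] [NormedSpace ℝ G]

lemma contDiffAt_gsLeft {k : WithTop ℕ∞} {ε : ℝ} {a : G → Mat n} {x : G} (ha : ContDiffAt ℝ k a x)
    (h : 0 < ε * metric (a x) (a x)) : ContDiffAt ℝ k (fun y => gsLeft ε (a y)) x := by
  have h1 : ContDiffAt ℝ k (fun y => ε * metric (a y) (a y)) x :=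
    contDiffAt_const.mul (contDiffAt_metric ha ha)
  exact ((h1.sqrt h.ne').inv (Real.sqrt_pos.2 h).ne').smul ha

lemma contDiffAt_gsPerp {k : WithTop ℕ∞} {ε : ℝ} {a b : G → Mat n} {x : G} (ha : ContDiffAt ℝ k a x)
    (hb : ContDiffAt ℝ k b x)
    (h : 0 < ε * metric (a x) (a x)) : ContDiffAt ℝ k (fun y => gsPerp ε (a y) (b y)) x := by
  have h1 := contDiffAt_gsLeft ha h
  exact hb.sub ((contDiffAt_const.mul (contDiffAt_metric hb h1)).smul h1)

/-- Local orthonormal frames. -/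
lemma exists_local_frame {V : Plane → Submodule ℝ (Mat n)} {ε : ℝ} (hV : IsRankTwoSubbundle V)
    (hd : ∀ x, IsDefPlane (V x) ε) (x : Plane) :
    ∃ u v : Plane → Mat n, ∀ᶠ y in nhds x, ContDiffAt ℝ ∞ u y ∧ ContDiffAt ℝ ∞ v y ∧
      IsFrame (V y) ε (u y) (v y) := by
  obtain ⟨U, hU, hxU, a, b, ha, hb, hab⟩ := hV.locally_spanned x
  refine ⟨fun y => gsLeft ε (a y), fun y => gsRight ε (a y) (b y), ?_⟩
  filter_upwards [hU.mem_nhds hxU] with y hy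
  have hUy := hU.mem_nhds hy
  have ha' := ha.contDiffAt hUy
  have hb' := hb.contDiffAt hUy
  obtain ⟨h1, h2, h3⟩ := gs_spec (hd y) (hab y hy)
  exact ⟨contDiffAt_gsLeft ha' h1, contDiffAt_gsLeft (contDiffAt_gsPerp ha' hb' h1) h2, h3⟩

lemma contDiffAt_orthProj {V : Plane → Submodule ℝ (Mat n)} {ε : ℝ} (hV : IsRankTwoSubbundle V)
    (hd : ∀ x, IsDefPlane (V x) ε) {Z : Plane → Mat n} {x : Plane} (hZ : ContDiffAt ℝ ∞ Z x) :
    ContDiffAt ℝ ∞ (fun y => orthProj (V y) (Z y)) x := by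
  obtain ⟨u, v, h⟩ := exists_local_frame hV hd x
  have hu := h.self_of_nhds.1
  have hv := h.self_of_nhds.2.1
  have h1 : ContDiffAt ℝ ∞ (fun y => (ε * metric (Z y) (u y)) • u y + (ε * metric (Z y) (v y)) • v y) x :=
    ((contDiffAt_const.mul (contDiffAt_metric hZ hu)).smul hu).add
      ((contDiffAt_const.mul (contDiffAt_metric hZ hv)).smul hv)
  refine h1.congr_of_eventuallyEq ?_
  filter_upwards [h] with y hy
  exact hy.2.2.orthProj_eq (hd y) _

lemma contDiff_orthProj {V : Plane → Submodule ℝ (Mat n)} {ε : ℝ} (hV : IsRankTwoSubbundle V)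
    (hd : ∀ x, IsDefPlane (V x) ε) {Z : Plane → Mat n} (hZ : ContDiff ℝ ∞ Z) :
    ContDiff ℝ ∞ (fun y => orthProj (V y) (Z y)) :=
  contDiff_iff_contDiffAt.2 fun _ => contDiffAt_orthProj hV hd hZ.contDiffAt

lemma contDiffAt_fderiv_mat {A : G → Mat n} {x : G} (hA : ContDiffAt ℝ ∞ A x) {X : G → G}
    (hX : ContDiffAt ℝ ∞ X x) : ContDiffAt ℝ ∞ (fun y => fderiv ℝ A y (X y)) x :=
  (hA.fderiv_right (m := ∞) (by simp)).clm_apply hX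

lemma differentiableAt_mat {A : G → Mat n} {x : G} (hA : ContDiffAt ℝ ∞ A x) :
    DifferentiableAt ℝ A x := hA.differentiableAt (by simp)

lemma fderiv_fderiv_comm {A : G → Mat n} {x : G} (hA : ContDiffAt ℝ ∞ A x) (v w : G) :
    fderiv ℝ (fun y => fderiv ℝ A y v) x w = fderiv ℝ (fun y => fderiv ℝ A y w) x v := by
  have h := hA.isSymmSndFDerivAt (by simpa using two_le_smooth)
  have hd : DifferentiableAt ℝ (fderiv ℝ A) x :=
    (hA.fderiv_right (m := ∞) (by simp)).differentiableAt (by simp)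
  have key : ∀ v w : G, fderiv ℝ (fun y => fderiv ℝ A y v) x w = fderiv ℝ (fderiv ℝ A) x w v := by
    intro v w
    exact congrArg (fun φ : G →L[ℝ] Mat n => φ w)
      ((hd.hasFDerivAt.clm_apply (hasFDerivAt_const v x)).fderiv) |>.trans
      ((congrArg (· + _) (map_zero (fderiv ℝ A x))).trans (zero_add _))
  rw [key, key]
  exact (h.eq v w).symm

end Smooth

end Planes

end ParaHyp
end

noncomputable section
namespace ParaHyp

/-! ### The Frenet splitting -/

/-- The sign of the metric on `ℒ_i`. -/
def eps (i : ℕ) : ℝ := (-1) ^ (i + 1)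

lemma eps_succ (i : ℕ) : eps (i + 1) = -eps i := by
  rw [eps, eps, pow_succ]; ring

lemma eps_mul_self (i : ℕ) : eps i * eps i = 1 := by
  rw [eps, ← mul_pow]; norm_num

lemma eps_of_odd {i : ℕ} (h : Odd i) : eps i = 1 := by
  rw [eps]; exact Even.neg_one_pow h.add_one

lemma eps_of_even {i : ℕ} (h : Even i) : eps i = -1 := by
  rw [eps]; exact Odd.neg_one_pow h.add_one

/-- A smooth section of `V` near `x`. -/
structure LocSec {n : ℕ} (V : Plane → Submodule ℝ (Mat n)) (ν : Plane → Mat n) (x : Plane) :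
    Prop where
  eventually_smooth : ∀ᶠ y in nhds x, ContDiffAt ℝ ∞ ν y
  mem : ∀ᶠ y in nhds x, ν y ∈ V y

/-- The component in `ℒ_i` of the derivative of sections of `ℒ_j`; it is tensorial for `i ≠ j`. -/
def connForm {n : ℕ} (L : ℕ → Plane → Submodule ℝ (Mat n)) (i j : ℕ) (x v : Plane) (Y : Mat n) :
    Mat n :=
  orthProj (L i x) (fderiv ℝ (fun y => orthProj (L j y) Y) x v)

section LocSecs

variable {n : ℕ} {V W : Plane → Submodule ℝ (Mat n)} {ν μ : Plane → Mat n} {x : Plane}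

lemma LocSec.mem_self (h : LocSec V ν x) : ν x ∈ V x := h.mem.self_of_nhds

lemma LocSec.smooth (h : LocSec V ν x) : ContDiffAt ℝ ∞ ν x := h.eventually_smooth.self_of_nhds

lemma LocSec.diff (h : LocSec V ν x) : DifferentiableAt ℝ ν x := differentiableAt_mat h.smooth

lemma IsSection.locSec (h : IsSection V ν) (x : Plane) : LocSec V ν x :=
  ⟨Filter.Eventually.of_forall fun _ => h.1.contDiffAt, Filter.Eventually.of_forall h.2⟩

lemma LocSec.eventually (h : LocSec V ν x) : ∀ᶠ y in nhds x, LocSec V ν y := by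
  filter_upwards [h.eventually_smooth.eventually_nhds, h.mem.eventually_nhds] with y hy hy'
    using ⟨hy, hy'⟩

lemma metric_fderiv_of_ortho (hν : LocSec V ν x) (hμ : LocSec W μ x)
    (ho : ∀ y, ∀ Y ∈ V y, ∀ Z ∈ W y, metric Y Z = 0) (v : Plane) :
    metric (fderiv ℝ ν x v) (μ x) = -metric (ν x) (fderiv ℝ μ x v) := by
  have h1 : (fun y => metric (ν y) (μ y)) =ᶠ[nhds x] fun _ => 0 := by
    filter_upwards [hν.mem, hμ.mem] with y hy hy' using ho y _ hy _ hy'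
  have h2 := fderiv_metric hν.diff hμ.diff v
  rw [h1.fderiv_eq, fderiv_fun_const] at h2
  change (0 : ℝ) = _ at h2
  linarith

end LocSecs

namespace IsIsotropicPAlternating

variable {m : ℕ} {σ : Plane → Mat (2 * m)} {L : ℕ → Plane → Submodule ℝ (Mat (2 * m))}
  (hσ : IsIsotropicPAlternating σ L)
include hσ

lemma idem (x : Plane) : σ x * σ x = σ x := paraHyp_mul_self (hσ.mem x)

lemma le_tangent {i : ℕ} (hi : i ∈ Finset.Icc 1 (2 * m)) (x : Plane) : L i x ≤ tangentSpace (σ x) :=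
  le_trans (le_iSup₂ (f := fun i (_ : i ∈ Finset.Icc 1 (2 * m)) => L i x) i hi)
    (hσ.frenet.sum_eq x).le

omit hσ in
lemma even_index {i : ℕ} (hi : i ∈ Finset.Icc 1 (2 * m)) (h : Even i) :
    ∃ k ∈ Finset.Icc 1 m, i = 2 * m - 2 * (k - 1) ∧ 2 * k - 1 = 2 * m + 1 - i := by
  obtain ⟨r, rfl⟩ := h
  rw [Finset.mem_Icc] at hi
  exact ⟨m + 1 - r, by rw [Finset.mem_Icc]; omega, by omega, by omega⟩

lemma defPlane {i : ℕ} (hi : i ∈ Finset.Icc 1 (2 * m)) (x : Plane) : IsDefPlane (L i x) (eps i) := by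
  refine ⟨eps_mul_self i, (hσ.frenet.subbundle i hi).finrank_eq x, fun Y hY hY0 => ?_⟩
  rcases Nat.even_or_odd i with h | h
  · rw [eps_of_even h]
    obtain ⟨k, hk, hik, hk'⟩ := even_index hi h
    rw [hik, ← hσ.alternating k hk x] at hY
    obtain ⟨Z, hZ, rfl⟩ := hY
    have hk1 : 2 * k - 1 ∈ Finset.Icc 1 (2 * m) := by
      rw [Finset.mem_Icc] at hk ⊢; omega
    have hodd : Odd (2 * k - 1) := by
      rw [Finset.mem_Icc] at hk
      exact ⟨k - 1, by omega⟩
    rw [metric_paraCx_paraCx (hσ.idem x) (hσ.le_tangent hk1 x hZ)]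
    have := hσ.pos_odd _ hk1 hodd x Z hZ (by rintro rfl; exact hY0 (map_zero _))
    linarith
  · rw [eps_of_odd h, one_mul]
    exact hσ.pos_odd i hi h x Y hY hY0

lemma paraCx_mem {i : ℕ} (hi : i ∈ Finset.Icc 1 (2 * m)) {x : Plane} {Y : Mat (2 * m)}
    (hY : Y ∈ L i x) : paraCx (σ x) Y ∈ L (2 * m + 1 - i) x := by
  rcases Nat.even_or_odd i with h | h
  · obtain ⟨k, hk, hik, hk'⟩ := even_index hi h
    rw [hik, ← hσ.alternating k hk x] at hY
    obtain ⟨Z, hZ, rfl⟩ := hY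
    have hk1 : 2 * k - 1 ∈ Finset.Icc 1 (2 * m) := by
      rw [Finset.mem_Icc] at hk ⊢; omega
    rw [paraCx_paraCx (hσ.idem x) (hσ.le_tangent hk1 x hZ), ← hk']
    exact hZ
  · obtain ⟨r, rfl⟩ := h
    rw [Finset.mem_Icc] at hi
    have h1 := hσ.alternating (r + 1) (by rw [Finset.mem_Icc]; omega) x
    have h2 : 2 * m + 1 - (2 * r + 1) = 2 * m - 2 * (r + 1 - 1) := by omega
    have h3 : 2 * (r + 1) - 1 = 2 * r + 1 := by omega
    rw [h2, ← h1, h3]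
    exact ⟨Y, hY, rfl⟩

lemma ortho {i j : ℕ} (hi : i ∈ Finset.Icc 1 (2 * m)) (hj : j ∈ Finset.Icc 1 (2 * m)) (hij : i ≠ j)
    (x : Plane) {Y Z : Mat (2 * m)} (hY : Y ∈ L i x) (hZ : Z ∈ L j x) : metric Y Z = 0 :=
  hσ.frenet.orthogonal i hi j hj hij x Y hY Z hZ

lemma orthProj_ortho {i j : ℕ} (hi : i ∈ Finset.Icc 1 (2 * m)) (hj : j ∈ Finset.Icc 1 (2 * m))
    (hij : i ≠ j) (x : Plane) {Y : Mat (2 * m)} (hY : Y ∈ L j x) : orthProj (L i x) Y = 0 :=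
  orthProj_eq_zero (hσ.defPlane hi x) fun _ hZ => hσ.ortho hj hi hij.symm x hY hZ

lemma metric_tangent_eq_zero {x : Plane} {W : Mat (2 * m)}
    (h : ∀ i ∈ Finset.Icc 1 (2 * m), ∀ Y ∈ L i x, metric W Y = 0) {Z : Mat (2 * m)}
    (hZ : Z ∈ tangentSpace (σ x)) : metric W Z = 0 := by
  let K : Submodule ℝ (Mat (2 * m)) :=
    { carrier := {Z | metric W Z = 0}
      add_mem' := fun {a b} ha hb => by
        change metric W (a + b) = 0
        rw [metric_add_right, show metric W a = 0 from ha, show metric W b = 0 from hb, add_zero]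
      zero_mem' := metric_zero_right W
      smul_mem' := fun c a ha => by
        change metric W (c • a) = 0
        rw [metric_smul_right, show metric W a = 0 from ha, mul_zero] }
  have : ⨆ i ∈ Finset.Icc 1 (2 * m), L i x ≤ K := iSup₂_le fun i hi Y hY => h i hi Y hY
  rw [hσ.frenet.sum_eq x] at this
  exact this hZ

lemma tangent_eq_zero {x : Plane} {W : Mat (2 * m)} (hW : W ∈ tangentSpace (σ x))
    (h : ∀ i ∈ Finset.Icc 1 (2 * m), ∀ Y ∈ L i x, metric W Y = 0) : W = 0 := by
  refine metric_nondegenerate fun Y => ?_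
  rw [← metric_tanProj_right (hσ.idem x) hW]
  exact hσ.metric_tangent_eq_zero h (tanProj_mem (hσ.idem x) Y)

lemma sum_orthProj {x : Plane} {Z : Mat (2 * m)} (hZ : Z ∈ tangentSpace (σ x)) :
    ∑ i ∈ Finset.Icc 1 (2 * m), orthProj (L i x) Z = Z := by
  rw [← sub_eq_zero]
  refine hσ.tangent_eq_zero (Submodule.sub_mem _ (Submodule.sum_mem _ fun i hi =>
    hσ.le_tangent hi x (orthProj_mem (hσ.defPlane hi x) Z)) hZ) fun i hi Y hY => ?_
  rw [metric_sub_left, metric_sum_left, Finset.sum_eq_single i,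
    metric_orthProj_left (hσ.defPlane hi x) Z hY, sub_self]
  · intro j hj hji
    exact hσ.ortho hj hi hji x (orthProj_mem (hσ.defPlane hj x) Z) hY
  · exact fun h => absurd hi h

lemma orthProj_tanProj {i : ℕ} (hi : i ∈ Finset.Icc 1 (2 * m)) (x : Plane) (Z : Mat (2 * m)) :
    orthProj (L i x) (tanProj (σ x) Z) = orthProj (L i x) Z := by
  refine orthProj_unique (hσ.defPlane hi x) (orthProj_mem (hσ.defPlane hi x) Z) fun Y hY => ?_
  rw [metric_sub_left, metric_orthProj_left (hσ.defPlane hi x) Z hY,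
    metric_tanProj_left (hσ.idem x) (hσ.le_tangent hi x hY), sub_self]

lemma tanProj_eq_sum (x : Plane) (Z : Mat (2 * m)) :
    tanProj (σ x) Z = ∑ i ∈ Finset.Icc 1 (2 * m), orthProj (L i x) Z := by
  rw [← hσ.sum_orthProj (tanProj_mem (hσ.idem x) Z)]
  exact Finset.sum_congr rfl fun i hi => hσ.orthProj_tanProj hi x Z

lemma metric_tanProj_eq_sum (x : Plane) (Z W : Mat (2 * m)) :
    metric (tanProj (σ x) Z) (tanProj (σ x) W)
      = ∑ i ∈ Finset.Icc 1 (2 * m), metric (orthProj (L i x) Z) (orthProj (L i x) W) := by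
  rw [hσ.tanProj_eq_sum x Z, metric_sum_left]
  refine Finset.sum_congr rfl fun i hi => ?_
  rw [← hσ.orthProj_tanProj hi x W,
    metric_orthProj_right (hσ.defPlane hi x) _ (orthProj_mem (hσ.defPlane hi x) Z)]

lemma contDiffAt_proj {i : ℕ} (hi : i ∈ Finset.Icc 1 (2 * m)) {Z : Plane → Mat (2 * m)} {x : Plane}
    (hZ : ContDiffAt ℝ ∞ Z x) : ContDiffAt ℝ ∞ (fun y => orthProj (L i y) (Z y)) x :=
  contDiffAt_orthProj (hσ.frenet.subbundle i hi) (hσ.defPlane hi) hZ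

lemma contDiff_proj {i : ℕ} (hi : i ∈ Finset.Icc 1 (2 * m)) {Z : Plane → Mat (2 * m)}
    (hZ : ContDiff ℝ ∞ Z) : ContDiff ℝ ∞ (fun y => orthProj (L i y) (Z y)) :=
  contDiff_orthProj (hσ.frenet.subbundle i hi) (hσ.defPlane hi) hZ

lemma isSection_proj {i : ℕ} (hi : i ∈ Finset.Icc 1 (2 * m)) {Z : Plane → Mat (2 * m)}
    (hZ : ContDiff ℝ ∞ Z) : IsSection (L i) (fun y => orthProj (L i y) (Z y)) :=
  ⟨hσ.contDiff_proj hi hZ, fun y => orthProj_mem (hσ.defPlane hi y) _⟩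

lemma isSection_const {i : ℕ} (hi : i ∈ Finset.Icc 1 (2 * m)) (Y : Mat (2 * m)) :
    IsSection (L i) (fun y => orthProj (L i y) Y) := hσ.isSection_proj hi contDiff_const

lemma locSec_proj {i : ℕ} (hi : i ∈ Finset.Icc 1 (2 * m)) {Z : Plane → Mat (2 * m)} {x : Plane}
    (hZ : ∀ᶠ y in nhds x, ContDiffAt ℝ ∞ Z y) : LocSec (L i) (fun y => orthProj (L i y) (Z y)) x :=
  ⟨hZ.mono fun _ h => hσ.contDiffAt_proj hi h, Filter.Eventually.of_forall fun y => orthProj_mem (hσ.defPlane hi y) _⟩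

lemma metric_fderiv_swap {i j : ℕ} (hi : i ∈ Finset.Icc 1 (2 * m)) (hj : j ∈ Finset.Icc 1 (2 * m))
    (hij : i ≠ j) {x : Plane} {ν μ : Plane → Mat (2 * m)} (hν : LocSec (L i) ν x)
    (hμ : LocSec (L j) μ x) (v : Plane) :
    metric (fderiv ℝ ν x v) (μ x) = -metric (ν x) (fderiv ℝ μ x v) :=
  metric_fderiv_of_ortho hν hμ (fun y _ hY _ hZ => hσ.ortho hi hj hij y hY hZ) v

lemma connForm_mem {i : ℕ} (hi : i ∈ Finset.Icc 1 (2 * m)) (j : ℕ) (x v : Plane) (Y : Mat (2 * m)) :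
    connForm L i j x v Y ∈ L i x := orthProj_mem (hσ.defPlane hi x) _

lemma orthProj_fderiv {i j : ℕ} (hi : i ∈ Finset.Icc 1 (2 * m)) (hj : j ∈ Finset.Icc 1 (2 * m))
    (hij : i ≠ j) {x : Plane} {ν : Plane → Mat (2 * m)} (hν : LocSec (L j) ν x) (v : Plane) :
    orthProj (L i x) (fderiv ℝ ν x v) = connForm L i j x v (ν x) := by
  refine eq_of_metric_eq (hσ.defPlane hi x) (orthProj_mem (hσ.defPlane hi x) _)
    (hσ.connForm_mem hi j x v _) fun Z hZ => ?_
  have hμ := (hσ.isSection_const hi Z).locSec x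
  have hν' := (hσ.isSection_const hj (ν x)).locSec x
  have e : orthProj (L i x) Z = Z := orthProj_of_mem (hσ.defPlane hi x) hZ
  have e' : orthProj (L j x) (ν x) = ν x := orthProj_of_mem (hσ.defPlane hj x) hν.mem_self
  have h1 := hσ.metric_fderiv_swap hj hi hij.symm hν hμ v
  have h2 := hσ.metric_fderiv_swap hj hi hij.symm hν' hμ v
  rw [e] at h1 h2
  rw [e'] at h2
  rw [connForm, metric_orthProj_left (hσ.defPlane hi x) _ hZ,
    metric_orthProj_left (hσ.defPlane hi x) _ hZ, h1, h2]

lemma metric_fderiv_eq {i j : ℕ} (hi : i ∈ Finset.Icc 1 (2 * m)) (hj : j ∈ Finset.Icc 1 (2 * m))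
    (hij : i ≠ j) {x : Plane} {ν : Plane → Mat (2 * m)} (hν : LocSec (L j) ν x) (v : Plane)
    {Z : Mat (2 * m)} (hZ : Z ∈ L i x) :
    metric (fderiv ℝ ν x v) Z = metric (connForm L i j x v (ν x)) Z := by
  rw [← hσ.orthProj_fderiv hi hj hij hν, metric_orthProj_left (hσ.defPlane hi x) _ hZ]

lemma connForm_adjoint {i j : ℕ} (hi : i ∈ Finset.Icc 1 (2 * m)) (hj : j ∈ Finset.Icc 1 (2 * m))
    (hij : i ≠ j) {x : Plane} (v : Plane) {Y Z : Mat (2 * m)} (hY : Y ∈ L j x) (hZ : Z ∈ L i x) :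
    metric (connForm L i j x v Y) Z = -metric Y (connForm L j i x v Z) := by
  have hμ := (hσ.isSection_const hi Z).locSec x
  have hν := (hσ.isSection_const hj Y).locSec x
  have e : orthProj (L i x) Z = Z := orthProj_of_mem (hσ.defPlane hi x) hZ
  have e' : orthProj (L j x) Y = Y := orthProj_of_mem (hσ.defPlane hj x) hY
  have h1 := hσ.metric_fderiv_swap hj hi hij.symm hν hμ v
  rw [e, e'] at h1
  rw [connForm, connForm, metric_orthProj_left (hσ.defPlane hi x) _ hZ,
    metric_orthProj_right (hσ.defPlane hj x) _ hY, h1]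

lemma connForm_add {i j : ℕ} (hi : i ∈ Finset.Icc 1 (2 * m)) (hj : j ∈ Finset.Icc 1 (2 * m))
    (x v : Plane) (Y Z : Mat (2 * m)) :
    connForm L i j x v (Y + Z) = connForm L i j x v Y + connForm L i j x v Z := by
  have e : (fun y => orthProj (L j y) (Y + Z))
      = fun y => orthProj (L j y) Y + orthProj (L j y) Z := by
    funext y; exact orthProj_add (hσ.defPlane hj y) Y Z
  rw [connForm, e, fderiv_add_mat ((hσ.isSection_const hj Y).locSec x).diff
    ((hσ.isSection_const hj Z).locSec x).diff, orthProj_add (hσ.defPlane hi x)]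
  rfl

lemma connForm_smul {i j : ℕ} (hi : i ∈ Finset.Icc 1 (2 * m)) (hj : j ∈ Finset.Icc 1 (2 * m))
    (x v : Plane) (c : ℝ) (Y : Mat (2 * m)) :
    connForm L i j x v (c • Y) = c • connForm L i j x v Y := by
  have e : (fun y => orthProj (L j y) (c • Y)) = fun y => c • orthProj (L j y) Y := by
    funext y; exact orthProj_smul (hσ.defPlane hj y) c Y
  rw [connForm, e, fderiv_const_smul_mat c ((hσ.isSection_const hj Y).locSec x).diff,
    orthProj_smul (hσ.defPlane hi x)]
  rfl

lemma connForm_add_dir {i : ℕ} (hi : i ∈ Finset.Icc 1 (2 * m)) (j : ℕ)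
    (x v w : Plane) (Y : Mat (2 * m)) :
    connForm L i j x (v + w) Y = connForm L i j x v Y + connForm L i j x w Y := by
  rw [connForm, map_add, orthProj_add (hσ.defPlane hi x)]
  rfl

lemma connForm_smul_dir {i : ℕ} (hi : i ∈ Finset.Icc 1 (2 * m)) (j : ℕ)
    (x v : Plane) (c : ℝ) (Y : Mat (2 * m)) :
    connForm L i j x (c • v) Y = c • connForm L i j x v Y := by
  rw [connForm, map_smul, orthProj_smul (hσ.defPlane hi x)]
  rfl

lemma connForm_eq_zero {i j : ℕ} (hi : i ∈ Finset.Icc 1 (2 * m)) (hj : j ∈ Finset.Icc 1 (2 * m))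
    (hij : i + 2 ≤ j ∨ j + 2 ≤ i) (x v : Plane) (Y : Mat (2 * m)) : connForm L i j x v Y = 0 := by
  have h := hσ.frenet.tridiagonal i hi j hj hij _ (hσ.isSection_const hj Y) x v
  rwa [cov, hσ.orthProj_tanProj hi] at h

lemma eta_eq {i : ℕ} (hi : i ∈ Finset.Icc 2 (2 * m)) {ν : Plane → Mat (2 * m)}
    (hν : IsSection (L (i - 1)) ν) (x v : Plane) :
    eta σ L i ν x v = connForm L i (i - 1) x v (ν x) := by
  rw [Finset.mem_Icc] at hi
  have hi1 : i ∈ Finset.Icc 1 (2 * m) := by rw [Finset.mem_Icc]; omega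
  have hi2 : i - 1 ∈ Finset.Icc 1 (2 * m) := by rw [Finset.mem_Icc]; omega
  rw [eta, cov, hσ.orthProj_tanProj hi1, hσ.orthProj_fderiv hi1 hi2 (by omega) (hν.locSec x)]

end IsIsotropicPAlternating

end ParaHyp
end

noncomputable section
namespace ParaHyp

/-! ### The equations of Gauss and Codazzi -/

lemma normalTerm_comm_of_ortho {n : ℕ} {M a b N K : Mat n} (hab : traceForm M a b = traceForm M b a)
    (h1 : traceForm M a K = 0) (h2 : traceForm M K a = 0) (h3 : traceForm M b K = 0)
    (h4 : traceForm M K b = 0) : normalTerm M a N b K = normalTerm M b N a K := by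
  rw [normalTerm, normalTerm, h1, h2, h3, h4, hab]; ring

lemma normalTerm_eq_zero {n : ℕ} {M a b N K : Mat n} (hab : traceForm M a b = traceForm M b a)
    (haN : traceForm M a N = traceForm M N a) (hbN : traceForm M b N = traceForm M N b)
    (h1 : traceForm M K a = -traceForm M a K) (h2 : traceForm M K b = -traceForm M b K)
    (h3 : traceForm M K N = -traceForm M N K) : normalTerm M a N b K = 0 := by
  rw [normalTerm, h1, h2, h3, hab, haN, hbN]; ring

lemma one_mem_Icc {m : ℕ} (hm : 1 ≤ m) : 1 ∈ Finset.Icc 1 (2 * m) := by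
  rw [Finset.mem_Icc]; omega

lemma one_mem_of_mem {m i : ℕ} (hi : i ∈ Finset.Icc 1 (2 * m)) : 1 ∈ Finset.Icc 1 (2 * m) := by
  rw [Finset.mem_Icc] at *; omega

/-- `X_1, X_2` is mapped to an orthonormal frame of the tangent plane. -/
structure IsTanFrame {n : ℕ} (σ : Plane → Mat n) (x X₁ X₂ : Plane) : Prop where
  left : metric (fderiv ℝ σ x X₁) (fderiv ℝ σ x X₁) = 1
  right : metric (fderiv ℝ σ x X₂) (fderiv ℝ σ x X₂) = 1
  ortho : metric (fderiv ℝ σ x X₁) (fderiv ℝ σ x X₂) = 0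
  expand : ∀ X, X = metric (fderiv ℝ σ x X) (fderiv ℝ σ x X₁) • X₁
    + metric (fderiv ℝ σ x X) (fderiv ℝ σ x X₂) • X₂

/-- `η_i` multiplies, up to sign, the square of the norm by `f |X|²`. -/
def IsConf {n : ℕ} (σ : Plane → Mat n) (L : ℕ → Plane → Submodule ℝ (Mat n)) (i : ℕ) (x : Plane)
    (f : ℝ) : Prop :=
  ∀ X, ∀ Y ∈ L i x, metric (connForm L (i + 1) i x X Y) (connForm L (i + 1) i x X Y)
    = -f * metric (fderiv ℝ σ x X) (fderiv ℝ σ x X) * metric Y Y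

lemma fderiv_metric_fderiv {n : ℕ} {ν μ : Plane → Mat n} {x : Plane}
    (hν : ContDiffAt ℝ ∞ ν x) (hμ : ContDiffAt ℝ ∞ μ x) (a b : Plane) :
    fderiv ℝ (fun y => metric (fderiv ℝ ν y b) (μ y)) x a
      - fderiv ℝ (fun y => metric (fderiv ℝ ν y a) (μ y)) x b
      = metric (fderiv ℝ ν x b) (fderiv ℝ μ x a) - metric (fderiv ℝ ν x a) (fderiv ℝ μ x b) := by
  have hd : ∀ c : Plane, DifferentiableAt ℝ (fun y => fderiv ℝ ν y c) x := fun c =>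
    differentiableAt_mat (contDiffAt_fderiv_mat hν contDiffAt_const)
  rw [fderiv_metric (hd b) (differentiableAt_mat hμ) a,
    fderiv_metric (hd a) (differentiableAt_mat hμ) b, fderiv_fderiv_comm hν b a]
  ring

lemma isFrame_of_ortho {n : ℕ} {V : Submodule ℝ (Mat n)} {ε : ℝ} (hV : IsDefPlane V ε) {u v : Mat n}
    (hu : u ∈ V) (hv : v ∈ V) (huu : metric u u = ε) (hvv : metric v v = ε) (huv : metric u v = 0) :
    IsFrame V ε u v := by
  have hε := hV.sign
  have hli : LinearIndependent ℝ ![u, v] := by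
    rw [LinearIndependent.pair_iff]
    intro s t hst
    have h1 := congrArg (metric u) hst
    have h2 := congrArg (metric v) hst
    rw [metric_add_right, metric_smul_right, metric_smul_right, huu, huv, metric_zero_right] at h1
    rw [metric_add_right, metric_smul_right, metric_smul_right, hvv, metric_comm v, huv,
      metric_zero_right] at h2
    exact ⟨by linear_combination ε * h1 - s * hε, by linear_combination ε * h2 - t * hε⟩
  have hr : Set.range ![u, v] = {u, v} := by simp [Set.pair_comm]
  have hspan : Submodule.span ℝ {u, v} = V := by
    have : FiniteDimensional ℝ V := FiniteDimensional.of_finrank_pos (by rw [hV.finrank_eq]; norm_num)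
    refine Submodule.eq_of_le_of_finrank_eq ?_ ?_
    · rw [Submodule.span_le]
      rintro Z (rfl | rfl) <;> assumption
    · rw [hV.finrank_eq, ← hr, finrank_span_eq_card hli]
      simp
  refine ⟨hε, hu, hv, huu, hvv, huv, fun Y hY => ?_⟩
  rw [← hspan, Submodule.mem_span_pair] at hY
  obtain ⟨s, t, rfl⟩ := hY
  have h1 : ε * metric (s • u + t • v) u = s := by
    rw [metric_add_left, metric_smul_left, metric_smul_left, huu, metric_comm v, huv]
    linear_combination s * hε
  have h2 : ε * metric (s • u + t • v) v = t := by
    rw [metric_add_left, metric_smul_left, metric_smul_left, hvv, huv]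
    linear_combination t * hε
  rw [h1, h2]

namespace IsIsotropicPAlternating

variable {m : ℕ} {σ : Plane → Mat (2 * m)} {L : ℕ → Plane → Submodule ℝ (Mat (2 * m))}
  (hσ : IsIsotropicPAlternating σ L)
include hσ

lemma diff (x : Plane) : DifferentiableAt ℝ σ x := differentiableAt_mat hσ.smooth.contDiffAt

lemma fderiv_mem (x X : Plane) : fderiv ℝ σ x X ∈ L 1 x := by
  rw [hσ.frenet.tangent x]
  exact ⟨X, rfl⟩

lemma exists_fderiv {x : Plane} {Y : Mat (2 * m)} (hY : Y ∈ L 1 x) : ∃ X, fderiv ℝ σ x X = Y := by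
  rw [hσ.frenet.tangent x] at hY
  exact hY

lemma locSec_fderiv (x X : Plane) : LocSec (L 1) (fun y => fderiv ℝ σ y X) x :=
  ⟨Filter.Eventually.of_forall fun _ => contDiffAt_fderiv_mat hσ.smooth.contDiffAt contDiffAt_const,
    Filter.Eventually.of_forall fun y => hσ.fderiv_mem y X⟩

lemma exists_tanFrame (hm : 1 ≤ m) (x : Plane) : ∃ X₁ X₂, IsTanFrame σ x X₁ X₂ := by
  obtain ⟨u, v, h⟩ := exists_frame (hσ.defPlane (one_mem_Icc hm) x)
  rw [eps_of_odd odd_one] at h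
  obtain ⟨X, hX⟩ := hσ.exists_fderiv h.mem_left
  obtain ⟨Y, hY⟩ := hσ.exists_fderiv h.mem_right
  refine ⟨X, Y, ?_, ?_, ?_, fun Z => ?_⟩
  · rw [hX]; exact h.left
  · rw [hY]; exact h.right
  · rw [hX, hY]; exact h.ortho
  · apply hσ.immersion x
    rw [map_add, map_smul, map_smul, hX, hY]
    simpa using h.expand _ (hσ.fderiv_mem x Z)

/-- Vectors of `ℒ_i`, `i ≠ 1, 2m`, are trace-orthogonal to the tangent plane. -/
lemma traceForm_tangent_left {i : ℕ} (hi : i ∈ Finset.Icc 1 (2 * m)) (h1 : i ≠ 1)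
    (h2 : i ≠ 2 * m) {x : Plane} {a K : Mat (2 * m)} (ha : a ∈ L 1 x) (hK : K ∈ L i x) :
    traceForm (σ x) a K = 0 ∧ traceForm (σ x) K a = 0 := by
  have ho := one_mem_of_mem hi
  have hg : metric a K = 0 := hσ.ortho ho hi h1.symm x ha hK
  have hw : omega (σ x) a K = 0 := by
    have hP := hσ.paraCx_mem hi hK
    rw [Finset.mem_Icc] at hi
    exact hσ.ortho ho (by rw [Finset.mem_Icc]; omega) (by omega) x ha hP
  refine ⟨?_, ?_⟩
  · rw [traceForm_eq (hσ.le_tangent ho x ha), hg, hw]; ring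
  · rw [traceForm_eq (hσ.le_tangent hi x hK), metric_comm, hg, omega_swap, hw]; ring

lemma traceForm_isotropic {i : ℕ} (hi : i ∈ Finset.Icc 1 (2 * m)) {x : Plane} {a b : Mat (2 * m)}
    (ha : a ∈ L i x) (hb : b ∈ L i x) : traceForm (σ x) a b = -metric a b := by
  rw [traceForm_eq (hσ.le_tangent hi x ha), hσ.isotropic i hi x a ha b hb]; ring

/-- The normal term is symmetric for sections of `ℒ_i` and `ℒ_{i+1}`. -/
lemma normalTerm_comm {i : ℕ} (hi : 1 ≤ i) (him : i ≤ m) {x : Plane} {a b N K : Mat (2 * m)}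
    (ha : a ∈ L 1 x) (hb : b ∈ L 1 x) (hN : N ∈ L i x) (hK : K ∈ L (i + 1) x) :
    normalTerm (σ x) a N b K = normalTerm (σ x) b N a K := by
  have h0 : i ∈ Finset.Icc 1 (2 * m) := by rw [Finset.mem_Icc]; omega
  have h1 : i + 1 ∈ Finset.Icc 1 (2 * m) := by rw [Finset.mem_Icc]; omega
  have ho := one_mem_of_mem h0
  have hs : ∀ a b, a ∈ L 1 x → b ∈ L 1 x → traceForm (σ x) a b = traceForm (σ x) b a := by
    intro a b ha hb
    rw [hσ.traceForm_isotropic ho ha hb, hσ.traceForm_isotropic ho hb ha, metric_comm]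
  by_cases hi2 : i + 1 = 2 * m
  · obtain rfl : i = 1 := by omega
    have hT : ∀ a ∈ L 1 x, traceForm (σ x) K a = -traceForm (σ x) a K := by
      intro a ha
      rw [traceForm_eq (hσ.le_tangent h1 x hK), traceForm_eq (hσ.le_tangent ho x ha),
        metric_comm K a, hσ.ortho ho h1 (by omega) x ha hK, omega_swap]
      ring
    rw [normalTerm_eq_zero (hs a b ha hb) (hs a N ha hN) (hs b N hb hN) (hT a ha) (hT b hb) (hT N hN),
      normalTerm_eq_zero (hs b a hb ha) (hs b N hb hN) (hs a N ha hN) (hT b hb) (hT a ha) (hT N hN)]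
  · have hT : ∀ c ∈ L 1 x, traceForm (σ x) c K = 0 ∧ traceForm (σ x) K c = 0 := fun c hc =>
      hσ.traceForm_tangent_left h1 (by omega) hi2 hc hK
    exact normalTerm_comm_of_ortho (hs a b ha hb) (hT a ha).1 (hT a ha).2 (hT b hb).1 (hT b hb).2

lemma metric_fderiv_eq_sum {j k : ℕ} (hj : j ∈ Finset.Icc 1 (2 * m))
    (hk : k ∈ Finset.Icc 1 (2 * m)) {x : Plane} {ν μ : Plane → Mat (2 * m)}
    (hν : LocSec (L j) ν x) (hμ : LocSec (L k) μ x) (v w : Plane) :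
    metric (fderiv ℝ ν x v) (fderiv ℝ μ x w)
      = ∑ i ∈ Finset.Icc 1 (2 * m),
          metric (orthProj (L i x) (fderiv ℝ ν x v)) (orthProj (L i x) (fderiv ℝ μ x w))
        + normalTerm (σ x) (fderiv ℝ σ x v) (ν x) (fderiv ℝ σ x w) (μ x) := by
  rw [metric_fderiv_split (hσ.diff x) (Filter.Eventually.of_forall hσ.mem) hν.diff hμ.diff
    (hν.mem.mono fun y hy => hσ.le_tangent hj y hy) (hμ.mem.mono fun y hy => hσ.le_tangent hk y hy),
    hσ.metric_tanProj_eq_sum]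

lemma locSec_paraCx {j : ℕ} (hj : j ∈ Finset.Icc 1 (2 * m)) {x : Plane} {ν : Plane → Mat (2 * m)}
    (hν : LocSec (L j) ν x) : LocSec (L (2 * m + 1 - j)) (fun y => paraCx (σ y) (ν y)) x :=
  ⟨hν.eventually_smooth.mono fun _ h =>
    (h.mul hσ.smooth.contDiffAt).sub (hσ.smooth.contDiffAt.mul h),
    hν.mem.mono fun _ h => hσ.paraCx_mem hj h⟩

lemma connForm_paraCx {i j : ℕ} (hi : i ∈ Finset.Icc 1 (2 * m)) (hj : j ∈ Finset.Icc 1 (2 * m))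
    (hij : i ≠ j) {x : Plane} (v : Plane) {Y : Mat (2 * m)} (hY : Y ∈ L j x) :
    connForm L (2 * m + 1 - i) (2 * m + 1 - j) x v (paraCx (σ x) Y)
      = paraCx (σ x) (connForm L i j x v Y) := by
  have hi' : 2 * m + 1 - i ∈ Finset.Icc 1 (2 * m) := by rw [Finset.mem_Icc] at *; omega
  have hj' : 2 * m + 1 - j ∈ Finset.Icc 1 (2 * m) := by rw [Finset.mem_Icc] at *; omega
  have hij' : 2 * m + 1 - i ≠ 2 * m + 1 - j := by rw [Finset.mem_Icc] at *; omega
  have hν := (hσ.isSection_const hj Y).locSec x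
  have e : orthProj (L j x) Y = Y := orthProj_of_mem (hσ.defPlane hj x) hY
  refine eq_of_metric_eq (hσ.defPlane hi' x) (hσ.connForm_mem hi' _ x v _)
    (hσ.paraCx_mem hi (hσ.connForm_mem hi j x v Y)) fun Z hZ => ?_
  have hPZ : paraCx (σ x) Z ∈ L i x := by
    have := hσ.paraCx_mem hi' hZ
    rwa [show 2 * m + 1 - (2 * m + 1 - i) = i by rw [Finset.mem_Icc] at hi; omega] at this
  have h1 := hσ.metric_fderiv_eq hi' hj' hij' (hσ.locSec_paraCx hj hν) v hZ
  have h2 := hσ.metric_fderiv_eq hi hj hij hν v hPZ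
  rw [e] at h1 h2
  rw [← h1, ← metric_tanProj_left (hσ.idem x) (hσ.le_tangent hi' x hZ),
    tanProj_fderiv_paraCx (hσ.diff x) (Filter.Eventually.of_forall hσ.idem) hν.diff
      (hσ.le_tangent hj x hν.mem_self), metric_paraCx_left, metric_paraCx_left,
    metric_tanProj_left (hσ.idem x) (hσ.le_tangent hi x hPZ), h2]

lemma connForm_tangent_comm (hm : 1 ≤ m) (x a b : Plane) :
    connForm L 2 1 x a (fderiv ℝ σ x b) = connForm L 2 1 x b (fderiv ℝ σ x a) := by
  have h2 : 2 ∈ Finset.Icc 1 (2 * m) := by rw [Finset.mem_Icc]; omega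
  rw [← hσ.orthProj_fderiv h2 (one_mem_Icc hm) (by norm_num) (hσ.locSec_fderiv x b),
    ← hσ.orthProj_fderiv h2 (one_mem_Icc hm) (by norm_num) (hσ.locSec_fderiv x a),
    fderiv_fderiv_comm hσ.smooth.contDiffAt b a]

/-- The Codazzi equation. -/
lemma connForm_comm {i : ℕ} (hi : 1 ≤ i) (him : i + 1 ≤ m) {x : Plane} (a b : Plane)
    {Y : Mat (2 * m)} (hY : Y ∈ L i x) :
    connForm L (i + 2) (i + 1) x a (connForm L (i + 1) i x b Y)
      = connForm L (i + 2) (i + 1) x b (connForm L (i + 1) i x a Y) := by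
  have h0 : i ∈ Finset.Icc 1 (2 * m) := by rw [Finset.mem_Icc]; omega
  have h1 : i + 1 ∈ Finset.Icc 1 (2 * m) := by rw [Finset.mem_Icc]; omega
  have h2 : i + 2 ∈ Finset.Icc 1 (2 * m) := by rw [Finset.mem_Icc]; omega
  have ho := one_mem_of_mem h0
  refine eq_of_metric_eq (hσ.defPlane h2 x) (hσ.connForm_mem h2 _ x _ _)
    (hσ.connForm_mem h2 _ x _ _) fun Z hZ => ?_
  have hν := (hσ.isSection_const h0 Y).locSec x
  have hμ := (hσ.isSection_const h2 Z).locSec x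
  have e : orthProj (L i x) Y = Y := orthProj_of_mem (hσ.defPlane h0 x) hY
  have e' : orthProj (L (i + 2) x) Z = Z := orthProj_of_mem (hσ.defPlane h2 x) hZ
  have key := fderiv_metric_fderiv hν.smooth hμ.smooth a b
  have hz : ∀ c : Plane, (fun y => metric (fderiv ℝ (fun y => orthProj (L i y) Y) y c)
      (orthProj (L (i + 2) y) Z)) =ᶠ[nhds x] fun _ => 0 := fun c => by
    filter_upwards with y
    rw [hσ.metric_fderiv_eq h2 h0 (by omega) ((hσ.isSection_const h0 Y).locSec y) c
      (orthProj_mem (hσ.defPlane h2 y) Z), hσ.connForm_eq_zero h2 h0 (by omega), metric_zero_left]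
  rw [(hz a).fderiv_eq, (hz b).fderiv_eq, fderiv_fun_const] at key
  have key2 := (sub_eq_zero.1 (key.symm.trans (sub_self _)))
  have hsum : ∀ a b : Plane, ∑ k ∈ Finset.Icc 1 (2 * m),
      metric (orthProj (L k x) (fderiv ℝ (fun y => orthProj (L i y) Y) x a))
        (orthProj (L k x) (fderiv ℝ (fun y => orthProj (L (i + 2) y) Z) x b))
      = -metric (connForm L (i + 2) (i + 1) x b (connForm L (i + 1) i x a Y)) Z := fun a b => by
    rw [Finset.sum_eq_single (i + 1)]
    · rw [hσ.orthProj_fderiv h1 h0 (by omega) hν, hσ.orthProj_fderiv h1 h2 (by omega) hμ, e, e',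
        hσ.connForm_adjoint h2 h1 (by omega) b (hσ.connForm_mem h1 _ x _ _) hZ, neg_neg]
    · intro k hk hki
      by_cases hk2 : k ≤ i
      · rw [hσ.orthProj_fderiv hk h2 (by omega) hμ, hσ.connForm_eq_zero hk h2 (by omega),
          metric_zero_right]
      · rw [hσ.orthProj_fderiv hk h0 (by omega) hν, hσ.connForm_eq_zero hk h0 (by omega),
          metric_zero_left]
    · exact fun h => absurd h1 h
  rw [hσ.metric_fderiv_eq_sum h0 h2 hν hμ, hσ.metric_fderiv_eq_sum h0 h2 hν hμ, hsum, hsum] at key2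
  have hT : ∀ c, traceForm (σ x) (fderiv ℝ σ x c) (orthProj (L (i + 2) x) Z) = 0 ∧
      traceForm (σ x) (orthProj (L (i + 2) x) Z) (fderiv ℝ σ x c) = 0 := fun c =>
    hσ.traceForm_tangent_left h2 (by omega) (by omega) (hσ.fderiv_mem x c) hμ.mem_self
  rw [normalTerm_comm_of_ortho _ (hT b).1 (hT b).2 (hT a).1 (hT a).2] at key2
  · linarith
  · rw [hσ.traceForm_isotropic ho (hσ.fderiv_mem x b) (hσ.fderiv_mem x a),
      hσ.traceForm_isotropic ho (hσ.fderiv_mem x a) (hσ.fderiv_mem x b), metric_comm]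

/-- `η_{i+1} (X)` is a homothety, up to sign. -/
lemma superconformal_at {i : ℕ} (hi : 1 ≤ i) (him : i + 1 ≤ 2 * m) (x X : Plane) :
    ∃ c : ℝ, 0 ≤ c ∧ ∀ Y ∈ L i x, ∀ Z ∈ L i x,
      metric (connForm L (i + 1) i x X Y) (connForm L (i + 1) i x X Z) = -c * metric Y Z := by
  have h0 : i ∈ Finset.Icc 1 (2 * m) := by rw [Finset.mem_Icc]; omega
  have h1 : i + 1 ∈ Finset.Icc 1 (2 * m) := by rw [Finset.mem_Icc]; omega
  have h1' : i + 1 ∈ Finset.Icc 2 (2 * m) := by rw [Finset.mem_Icc]; omega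
  obtain ⟨c, hc, h⟩ := hσ.superconformal (i + 1) h1' x X
  have habs : ∀ j ∈ Finset.Icc 1 (2 * m), ∀ Y ∈ L j x, |metric Y Y| = eps j * metric Y Y := by
    intro j hj Y hY
    have h2 := (hσ.defPlane hj x).nonneg hY
    rcases Nat.even_or_odd j with h3 | h3
    · rw [eps_of_even h3] at h2 ⊢
      rw [abs_of_nonpos (by linarith)]; ring
    · rw [eps_of_odd h3] at h2 ⊢
      rw [abs_of_nonneg (by linarith)]; ring
  have hq : ∀ Y ∈ L i x,
      metric (connForm L (i + 1) i x X Y) (connForm L (i + 1) i x X Y) = -c * metric Y Y := by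
    intro Y hY
    have h2 := h _ (hσ.isSection_const h0 Y)
    rw [hσ.eta_eq h1' (hσ.isSection_const h0 Y)] at h2
    simp only [Nat.add_sub_cancel] at h2
    rw [orthProj_of_mem (hσ.defPlane h0 x) hY, habs _ h1 _ (hσ.connForm_mem h1 _ x _ _),
      habs _ h0 _ hY, eps_succ] at h2
    have h3 := eps_mul_self i
    linear_combination (-eps i) * h2 + (-metric (connForm L (i + 1) i x X Y)
      (connForm L (i + 1) i x X Y) - c * metric Y Y) * h3
  refine ⟨c, hc, fun Y hY Z hZ => ?_⟩
  have h2 := hq _ ((L i x).add_mem hY hZ)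
  rw [hσ.connForm_add h1 h0, metric_add_left, metric_add_right, metric_add_right, hq Y hY, hq Z hZ,
    metric_add_left, metric_add_right, metric_add_right, metric_comm Z Y,
    metric_comm (connForm L (i + 1) i x X Z)] at h2
  linarith

lemma conf_polar {i : ℕ} (hi : 1 ≤ i) (him : i + 1 ≤ 2 * m) {x : Plane} {f : ℝ}
    (hf : IsConf σ L i x f) (X X' : Plane) {Y Z : Mat (2 * m)} (hY : Y ∈ L i x) (hZ : Z ∈ L i x) :
    metric (connForm L (i + 1) i x X Y) (connForm L (i + 1) i x X' Z)
      + metric (connForm L (i + 1) i x X' Y) (connForm L (i + 1) i x X Z)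
      = -2 * f * metric (fderiv ℝ σ x X) (fderiv ℝ σ x X') * metric Y Z := by
  have h0 : i ∈ Finset.Icc 1 (2 * m) := by rw [Finset.mem_Icc]; omega
  have h1 : i + 1 ∈ Finset.Icc 1 (2 * m) := by rw [Finset.mem_Icc]; omega
  have hp : ∀ X, metric (connForm L (i + 1) i x X Y) (connForm L (i + 1) i x X Z)
      = -f * metric (fderiv ℝ σ x X) (fderiv ℝ σ x X) * metric Y Z := by
    intro X
    have h2 := hf X _ ((L i x).add_mem hY hZ)
    rw [hσ.connForm_add h1 h0, metric_add_left, metric_add_right, metric_add_right, hf X Y hY,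
      hf X Z hZ, metric_add_left, metric_add_right, metric_add_right, metric_comm Z Y,
      metric_comm (connForm L (i + 1) i x X Z)] at h2
    linarith
  have h2 := hp (X + X')
  rw [hσ.connForm_add_dir h1, hσ.connForm_add_dir h1, metric_add_left, metric_add_right,
    metric_add_right, hp, hp, map_add, metric_add_left, metric_add_right, metric_add_right,
    metric_comm (fderiv ℝ σ x X') (fderiv ℝ σ x X)] at h2
  linarith

lemma conf_inner {i : ℕ} (hi : 1 ≤ i) (him : i + 1 ≤ 2 * m) {x : Plane} {f : ℝ}
    (hf : IsConf σ L i x f) (X : Plane) {Y Z : Mat (2 * m)} (hY : Y ∈ L i x) (hZ : Z ∈ L i x) :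
    metric (connForm L (i + 1) i x X Y) (connForm L (i + 1) i x X Z)
      = -f * metric (fderiv ℝ σ x X) (fderiv ℝ σ x X) * metric Y Z := by
  have := hσ.conf_polar hi him hf X X hY hZ
  linarith

lemma conf_step {i : ℕ} (hi : 1 ≤ i) (him : i + 1 ≤ 2 * m) {x X₁ X₂ : Plane}
    (hX : IsTanFrame σ x X₁ X₂) {u v : Mat (2 * m)} (hu : u ∈ L i x) (hv : v ∈ L i x)
    (huv : metric u v = 0) (hn : metric u u = metric v v) (hu0 : u ≠ 0)
    (hcomm : connForm L (i + 1) i x X₁ v = connForm L (i + 1) i x X₂ u) :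
    ∃ f : ℝ, 0 ≤ f ∧ IsConf σ L i x f := by
  have h0 : i ∈ Finset.Icc 1 (2 * m) := by rw [Finset.mem_Icc]; omega
  have h1 : i + 1 ∈ Finset.Icc 1 (2 * m) := by rw [Finset.mem_Icc]; omega
  obtain ⟨c₁, hc₁, hq₁⟩ := hσ.superconformal_at hi him x X₁
  obtain ⟨c₂, hc₂, hq₂⟩ := hσ.superconformal_at hi him x X₂
  have huu : metric u u ≠ 0 := fun h => hu0 ((hσ.defPlane h0 x).eq_zero hu h)
  have hcc : c₁ = c₂ := by
    have h2 := hq₁ v hv v hv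
    rw [hcomm, hq₂ u hu u hu, ← hn] at h2
    have := mul_right_cancel₀ huu h2
    linarith
  refine ⟨c₁, hc₁, fun X Y hY => ?_⟩
  obtain ⟨c, -, hq⟩ := hσ.superconformal_at hi him x X
  have hXe := hX.expand X
  set α := metric (fderiv ℝ σ x X) (fderiv ℝ σ x X₁)
  set β := metric (fderiv ℝ σ x X) (fderiv ℝ σ x X₂)
  have h3 := hq u hu u hu
  rw [hXe, hσ.connForm_add_dir h1, hσ.connForm_smul_dir h1, hσ.connForm_smul_dir h1] at h3
  simp only [metric_add_left, metric_add_right, metric_smul_left, metric_smul_right] at h3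
  have h4 : metric (connForm L (i + 1) i x X₁ u) (connForm L (i + 1) i x X₂ u) = 0 := by
    rw [← hcomm, hq₁ u hu v hv, huv, mul_zero]
  rw [metric_comm (connForm L (i + 1) i x X₂ u) (connForm L (i + 1) i x X₁ u), h4,
    hq₁ u hu u hu, hq₂ u hu u hu, ← hcc] at h3
  have h5 : c = (α * α + β * β) * c₁ := mul_right_cancel₀ huu (by linarith)
  have h6 : metric (fderiv ℝ σ x X) (fderiv ℝ σ x X) = α * α + β * β := by
    conv_lhs => rw [hXe]
    rw [map_add, map_smul, map_smul]
    simp only [metric_add_left, metric_add_right, metric_smul_left, metric_smul_right, hX.left,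
      hX.right, hX.ortho, metric_comm (fderiv ℝ σ x X₂) (fderiv ℝ σ x X₁)]
    ring
  rw [hq Y hY Y hY, h5, h6]
  ring

lemma conf_sum_eq_zero {i : ℕ} (hi : 1 ≤ i) (him : i + 1 ≤ 2 * m) {x X₁ X₂ : Plane}
    (hX : IsTanFrame σ x X₁ X₂) {u v : Mat (2 * m)} (hu : u ∈ L i x) (hv : v ∈ L i x)
    (hn : metric u u = metric v v)
    (hcomm : connForm L (i + 1) i x X₁ v = connForm L (i + 1) i x X₂ u) {f : ℝ}
    (hf : IsConf σ L i x f) :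
    connForm L (i + 1) i x X₁ u + connForm L (i + 1) i x X₂ v = 0 := by
  have h1 : i + 1 ∈ Finset.Icc 1 (2 * m) := by rw [Finset.mem_Icc]; omega
  refine (hσ.defPlane h1 x).eq_zero ((L (i + 1) x).add_mem (hσ.connForm_mem h1 _ x _ _)
    (hσ.connForm_mem h1 _ x _ _)) ?_
  have h2 := hσ.conf_polar hi him hf X₁ X₂ hu hv
  rw [hX.ortho, hcomm, ← hcomm, hσ.conf_inner hi him hf X₁ hv hv, hX.left] at h2
  simp only [metric_add_left, metric_add_right]
  rw [metric_comm (connForm L (i + 1) i x X₂ v), hσ.conf_inner hi him hf X₁ hu hu,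
    hσ.conf_inner hi him hf X₂ hv hv, hX.left, hX.right, hn]
  linarith

end IsIsotropicPAlternating
end ParaHyp
end

noncomputable section
namespace ParaHyp

/-! ### The conformal factors -/

/-- The conformal factor of `η_{i+1}`: `|η_{i+1} (X) ν|² = f |X|² |ν|²`. -/
def fac {n : ℕ} (σ : Plane → Mat n) (L : ℕ → Plane → Submodule ℝ (Mat n)) (i : ℕ) (x : Plane) : ℝ :=
  Classical.epsilon (IsConf σ L i x)

open Asymptotics in
lemma EtaVanishes.mono {n : ℕ} {σ : Plane → Mat n} {L : ℕ → Plane → Submodule ℝ (Mat n)} {i : ℕ}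
    {p : Plane} {k l : ℕ} (h : EtaVanishes σ L i p l) (hkl : k ≤ l) : EtaVanishes σ L i p k := by
  intro ν hν X
  refine (h ν hν X).trans ?_
  refine IsBigO.of_bound 1 ?_
  filter_upwards [Metric.ball_mem_nhds p one_pos] with x hx
  rw [mem_ball_iff_norm] at hx
  rw [one_mul, norm_pow, norm_pow, norm_norm]
  exact pow_le_pow_of_le_one (norm_nonneg _) hx.le hkl

lemma EtaVanishes.le_etaDivisor {n : ℕ} {σ : Plane → Mat n}
    {L : ℕ → Plane → Submodule ℝ (Mat n)} {i : ℕ} {p : Plane} {k : ℕ}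
    (h : EtaVanishes σ L i p k) : (k : ℕ∞) ≤ etaDivisor σ L i p :=
  le_iSup₂ (f := fun (k : ℕ) (_ : EtaVanishes σ L i p k) => (k : ℕ∞)) k h

lemma etaVanishes_of_lt {n : ℕ} {σ : Plane → Mat n} {L : ℕ → Plane → Submodule ℝ (Mat n)}
    {i : ℕ} {p : Plane} {k : ℕ} (h : (k : ℕ∞) < etaDivisor σ L i p) :
    EtaVanishes σ L i p (k + 1) := by
  rw [etaDivisor] at h
  simp only [lt_iSup_iff] at h
  obtain ⟨l, hl, hkl⟩ := h
  exact hl.mono (by exact_mod_cast hkl)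

namespace IsIsotropicPAlternating

variable {m : ℕ} {σ : Plane → Mat (2 * m)} {L : ℕ → Plane → Submodule ℝ (Mat (2 * m))}
  (hσ : IsIsotropicPAlternating σ L)
include hσ

lemma metric_fderiv_pos (hm : 1 ≤ m) (x : Plane) {X : Plane} (hX : X ≠ 0) :
    0 < metric (fderiv ℝ σ x X) (fderiv ℝ σ x X) := by
  refine hσ.pos_odd 1 (one_mem_Icc hm) odd_one x _ (hσ.fderiv_mem x X) fun h => hX ?_
  exact hσ.immersion x (h.trans (map_zero _).symm)

lemma metric_fderiv_nonneg (hm : 1 ≤ m) (x X : Plane) :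
    0 ≤ metric (fderiv ℝ σ x X) (fderiv ℝ σ x X) := by
  rcases eq_or_ne X 0 with rfl | h
  · rw [map_zero, metric_zero_left]
  · exact (hσ.metric_fderiv_pos hm x h).le

lemma conf_nonneg {i : ℕ} (hi : 1 ≤ i) (him : i + 1 ≤ 2 * m) {x : Plane} {f : ℝ}
    (hf : IsConf σ L i x f) : 0 ≤ f := by
  have h0 : i ∈ Finset.Icc 1 (2 * m) := by rw [Finset.mem_Icc]; omega
  have h1 : i + 1 ∈ Finset.Icc 1 (2 * m) := by rw [Finset.mem_Icc]; omega
  obtain ⟨X₁, X₂, hX⟩ := hσ.exists_tanFrame (by omega) x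
  obtain ⟨u, v, h⟩ := exists_frame (hσ.defPlane h0 x)
  have h2 := (hσ.defPlane h1 x).nonneg (hσ.connForm_mem h1 i x X₁ u)
  rw [hf X₁ u h.mem_left, hX.left, h.left, eps_succ] at h2
  have := eps_mul_self i
  nlinarith

lemma conf_unique {i : ℕ} (hi : i ∈ Finset.Icc 1 (2 * m)) {x : Plane} {f f' : ℝ}
    (hf : IsConf σ L i x f) (hf' : IsConf σ L i x f') : f = f' := by
  obtain ⟨X₁, X₂, hX⟩ := hσ.exists_tanFrame (by rw [Finset.mem_Icc] at hi; omega) x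
  obtain ⟨u, v, h⟩ := exists_frame (hσ.defPlane hi x)
  have h2 := hf X₁ u h.mem_left
  rw [hf' X₁ u h.mem_left, hX.left, h.left] at h2
  have := eps_mul_self i
  linear_combination eps i * h2 + (f' - f) * this

/-- `η_{i+1} (X)` maps orthonormal frames to orthonormal frames, up to scaling. -/
lemma frame_image {i : ℕ} (hi : 1 ≤ i) (him : i + 1 ≤ 2 * m) {x : Plane} {f : ℝ}
    (hf : IsConf σ L i x f) {X : Plane} (hk : 0 < f * metric (fderiv ℝ σ x X) (fderiv ℝ σ x X))
    {u v : Mat (2 * m)} (h : IsFrame (L i x) (eps i) u v) :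
    IsFrame (L (i + 1) x) (eps (i + 1))
      ((√(f * metric (fderiv ℝ σ x X) (fderiv ℝ σ x X)))⁻¹ • connForm L (i + 1) i x X u)
      ((√(f * metric (fderiv ℝ σ x X) (fderiv ℝ σ x X)))⁻¹ • connForm L (i + 1) i x X v) := by
  have h1 : i + 1 ∈ Finset.Icc 1 (2 * m) := by rw [Finset.mem_Icc]; omega
  have hs := (Real.sqrt_pos.2 hk).ne'
  have hss := Real.mul_self_sqrt hk.le
  set s := √(f * metric (fderiv ℝ σ x X) (fderiv ℝ σ x X))
  refine isFrame_of_ortho (hσ.defPlane h1 x) ((L (i + 1) x).smul_mem _ (hσ.connForm_mem h1 _ x _ _))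
    ((L (i + 1) x).smul_mem _ (hσ.connForm_mem h1 _ x _ _)) ?_ ?_ ?_
  · rw [metric_smul_left, metric_smul_right, hσ.conf_inner hi him hf X h.mem_left h.mem_left,
      neg_mul, ← hss, h.left, eps_succ]
    field_simp
  · rw [metric_smul_left, metric_smul_right, hσ.conf_inner hi him hf X h.mem_right h.mem_right,
      neg_mul, ← hss, h.right, eps_succ]
    field_simp
  · rw [metric_smul_left, metric_smul_right, hσ.conf_inner hi him hf X h.mem_left h.mem_right,
      h.ortho]
    ring

lemma conf_adjoint {i : ℕ} (hi : 1 ≤ i) (him : i + 1 ≤ 2 * m) {x : Plane} {f : ℝ}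
    (hf : IsConf σ L i x f) (X : Plane) {Z : Mat (2 * m)} (hZ : Z ∈ L (i + 1) x) :
    metric (connForm L i (i + 1) x X Z) (connForm L i (i + 1) x X Z)
      = -f * metric (fderiv ℝ σ x X) (fderiv ℝ σ x X) * metric Z Z := by
  have h0 : i ∈ Finset.Icc 1 (2 * m) := by rw [Finset.mem_Icc]; omega
  have h1 : i + 1 ∈ Finset.Icc 1 (2 * m) := by rw [Finset.mem_Icc]; omega
  have hk0 : 0 ≤ f * metric (fderiv ℝ σ x X) (fderiv ℝ σ x X) :=
    mul_nonneg (hσ.conf_nonneg hi him hf) (hσ.metric_fderiv_nonneg (by omega) x X)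
  have hB := hσ.connForm_mem h0 (i + 1) x X Z
  rcases hk0.eq_or_lt with hk | hk
  · have hA : ∀ Y ∈ L i x, connForm L (i + 1) i x X Y = 0 := fun Y hY =>
      (hσ.defPlane h1 x).eq_zero (hσ.connForm_mem h1 i x X Y) (by
        rw [hf X Y hY, neg_mul, ← hk]; ring)
    have : connForm L i (i + 1) x X Z = 0 := (hσ.defPlane h0 x).eq_zero hB (by
      rw [hσ.connForm_adjoint h0 h1 (by omega) X hZ hB, hA _ hB, metric_zero_right, neg_zero])
    rw [this, metric_zero_left, neg_mul, ← hk]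
    ring
  · obtain ⟨u, v, h⟩ := exists_frame (hσ.defPlane h0 x)
    have hZe := (hσ.frame_image hi him hf hk h).expand Z hZ
    set k := f * metric (fderiv ℝ σ x X) (fderiv ℝ σ x X)
    set s := eps (i + 1) * metric Z ((√k)⁻¹ • connForm L (i + 1) i x X u)
    set t := eps (i + 1) * metric Z ((√k)⁻¹ • connForm L (i + 1) i x X v)
    obtain ⟨Y, hY, hZY⟩ : ∃ Y ∈ L i x, Z = connForm L (i + 1) i x X Y := by
      refine ⟨(s * (√k)⁻¹) • u + (t * (√k)⁻¹) • v,
        (L i x).add_mem ((L i x).smul_mem _ h.mem_left) ((L i x).smul_mem _ h.mem_right), ?_⟩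
      rw [hσ.connForm_add h1 h0, hσ.connForm_smul h1 h0, hσ.connForm_smul h1 h0, mul_smul s, mul_smul t]
      exact hZe
    have hBZ : connForm L i (i + 1) x X Z = k • Y := by
      refine eq_of_metric_eq (hσ.defPlane h0 x) hB ((L i x).smul_mem _ hY) fun W hW => ?_
      rw [hσ.connForm_adjoint h0 h1 (by omega) X hZ hW, hZY, hσ.conf_inner hi him hf X hY hW,
        metric_smul_left]
      ring
    rw [hBZ, hZY, hf X Y hY, metric_smul_left, metric_smul_right]
    ring

lemma conf_dual {i : ℕ} (hi : 1 ≤ i) (him : i + 1 ≤ 2 * m) {x : Plane} {f : ℝ}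
    (hf : IsConf σ L i x f) : IsConf σ L (2 * m - i) x f := by
  have h0 : i ∈ Finset.Icc 1 (2 * m) := by rw [Finset.mem_Icc]; omega
  have h1 : i + 1 ∈ Finset.Icc 1 (2 * m) := by rw [Finset.mem_Icc]; omega
  have h2 : 2 * m - i ∈ Finset.Icc 1 (2 * m) := by rw [Finset.mem_Icc]; omega
  intro X Y hY
  have hPY := hσ.paraCx_mem h2 hY
  rw [show 2 * m + 1 - (2 * m - i) = i + 1 by omega] at hPY
  have e := paraCx_paraCx (hσ.idem x) (hσ.le_tangent h2 x hY)
  have h3 := hσ.connForm_paraCx h0 h1 (by omega) X hPY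
  rw [e, show 2 * m + 1 - i = 2 * m - i + 1 by omega,
    show 2 * m + 1 - (i + 1) = 2 * m - i by omega] at h3
  rw [h3, metric_paraCx_paraCx (hσ.idem x) (hσ.le_tangent h0 x (hσ.connForm_mem h0 _ x _ _)),
    hσ.conf_adjoint hi him hf X hPY,
    metric_paraCx_paraCx (hσ.idem x) (hσ.le_tangent h2 x hY)]
  ring

lemma contDiffAt_connForm {i j : ℕ} (hi : i ∈ Finset.Icc 1 (2 * m)) (hj : j ∈ Finset.Icc 1 (2 * m))
    (hij : i ≠ j) {x : Plane} {ν : Plane → Mat (2 * m)} (hν : LocSec (L j) ν x)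
    {X : Plane → Plane} (hX : ContDiffAt ℝ ∞ X x) :
    ContDiffAt ℝ ∞ (fun y => connForm L i j y (X y) (ν y)) x := by
  refine (hσ.contDiffAt_proj hi (contDiffAt_fderiv_mat hν.smooth hX)).congr_of_eventuallyEq ?_
  filter_upwards [hν.eventually] with y hy
  rw [hσ.orthProj_fderiv hi hj hij hy]

open Asymptotics in
lemma etaVanishes_one_iff {i : ℕ} (hi : 1 ≤ i) (him : i + 1 ≤ 2 * m) (p : Plane) :
    EtaVanishes σ L (i + 1) p 1 ↔ ∀ X, ∀ Y ∈ L i p, connForm L (i + 1) i p X Y = 0 := by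
  have h0 : i ∈ Finset.Icc 1 (2 * m) := by rw [Finset.mem_Icc]; omega
  have h1 : i + 1 ∈ Finset.Icc 1 (2 * m) := by rw [Finset.mem_Icc]; omega
  have h1' : i + 1 ∈ Finset.Icc 2 (2 * m) := by rw [Finset.mem_Icc]; omega
  constructor
  · intro h X Y hY
    have h2 := (h _ (hσ.isSection_const h0 Y) X).eq_zero_of_norm_pow one_ne_zero
    rw [hσ.eta_eq h1' (hσ.isSection_const h0 Y)] at h2
    simpa only [Nat.add_sub_cancel, orthProj_of_mem (hσ.defPlane h0 p) hY] using h2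
  · intro h ν hν X
    have hν' : IsSection (L i) ν := hν
    have h2 := (hσ.contDiffAt_connForm h1 h0 (by omega) (hν'.locSec p)
      (contDiffAt_const (c := X))).differentiableAt (by simp)
    have h3 := h2.isBigO_sub
    rw [h X _ (hν'.2 p)] at h3
    refine IsBigO.congr_left (f₁ := fun y => connForm L (i + 1) i y X (ν y)) ?_ ?_
    · refine IsBigO.trans (g := fun y => y - p) (by simpa using h3) ?_
      exact IsBigO.of_bound 1 (Filter.Eventually.of_forall fun y => by simp)
    · intro y
      rw [hσ.eta_eq h1' hν]
      rfl

lemma exists_conf_of_le (hdiv : DivisorCondition σ L) {i : ℕ} (hi : 1 ≤ i) (him : i ≤ m)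
    (x : Plane) : ∃ f, IsConf σ L i x f := by
  induction i, hi using Nat.le_induction with
  | base =>
    obtain ⟨X₁, X₂, hX⟩ := hσ.exists_tanFrame him x
    obtain ⟨f, -, hf⟩ := hσ.conf_step le_rfl (by omega) hX (hσ.fderiv_mem x X₁) (hσ.fderiv_mem x X₂)
      hX.ortho (hX.left.trans hX.right.symm)
      (fun h => by have := hX.left; rw [h, metric_zero_left] at this; exact zero_ne_one this)
      (hσ.connForm_tangent_comm him x X₁ X₂)
    exact ⟨f, hf⟩
  | succ i hi ih =>
    obtain ⟨f, hf⟩ := ih (by omega)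
    have h0 : i ∈ Finset.Icc 1 (2 * m) := by rw [Finset.mem_Icc]; omega
    have h1 : i + 1 ∈ Finset.Icc 1 (2 * m) := by rw [Finset.mem_Icc]; omega
    have h2 : i + 2 ∈ Finset.Icc 1 (2 * m) := by rw [Finset.mem_Icc]; omega
    rcases eq_or_ne f 0 with hf0 | hf0
    · have hv : ∀ X, ∀ Y ∈ L i x, connForm L (i + 1) i x X Y = 0 := fun X Y hY =>
        (hσ.defPlane h1 x).eq_zero (hσ.connForm_mem h1 i x X Y) (by rw [hf X Y hY, hf0]; ring)
      have h3 := ((hσ.etaVanishes_one_iff hi (by omega) x).2 hv).le_etaDivisor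
      have h4 := hdiv (i + 1) (by rw [Finset.mem_Icc]; omega) x (by
        intro h; rw [h] at h3; simp at h3)
      have h5 := etaVanishes_of_lt (k := 0) (lt_of_le_of_lt bot_le h4)
      have h6 := (hσ.etaVanishes_one_iff (i := i + 1) (by omega) (by omega) x).1 h5
      refine ⟨0, fun X Y hY => ?_⟩
      rw [h6 X Y hY, metric_zero_left]
      ring
    · obtain ⟨X₁, X₂, hX⟩ := hσ.exists_tanFrame (by omega) x
      obtain ⟨u, v, h⟩ := exists_frame (hσ.defPlane h0 x)
      have h3 := hσ.conf_polar hi (by omega) hf X₁ X₂ h.mem_left h.mem_left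
      rw [hX.ortho, metric_comm (connForm L (i + 1) i x X₂ u)] at h3
      obtain ⟨f', -, hf'⟩ := hσ.conf_step (i := i + 1) (by omega) (by omega) hX
        (hσ.connForm_mem h1 i x X₁ u) (hσ.connForm_mem h1 i x X₂ u) (by linarith)
        (by rw [hf X₁ u h.mem_left, hf X₂ u h.mem_left, hX.left, hX.right])
        (by
          intro h4
          have h5 := hf X₁ u h.mem_left
          rw [h4, metric_zero_left, hX.left, h.left] at h5
          have := eps_mul_self i
          exact hf0 (by linear_combination eps i * h5 - f * this))
        (hσ.connForm_comm hi him X₁ X₂ h.mem_left)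
      exact ⟨f', hf'⟩

variable (hdiv : DivisorCondition σ L)
include hdiv

lemma isConf_fac {i : ℕ} (hi : 1 ≤ i) (him : i + 1 ≤ 2 * m) (x : Plane) :
    IsConf σ L i x (fac σ L i x) := by
  refine Classical.epsilon_spec (p := IsConf σ L i x) ?_
  by_cases h : i ≤ m
  · exact hσ.exists_conf_of_le hdiv hi h x
  · obtain ⟨f, hf⟩ := hσ.exists_conf_of_le hdiv (i := 2 * m - i) (by omega) (by omega) x
    have := hσ.conf_dual (by omega) (by omega) hf
    rw [show 2 * m - (2 * m - i) = i by omega] at this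
    exact ⟨f, this⟩

lemma fac_nonneg {i : ℕ} (hi : 1 ≤ i) (him : i + 1 ≤ 2 * m) (x : Plane) : 0 ≤ fac σ L i x :=
  hσ.conf_nonneg hi him (hσ.isConf_fac hdiv hi him x)

lemma fac_dual {i : ℕ} (hi : 1 ≤ i) (him : i + 1 ≤ 2 * m) (x : Plane) :
    fac σ L (2 * m - i) x = fac σ L i x :=
  hσ.conf_unique (by rw [Finset.mem_Icc]; omega) (hσ.isConf_fac hdiv (by omega) (by omega) x)
    (hσ.conf_dual hi him (hσ.isConf_fac hdiv hi him x))

lemma fac_eq {i : ℕ} (hi : 1 ≤ i) (him : i + 1 ≤ 2 * m) (x : Plane) {X : Plane} (hX : X ≠ 0)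
    {Y : Mat (2 * m)} (hY : Y ∈ L i x) (hY0 : Y ≠ 0) :
    fac σ L i x = -(metric (connForm L (i + 1) i x X Y) (connForm L (i + 1) i x X Y)
      / (metric (fderiv ℝ σ x X) (fderiv ℝ σ x X) * metric Y Y)) := by
  have h0 : i ∈ Finset.Icc 1 (2 * m) := by rw [Finset.mem_Icc]; omega
  have h1 := (hσ.metric_fderiv_pos (by omega) x hX).ne'
  have h2 : metric Y Y ≠ 0 := fun h => hY0 ((hσ.defPlane h0 x).eq_zero hY h)
  rw [hσ.isConf_fac hdiv hi him x X Y hY]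
  field_simp

lemma contDiff_fac {i : ℕ} (hi : 1 ≤ i) (him : i + 1 ≤ 2 * m) : ContDiff ℝ ∞ (fac σ L i) := by
  rw [contDiff_iff_contDiffAt]
  intro x
  have h0 : i ∈ Finset.Icc 1 (2 * m) := by rw [Finset.mem_Icc]; omega
  have h1 : i + 1 ∈ Finset.Icc 1 (2 * m) := by rw [Finset.mem_Icc]; omega
  obtain ⟨u, v, huv⟩ := exists_local_frame (hσ.frenet.subbundle i h0) (hσ.defPlane h0) x
  have hu : LocSec (L i) u x :=
    ⟨huv.mono fun _ h => h.1, huv.mono fun _ h => h.2.2.mem_left⟩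
  have hX0 : (EuclideanSpace.single 0 1 : Plane) ≠ 0 := by simp
  have hu0 : ∀ᶠ y in nhds x, u y ≠ 0 := huv.mono fun y h h2 => by
    have h3 := h.2.2.left
    rw [h2, metric_zero_left] at h3
    have h4 := eps_mul_self i
    rw [← h3] at h4
    norm_num at h4
  have hd := hσ.contDiffAt_connForm h1 h0 (by omega) hu
    (contDiffAt_const (c := (EuclideanSpace.single 0 1 : Plane)))
  have hd2 := (hσ.locSec_fderiv x (EuclideanSpace.single 0 1)).smooth
  have h2 : metric (u x) (u x) ≠ 0 := fun h =>
    hu0.self_of_nhds ((hσ.defPlane h0 x).eq_zero hu.mem_self h)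
  refine ((contDiffAt_metric hd hd).div ((contDiffAt_metric hd2 hd2).mul
    (contDiffAt_metric hu.smooth hu.smooth)) ?_).neg.congr_of_eventuallyEq ?_
  · exact mul_ne_zero (hσ.metric_fderiv_pos (by omega) x hX0).ne' h2
  · filter_upwards [hu0, hu.mem] with y hy hy2
    exact hσ.fac_eq hdiv hi him y hX0 hy2 hy

end IsIsotropicPAlternating
end ParaHyp
end

noncomputable section
namespace ParaHyp

/-! ### Orthonormal tangent frames -/

open Asymptotics Filter

/-- The standard basis of the plane. -/
def bas (i : Fin 2) : Plane := EuclideanSpace.single i 1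

lemma plane_eq (X : Plane) : X = X 0 • bas 0 + X 1 • bas 1 := by
  ext i; fin_cases i <;> simp [bas]

lemma bas_ne_zero (i : Fin 2) : bas i ≠ 0 := by simp [bas]

/-- The first vector of the Gram-Schmidt frame. -/
def frameOne {n : ℕ} (σ : Plane → Mat n) (x : Plane) : Plane := (√(gram σ x 0 0))⁻¹ • bas 0

/-- The second vector of the Gram-Schmidt frame. -/
def frameTwo {n : ℕ} (σ : Plane → Mat n) (x : Plane) : Plane :=
  (√(gram σ x 0 0 * (gram σ x).det))⁻¹ • (gram σ x 0 0 • bas 1 - gram σ x 0 1 • bas 0)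

lemma gram_apply {n : ℕ} (σ : Plane → Mat n) (x : Plane) (i j : Fin 2) :
    gram σ x i j = metric (fderiv ℝ σ x (bas i)) (fderiv ℝ σ x (bas j)) := rfl

lemma gram_symm {n : ℕ} (σ : Plane → Mat n) (x : Plane) (i j : Fin 2) :
    gram σ x i j = gram σ x j i := metric_comm _ _

namespace IsIsotropicPAlternating

variable {m : ℕ} {σ : Plane → Mat (2 * m)} {L : ℕ → Plane → Submodule ℝ (Mat (2 * m))}
  (hσ : IsIsotropicPAlternating σ L)
include hσ

lemma isTanFrame_of {x X₁ X₂ : Plane} (hm : 1 ≤ m)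
    (h1 : metric (fderiv ℝ σ x X₁) (fderiv ℝ σ x X₁) = 1)
    (h2 : metric (fderiv ℝ σ x X₂) (fderiv ℝ σ x X₂) = 1)
    (h3 : metric (fderiv ℝ σ x X₁) (fderiv ℝ σ x X₂) = 0) : IsTanFrame σ x X₁ X₂ := by
  have hd := hσ.defPlane (one_mem_Icc hm) x
  rw [eps_of_odd odd_one] at hd
  have h := isFrame_of_ortho hd (hσ.fderiv_mem x X₁) (hσ.fderiv_mem x X₂) h1 h2 h3
  refine ⟨h1, h2, h3, fun Z => ?_⟩
  apply hσ.immersion x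
  rw [map_add, map_smul, map_smul]
  simpa using h.expand _ (hσ.fderiv_mem x Z)

lemma gram_zero_pos (hm : 1 ≤ m) (x : Plane) : 0 < gram σ x 0 0 :=
  hσ.metric_fderiv_pos hm x (bas_ne_zero 0)

omit hσ in
lemma metric_gs_perp (x : Plane) :
    metric (fderiv ℝ σ x (gram σ x 0 0 • bas 1 - gram σ x 0 1 • bas 0))
      (fderiv ℝ σ x (gram σ x 0 0 • bas 1 - gram σ x 0 1 • bas 0))
      = gram σ x 0 0 * (gram σ x).det := by
  rw [map_sub, map_smul, map_smul, Matrix.det_fin_two]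
  simp only [metric_sub_left, metric_sub_right, metric_smul_left, metric_smul_right, ← gram_apply]
  rw [gram_symm σ x 1 0]
  ring

lemma gram_mul_det_pos (hm : 1 ≤ m) (x : Plane) : 0 < gram σ x 0 0 * (gram σ x).det := by
  rw [← metric_gs_perp]
  refine hσ.metric_fderiv_pos hm x fun h => ?_
  have h2 := congrArg (fun v : Plane => v 1) h
  simp [bas] at h2
  exact (hσ.gram_zero_pos hm x).ne' h2

lemma gram_det_pos (hm : 1 ≤ m) (x : Plane) : 0 < (gram σ x).det :=
  pos_of_mul_pos_right (hσ.gram_mul_det_pos hm x) (hσ.gram_zero_pos hm x).le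

lemma isTanFrame (hm : 1 ≤ m) (x : Plane) : IsTanFrame σ x (frameOne σ x) (frameTwo σ x) := by
  have h1 := hσ.gram_zero_pos hm x
  have h2 := hσ.gram_mul_det_pos hm x
  have s1 := Real.mul_self_sqrt h1.le
  have s2 := Real.mul_self_sqrt h2.le
  have t1 := (Real.sqrt_pos.2 h1).ne'
  have t2 := (Real.sqrt_pos.2 h2).ne'
  refine hσ.isTanFrame_of hm ?_ ?_ ?_
  · rw [frameOne, map_smul, metric_smul_left, metric_smul_right, ← gram_apply]
    nth_rewrite 3 [← s1]
    field_simp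
  · rw [frameTwo, map_smul, metric_smul_left, metric_smul_right, metric_gs_perp]
    nth_rewrite 3 [← s2]
    field_simp
  · rw [frameOne, frameTwo, map_smul, map_smul, metric_smul_left, metric_smul_right, map_sub,
      map_smul, map_smul, metric_sub_right, metric_smul_right, metric_smul_right, ← gram_apply,
      ← gram_apply]
    ring

lemma contDiff_gram (i j : Fin 2) : ContDiff ℝ ∞ fun x => gram σ x i j :=
  contDiff_iff_contDiffAt.2 fun x => contDiffAt_metric
    (hσ.locSec_fderiv x (bas i)).smooth (hσ.locSec_fderiv x (bas j)).smooth

lemma contDiff_gram_det : ContDiff ℝ ∞ fun x => (gram σ x).det := by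
  simp only [Matrix.det_fin_two]
  exact ((hσ.contDiff_gram 0 0).mul (hσ.contDiff_gram 1 1)).sub
    ((hσ.contDiff_gram 0 1).mul (hσ.contDiff_gram 1 0))

lemma contDiff_frameOne (hm : 1 ≤ m) : ContDiff ℝ ∞ (frameOne σ) :=
  (((hσ.contDiff_gram 0 0).sqrt fun x => (hσ.gram_zero_pos hm x).ne').inv
    fun x => (Real.sqrt_pos.2 (hσ.gram_zero_pos hm x)).ne').smul contDiff_const

lemma contDiff_frameTwo (hm : 1 ≤ m) : ContDiff ℝ ∞ (frameTwo σ) :=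
  ((((hσ.contDiff_gram 0 0).mul hσ.contDiff_gram_det).sqrt fun x =>
    (hσ.gram_mul_det_pos hm x).ne').inv
    fun x => (Real.sqrt_pos.2 (hσ.gram_mul_det_pos hm x)).ne').smul
    (((hσ.contDiff_gram 0 0).smul contDiff_const).sub ((hσ.contDiff_gram 0 1).smul contDiff_const))

end IsIsotropicPAlternating

/-! ### Orders of vanishing -/

lemma exists_contDiff_eventuallyEq {G F : Type*} [NormedAddCommGroup G] [NormedSpace ℝ G]
    [FiniteDimensional ℝ G] [NormedAddCommGroup F] [NormedSpace ℝ F] {f : G → F} {p : G}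
    (hf : ∀ᶠ y in nhds p, ContDiffAt ℝ ∞ f y) : ∃ g : G → F, ContDiff ℝ ∞ g ∧ g =ᶠ[nhds p] f := by
  obtain ⟨r, hr, h⟩ := Metric.eventually_nhds_iff_ball.1 hf
  let b : ContDiffBump p := ⟨r / 4, r / 2, by positivity, by linarith⟩
  refine ⟨fun y => b y • f y, ?_, ?_⟩
  · rw [contDiff_iff_contDiffAt]
    intro y
    by_cases hy : y ∈ Metric.ball p r
    · exact b.contDiff.contDiffAt.smul (h y hy)
    · have hy' : y ∉ tsupport b := by
        rw [b.tsupport_eq]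
        simp only [Metric.mem_closedBall, Metric.mem_ball, not_lt, not_le, b] at hy ⊢
        linarith
      refine (contDiffAt_const (c := (0 : F))).congr_of_eventuallyEq ?_
      filter_upwards [(isClosed_tsupport b).isOpen_compl.mem_nhds hy'] with z hz
      rw [image_eq_zero_of_notMem_tsupport hz, zero_smul]
  · filter_upwards [b.eventuallyEq_one] with y hy
    rw [hy]; simp

lemma isBigO_one_of_continuousAt {F : Type*} [NormedAddCommGroup F] {f : Plane → F} {p : Plane}
    (hf : ContinuousAt f p) : f =O[nhds p] fun _ => (1 : ℝ) := hf.isBigO_one ℝ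

lemma isBigO_smul_of_continuousAt {F : Type*} [NormedAddCommGroup F] [NormedSpace ℝ F]
    {c : Plane → ℝ} {f : Plane → F} {g : Plane → ℝ} {p : Plane} (hc : ContinuousAt c p)
    (hf : f =O[nhds p] g) : (fun x => c x • f x) =O[nhds p] g := by
  simpa using (isBigO_one_of_continuousAt hc).smul hf

/-- The closedness equation in a moving frame. -/
lemma isBigO_curl_frame {X₁ X₂ : Plane → Plane} (h1 : ContDiff ℝ ∞ X₁) (h2 : ContDiff ℝ ∞ X₂)
    {f₀ f₁ : Plane → ℂ} (hf₀ : ContDiff ℝ ∞ f₀) (hf₁ : ContDiff ℝ ∞ f₁) {p : Plane} {k : ℕ}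
    (hO₀ : f₀ =O[nhds p] fun x => ‖x - p‖ ^ k) (hO₁ : f₁ =O[nhds p] fun x => ‖x - p‖ ^ k)
    (hc : (fun x => fderiv ℝ f₁ x (bas 0) - fderiv ℝ f₀ x (bas 1))
      =O[nhds p] fun x => ‖x - p‖ ^ k) :
    (fun x => fderiv ℝ (fun y => X₂ y 0 • f₀ y + X₂ y 1 • f₁ y) x (X₁ p)
      - fderiv ℝ (fun y => X₁ y 0 • f₀ y + X₁ y 1 • f₁ y) x (X₂ p))
      =O[nhds p] fun x => ‖x - p‖ ^ k := by
  have hcd : ∀ {X : Plane → Plane} (i : Fin 2), ContDiff ℝ ∞ X → ContDiff ℝ ∞ fun y => X y i := by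
    intro X i hX
    exact (EuclideanSpace.proj (𝕜 := ℝ) i).contDiff.comp hX
  have hdf : ∀ {g : Plane → ℂ}, ContDiff ℝ ∞ g → ∀ x, DifferentiableAt ℝ g x := fun h x =>
    h.differentiable (by simp) x
  have hdr : ∀ {g : Plane → ℝ}, ContDiff ℝ ∞ g → ∀ x, DifferentiableAt ℝ g x := fun h x =>
    h.differentiable (by simp) x
  have hder : ∀ {X : Plane → Plane}, ContDiff ℝ ∞ X → ∀ x v,
      fderiv ℝ (fun y => X y 0 • f₀ y + X y 1 • f₁ y) x v
        = (fderiv ℝ (fun y => X y 0) x v • f₀ x + fderiv ℝ (fun y => X y 1) x v • f₁ x)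
          + (X x 0 • fderiv ℝ f₀ x v + X x 1 • fderiv ℝ f₁ x v) := by
    intro X hX x v
    rw [fderiv_fun_add (f := fun y => X y 0 • f₀ y) (g := fun y => X y 1 • f₁ y)
      ((hdr (hcd 0 hX) x).smul (hdf hf₀ x)) ((hdr (hcd 1 hX) x).smul (hdf hf₁ x)),
      fderiv_fun_smul (hdr (hcd 0 hX) x) (hdf hf₀ x), fderiv_fun_smul (hdr (hcd 1 hX) x) (hdf hf₁ x)]
    simp only [add_apply, smul_apply, ContinuousLinearMap.smulRight_apply]
    abel
  have hcc : ∀ {g : Plane → ℝ}, ContDiff ℝ ∞ g → ∀ v, Continuous fun x => fderiv ℝ g x v :=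
    fun h v => (h.continuous_fderiv (by simp)).clm_apply continuous_const
  have hcC : ∀ {g : Plane → ℂ}, ContDiff ℝ ∞ g → ∀ v, Continuous fun x => fderiv ℝ g x v :=
    fun h v => (h.continuous_fderiv (by simp)).clm_apply continuous_const
  have hlin : ∀ (g : Plane → ℂ) (x v : Plane),
      fderiv ℝ g x v = v 0 • fderiv ℝ g x (bas 0) + v 1 • fderiv ℝ g x (bas 1) := by
    intro g x v
    conv_lhs => rw [plane_eq v]
    rw [map_add, map_smul, map_smul]
  have herr : ∀ {X Y : Plane → Plane}, ContDiff ℝ ∞ X → ContDiff ℝ ∞ Y → ∀ i j : Fin 2,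
      ∀ {f : Plane → ℂ}, ContDiff ℝ ∞ f → f =O[nhds p] (fun x => ‖x - p‖ ^ k) → ∀ l : Fin 2,
      (fun x => (X x i * Y p j - X p i * Y p j) • fderiv ℝ f x (bas l))
        =O[nhds p] fun x => ‖x - p‖ ^ k := by
    intro X Y hX hY i j f hf hfO l
    rcases Nat.eq_zero_or_pos k with rfl | hk
    · simp only [pow_zero]
      exact isBigO_one_of_continuousAt (((((hcd i hX).continuous.mul continuous_const).sub
        continuous_const).smul (hcC hf _)).continuousAt)
    · obtain ⟨k, rfl⟩ := Nat.exists_eq_succ_of_ne_zero hk.ne'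
      have h3 := isBigO_fderiv_of_isBigO_pow hf hfO (bas l)
      have h4 : (fun x => X x i * Y p j - X p i * Y p j) =O[nhds p] fun x => ‖x - p‖ := by
        have h5 := (((hdr (hcd i hX) p).mul_const (Y p j))).isBigO_sub
        exact h5.norm_right
      exact (h4.smul h3).congr_right fun x => by rw [smul_eq_mul, pow_succ']
  have main : ∀ x, fderiv ℝ (fun y => X₂ y 0 • f₀ y + X₂ y 1 • f₁ y) x (X₁ p)
      - fderiv ℝ (fun y => X₁ y 0 • f₀ y + X₁ y 1 • f₁ y) x (X₂ p)
      = (fderiv ℝ (fun y => X₂ y 0) x (X₁ p) - fderiv ℝ (fun y => X₁ y 0) x (X₂ p)) • f₀ x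
        + (fderiv ℝ (fun y => X₂ y 1) x (X₁ p) - fderiv ℝ (fun y => X₁ y 1) x (X₂ p)) • f₁ x
        + (X₁ p 0 * X₂ p 1 - X₁ p 1 * X₂ p 0) • (fderiv ℝ f₁ x (bas 0) - fderiv ℝ f₀ x (bas 1))
        + ((X₂ x 0 * X₁ p 0 - X₂ p 0 * X₁ p 0) • fderiv ℝ f₀ x (bas 0)
          + (X₂ x 0 * X₁ p 1 - X₂ p 0 * X₁ p 1) • fderiv ℝ f₀ x (bas 1)
          + (X₂ x 1 * X₁ p 0 - X₂ p 1 * X₁ p 0) • fderiv ℝ f₁ x (bas 0)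
          + (X₂ x 1 * X₁ p 1 - X₂ p 1 * X₁ p 1) • fderiv ℝ f₁ x (bas 1)
          - (X₁ x 0 * X₂ p 0 - X₁ p 0 * X₂ p 0) • fderiv ℝ f₀ x (bas 0)
          - (X₁ x 0 * X₂ p 1 - X₁ p 0 * X₂ p 1) • fderiv ℝ f₀ x (bas 1)
          - (X₁ x 1 * X₂ p 0 - X₁ p 1 * X₂ p 0) • fderiv ℝ f₁ x (bas 0)
          - (X₁ x 1 * X₂ p 1 - X₁ p 1 * X₂ p 1) • fderiv ℝ f₁ x (bas 1)) := by
    intro x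
    rw [hder h2, hder h1, hlin f₀ x (X₁ p), hlin f₁ x (X₁ p), hlin f₀ x (X₂ p), hlin f₁ x (X₂ p)]
    module
  simp only [main]
  refine ((IsBigO.add ?_ ?_).add ?_).add ?_
  · exact isBigO_smul_of_continuousAt ((hcc (hcd 0 h2) _).sub (hcc (hcd 0 h1) _)).continuousAt hO₀
  · exact isBigO_smul_of_continuousAt ((hcc (hcd 1 h2) _).sub (hcc (hcd 1 h1) _)).continuousAt hO₁
  · exact isBigO_smul_of_continuousAt continuousAt_const hc
  · exact (((((((herr h2 h1 0 0 hf₀ hO₀ 0).add (herr h2 h1 0 1 hf₀ hO₀ 1)).add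
      (herr h2 h1 1 0 hf₁ hO₁ 0)).add (herr h2 h1 1 1 hf₁ hO₁ 1)).sub
      (herr h1 h2 0 0 hf₀ hO₀ 0)).sub (herr h1 h2 0 1 hf₀ hO₀ 1)).sub
      (herr h1 h2 1 0 hf₁ hO₁ 0)).sub (herr h1 h2 1 1 hf₁ hO₁ 1)

lemma exists_metric_bound (n : ℕ) : ∃ C : ℝ, ∀ A B : Mat n, |metric A B| ≤ C * (‖A‖ * ‖B‖) := by
  have hc : Continuous (Matrix.traceLinearMap (Fin (n + 1)) ℝ ℝ) := (traceL n).continuous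
  obtain ⟨C, hC0, hC⟩ := SemilinearMapClass.bound_of_continuous _ hc
  refine ⟨1 / 2 * C, fun A B => ?_⟩
  have h1 : |(A * B).trace| ≤ C * ‖A * B‖ := hC (A * B)
  have h2 : ‖A * B‖ ≤ ‖A‖ * ‖B‖ := norm_mul_le A B
  rw [metric, abs_mul, abs_neg, abs_of_pos (by norm_num : (0 : ℝ) < 1 / 2), mul_assoc]
  exact mul_le_mul_of_nonneg_left (h1.trans (mul_le_mul_of_nonneg_left h2 hC0.le)) (by norm_num)

lemma isBigO_metric {n : ℕ} {A B : Plane → Mat n} {f g : Plane → ℝ} {l : Filter Plane}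
    (hA : A =O[l] f) (hB : B =O[l] g) : (fun x => metric (A x) (B x)) =O[l] fun x => f x * g x := by
  obtain ⟨C, hC⟩ := exists_metric_bound n
  refine IsBigO.trans (IsBigO.of_bound C (Eventually.of_forall fun x => ?_))
    (hA.norm_left.mul hB.norm_left)
  rw [Real.norm_eq_abs, norm_mul, norm_norm, norm_norm]
  exact hC _ _

end ParaHyp
end

noncomputable section
namespace ParaHyp

open Asymptotics Filter

lemma IsFrame.metric_eq {n : ℕ} {V : Submodule ℝ (Mat n)} {ε : ℝ} {u v : Mat n}
    (h : IsFrame V ε u v) {Y : Mat n} (hY : Y ∈ V) (Z : Mat n) :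
    ε * metric Y Z = metric Y u * metric Z u + metric Y v * metric Z v := by
  have e := congrArg (fun W => metric W Z) (h.expand Y hY)
  simp only [metric_add_left, metric_smul_left, metric_comm u Z, metric_comm v Z] at e
  rw [e]
  linear_combination (metric Y u * metric Z u + metric Y v * metric Z v) * h.sign

lemma IsFrame.left_ne_zero {n : ℕ} {V : Submodule ℝ (Mat n)} {ε : ℝ} {u v : Mat n}
    (h : IsFrame V ε u v) : u ≠ 0 := by
  rintro rfl
  have h3 := h.left
  rw [metric_zero_left] at h3
  have h4 := h.sign
  rw [← h3] at h4
  norm_num at h4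

lemma fderiv_complex {r s : Plane → ℝ} {x : Plane} (hr : DifferentiableAt ℝ r x)
    (hs : DifferentiableAt ℝ s x) (v : Plane) :
    fderiv ℝ (fun y => (r y : ℂ) + (s y : ℂ) * Complex.I) x v
      = (fderiv ℝ r x v : ℂ) + (fderiv ℝ s x v : ℂ) * Complex.I := by
  have h1 := (Complex.ofRealCLM.hasFDerivAt.comp x hr.hasFDerivAt).add
    ((Complex.ofRealCLM.hasFDerivAt.comp x hs.hasFDerivAt).mul_const Complex.I)
  have h2 : fderiv ℝ (fun y => (r y : ℂ) + (s y : ℂ) * Complex.I) x = _ := h1.fderiv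
  rw [h2]
  simp [mul_comm]

lemma isBigO_complex {r s : Plane → ℝ} {g : Plane → ℝ} {l : Filter Plane} (hr : r =O[l] g)
    (hs : s =O[l] g) : (fun y => (r y : ℂ) + (s y : ℂ) * Complex.I) =O[l] g := by
  have h1 : (fun y => (r y : ℂ)) =O[l] g := (IsBigO.of_norm_eventuallyLE
    (Eventually.of_forall fun y => by simp)).trans hr.norm_left
  have h2 : (fun y => (s y : ℂ) * Complex.I) =O[l] g := (IsBigO.of_norm_eventuallyLE
    (Eventually.of_forall fun y => by simp)).trans hs.norm_left
  exact h1.add h2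

namespace IsTanFrame

variable {n : ℕ} {σ : Plane → Mat n} {x X₁ X₂ : Plane} (h : IsTanFrame σ x X₁ X₂)
include h

lemma metric_eq (X Y : Plane) : metric (fderiv ℝ σ x X) (fderiv ℝ σ x Y)
    = metric (fderiv ℝ σ x X) (fderiv ℝ σ x X₁) * metric (fderiv ℝ σ x Y) (fderiv ℝ σ x X₁)
      + metric (fderiv ℝ σ x X) (fderiv ℝ σ x X₂) * metric (fderiv ℝ σ x Y) (fderiv ℝ σ x X₂) := by
  conv_lhs => rw [h.expand X, h.expand Y]
  simp only [map_add, map_smul, metric_add_left, metric_add_right, metric_smul_left,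
    metric_smul_right, h.left, h.right, h.ortho, metric_comm (fderiv ℝ σ x X₂) (fderiv ℝ σ x X₁)]
  ring

/-- The complex coordinate of the tangent plane. -/
lemma exists_coord : ∃ (ℓ : Plane →L[ℝ] ℂ) (δ : ℝ), ℓ X₁ = 1 ∧ ℓ X₂ = Complex.I ∧ 0 < δ ∧
    ∀ X, δ * ‖X‖ ≤ ‖ℓ X‖ := by
  let ℓ' : Plane →ₗ[ℝ] ℂ :=
    { toFun := fun X => (metric (fderiv ℝ σ x X) (fderiv ℝ σ x X₁) : ℂ)
        + (metric (fderiv ℝ σ x X) (fderiv ℝ σ x X₂) : ℂ) * Complex.I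
      map_add' := fun X Y => by
        rw [map_add, metric_add_left, metric_add_left]; push_cast; ring
      map_smul' := fun c X => by
        rw [map_smul, metric_smul_left, metric_smul_left]
        simp only [Complex.real_smul, RingHom.id_apply]
        push_cast; ring }
  have hker : LinearMap.ker ℓ' = ⊥ := by
    rw [LinearMap.ker_eq_bot']
    intro X hX
    have hX' : (metric (fderiv ℝ σ x X) (fderiv ℝ σ x X₁) : ℂ)
        + (metric (fderiv ℝ σ x X) (fderiv ℝ σ x X₂) : ℂ) * Complex.I = 0 := hX
    have h1 := congrArg Complex.re hX'
    have h2 := congrArg Complex.im hX'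
    simp at h1 h2
    rw [h.expand X, h1, h2, zero_smul, zero_smul, add_zero]
  obtain ⟨K, hK, hA⟩ := ℓ'.exists_antilipschitzWith hker
  refine ⟨LinearMap.toContinuousLinearMap ℓ', (K : ℝ)⁻¹, ?_, ?_, by positivity, fun X => ?_⟩
  · change (metric (fderiv ℝ σ x X₁) (fderiv ℝ σ x X₁) : ℂ)
        + (metric (fderiv ℝ σ x X₁) (fderiv ℝ σ x X₂) : ℂ) * Complex.I = 1
    rw [h.left, h.ortho]; simp
  · change (metric (fderiv ℝ σ x X₂) (fderiv ℝ σ x X₁) : ℂ)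
        + (metric (fderiv ℝ σ x X₂) (fderiv ℝ σ x X₂) : ℂ) * Complex.I = Complex.I
    rw [h.right, metric_comm, h.ortho]; simp
  · have h1 := hA.le_mul_dist X 0
    rw [map_zero, dist_zero_right, dist_zero_right] at h1
    rw [inv_mul_le_iff₀ (by exact_mod_cast hK)]
    exact h1

end IsTanFrame

namespace IsIsotropicPAlternating

variable {m : ℕ} {σ : Plane → Mat (2 * m)} {L : ℕ → Plane → Submodule ℝ (Mat (2 * m))}
  (hσ : IsIsotropicPAlternating σ L)
include hσ

/-- The derivatives of the components of `η_{i+1}` in constant directions. -/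
lemma curl_connForm {i : ℕ} (hi : 1 ≤ i) (him : i ≤ m) {x : Plane} {ν μ : Plane → Mat (2 * m)}
    (hν : LocSec (L i) ν x) (hμ : LocSec (L (i + 1)) μ x) (c d : Plane) :
    fderiv ℝ (fun y => metric (fderiv ℝ ν y d) (μ y)) x c
      - fderiv ℝ (fun y => metric (fderiv ℝ ν y c) (μ y)) x d
      = (-metric (connForm L (i + 1) i x c (orthProj (L i x) (fderiv ℝ ν x d))) (μ x)
          + metric (connForm L (i + 1) i x d (ν x)) (orthProj (L (i + 1) x) (fderiv ℝ μ x c)))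
        - (-metric (connForm L (i + 1) i x d (orthProj (L i x) (fderiv ℝ ν x c))) (μ x)
          + metric (connForm L (i + 1) i x c (ν x)) (orthProj (L (i + 1) x) (fderiv ℝ μ x d))) := by
  have h0 : i ∈ Finset.Icc 1 (2 * m) := by rw [Finset.mem_Icc]; omega
  have h1 : i + 1 ∈ Finset.Icc 1 (2 * m) := by rw [Finset.mem_Icc]; omega
  rw [fderiv_metric_fderiv hν.smooth hμ.smooth]
  have hsum : ∀ a b : Plane, ∑ k ∈ Finset.Icc 1 (2 * m),
      metric (orthProj (L k x) (fderiv ℝ ν x a)) (orthProj (L k x) (fderiv ℝ μ x b))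
      = -metric (connForm L (i + 1) i x b (orthProj (L i x) (fderiv ℝ ν x a))) (μ x)
          + metric (connForm L (i + 1) i x a (ν x)) (orthProj (L (i + 1) x) (fderiv ℝ μ x b)) := by
    intro a b
    rw [← Finset.sum_subset (s₁ := {i, i + 1}), Finset.sum_pair (by omega)]
    · rw [hσ.orthProj_fderiv h0 h1 (by omega) hμ, hσ.orthProj_fderiv h1 h0 (by omega) hν,
        hσ.connForm_adjoint h1 h0 (by omega) b (orthProj_mem (hσ.defPlane h0 x) _) hμ.mem_self,
        neg_neg]
    · intro k hk
      rw [Finset.mem_insert, Finset.mem_singleton] at hk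
      rcases hk with rfl | rfl <;> assumption
    · intro k hk hki
      rw [Finset.mem_insert, Finset.mem_singleton, not_or] at hki
      by_cases hk2 : k < i
      · rw [hσ.orthProj_fderiv hk h1 (by omega) hμ, hσ.connForm_eq_zero hk h1 (by omega),
          metric_zero_right]
      · rw [hσ.orthProj_fderiv hk h0 (by omega) hν, hσ.connForm_eq_zero hk h0 (by omega),
          metric_zero_left]
  rw [hσ.metric_fderiv_eq_sum h0 h1 hν hμ, hσ.metric_fderiv_eq_sum h0 h1 hν hμ, hsum, hsum]
  rw [hσ.normalTerm_comm hi him (hσ.fderiv_mem x d) (hσ.fderiv_mem x c) hν.mem_self hμ.mem_self]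
  ring

variable (hdiv : DivisorCondition σ L)
include hdiv

lemma isBigO_connForm {i k : ℕ} (hi : 1 ≤ i) (him : i + 1 ≤ 2 * m) {p : Plane}
    (h : fac σ L i =O[nhds p] fun x => ‖x - p‖ ^ (2 * k)) {ν : Plane → Mat (2 * m)}
    (hν : LocSec (L i) ν p) {X : Plane → Plane} (hX : ContDiffAt ℝ ∞ X p) :
    (fun y => connForm L (i + 1) i y (X y) (ν y)) =O[nhds p] fun x => ‖x - p‖ ^ k := by
  have h0 : i ∈ Finset.Icc 1 (2 * m) := by rw [Finset.mem_Icc]; omega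
  have h1 : i + 1 ∈ Finset.Icc 1 (2 * m) := by rw [Finset.mem_Icc]; omega
  obtain ⟨a, b, hab⟩ := exists_local_frame (hσ.frenet.subbundle _ h1) (hσ.defPlane h1) p
  set w := fun y => connForm L (i + 1) i y (X y) (ν y) with hw
  have hwm : ∀ y, w y ∈ L (i + 1) y := fun y => hσ.connForm_mem h1 _ y _ _
  have hdσ := contDiffAt_fderiv_mat hσ.smooth.contDiffAt hX
  have hbound : (fun y => eps (i + 1) * metric (w y) (w y)) =O[nhds p]
      fun x => ‖x - p‖ ^ (2 * k) := by
    have h2 : (fun y => (eps i * (metric (fderiv ℝ σ y (X y)) (fderiv ℝ σ y (X y))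
        * metric (ν y) (ν y))) • fac σ L i y) =O[nhds p] fun x => ‖x - p‖ ^ (2 * k) :=
      isBigO_smul_of_continuousAt (continuousAt_const.mul ((contDiffAt_metric hdσ hdσ).continuousAt.mul
        (contDiffAt_metric hν.smooth hν.smooth).continuousAt)) h
    refine h2.congr' ?_ EventuallyEq.rfl
    filter_upwards [hν.mem] with y hy
    rw [hw, hσ.isConf_fac hdiv hi him y (X y) (ν y) hy, eps_succ, smul_eq_mul]
    ring
  have hsq : ∀ c : Plane → Mat (2 * m), (∀ᶠ y in nhds p, metric (w y) (c y) ^ 2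
      ≤ eps (i + 1) * metric (w y) (w y)) → ContinuousAt c p →
      (fun y => (eps (i + 1) * metric (w y) (c y)) • c y) =O[nhds p] fun x => ‖x - p‖ ^ k := by
    intro c hc hcc
    have h2 : (fun y => metric (w y) (c y) ^ 2) =O[nhds p] fun x => (‖x - p‖ ^ k) ^ 2 := by
      refine (IsBigO.of_bound 1 ?_).trans (hbound.congr_right fun x => by rw [mul_comm, pow_mul])
      filter_upwards [hc] with y hy
      rw [one_mul, Real.norm_eq_abs, Real.norm_eq_abs, abs_of_nonneg (sq_nonneg _)]
      exact hy.trans (le_abs_self _)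
    have h3 : (fun y => metric (w y) (c y)) =O[nhds p] fun x => ‖x - p‖ ^ k :=
      IsBigO.of_pow (n := 2) two_ne_zero h2
    have h4 := (h3.const_mul_left (eps (i + 1))).smul (hcc.isBigO_one ℝ)
    simpa using h4
  have hframe : ∀ᶠ y in nhds p, metric (w y) (a y) ^ 2 + metric (w y) (b y) ^ 2
      = eps (i + 1) * metric (w y) (w y) := by
    filter_upwards [hab] with y hy
    rw [hy.2.2.metric_eq (hwm y)]; ring
  have ha := hsq a (hframe.mono fun y hy => by nlinarith [sq_nonneg (metric (w y) (b y))])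
    hab.self_of_nhds.1.continuousAt
  have hb := hsq b (hframe.mono fun y hy => by nlinarith [sq_nonneg (metric (w y) (a y))])
    hab.self_of_nhds.2.1.continuousAt
  refine (ha.add hb).congr' ?_ EventuallyEq.rfl
  filter_upwards [hab] with y hy
  exact (hy.2.2.expand _ (hwm y)).symm

lemma etaVanishes_iff_fac {i : ℕ} (hi : 1 ≤ i) (him : i + 1 ≤ 2 * m) (p : Plane) (k : ℕ) :
    EtaVanishes σ L (i + 1) p k ↔ fac σ L i =O[nhds p] fun x => ‖x - p‖ ^ (2 * k) := by
  have h0 : i ∈ Finset.Icc 1 (2 * m) := by rw [Finset.mem_Icc]; omega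
  have h1' : i + 1 ∈ Finset.Icc 2 (2 * m) := by rw [Finset.mem_Icc]; omega
  constructor
  · intro h
    obtain ⟨u, v, huv⟩ := exists_frame (hσ.defPlane h0 p)
    have hs := hσ.isSection_const h0 u
    have e : orthProj (L i p) u = u := orthProj_of_mem (hσ.defPlane h0 p) huv.mem_left
    have hs0 : ∀ᶠ y in nhds p, orthProj (L i y) u ≠ 0 :=
      (hs.1.continuous.continuousAt.eventually_ne (by rw [e]; exact huv.left_ne_zero))
    have h2 := isBigO_metric (h _ hs (bas 0)) (h _ hs (bas 0))
    have hd := (hσ.locSec_fderiv p (bas 0)).smooth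
    have hc : ContinuousAt (fun y => -(metric (fderiv ℝ σ y (bas 0)) (fderiv ℝ σ y (bas 0))
        * metric (orthProj (L i y) u) (orthProj (L i y) u))⁻¹) p := by
      refine (ContinuousAt.inv₀ (((contDiffAt_metric hd hd).continuousAt).mul
        (contDiff_metric hs.1 hs.1).continuous.continuousAt) ?_).neg
      refine mul_ne_zero (hσ.metric_fderiv_pos (by omega) p (bas_ne_zero 0)).ne' ?_
      exact fun h => hs0.self_of_nhds ((hσ.defPlane h0 p).eq_zero (hs.2 p) h)
    have h3 := isBigO_smul_of_continuousAt hc h2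
    refine h3.congr' ?_ (Eventually.of_forall fun x => by beta_reduce; rw [← pow_add, two_mul])
    filter_upwards [hs0] with y hy
    rw [hσ.fac_eq hdiv hi him y (bas_ne_zero 0) (hs.2 y) hy, hσ.eta_eq h1' hs, smul_eq_mul,
      div_eq_mul_inv]
    simp only [Nat.add_sub_cancel]
    ring
  · intro h ν hν X
    refine (hσ.isBigO_connForm hdiv hi him h (IsSection.locSec hν p)
      (contDiffAt_const (c := X))).congr_left fun y => ?_
    rw [hσ.eta_eq h1' hν]
    rfl

lemma fac_lower_of_order {i k : ℕ} (hi : 1 ≤ i) (him : i + 1 ≤ m) {p : Plane}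
    (h : EtaVanishes σ L (i + 1) p k) (h' : ¬ EtaVanishes σ L (i + 1) p (k + 1)) :
    ∃ a : ℝ, 0 < a ∧ ∀ᶠ x in nhds p, a * ‖x - p‖ ^ (2 * k) ≤ fac σ L i x := by
  have h0 : i ∈ Finset.Icc 1 (2 * m) := by rw [Finset.mem_Icc]; omega
  have h1 : i + 1 ∈ Finset.Icc 1 (2 * m) := by rw [Finset.mem_Icc]; omega
  rw [hσ.etaVanishes_iff_fac hdiv hi (by omega)] at h h'
  obtain ⟨u, v, huv⟩ := exists_local_frame (hσ.frenet.subbundle _ h0) (hσ.defPlane h0) p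
  obtain ⟨a, b, hab⟩ := exists_local_frame (hσ.frenet.subbundle _ h1) (hσ.defPlane h1) p
  have hu : LocSec (L i) u p := ⟨huv.mono fun _ h => h.1, huv.mono fun _ h => h.2.2.mem_left⟩
  have ha : LocSec (L (i + 1)) a p := ⟨hab.mono fun _ h => h.1, hab.mono fun _ h => h.2.2.mem_left⟩
  have hb : LocSec (L (i + 1)) b p :=
    ⟨hab.mono fun _ h => h.2.1, hab.mono fun _ h => h.2.2.mem_right⟩
  have hcO : ∀ {μ : Plane → Mat (2 * m)}, LocSec (L (i + 1)) μ p → ∀ {ν : Plane → Mat (2 * m)},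
      LocSec (L i) ν p → ∀ c : Plane, (fun y => metric (connForm L (i + 1) i y c (ν y)) (μ y))
        =O[nhds p] fun x => ‖x - p‖ ^ k := by
    intro μ hμ ν hν c
    have := isBigO_metric (hσ.isBigO_connForm hdiv hi (by omega) h hν (contDiffAt_const (c := c)))
      (hμ.smooth.continuousAt.isBigO_one ℝ)
    simpa using this
  have hcurl : ∀ {μ : Plane → Mat (2 * m)}, LocSec (L (i + 1)) μ p →
      (fun x => fderiv ℝ (fun y => metric (fderiv ℝ u y (bas 1)) (μ y)) x (bas 0)
        - fderiv ℝ (fun y => metric (fderiv ℝ u y (bas 0)) (μ y)) x (bas 1))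
        =O[nhds p] fun x => ‖x - p‖ ^ k := by
    intro μ hμ
    have hds : ∀ c : Plane, ∀ᶠ y in nhds p, ContDiffAt ℝ ∞ (fun y => fderiv ℝ u y c) y := fun c =>
      hu.eventually_smooth.mono fun y hy => contDiffAt_fderiv_mat hy contDiffAt_const
    have hds' : ∀ c : Plane, ∀ᶠ y in nhds p, ContDiffAt ℝ ∞ (fun y => fderiv ℝ μ y c) y := fun c =>
      hμ.eventually_smooth.mono fun y hy => contDiffAt_fderiv_mat hy contDiffAt_const
    have hcO' : ∀ c d : Plane, (fun y => metric (connForm L (i + 1) i y c (u y))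
        (orthProj (L (i + 1) y) (fderiv ℝ μ y d))) =O[nhds p] fun x => ‖x - p‖ ^ k := fun c d =>
      hcO (hσ.locSec_proj h1 (hds' d)) hu c
    have hcO'' : ∀ c d : Plane, (fun y => metric (connForm L (i + 1) i y c
        (orthProj (L i y) (fderiv ℝ u y d))) (μ y)) =O[nhds p] fun x => ‖x - p‖ ^ k := fun c d =>
      hcO hμ (hσ.locSec_proj h0 (hds d)) c
    refine IsBigO.congr' (((hcO'' (bas 0) (bas 1)).neg_left.add (hcO' (bas 1) (bas 0))).sub
      ((hcO'' (bas 1) (bas 0)).neg_left.add (hcO' (bas 0) (bas 1)))) ?_ EventuallyEq.rfl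
    filter_upwards [hu.eventually, hμ.eventually] with y hy hy'
    exact (hσ.curl_connForm hi (by omega) hy hy' (bas 0) (bas 1)).symm
  have hcomp : ∀ {μ : Plane → Mat (2 * m)}, LocSec (L (i + 1)) μ p → ∀ c : Plane,
      ∀ᶠ y in nhds p, metric (fderiv ℝ u y c) (μ y)
        = metric (connForm L (i + 1) i y c (u y)) (μ y) := by
    intro μ hμ c
    filter_upwards [hu.eventually, hμ.mem] with y hy hy'
    exact hσ.metric_fderiv_eq h1 h0 (by omega) hy c hy'
  have hfs : ∀ {μ : Plane → Mat (2 * m)}, LocSec (L (i + 1)) μ p → ∀ c : Plane,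
      ∀ᶠ y in nhds p, ContDiffAt ℝ ∞ (fun y => metric (fderiv ℝ u y c) (μ y)) y := by
    intro μ hμ c
    filter_upwards [hu.eventually_smooth, hμ.eventually_smooth] with y hy hy'
    exact contDiffAt_metric (contDiffAt_fderiv_mat hy contDiffAt_const) hy'
  set φ : Fin 2 → Plane → ℂ := fun j y => (metric (fderiv ℝ u y (bas j)) (a y) : ℂ)
    + (metric (fderiv ℝ u y (bas j)) (b y) : ℂ) * Complex.I with hφ
  have hφs : ∀ j, ∀ᶠ y in nhds p, ContDiffAt ℝ ∞ (φ j) y := by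
    intro j
    filter_upwards [hfs ha (bas j), hfs hb (bas j)] with y hy hy'
    exact (Complex.ofRealCLM.contDiff.contDiffAt.comp y hy).add
      ((Complex.ofRealCLM.contDiff.contDiffAt.comp y hy').mul contDiffAt_const)
  have hφO : ∀ j, φ j =O[nhds p] fun x => ‖x - p‖ ^ k := by
    intro j
    refine isBigO_complex ((hcO ha hu (bas j)).congr' ?_ EventuallyEq.rfl)
      ((hcO hb hu (bas j)).congr' ?_ EventuallyEq.rfl)
    · exact (hcomp ha (bas j)).mono fun y hy => hy.symm
    · exact (hcomp hb (bas j)).mono fun y hy => hy.symm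
  have hφcurl : (fun x => fderiv ℝ (φ 1) x (bas 0) - fderiv ℝ (φ 0) x (bas 1))
      =O[nhds p] fun x => ‖x - p‖ ^ k := by
    refine (isBigO_complex (hcurl ha) (hcurl hb)).congr' ?_ EventuallyEq.rfl
    filter_upwards [hfs ha (bas 0), hfs hb (bas 0), hfs ha (bas 1), hfs hb (bas 1)] with y h2 h3 h4 h5
    rw [hφ]
    dsimp only
    rw [fderiv_complex (h4.differentiableAt (by simp)) (h5.differentiableAt (by simp)),
      fderiv_complex (h2.differentiableAt (by simp)) (h3.differentiableAt (by simp))]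
    push_cast
    ring
  obtain ⟨f₀, hf₀, he₀⟩ := exists_contDiff_eventuallyEq (hφs 0)
  obtain ⟨f₁, hf₁, he₁⟩ := exists_contDiff_eventuallyEq (hφs 1)
  have hm : 1 ≤ m := by omega
  have hX₁ := hσ.contDiff_frameOne hm
  have hX₂ := hσ.contDiff_frameTwo hm
  have hX := hσ.isTanFrame hm p
  have hcd : ∀ {X : Plane → Plane} (i : Fin 2), ContDiff ℝ ∞ X → ContDiff ℝ ∞ fun y => X y i :=
    fun i hX => (EuclideanSpace.proj (𝕜 := ℝ) i).contDiff.comp hX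
  have hO₀ := (hφO 0).congr' he₀.symm EventuallyEq.rfl
  have hO₁ := (hφO 1).congr' he₁.symm EventuallyEq.rfl
  have hc01 : (fun x => fderiv ℝ f₁ x (bas 0) - fderiv ℝ f₀ x (bas 1))
      =O[nhds p] fun x => ‖x - p‖ ^ k := by
    refine hφcurl.congr' ?_ EventuallyEq.rfl
    filter_upwards [he₀.eventuallyEq_nhds, he₁.eventuallyEq_nhds] with y h2 h3
    rw [h2.fderiv_eq, h3.fderiv_eq]
  have hW := isBigO_curl_frame hX₁ hX₂ hf₀ hf₁ hO₀ hO₁ hc01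
  have hval : ∀ X : Plane → Plane, ∀ᶠ y in nhds p, X y 0 • f₀ y + X y 1 • f₁ y
      = (metric (connForm L (i + 1) i y (X y) (u y)) (a y) : ℂ)
        + (metric (connForm L (i + 1) i y (X y) (u y)) (b y) : ℂ) * Complex.I := by
    intro X
    filter_upwards [he₀, he₁, hcomp ha (bas 0), hcomp ha (bas 1), hcomp hb (bas 0),
      hcomp hb (bas 1)] with y e0 e1 e2 e3 e4 e5
    rw [e0, e1, hφ]
    dsimp only
    rw [e2, e3, e4, e5]
    have e6 : connForm L (i + 1) i y (X y) (u y) = X y 0 • connForm L (i + 1) i y (bas 0) (u y)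
        + X y 1 • connForm L (i + 1) i y (bas 1) (u y) := by
      conv_lhs => rw [plane_eq (X y)]
      rw [hσ.connForm_add_dir h1, hσ.connForm_smul_dir h1, hσ.connForm_smul_dir h1]
    rw [e6]
    simp only [metric_add_left, metric_smul_left, Complex.real_smul]
    push_cast
    ring
  set A : Plane → ℂ := fun y => frameOne σ y 0 • f₀ y + frameOne σ y 1 • f₁ y with hA
  set B : Plane → ℂ := fun y => frameTwo σ y 0 • f₀ y + frameTwo σ y 1 • f₁ y with hB
  have hfr : ∀ᶠ y in nhds p, ∀ X Y : Plane,
      metric (connForm L (i + 1) i y X (u y)) (a y) * metric (connForm L (i + 1) i y Y (u y)) (a y)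
        + metric (connForm L (i + 1) i y X (u y)) (b y) * metric (connForm L (i + 1) i y Y (u y)) (b y)
      = eps (i + 1) * metric (connForm L (i + 1) i y X (u y)) (connForm L (i + 1) i y Y (u y)) := by
    filter_upwards [hab] with y hy X Y
    exact (hy.2.2.metric_eq (hσ.connForm_mem h1 _ y _ _) _).symm
  have hnorm : ∀ᶠ y in nhds p, ‖A y‖ ^ 2 = fac σ L i y := by
    filter_upwards [hval (frameOne σ), hfr, huv] with y h2 h3 h4
    have h5 := h3 (frameOne σ y) (frameOne σ y)
    rw [hσ.isConf_fac hdiv hi (by omega) y _ _ h4.2.2.mem_left, (hσ.isTanFrame hm y).left,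
      h4.2.2.left, eps_succ] at h5
    rw [hA]
    dsimp only
    rw [h2, ← Complex.normSq_eq_norm_sq, Complex.normSq_add_mul_I]
    linear_combination h5 + fac σ L i y * eps_mul_self i
  have hAB : ∀ᶠ y in nhds p, A y ^ 2 + B y ^ 2 = 0 := by
    filter_upwards [hval (frameOne σ), hval (frameTwo σ), hfr, huv] with y h2 h2' h3 h4
    have hfr := hσ.isTanFrame hm y
    have hc := hσ.isConf_fac hdiv hi (by omega) y
    have h5 := h3 (frameOne σ y) (frameOne σ y)
    have h6 := h3 (frameTwo σ y) (frameTwo σ y)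
    have h7 := h3 (frameOne σ y) (frameTwo σ y)
    have h8 := hσ.conf_polar hi (by omega) hc (frameOne σ y) (frameTwo σ y) h4.2.2.mem_left
      h4.2.2.mem_left
    rw [hfr.ortho, metric_comm (connForm L (i + 1) i y (frameTwo σ y) (u y))] at h8
    rw [show metric (connForm L (i + 1) i y (frameOne σ y) (u y))
      (connForm L (i + 1) i y (frameTwo σ y) (u y)) = 0 by linarith, mul_zero] at h7
    rw [hc _ _ h4.2.2.mem_left, hfr.left] at h5
    rw [hc _ _ h4.2.2.mem_left, hfr.right, ← h5] at h6
    rw [hA, hB]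
    dsimp only
    rw [h2, h2']
    generalize metric (connForm L (i + 1) i y (frameOne σ y) (u y)) (a y) = a1 at *
    generalize metric (connForm L (i + 1) i y (frameOne σ y) (u y)) (b y) = a2 at *
    generalize metric (connForm L (i + 1) i y (frameTwo σ y) (u y)) (a y) = b1 at *
    generalize metric (connForm L (i + 1) i y (frameTwo σ y) (u y)) (b y) = b2 at *
    have h9 : (a1 * a1 - a2 * a2 + b1 * b1 - b2 * b2) ^ 2 + (2 * (a1 * a2 + b1 * b2)) ^ 2 = 0 := by
      linear_combination (b1 * b1 + b2 * b2 - (a1 * a1 + a2 * a2)) * h6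
        + 4 * (a1 * b1 + a2 * b2) * h7
    have h10 : a1 * a1 - a2 * a2 + b1 * b1 - b2 * b2 = 0 := by
      nlinarith [sq_nonneg (a1 * a1 - a2 * a2 + b1 * b1 - b2 * b2),
        sq_nonneg (2 * (a1 * a2 + b1 * b2))]
    have h11 : a1 * a2 + b1 * b2 = 0 := by
      rw [h10] at h9
      nlinarith
    have h10' : (a1 * a1 - a2 * a2 + b1 * b1 - b2 * b2 : ℂ) = 0 := by exact_mod_cast h10
    have h11' : (a1 * a2 + b1 * b2 : ℂ) = 0 := by exact_mod_cast h11
    linear_combination h10' + 2 * Complex.I * h11'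
      + (a2 * a2 + b2 * b2 : ℂ) * Complex.I_sq
  have hAs : ContDiff ℝ ∞ A := ((hcd 0 hX₁).smul hf₀).add ((hcd 1 hX₁).smul hf₁)
  have hBs : ContDiff ℝ ∞ B := ((hcd 0 hX₂).smul hf₀).add ((hcd 1 hX₂).smul hf₁)
  have hAO : A =O[nhds p] fun x => ‖x - p‖ ^ k :=
    (isBigO_smul_of_continuousAt (hcd 0 hX₁).continuous.continuousAt hO₀).add
      (isBigO_smul_of_continuousAt (hcd 1 hX₁).continuous.continuousAt hO₁)
  have hBO : B =O[nhds p] fun x => ‖x - p‖ ^ k :=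
    (isBigO_smul_of_continuousAt (hcd 0 hX₂).continuous.continuousAt hO₀).add
      (isBigO_smul_of_continuousAt (hcd 1 hX₂).continuous.continuousAt hO₁)
  obtain ⟨ℓ, δ, hℓ1, hℓ2, hδ, hℓ⟩ := hX.exists_coord
  obtain ⟨r, hr, hlow⟩ := eventually_le_norm_of_conformal
    (fun x => ⟨_, _, hX.expand x⟩) ℓ hℓ1 hℓ2 hδ hℓ hAs hBs hAO hBO hAB hW (fun hcon => h' (by
      refine (hcon.norm_left.pow 2).congr' hnorm (Eventually.of_forall fun x => ?_)
      beta_reduce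
      rw [← pow_mul, mul_comm]))
  refine ⟨r ^ 2, by positivity, ?_⟩
  filter_upwards [hlow, hnorm] with x h2 h3
  rw [← h3, mul_comm 2 k, pow_mul, ← mul_pow]
  exact pow_le_pow_left₀ (by positivity) h2 2

/-- The behaviour of two consecutive conformal factors at a zero of the first one. -/
lemma fac_at_zero {i : ℕ} (hi : 1 ≤ i) (him : i + 1 ≤ m) {p : Plane} (hp : fac σ L i p = 0) :
    ∃ k : ℕ, ∃ a : ℝ, 0 < a ∧ (∀ᶠ x in nhds p, a * ‖x - p‖ ^ (2 * k) ≤ fac σ L i x) ∧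
      fac σ L (i + 1) =O[nhds p] fun x => ‖x - p‖ ^ (2 * k + 2) := by
  have h1 : i + 1 ∈ Finset.Icc 1 (2 * m) := by rw [Finset.mem_Icc]; omega
  have hv1 : EtaVanishes σ L (i + 1) p 1 := by
    rw [hσ.etaVanishes_one_iff hi (by omega)]
    intro X Y hY
    refine (hσ.defPlane h1 p).eq_zero (hσ.connForm_mem h1 i p X Y) ?_
    rw [hσ.isConf_fac hdiv hi (by omega) p X Y hY, hp]
    ring
  have hlt := hdiv (i + 1) (by rw [Finset.mem_Icc]; omega) p (fun h => by
    have := hv1.le_etaDivisor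
    rw [h] at this
    simp at this)
  obtain ⟨k, hk⟩ := ENat.ne_top_iff_exists.1 hlt.ne_top
  have hk1 : 1 ≤ k := by
    have := hv1.le_etaDivisor
    rw [← hk] at this
    exact_mod_cast this
  have hvk : EtaVanishes σ L (i + 1) p k := by
    have : ((k - 1 : ℕ) : ℕ∞) < etaDivisor σ L (i + 1) p := by
      rw [← hk]
      exact_mod_cast (by omega : k - 1 < k)
    have h2 := etaVanishes_of_lt this
    rwa [Nat.sub_add_cancel hk1] at h2
  have hvk' : ¬ EtaVanishes σ L (i + 1) p (k + 1) := fun h => by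
    have := h.le_etaDivisor
    rw [← hk] at this
    have h2 : k + 1 ≤ k := by exact_mod_cast this
    omega
  obtain ⟨a, ha, hlow⟩ := hσ.fac_lower_of_order hdiv hi him hvk hvk'
  rw [← hk] at hlt
  have h3 := (hσ.etaVanishes_iff_fac hdiv (i := i + 1) (by omega) (by omega) p (k + 1)).1
    (etaVanishes_of_lt hlt)
  exact ⟨k, a, ha, hlow, h3⟩

end IsIsotropicPAlternating
end ParaHyp
end

noncomputable section
namespace ParaHyp

open Asymptotics Filter

/-! ### Quotients of consecutive conformal factors -/

/-- The conformal factors, with the convention that the one of index `0` is `1 / 2`. -/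
def fac₀ {n : ℕ} (σ : Plane → Mat n) (L : ℕ → Plane → Submodule ℝ (Mat n)) (i : ℕ) (x : Plane) : ℝ :=
  if i = 0 then 1 / 2 else fac σ L i x

/-- The quotient of two consecutive conformal factors. -/
def ratio {n : ℕ} (σ : Plane → Mat n) (L : ℕ → Plane → Submodule ℝ (Mat n)) (i : ℕ) (x : Plane) :
    ℝ := fac₀ σ L i x / fac₀ σ L (i - 1) x

/-! ### Conjugation -/

section Conj

variable {n : ℕ} {A B : Mat n} (hAB : A * B = 1) (hBA : B * A = 1)

/-- Conjugation of matrices. -/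
def conj (A B : Mat n) : Mat n →ₗ[ℝ] Mat n where
  toFun Z := A * Z * B
  map_add' X Y := by rw [mul_add, add_mul]
  map_smul' c X := by simp

lemma conj_apply (A B Z : Mat n) : conj A B Z = A * Z * B := rfl

include hBA in
lemma conj_mul (X Y : Mat n) : conj A B (X * Y) = conj A B X * conj A B Y := by
  simp only [conj_apply]
  calc A * (X * Y) * B = A * X * 1 * Y * B := by rw [mul_one]; simp only [mul_assoc]
    _ = A * X * B * (A * Y * B) := by rw [← hBA]; simp only [mul_assoc]

include hAB in
lemma conj_one : conj A B 1 = 1 := by rw [conj_apply, mul_one, hAB]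

include hBA in
lemma metric_conj (X Y : Mat n) : metric (conj A B X) (conj A B Y) = metric X Y := by
  rw [metric, ← conj_mul hBA, conj_apply, Matrix.trace_mul_comm, ← mul_assoc, hBA, one_mul, metric]

include hBA in
lemma conj_injective : Function.Injective (conj A B) := by
  rw [injective_iff_map_eq_zero]
  intro X hX
  refine metric_nondegenerate fun Y => ?_
  rw [← metric_conj hBA, hX, metric_zero_left]

include hAB hBA in
lemma tanProj_conj (M X : Mat n) : tanProj (conj A B M) (conj A B X) = conj A B (tanProj M X) := by
  simp only [tanProj, map_add, conj_mul hBA, map_sub, conj_one hAB]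

include hBA in
lemma paraCx_conj (M X : Mat n) : paraCx (conj A B M) (conj A B X) = conj A B (paraCx M X) := by
  simp only [paraCx_apply, map_sub, conj_mul hBA]

lemma fderiv_conj {ν : Plane → Mat n} {x : Plane} (hν : DifferentiableAt ℝ ν x) (v : Plane) :
    fderiv ℝ (fun y => conj A B (ν y)) x v = conj A B (fderiv ℝ ν x v) := by
  have h1 : DifferentiableAt ℝ (fun _ : Plane => A) x := differentiableAt_const _
  have h2 : DifferentiableAt ℝ (fun _ : Plane => B) x := differentiableAt_const _
  simp only [conj_apply]
  rw [fderiv_mul_mat (differentiableAt_mul_mat h1 hν) h2, fderiv_mul_mat h1 hν, fderiv_const_mat,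
    fderiv_const_mat, zero_mul, mul_zero, zero_add, add_zero]

lemma fderiv_comp_mat {ν : Plane → Mat n} {φ : Plane → Plane} {x : Plane}
    (hν : DifferentiableAt ℝ ν (φ x)) (hφ : DifferentiableAt ℝ φ x) (v : Plane) :
    fderiv ℝ (fun y => ν (φ y)) x v = fderiv ℝ ν (φ x) (fderiv ℝ φ x v) :=
  congrArg (fun ψ : Plane →L[ℝ] Mat n => ψ v) (hν.hasFDerivAt.comp x hφ.hasFDerivAt).fderiv

end Conj

namespace IsIsotropicPAlternating

variable {m : ℕ} {σ : Plane → Mat (2 * m)} {L : ℕ → Plane → Submodule ℝ (Mat (2 * m))}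
  (hσ : IsIsotropicPAlternating σ L) (hdiv : DivisorCondition σ L)
include hσ hdiv

lemma fac₀_nonneg {i : ℕ} (him : i + 1 ≤ 2 * m) (x : Plane) : 0 ≤ fac₀ σ L i x := by
  rw [fac₀]
  split_ifs with h
  · norm_num
  · exact hσ.fac_nonneg hdiv (by omega) him x

lemma contDiff_fac₀ {i : ℕ} (him : i + 1 ≤ 2 * m) : ContDiff ℝ ∞ (fac₀ σ L i) := by
  rcases Nat.eq_zero_or_pos i with rfl | h
  · exact contDiff_const
  · have : fac₀ σ L i = fac σ L i := by funext x; exact if_neg h.ne'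
    rw [this]
    exact hσ.contDiff_fac hdiv h him

lemma fac₀_at_zero {i : ℕ} (him : i + 1 ≤ m) {p : Plane} (hp : fac₀ σ L i p = 0) :
    ∃ k : ℕ, ∃ a : ℝ, 0 < a ∧ (∀ᶠ x in nhds p, a * ‖x - p‖ ^ (2 * k) ≤ fac₀ σ L i x) ∧
      fac₀ σ L (i + 1) =O[nhds p] fun x => ‖x - p‖ ^ (2 * k + 2) := by
  rcases Nat.eq_zero_or_pos i with rfl | h
  · norm_num [fac₀] at hp
  · have h1 : fac₀ σ L i = fac σ L i := by funext x; exact if_neg h.ne'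
    have h2 : fac₀ σ L (i + 1) = fac σ L (i + 1) := by funext x; exact if_neg (by omega)
    rw [h1] at hp ⊢
    rw [h2]
    exact hσ.fac_at_zero hdiv h him hp

lemma fac₀_succ_eq_zero {i : ℕ} (him : i + 1 ≤ m) {p : Plane} (hp : fac₀ σ L i p = 0) :
    fac₀ σ L (i + 1) p = 0 := by
  obtain ⟨k, a, -, -, hO⟩ := hσ.fac₀_at_zero hdiv him hp
  exact hO.eq_zero_of_norm_pow (by omega)

lemma continuous_ratio {i : ℕ} (hi : 1 ≤ i) (him : i ≤ m) : Continuous (ratio σ L i) := by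
  obtain ⟨i, rfl⟩ := Nat.exists_eq_succ_of_ne_zero (by omega : i ≠ 0)
  rw [continuous_iff_continuousAt]
  intro p
  have hr : ratio σ L (i + 1) = fun x => fac₀ σ L (i + 1) x / fac₀ σ L i x := rfl
  rw [Nat.succ_eq_add_one, hr]
  by_cases hp : fac₀ σ L i p = 0
  · obtain ⟨k, a, ha, hlow, hO⟩ := hσ.fac₀_at_zero hdiv him hp
    obtain ⟨C, hC⟩ := hO.bound
    rw [ContinuousAt, hp, div_zero]
    refine squeeze_zero_norm' (a := fun x => |C| / a * ‖x - p‖ ^ 2) ?_ ?_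
    · filter_upwards [hlow, hC] with x h1 h2
      rcases eq_or_ne x p with rfl | hx
      · rw [hp]; simp
      · have hx' : 0 < ‖x - p‖ := norm_pos_iff.2 (sub_ne_zero.2 hx)
        have h3 : 0 < a * ‖x - p‖ ^ (2 * k) := by positivity
        have h4 := h3.trans_le h1
        rw [norm_div, Real.norm_of_nonneg h4.le, div_le_iff₀ h4]
        refine h2.trans ?_
        rw [norm_pow, norm_norm]
        calc C * ‖x - p‖ ^ (2 * k + 2) ≤ |C| * ‖x - p‖ ^ (2 * k + 2) :=
              mul_le_mul_of_nonneg_right (le_abs_self C) (by positivity)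
          _ = |C| / a * ‖x - p‖ ^ 2 * (a * ‖x - p‖ ^ (2 * k)) := by
              rw [pow_add]; field_simp
          _ ≤ _ := mul_le_mul_of_nonneg_left h1 (by positivity)
    · have : Continuous fun x : Plane => |C| / a * ‖x - p‖ ^ 2 := by fun_prop
      have h2 := this.tendsto p
      simpa using h2
  · exact (hσ.contDiff_fac₀ hdiv (by omega)).continuous.continuousAt.div
      (hσ.contDiff_fac₀ hdiv (by omega)).continuous.continuousAt hp

lemma dense_fac_ne_zero {i : ℕ} (hi : 1 ≤ i) (him : i + 1 ≤ m) : Dense {x | fac σ L i x ≠ 0} := by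
  intro p
  by_cases hp : fac σ L i p = 0
  · obtain ⟨k, a, ha, hlow, -⟩ := hσ.fac_at_zero hdiv hi him hp
    rw [mem_closure_iff_frequently]
    have h1 : ∀ᶠ x in nhdsWithin p {p}ᶜ, fac σ L i x ≠ 0 := by
      filter_upwards [nhdsWithin_le_nhds hlow, self_mem_nhdsWithin] with x h1 hx
      have hx' : 0 < ‖x - p‖ := norm_pos_iff.2 (sub_ne_zero.2 hx)
      exact (lt_of_lt_of_le (by positivity) h1).ne'
    exact h1.frequently.filter_mono nhdsWithin_le_nhds
  · exact subset_closure hp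

section Equivariance

variable {A B : Mat (2 * m)} (hAB : A * B = 1) (hBA : B * A = 1) {φ : Plane → Plane}
  (hφ : ContDiff ℝ ∞ φ) (hφσ : ∀ x, σ (φ x) = conj A B (σ x))

omit hdiv in
include hBA in
lemma map_conj_eq {i : ℕ} (hi : i ∈ Finset.Icc 1 (2 * m)) {x : Plane}
    (h : ∀ Y ∈ L i x, conj A B Y ∈ L i (φ x)) : (L i x).map (conj A B) = L i (φ x) := by
  have : FiniteDimensional ℝ (L i (φ x)) :=
    FiniteDimensional.of_finrank_pos (by rw [(hσ.defPlane hi (φ x)).finrank_eq]; norm_num)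
  refine Submodule.eq_of_le_of_finrank_eq ?_ ?_
  · rintro _ ⟨Y, hY, rfl⟩
    exact h Y hY
  · exact (Submodule.equivMapOfInjective _ (conj_injective hBA) _).finrank_eq.symm.trans
      ((hσ.defPlane hi x).finrank_eq.trans (hσ.defPlane hi (φ x)).finrank_eq.symm)

omit hdiv in
include hBA in
lemma orthProj_conj {i : ℕ} (hi : i ∈ Finset.Icc 1 (2 * m)) {x : Plane}
    (h : ∀ Y ∈ L i x, conj A B Y ∈ L i (φ x)) (Z : Mat (2 * m)) :
    orthProj (L i (φ x)) (conj A B Z) = conj A B (orthProj (L i x) Z) := by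
  refine orthProj_unique (hσ.defPlane hi (φ x)) (h _ (orthProj_mem (hσ.defPlane hi x) Z)) ?_
  intro Y hY
  rw [← hσ.map_conj_eq hBA hi h] at hY
  obtain ⟨W, hW, rfl⟩ := hY
  rw [← map_sub, metric_conj hBA, metric_sub_left,
    metric_orthProj_left (hσ.defPlane hi x) Z hW, sub_self]

omit hdiv in
include hBA hφ in
lemma fderiv_proj_conj {j : ℕ} (hj : j ∈ Finset.Icc 1 (2 * m))
    (h : ∀ x, ∀ Y ∈ L j x, conj A B Y ∈ L j (φ x)) (x v : Plane) (Y : Mat (2 * m)) :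
    fderiv ℝ (fun y => orthProj (L j y) (conj A B Y)) (φ x) (fderiv ℝ φ x v)
      = conj A B (fderiv ℝ (fun y => orthProj (L j y) Y) x v) := by
  rw [← fderiv_comp_mat ((hσ.isSection_const hj _).locSec _).diff
    (hφ.differentiable (by simp) x), ← fderiv_conj ((hσ.isSection_const hj _).locSec _).diff]
  refine fderiv_congr_mat (Eventually.of_forall fun y => ?_) v
  exact hσ.orthProj_conj hBA hj (h y) Y

omit hdiv in
include hBA hφ in
lemma connForm_conj {i j : ℕ} (hi : i ∈ Finset.Icc 1 (2 * m)) (hj : j ∈ Finset.Icc 1 (2 * m))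
    (h : ∀ x, ∀ Y ∈ L i x, conj A B Y ∈ L i (φ x)) (h' : ∀ x, ∀ Y ∈ L j x, conj A B Y ∈ L j (φ x))
    (x v : Plane) (Y : Mat (2 * m)) :
    connForm L i j (φ x) (fderiv ℝ φ x v) (conj A B Y) = conj A B (connForm L i j x v Y) := by
  rw [connForm, hσ.fderiv_proj_conj hBA hφ hj h', hσ.orthProj_conj hBA hi (h x), connForm]

omit hdiv in
include hφ hφσ in
lemma fderiv_equivariant (x v : Plane) :
    fderiv ℝ σ (φ x) (fderiv ℝ φ x v) = conj A B (fderiv ℝ σ x v) := by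
  rw [← fderiv_comp_mat (hσ.diff _) (hφ.differentiable (by simp) x), ← fderiv_conj (hσ.diff x)]
  exact fderiv_congr_mat (Eventually.of_forall hφσ) v

include hAB hBA hφ hφσ in
lemma conj_mem {i : ℕ} (hi : 1 ≤ i) (him : i ≤ m) :
    ∀ x, ∀ Y ∈ L i x, conj A B Y ∈ L i (φ x) := by
  induction i using Nat.strong_induction_on with
  | _ i ih =>
  obtain ⟨j, rfl⟩ := Nat.exists_eq_succ_of_ne_zero (by omega : i ≠ 0)
  rcases Nat.eq_zero_or_pos j with rfl | hj
  · intro x Y hY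
    obtain ⟨X, rfl⟩ := hσ.exists_fderiv hY
    have h1 := hσ.fderiv_mem (φ x) (fderiv ℝ φ x X)
    rwa [hσ.fderiv_equivariant hφ hφσ] at h1
  · have h0 : j ∈ Finset.Icc 1 (2 * m) := by rw [Finset.mem_Icc]; omega
    have h1 : j + 1 ∈ Finset.Icc 1 (2 * m) := by rw [Finset.mem_Icc]; omega
    have hd : ∀ x, fac σ L j x ≠ 0 → ∀ Z ∈ L (j + 1) x, conj A B Z ∈ L (j + 1) (φ x) := by
      intro x hx Z hZ
      have hc := hσ.isConf_fac hdiv hj (by omega) x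
      obtain ⟨X₁, X₂, hX⟩ := hσ.exists_tanFrame (by omega) x
      obtain ⟨u, v, huv⟩ := exists_frame (hσ.defPlane h0 x)
      have key : ∀ Y ∈ L j x, conj A B (connForm L (j + 1) j x X₁ Y) ∈ L (j + 1) (φ x) := by
        intro Y hY
        have hsY := hσ.isSection_const h0 Y
        have hsY' := hσ.isSection_const h0 (conj A B Y)
        have hder := hσ.fderiv_proj_conj hBA hφ h0 (ih j (by omega) hj (by omega)) x X₁ Y
        set W := fderiv ℝ (fun y => orthProj (L j y) Y) x X₁
        have hsum := tanProj_conj hAB hBA (σ x) W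
        rw [← hφσ, hσ.tanProj_eq_sum, hσ.tanProj_eq_sum, map_sum] at hsum
        have hoth : ∀ k ∈ Finset.Icc 1 (2 * m), k ≠ j + 1 →
            orthProj (L k (φ x)) (conj A B W) = conj A B (orthProj (L k x) W) := by
          intro k hk hkj
          by_cases hk2 : k ≤ j
          · refine hσ.orthProj_conj hBA hk (ih k (by omega) ?_ (by omega) x) W
            exact (Finset.mem_Icc.1 hk).1
          · rw [← hder, hσ.orthProj_fderiv hk h0 (by omega) (hsY'.locSec _),
              hσ.orthProj_fderiv hk h0 (by omega) (hsY.locSec _),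
              hσ.connForm_eq_zero hk h0 (by omega), hσ.connForm_eq_zero hk h0 (by omega), map_zero]
        rw [← Finset.add_sum_erase _ _ h1, ← Finset.add_sum_erase _ _ h1,
          Finset.sum_congr rfl fun k hk => hoth k (Finset.mem_of_mem_erase hk)
            (Finset.ne_of_mem_erase hk)] at hsum
        have h2 := add_right_cancel hsum
        change conj A B (orthProj (L (j + 1) x) W) ∈ _
        rw [← h2]
        exact orthProj_mem (hσ.defPlane h1 (φ x)) _
      have hk : 0 < fac σ L j x * metric (fderiv ℝ σ x X₁) (fderiv ℝ σ x X₁) := by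
        rw [hX.left, mul_one]
        exact lt_of_le_of_ne (hσ.fac_nonneg hdiv hj (by omega) x) hx.symm
      rw [(hσ.frame_image hj (by omega) hc hk huv).expand Z hZ]
      rw [map_add, map_smul, map_smul, map_smul, map_smul]
      exact Submodule.add_mem _ (Submodule.smul_mem _ _ (Submodule.smul_mem _ _ (key u huv.mem_left)))
        (Submodule.smul_mem _ _ (Submodule.smul_mem _ _ (key v huv.mem_right)))
    intro x Y hY
    have hcont : Continuous fun x => conj A B (orthProj (L (j + 1) x) Y) :=
      (continuous_const.mul (hσ.isSection_const h1 Y).1.continuous).mul continuous_const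
    have hext := Continuous.ext_on (hσ.dense_fac_ne_zero hdiv hj (by omega)) hcont
      (g := fun x => orthProj (L (j + 1) (φ x)) (conj A B (orthProj (L (j + 1) x) Y)))
      (continuous_iff_continuousAt.2 fun x => ?_) (fun x hx => ?_)
    · have h2 := congrFun hext x
      simp only [orthProj_of_mem (hσ.defPlane h1 x) hY] at h2
      rw [Nat.succ_eq_add_one, h2]
      exact orthProj_mem (hσ.defPlane h1 (φ x)) _
    · obtain ⟨a, b, hab⟩ := exists_local_frame (hσ.frenet.subbundle _ h1) (hσ.defPlane h1) (φ x)
      have ha := hab.self_of_nhds.1.continuousAt.comp hφ.continuous.continuousAt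
      have hb := hab.self_of_nhds.2.1.continuousAt.comp hφ.continuous.continuousAt
      have hY' := hcont.continuousAt (x := x)
      have hmc : ∀ {c : Plane → Mat (2 * m)}, ContinuousAt c x → ContinuousAt
          (fun x => metric (conj A B (orthProj (L (j + 1) x) Y)) (c x)) x := by
        intro c hc
        exact continuousAt_const.mul
          ((traceL _).continuous.continuousAt.comp (hY'.mul hc))
      refine ContinuousAt.congr (((continuousAt_const (y := eps (j + 1))).mul (hmc ha)).smul ha |>.add
        (((continuousAt_const (y := eps (j + 1))).mul (hmc hb)).smul hb)) ?_
      filter_upwards [hφ.continuous.continuousAt.eventually hab] with y hy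
      exact (hy.2.2.orthProj_eq (hσ.defPlane h1 _) _).symm
    · exact (orthProj_of_mem (hσ.defPlane h1 _)
        (hd x hx _ (orthProj_mem (hσ.defPlane h1 x) Y))).symm

include hAB hBA hφ hφσ in
lemma conj_mem' {i : ℕ} (hi : 1 ≤ i) (him : i ≤ m + 1) (hm : 1 ≤ m) :
    ∀ x, ∀ Y ∈ L i x, conj A B Y ∈ L i (φ x) := by
  rcases him.lt_or_eq with h | rfl
  · exact hσ.conj_mem hdiv hAB hBA hφ hφσ hi (by omega)
  · intro x Y hY
    have h1 : m + 1 ∈ Finset.Icc 1 (2 * m) := by rw [Finset.mem_Icc]; omega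
    have h2 : m ∈ Finset.Icc 1 (2 * m) := by rw [Finset.mem_Icc]; omega
    have h3 := hσ.paraCx_mem h1 hY
    rw [show 2 * m + 1 - (m + 1) = m by omega] at h3
    have h4 := hσ.paraCx_mem h2 (hσ.conj_mem hdiv hAB hBA hφ hφσ hm le_rfl x _ h3)
    rwa [show 2 * m + 1 - m = m + 1 by omega, hφσ, paraCx_conj hBA,
      paraCx_paraCx (hσ.idem x) (hσ.le_tangent h1 x hY)] at h4

include hAB hBA hφ hφσ in
lemma fac_equivariant {i : ℕ} (hi : 1 ≤ i) (him : i ≤ m) (x : Plane) :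
    fac σ L i (φ x) = fac σ L i x := by
  have h0 : i ∈ Finset.Icc 1 (2 * m) := by rw [Finset.mem_Icc]; omega
  have h1 : i + 1 ∈ Finset.Icc 1 (2 * m) := by rw [Finset.mem_Icc]; omega
  have hm : 1 ≤ m := by omega
  have e0 := hσ.conj_mem' hdiv hAB hBA hφ hφσ hi (by omega) hm
  have e1 := hσ.conj_mem' hdiv hAB hBA hφ hφσ (i := i + 1) (by omega) (by omega) hm
  obtain ⟨u, v, huv⟩ := exists_frame (hσ.defPlane h0 x)
  have hpos := hσ.metric_fderiv_pos hm x (bas_ne_zero 0)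
  have hX : fderiv ℝ φ x (bas 0) ≠ 0 := fun h => by
    have := hσ.fderiv_equivariant hφ hφσ x (bas 0)
    rw [h, map_zero] at this
    rw [← metric_conj hBA, ← this, metric_zero_left] at hpos
    exact lt_irrefl _ hpos
  have hu0 : conj A B u ≠ 0 := fun h => huv.left_ne_zero (conj_injective hBA (h.trans (map_zero _).symm))
  rw [hσ.fac_eq hdiv hi (by omega) (φ x) hX (e0 x u huv.mem_left) hu0,
    hσ.fac_eq hdiv hi (by omega) x (bas_ne_zero 0) huv.mem_left huv.left_ne_zero,
    hσ.connForm_conj hBA hφ h1 h0 e1 e0, hσ.fderiv_equivariant hφ hφσ, metric_conj hBA,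
    metric_conj hBA, metric_conj hBA]

include hAB hBA hφ hφσ in
lemma ratio_equivariant {i : ℕ} (him : i ≤ m) (x : Plane) :
    ratio σ L i (φ x) = ratio σ L i x := by
  have : ∀ j, j ≤ m → fac₀ σ L j (φ x) = fac₀ σ L j x := by
    intro j hj
    rw [fac₀, fac₀]
    split_ifs with h
    · rfl
    · exact hσ.fac_equivariant hdiv hAB hBA hφ hφσ (by omega) hj x
  rw [ratio, ratio, this i him, this (i - 1) (by omega)]

end Equivariance

end IsIsotropicPAlternating

/-- A continuous function on the universal covering of a closed surface which is invariant under the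
deck transformations has a maximum. -/
lemma exists_max_of_invariant {Γ : Type*} [Group Γ] [MulAction Γ Plane]
    (hc : CompactSpace (MulAction.orbitRel.Quotient Γ Plane)) {f : Plane → ℝ} (hf : Continuous f)
    (hinv : ∀ (γ : Γ) x, f (γ • x) = f x) : ∃ p, ∀ x, f x ≤ f p := by
  let g : MulAction.orbitRel.Quotient Γ Plane → ℝ := Quotient.lift f (by
    rintro a b ⟨γ, rfl⟩
    exact hinv γ b)
  have hg : Continuous g := hf.quotient_lift _
  obtain ⟨q, -, hq⟩ := isCompact_univ.exists_isMaxOn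
    (⟨Quotient.mk'' (0 : Plane), trivial⟩ : (Set.univ : Set (MulAction.orbitRel.Quotient Γ Plane)).Nonempty)
    hg.continuousOn
  induction q using Quotient.inductionOn' with
  | h p => exact ⟨p, fun x => hq (Set.mem_univ (Quotient.mk'' x))⟩

end ParaHyp
end

noncomputable section
namespace ParaHyp

open Filter

/-! ### Adapted frames -/

/-- The first vector of the adapted frame of `ℒ_j`. -/
def adU {n : ℕ} (σ : Plane → Mat n) (L : ℕ → Plane → Submodule ℝ (Mat n)) : ℕ → Plane → Mat n
  | 0 => fun _ => 0
  | 1 => fun x => fderiv ℝ σ x (frameOne σ x)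
  | j + 2 => fun x => (√(fac σ L (j + 1) x))⁻¹ •
      connForm L (j + 2) (j + 1) x (frameOne σ x) (adU σ L (j + 1) x)

/-- The second vector of the adapted frame of `ℒ_j`. -/
def adV {n : ℕ} (σ : Plane → Mat n) (L : ℕ → Plane → Submodule ℝ (Mat n)) : ℕ → Plane → Mat n
  | 0 => fun _ => 0
  | 1 => fun x => fderiv ℝ σ x (frameTwo σ x)
  | j + 2 => fun x => (√(fac σ L (j + 1) x))⁻¹ •
      connForm L (j + 2) (j + 1) x (frameOne σ x) (adV σ L (j + 1) x)

/-- The dual forms of the tangent frame. -/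
def thetaOne {n : ℕ} (σ : Plane → Mat n) (x v : Plane) : ℝ :=
  metric (fderiv ℝ σ x v) (fderiv ℝ σ x (frameOne σ x))

/-- The dual forms of the tangent frame. -/
def thetaTwo {n : ℕ} (σ : Plane → Mat n) (x v : Plane) : ℝ :=
  metric (fderiv ℝ σ x v) (fderiv ℝ σ x (frameTwo σ x))

/-- The area form. -/
def areaForm {n : ℕ} (σ : Plane → Mat n) (x a b : Plane) : ℝ :=
  thetaOne σ x a * thetaTwo σ x b - thetaTwo σ x a * thetaOne σ x b

/-- The connection form of the adapted frame of `ℒ_j`. -/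
def alpha {n : ℕ} (σ : Plane → Mat n) (L : ℕ → Plane → Submodule ℝ (Mat n)) (j : ℕ)
    (x v : Plane) : ℝ :=
  eps j * metric (fderiv ℝ (adU σ L j) x v) (adV σ L j x)

/-- The exterior derivative of a form. -/
def extDeriv (α : Plane → Plane → ℝ) (x a b : Plane) : ℝ :=
  fderiv ℝ (fun y => α y b) x a - fderiv ℝ (fun y => α y a) x b

/-- The first `j - 1` of the forms `η` do not vanish. -/
def NonDeg {n : ℕ} (σ : Plane → Mat n) (L : ℕ → Plane → Submodule ℝ (Mat n)) (j : ℕ) (x : Plane) :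
    Prop := ∀ i, 1 ≤ i → i < j → fac σ L i x ≠ 0

lemma NonDeg.mono {n : ℕ} {σ : Plane → Mat n} {L : ℕ → Plane → Submodule ℝ (Mat n)} {j k : ℕ}
    {x : Plane} (h : NonDeg σ L j x) (hk : k ≤ j) : NonDeg σ L k x :=
  fun i hi hik => h i hi (by omega)

lemma adU_succ {n : ℕ} {σ : Plane → Mat n} {L : ℕ → Plane → Submodule ℝ (Mat n)} {j : ℕ}
    (hj : 1 ≤ j) (x : Plane) : adU σ L (j + 1) x = (√(fac σ L j x))⁻¹ •
      connForm L (j + 1) j x (frameOne σ x) (adU σ L j x) := by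
  obtain ⟨j, rfl⟩ := Nat.exists_eq_succ_of_ne_zero (by omega : j ≠ 0)
  rfl

lemma adV_succ {n : ℕ} {σ : Plane → Mat n} {L : ℕ → Plane → Submodule ℝ (Mat n)} {j : ℕ}
    (hj : 1 ≤ j) (x : Plane) : adV σ L (j + 1) x = (√(fac σ L j x))⁻¹ •
      connForm L (j + 1) j x (frameOne σ x) (adV σ L j x) := by
  obtain ⟨j, rfl⟩ := Nat.exists_eq_succ_of_ne_zero (by omega : j ≠ 0)
  rfl

namespace IsIsotropicPAlternating

variable {m : ℕ} {σ : Plane → Mat (2 * m)} {L : ℕ → Plane → Submodule ℝ (Mat (2 * m))}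
  (hσ : IsIsotropicPAlternating σ L)
include hσ

lemma theta_frameOne (hm : 1 ≤ m) (x : Plane) :
    thetaOne σ x (frameOne σ x) = 1 ∧ thetaTwo σ x (frameOne σ x) = 0 :=
  ⟨(hσ.isTanFrame hm x).left, (hσ.isTanFrame hm x).ortho⟩

lemma theta_frameTwo (hm : 1 ≤ m) (x : Plane) :
    thetaOne σ x (frameTwo σ x) = 0 ∧ thetaTwo σ x (frameTwo σ x) = 1 :=
  ⟨(metric_comm _ _).trans (hσ.isTanFrame hm x).ortho, (hσ.isTanFrame hm x).right⟩

lemma contDiff_theta (hm : 1 ≤ m) (v : Plane) :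
    ContDiff ℝ ∞ (fun x => thetaOne σ x v) ∧ ContDiff ℝ ∞ (fun x => thetaTwo σ x v) := by
  constructor <;> refine contDiff_iff_contDiffAt.2 fun x =>
    contDiffAt_metric (hσ.locSec_fderiv x v).smooth
      (contDiffAt_fderiv_mat hσ.smooth.contDiffAt ?_)
  · exact (hσ.contDiff_frameOne hm).contDiffAt
  · exact (hσ.contDiff_frameTwo hm).contDiffAt

lemma connForm_expand {i j : ℕ} (hi : i ∈ Finset.Icc 1 (2 * m)) (x v : Plane) (Y : Mat (2 * m)) :
    connForm L i j x v Y = thetaOne σ x v • connForm L i j x (frameOne σ x) Y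
      + thetaTwo σ x v • connForm L i j x (frameTwo σ x) Y := by
  have hm : 1 ≤ m := by rw [Finset.mem_Icc] at hi; omega
  conv_lhs => rw [(hσ.isTanFrame hm x).expand v]
  rw [hσ.connForm_add_dir hi, hσ.connForm_smul_dir hi, hσ.connForm_smul_dir hi]
  rfl

variable (hdiv : DivisorCondition σ L)
include hdiv

lemma ad_frame {j : ℕ} (hj : 1 ≤ j) (hjm : j ≤ m + 1) {x : Plane} (hm : 1 ≤ m)
    (h : NonDeg σ L j x) : IsFrame (L j x) (eps j) (adU σ L j x) (adV σ L j x) := by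
  induction j, hj using Nat.le_induction with
  | base =>
    have hX := hσ.isTanFrame hm x
    have he : eps 1 = 1 := eps_of_odd odd_one
    refine isFrame_of_ortho (hσ.defPlane (one_mem_Icc hm) x) (hσ.fderiv_mem x _)
      (hσ.fderiv_mem x _) ?_ ?_ hX.ortho
    · rw [he]; exact hX.left
    · rw [he]; exact hX.right
  | succ j hj ih =>
    have hX := hσ.isTanFrame hm x
    have hc := hσ.isConf_fac hdiv hj (by omega) x
    have hpos : 0 < fac σ L j x * metric (fderiv ℝ σ x (frameOne σ x))
        (fderiv ℝ σ x (frameOne σ x)) := by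
      rw [hX.left, mul_one]
      exact lt_of_le_of_ne (hσ.fac_nonneg hdiv hj (by omega) x) (h j hj (by omega)).symm
    have := hσ.frame_image hj (by omega) hc hpos (ih (by omega) (h.mono (by omega)))
    rw [hX.left, mul_one] at this
    rw [adU_succ hj, adV_succ hj]
    exact this

lemma nonDeg_eventually {j : ℕ} (hjm : j ≤ 2 * m) {p : Plane} (h : NonDeg σ L j p) :
    ∀ᶠ x in nhds p, NonDeg σ L j x := by
  have h1 : ∀ i ∈ Finset.Ico 1 j, ∀ᶠ x in nhds p, fac σ L i x ≠ 0 := by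
    intro i hi
    rw [Finset.mem_Ico] at hi
    exact (hσ.contDiff_fac hdiv hi.1 (by omega)).continuous.continuousAt.eventually_ne
      (h i hi.1 hi.2)
  filter_upwards [(Filter.eventually_all_finset _).2 h1] with x hx i hi hij
  exact hx i (Finset.mem_Ico.2 ⟨hi, hij⟩)

lemma ad_locSec {j : ℕ} (hj : 1 ≤ j) (hjm : j ≤ m + 1) {p : Plane} (hm : 1 ≤ m)
    (h : NonDeg σ L j p) : LocSec (L j) (adU σ L j) p ∧ LocSec (L j) (adV σ L j) p := by
  have hmem : ∀ᶠ x in nhds p, adU σ L j x ∈ L j x ∧ adV σ L j x ∈ L j x := by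
    filter_upwards [hσ.nonDeg_eventually hdiv (by omega) h] with x hx
    have := hσ.ad_frame hdiv hj hjm hm hx
    exact ⟨this.mem_left, this.mem_right⟩
  suffices hs : ∀ x, NonDeg σ L j x → ContDiffAt ℝ ∞ (adU σ L j) x ∧ ContDiffAt ℝ ∞ (adV σ L j) x by
    have h2 := (hσ.nonDeg_eventually hdiv (by omega) h).mono hs
    exact ⟨⟨h2.mono fun _ h => h.1, hmem.mono fun _ h => h.1⟩,
      ⟨h2.mono fun _ h => h.2, hmem.mono fun _ h => h.2⟩⟩
  clear hmem h
  induction j, hj using Nat.le_induction with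
  | base =>
    intro x _
    exact ⟨contDiffAt_fderiv_mat hσ.smooth.contDiffAt (hσ.contDiff_frameOne hm).contDiffAt,
      contDiffAt_fderiv_mat hσ.smooth.contDiffAt (hσ.contDiff_frameTwo hm).contDiffAt⟩
  | succ j hj ih =>
    intro x hx
    have h0 : j ∈ Finset.Icc 1 (2 * m) := by rw [Finset.mem_Icc]; omega
    have h1 : j + 1 ∈ Finset.Icc 1 (2 * m) := by rw [Finset.mem_Icc]; omega
    have hev := hσ.nonDeg_eventually hdiv (by omega) (hx.mono (k := j) (by omega))
    have hsm := hev.mono fun y hy => ih (by omega) y hy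
    have hfr := hev.mono fun y hy => hσ.ad_frame hdiv hj (by omega) hm hy
    have hu : LocSec (L j) (adU σ L j) x := ⟨hsm.mono fun _ h => h.1, hfr.mono fun _ h => h.mem_left⟩
    have hv : LocSec (L j) (adV σ L j) x := ⟨hsm.mono fun _ h => h.2, hfr.mono fun _ h => h.mem_right⟩
    have hfac := (hσ.contDiff_fac hdiv hj (by omega)).contDiffAt (x := x)
    have hne := hx j hj (by omega)
    have hs : ContDiffAt ℝ ∞ (fun y => (√(fac σ L j y))⁻¹) x :=
      (hfac.sqrt hne).inv (Real.sqrt_ne_zero'.2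
        (lt_of_le_of_ne (hσ.fac_nonneg hdiv hj (by omega) x) hne.symm))
    have hX := (hσ.contDiff_frameOne hm).contDiffAt (x := x)
    constructor
    · exact (hs.smul (hσ.contDiffAt_connForm h1 h0 (by omega) hu hX)).congr_of_eventuallyEq
        (Eventually.of_forall fun y => adU_succ hj y)
    · exact (hs.smul (hσ.contDiffAt_connForm h1 h0 (by omega) hv hX)).congr_of_eventuallyEq
        (Eventually.of_forall fun y => adV_succ hj y)

/-- In an adapted frame `η_{j+1}` is complex linear. -/
lemma ad_comm {j : ℕ} (hj : 1 ≤ j) (hjm : j ≤ m) {x : Plane} (h : NonDeg σ L j x) :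
    connForm L (j + 1) j x (frameTwo σ x) (adU σ L j x)
      = connForm L (j + 1) j x (frameOne σ x) (adV σ L j x) ∧
    connForm L (j + 1) j x (frameTwo σ x) (adV σ L j x)
      = -connForm L (j + 1) j x (frameOne σ x) (adU σ L j x) := by
  have hm : 1 ≤ m := by omega
  suffices hs : connForm L (j + 1) j x (frameOne σ x) (adV σ L j x)
      = connForm L (j + 1) j x (frameTwo σ x) (adU σ L j x) by
    refine ⟨hs.symm, ?_⟩
    have hf := hσ.ad_frame hdiv hj (by omega) hm h
    have := hσ.conf_sum_eq_zero hj (by omega) (hσ.isTanFrame hm x) hf.mem_left hf.mem_right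
      (hf.left.trans hf.right.symm) hs (hσ.isConf_fac hdiv hj (by omega) x)
    exact eq_neg_of_add_eq_zero_right this
  induction j, hj using Nat.le_induction with
  | base => exact hσ.connForm_tangent_comm hm x _ _
  | succ j hj ih =>
    have h0 : j ∈ Finset.Icc 1 (2 * m) := by rw [Finset.mem_Icc]; omega
    have h1 : j + 1 ∈ Finset.Icc 1 (2 * m) := by rw [Finset.mem_Icc]; omega
    have h2 : j + 2 ∈ Finset.Icc 1 (2 * m) := by rw [Finset.mem_Icc]; omega
    have hf := hσ.ad_frame hdiv hj (by omega) hm (h.mono (k := j) (by omega))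
    have h3 := ih (by omega) (h.mono (by omega))
    rw [adU_succ hj, adV_succ hj, hσ.connForm_smul h2 h1, hσ.connForm_smul h2 h1, h3,
      hσ.connForm_comm hj hjm _ _ hf.mem_left]

lemma connForm_adU {j : ℕ} (hj : 1 ≤ j) (hjm : j ≤ m) {x : Plane} (h : NonDeg σ L j x) (v : Plane) :
    connForm L (j + 1) j x v (adU σ L j x)
      = thetaOne σ x v • connForm L (j + 1) j x (frameOne σ x) (adU σ L j x)
        + thetaTwo σ x v • connForm L (j + 1) j x (frameOne σ x) (adV σ L j x) := by
  rw [hσ.connForm_expand (by rw [Finset.mem_Icc]; omega), (hσ.ad_comm hdiv hj hjm h).1]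

lemma connForm_adV {j : ℕ} (hj : 1 ≤ j) (hjm : j ≤ m) {x : Plane} (h : NonDeg σ L j x) (v : Plane) :
    connForm L (j + 1) j x v (adV σ L j x)
      = thetaOne σ x v • connForm L (j + 1) j x (frameOne σ x) (adV σ L j x)
        - thetaTwo σ x v • connForm L (j + 1) j x (frameOne σ x) (adU σ L j x) := by
  rw [hσ.connForm_expand (by rw [Finset.mem_Icc]; omega), (hσ.ad_comm hdiv hj hjm h).2, smul_neg,
    ← sub_eq_add_neg]

lemma connForm_adU_succ {j : ℕ} (hj : 1 ≤ j) (hjm : j ≤ m) {x : Plane} (h : NonDeg σ L (j + 1) x)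
    (v : Plane) : connForm L (j + 1) j x v (adU σ L j x)
      = √(fac σ L j x) • (thetaOne σ x v • adU σ L (j + 1) x + thetaTwo σ x v • adV σ L (j + 1) x) := by
  have hs : √(fac σ L j x) ≠ 0 := Real.sqrt_ne_zero'.2 (lt_of_le_of_ne
    (hσ.fac_nonneg hdiv hj (by omega) x) (h j hj (by omega)).symm)
  have e : ∀ (c : ℝ) (Z : Mat (2 * m)),
      √(fac σ L j x) • c • (√(fac σ L j x))⁻¹ • Z = c • Z := fun c Z => by
    rw [smul_comm, smul_inv_smul₀ hs]
  rw [hσ.connForm_adU hdiv hj hjm (h.mono (by omega)), adU_succ hj, adV_succ hj, smul_add, e, e]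

lemma connForm_adV_succ {j : ℕ} (hj : 1 ≤ j) (hjm : j ≤ m) {x : Plane} (h : NonDeg σ L (j + 1) x)
    (v : Plane) : connForm L (j + 1) j x v (adV σ L j x)
      = √(fac σ L j x) • (thetaOne σ x v • adV σ L (j + 1) x - thetaTwo σ x v • adU σ L (j + 1) x) := by
  have hs : √(fac σ L j x) ≠ 0 := Real.sqrt_ne_zero'.2 (lt_of_le_of_ne
    (hσ.fac_nonneg hdiv hj (by omega) x) (h j hj (by omega)).symm)
  have e : ∀ (c : ℝ) (Z : Mat (2 * m)),
      √(fac σ L j x) • c • (√(fac σ L j x))⁻¹ • Z = c • Z := fun c Z => by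
    rw [smul_comm, smul_inv_smul₀ hs]
  rw [hσ.connForm_adV hdiv hj hjm (h.mono (by omega)), adU_succ hj, adV_succ hj, smul_sub, e, e]

lemma metric_fderiv_ad {j : ℕ} (hj : 1 ≤ j) (hjm : j ≤ m + 1) {x : Plane} (hm : 1 ≤ m)
    (h : NonDeg σ L j x) (v : Plane) :
    metric (fderiv ℝ (adU σ L j) x v) (adU σ L j x) = 0 ∧
    metric (fderiv ℝ (adV σ L j) x v) (adV σ L j x) = 0 ∧
    metric (fderiv ℝ (adV σ L j) x v) (adU σ L j x)
      = -metric (fderiv ℝ (adU σ L j) x v) (adV σ L j x) := by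
  obtain ⟨hu, hv⟩ := hσ.ad_locSec hdiv hj hjm hm h
  have hfr : ∀ᶠ y in nhds x, IsFrame (L j y) (eps j) (adU σ L j y) (adV σ L j y) :=
    (hσ.nonDeg_eventually hdiv (by omega) h).mono fun y hy => hσ.ad_frame hdiv hj hjm hm hy
  have hz : ∀ {f : Plane → ℝ} {c : ℝ}, f =ᶠ[nhds x] (fun _ => c) → fderiv ℝ f x v = 0 := by
    intro f c hf
    rw [hf.fderiv_eq, fderiv_fun_const]
    rfl
  have h1 := fderiv_metric hu.diff hu.diff v
  have h2 := fderiv_metric hv.diff hv.diff v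
  have h3 := fderiv_metric hv.diff hu.diff v
  rw [hz (c := eps j) (hfr.mono fun y hy => hy.left)] at h1
  rw [hz (c := eps j) (hfr.mono fun y hy => hy.right)] at h2
  rw [hz (c := 0) (hfr.mono fun y hy => (metric_comm _ _).trans hy.ortho)] at h3
  rw [metric_comm (adU σ L j x)] at h1
  rw [metric_comm (adV σ L j x)] at h2
  rw [metric_comm (adV σ L j x)] at h3
  exact ⟨by linarith, by linarith, by linarith⟩

lemma orthProj_fderiv_ad {j : ℕ} (hj : 1 ≤ j) (hjm : j ≤ m + 1) {x : Plane} (hm : 1 ≤ m)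
    (h : NonDeg σ L j x) (v : Plane) :
    orthProj (L j x) (fderiv ℝ (adU σ L j) x v) = alpha σ L j x v • adV σ L j x ∧
    orthProj (L j x) (fderiv ℝ (adV σ L j) x v) = -(alpha σ L j x v • adU σ L j x) := by
  obtain ⟨h1, h2, h3⟩ := hσ.metric_fderiv_ad hdiv hj hjm hm h v
  have hfr := hσ.ad_frame hdiv hj hjm hm h
  have hd := hσ.defPlane (i := j) (by rw [Finset.mem_Icc]; omega) x
  constructor
  · rw [hfr.orthProj_eq hd, h1, mul_zero, zero_smul, zero_add, alpha]
  · rw [hfr.orthProj_eq hd, h2, h3, mul_zero, zero_smul, add_zero, alpha, mul_neg, neg_smul]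

end IsIsotropicPAlternating
end ParaHyp
end

noncomputable section
namespace ParaHyp

open Filter Topology

/-! ### The Toda equations and the maximum principle -/

lemma second_deriv_nonpos_of_isLocalMax {φ : Plane → ℝ} {p : Plane} (hφ : ContDiffAt ℝ ∞ φ p)
    (hmax : IsLocalMax φ p) (w : Plane) : fderiv ℝ (fun y => fderiv ℝ φ y w) p w ≤ 0 := by
  have hline : ∀ t : ℝ, HasDerivAt (fun t : ℝ => p + t • w) w t := fun t => by
    simpa using ((hasDerivAt_id t).smul_const w).const_add p
  have hcont : Tendsto (fun t : ℝ => p + t • w) (𝓝 0) (𝓝 p) := by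
    have := (hline 0).continuousAt.tendsto
    simpa using this
  have hev : ∀ᶠ y in 𝓝 p, DifferentiableAt ℝ φ y :=
    ((hφ.of_le (by norm_cast : (1 : WithTop ℕ∞) ≤ ∞)).eventually (by simp)).mono
      fun y hy => hy.differentiableAt (by simp)
  have hd1 : ∀ᶠ t in 𝓝 (0 : ℝ), deriv (fun t : ℝ => φ (p + t • w)) t = fderiv ℝ φ (p + t • w) w := by
    filter_upwards [hcont.eventually hev] with t ht
    exact (ht.hasFDerivAt.comp_hasDerivAt t (hline t)).deriv
  have h2 : DifferentiableAt ℝ (fun y => fderiv ℝ φ y w) p :=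
    ((hφ.fderiv_right (m := 1) (by rw [one_add_one_eq_two]; exact two_le_smooth)).differentiableAt (by simp)).clm_apply
      (differentiableAt_const w)
  have hp : p + (0 : ℝ) • w = p := by simp
  have hd2 : HasDerivAt (deriv (fun t : ℝ => φ (p + t • w)))
      (fderiv ℝ (fun y => fderiv ℝ φ y w) p w) 0 := by
    have h3 : HasFDerivAt (fun y => fderiv ℝ φ y w) (fderiv ℝ (fun y => fderiv ℝ φ y w) p)
        (p + (0 : ℝ) • w) := by rw [hp]; exact h2.hasFDerivAt
    have h5 : HasDerivAt ((fun y => fderiv ℝ φ y w) ∘ fun t : ℝ => p + t • w)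
        (fderiv ℝ (fun y => fderiv ℝ φ y w) p w) 0 := h3.comp_hasDerivAt (0 : ℝ) (hline 0)
    exact h5.congr_of_eventuallyEq hd1
  have hmax' : IsLocalMax (fun t : ℝ => φ (p + t • w)) 0 := by
    have := hcont.eventually hmax
    filter_upwards [this] with t ht
    simpa using ht
  by_contra! hpos
  have hdz := hmax'.deriv_eq_zero
  have hcd : ContinuousAt (fun t : ℝ => φ (p + t • w)) 0 := by
    have h4 : ContinuousAt φ (p + (0 : ℝ) • w) := by rw [hp]; exact hφ.continuousAt
    exact ContinuousAt.comp (f := fun t : ℝ => p + t • w) h4 (hline 0).continuousAt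
  have hmin := isLocalMin_of_deriv_deriv_pos (by rw [hd2.deriv]; exact hpos) hdz hcd
  have hconst : (fun t : ℝ => φ (p + t • w)) =ᶠ[𝓝 0] fun _ => φ (p + (0 : ℝ) • w) := by
    filter_upwards [hmin, hmax'] with t h1 h2
    exact le_antisymm h2 h1
  have := hconst.deriv.deriv_eq
  rw [hd2.deriv] at this
  simp at this
  linarith

/-- At a maximum of `φ`, the differential of a form conjugate to `dφ` is nonpositive. -/
lemma extDeriv_nonpos_of_isLocalMax {φ : Plane → ℝ} {p : Plane} (hφ : ContDiffAt ℝ ∞ φ p)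
    (hmax : IsLocalMax φ p) {X₁ X₂ : Plane → Plane} {θ₁ θ₂ Ξ : Plane → Plane → ℝ}
    (hX₁ : DifferentiableAt ℝ X₁ p) (hX₂ : DifferentiableAt ℝ X₂ p)
    (hθ₁ : ∀ v, DifferentiableAt ℝ (fun y => θ₁ y v) p)
    (hθ₂ : ∀ v, DifferentiableAt ℝ (fun y => θ₂ y v) p)
    (h11 : θ₁ p (X₁ p) = 1) (h12 : θ₁ p (X₂ p) = 0)
    (h21 : θ₂ p (X₁ p) = 0) (h22 : θ₂ p (X₂ p) = 1)
    (hΞ : ∀ᶠ y in 𝓝 p, ∀ v, Ξ y v = θ₁ y v * Ξ y (X₁ y) + θ₂ y v * Ξ y (X₂ y))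
    (h1 : ∀ᶠ y in 𝓝 p, fderiv ℝ φ y (X₁ y) = Ξ y (X₂ y))
    (h2 : ∀ᶠ y in 𝓝 p, fderiv ℝ φ y (X₂ y) = -Ξ y (X₁ y)) :
    extDeriv Ξ p (X₁ p) (X₂ p) ≤ 0 := by
  have hz : fderiv ℝ φ p = 0 := hmax.fderiv_eq_zero
  have hdd : DifferentiableAt ℝ (fun y => fderiv ℝ φ y) p :=
    (hφ.fderiv_right (m := 1) (by rw [one_add_one_eq_two]; exact two_le_smooth)).differentiableAt (by simp)
  have hX : ∀ {X : Plane → Plane}, DifferentiableAt ℝ X p → ∀ a,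
      fderiv ℝ (fun y => fderiv ℝ φ y (X y)) p a = fderiv ℝ (fun y => fderiv ℝ φ y (X p)) p a := by
    intro X hX a
    rw [fderiv_clm_apply hdd hX, fderiv_clm_apply hdd (differentiableAt_const _), hz]
    simp
  have key : ∀ v a, fderiv ℝ (fun y => Ξ y v) p a
      = θ₂ p v * fderiv ℝ (fun y => fderiv ℝ φ y (X₁ p)) p a
        - θ₁ p v * fderiv ℝ (fun y => fderiv ℝ φ y (X₂ p)) p a := by
    intro v a
    have e : (fun y => Ξ y v) =ᶠ[𝓝 p]
        fun y => θ₂ y v * fderiv ℝ φ y (X₁ y) - θ₁ y v * fderiv ℝ φ y (X₂ y) := by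
      filter_upwards [hΞ, h1, h2] with y h0 h1 h2
      rw [h0 v, h1, h2]; ring
    have d1 := hdd.clm_apply hX₁
    have d2 := hdd.clm_apply hX₂
    rw [e.fderiv_eq, fderiv_fun_sub ((hθ₂ v).fun_mul d1) ((hθ₁ v).fun_mul d2), fderiv_fun_mul (hθ₂ v) d1,
      fderiv_fun_mul (hθ₁ v) d2, ← hX hX₁, ← hX hX₂, hz]
    simp
  rw [extDeriv, key, key, h11, h12, h21, h22]
  have := second_deriv_nonpos_of_isLocalMax hφ hmax (X₁ p)
  have := second_deriv_nonpos_of_isLocalMax hφ hmax (X₂ p)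
  linarith

lemma toda_sum_identity (C : ℝ) (y : ℕ → ℝ) (h0 : y 0 = 0) (M : ℕ) :
    ∑ J ∈ Finset.Icc 1 M, (J * (C - J)) * (2 * y J - y (J + 1) - y (J - 1))
      = 2 * ∑ J ∈ Finset.Icc 1 M, y J + ((M + 1) * (C - (M + 1))) * y M
        - (M * (C - M)) * y (M + 1) := by
  induction M with
  | zero => norm_num [h0]
  | succ M ih =>
    rw [Finset.sum_Icc_succ_top (by omega), Finset.sum_Icc_succ_top (by omega), ih]
    push_cast
    ring

/-- The linear algebra behind the maximum principle for the Toda system. -/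
lemma toda_contradiction {m : ℕ} {x : ℕ → ℝ} (h0 : x 0 = 0) (hm : x (m + 1) = -x m)
    {S : Finset ℕ} (hS : S ⊆ Finset.Icc 1 m) (hne : S.Nonempty) (hpos : ∀ J ∈ S, 0 < x J)
    (hneg : ∀ J ∈ Finset.Icc 1 m, J ∉ S → x J ≤ 0) :
    0 < ∑ J ∈ S, (J * ((2 * m + 2 : ℝ) - J)) * (2 * x J - x (J + 1) - x (J - 1)) := by
  classical
  let y : ℕ → ℝ := fun J => if J ∈ S then x J else 0
  have hy0 : ∀ J, 0 ≤ y J := fun J => by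
    by_cases h : J ∈ S
    · simp only [y, h, if_true]; exact (hpos J h).le
    · simp [y, h]
  have hxy : ∀ J ≤ m, x J ≤ y J := fun J hJ => by
    by_cases h : J ∈ S
    · simp [y, h]
    · simp only [y, h, if_false]
      rcases Nat.eq_zero_or_pos J with rfl | h1
      · exact h0.le
      · exact hneg J (Finset.mem_Icc.2 ⟨h1, hJ⟩) h
  have hw : ∀ J ∈ Finset.Icc 1 m, 0 < (J * ((2 * m + 2 : ℝ) - J)) := fun J hJ => by
    rw [Finset.mem_Icc] at hJ
    have h1 : (1 : ℝ) ≤ J := by exact_mod_cast hJ.1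
    have h2 : (J : ℝ) ≤ m := by exact_mod_cast hJ.2
    exact mul_pos (by linarith) (by linarith)
  have hns : ∀ J, J ∉ Finset.Icc 1 m → y J = 0 := fun J hJ => by
    have : J ∉ S := fun h => hJ (hS h)
    simp [y, this]
  calc 0 < 2 * ∑ J ∈ Finset.Icc 1 m, y J + ((m + 1) * ((2 * m + 2 : ℝ) - (m + 1))) * y m
        - (m * ((2 * m + 2 : ℝ) - m)) * y (m + 1) := by
        rw [hns (m + 1) (by simp), mul_zero, sub_zero]
        obtain ⟨J, hJ⟩ := hne
        have h1 : 0 < ∑ J ∈ Finset.Icc 1 m, y J :=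
          Finset.sum_pos' (fun J _ => hy0 J) ⟨J, hS hJ, by simp only [y, hJ, if_true]; exact hpos J hJ⟩
        have h2 : 0 ≤ ((m + 1) * ((2 * m + 2 : ℝ) - (m + 1))) * y m :=
          mul_nonneg (mul_nonneg (by positivity) (by linarith [(Nat.cast_nonneg m : (0 : ℝ) ≤ m)]))
            (hy0 m)
        linarith
    _ = ∑ J ∈ Finset.Icc 1 m, (J * ((2 * m + 2 : ℝ) - J)) * (2 * y J - y (J + 1) - y (J - 1)) :=
        (toda_sum_identity _ y (hns 0 (by simp)) m).symm
    _ ≤ ∑ J ∈ S, (J * ((2 * m + 2 : ℝ) - J)) * (2 * y J - y (J + 1) - y (J - 1)) := by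
        rw [← Finset.sum_sdiff hS]
        have : ∑ J ∈ Finset.Icc 1 m \ S,
            (J * ((2 * m + 2 : ℝ) - J)) * (2 * y J - y (J + 1) - y (J - 1)) ≤ 0 := by
          refine Finset.sum_nonpos fun J hJ => ?_
          rw [Finset.mem_sdiff] at hJ
          have h1 : y J = 0 := by simp [y, hJ.2]
          refine mul_nonpos_of_nonneg_of_nonpos (hw J hJ.1).le ?_
          rw [h1]
          linarith [hy0 (J + 1), hy0 (J - 1)]
        linarith
    _ ≤ _ := by
        refine Finset.sum_le_sum fun J hJ => mul_le_mul_of_nonneg_left ?_ (hw J (hS hJ)).le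
        have hJm := Finset.mem_Icc.1 (hS hJ)
        have h1 : y J = x J := by simp [y, hJ]
        have h2 : x (J - 1) ≤ y (J - 1) := hxy _ (by omega)
        have h3 : x (J + 1) ≤ y (J + 1) := by
          rcases Nat.lt_or_ge J m with h | h
          · exact hxy _ h
          · have : J = m := by omega
            subst this
            rw [hm]
            linarith [hpos J hJ, hy0 (J + 1)]
        rw [h1]
        linarith

end ParaHyp
end

noncomputable section
namespace ParaHyp

open Filter Topology

lemma areaForm_swap {n : ℕ} {σ : Plane → Mat n} (x a b : Plane) :
    areaForm σ x b a = -areaForm σ x a b := by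
  rw [areaForm, areaForm]; ring

lemma fac₀_of_pos {n : ℕ} {σ : Plane → Mat n} {L : ℕ → Plane → Submodule ℝ (Mat n)} {i : ℕ}
    (hi : 1 ≤ i) (x : Plane) : fac₀ σ L i x = fac σ L i x := if_neg (by omega)

lemma extDeriv_congr {α β : Plane → Plane → ℝ} {x : Plane} (h : ∀ᶠ y in 𝓝 x, ∀ v, α y v = β y v)
    (a b : Plane) : extDeriv α x a b = extDeriv β x a b := by
  have e : ∀ v, (fun y => α y v) =ᶠ[𝓝 x] fun y => β y v := fun v => h.mono fun y hy => hy v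
  rw [extDeriv, extDeriv, (e b).fderiv_eq, (e a).fderiv_eq]

namespace IsIsotropicPAlternating

variable {m : ℕ} {σ : Plane → Mat (2 * m)} {L : ℕ → Plane → Submodule ℝ (Mat (2 * m))}
  (hσ : IsIsotropicPAlternating σ L) (hdiv : DivisorCondition σ L)
include hσ hdiv

lemma differentiableAt_alpha {j : ℕ} (hj : 1 ≤ j) (hjm : j ≤ m + 1) (hm : 1 ≤ m) {x : Plane}
    (h : NonDeg σ L j x) (v : Plane) :
    DifferentiableAt ℝ (fun y => eps j * metric (fderiv ℝ (adU σ L j) y v) (adV σ L j y)) x := by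
  obtain ⟨hu, hv⟩ := hσ.ad_locSec hdiv hj hjm hm h
  exact ((contDiffAt_metric (contDiffAt_fderiv_mat hu.smooth contDiffAt_const)
    hv.smooth).differentiableAt (by simp)).const_mul _

lemma extDeriv_alpha_eq {j : ℕ} (hj : 1 ≤ j) (hjm : j ≤ m + 1) (hm : 1 ≤ m) {x : Plane}
    (h : NonDeg σ L j x) (a b : Plane) : extDeriv (alpha σ L j) x a b
      = eps j * (metric (fderiv ℝ (adU σ L j) x b) (fderiv ℝ (adV σ L j) x a)
        - metric (fderiv ℝ (adU σ L j) x a) (fderiv ℝ (adV σ L j) x b)) := by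
  obtain ⟨hu, hv⟩ := hσ.ad_locSec hdiv hj hjm hm h
  have hd : ∀ v, DifferentiableAt ℝ
      (fun y => metric (fderiv ℝ (adU σ L j) y v) (adV σ L j y)) x := fun v =>
    (contDiffAt_metric (contDiffAt_fderiv_mat hu.smooth contDiffAt_const)
      hv.smooth).differentiableAt (by simp)
  rw [← fderiv_metric_fderiv hu.smooth hv.smooth, extDeriv]
  simp only [alpha]
  rw [fderiv_const_mul (hd b), fderiv_const_mul (hd a), mul_sub]
  rfl

/-- The part of the curvature of `ℒ_j` coming from `ℒ_{j+1}`. -/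
lemma curvature_next {j : ℕ} (hj : 1 ≤ j) (hjm : j ≤ m) {x : Plane} (h : NonDeg σ L j x)
    (a b : Plane) :
    metric (connForm L (j + 1) j x b (adU σ L j x)) (connForm L (j + 1) j x a (adV σ L j x))
      = -(eps j * fac σ L j x * areaForm σ x a b) := by
  have hm : 1 ≤ m := by omega
  have hX := hσ.isTanFrame hm x
  have hf := hσ.ad_frame hdiv hj (by omega) hm h
  have hc := hσ.isConf_fac hdiv hj (by omega) x
  have h1 := hσ.conf_inner hj (by omega) hc (frameOne σ x) hf.mem_left hf.mem_left
  have h2 := hσ.conf_inner hj (by omega) hc (frameOne σ x) hf.mem_right hf.mem_right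
  have h3 := hσ.conf_inner hj (by omega) hc (frameOne σ x) hf.mem_left hf.mem_right
  rw [hX.left, hf.left] at h1
  rw [hX.left, hf.right] at h2
  rw [hf.ortho, mul_zero] at h3
  rw [hσ.connForm_adU hdiv hj hjm h b, hσ.connForm_adV hdiv hj hjm h a]
  simp only [metric_add_left, metric_sub_right, metric_smul_left, metric_smul_right, h1, h2, h3,
    metric_comm (connForm L (j + 1) j x (frameOne σ x) (adV σ L j x))
      (connForm L (j + 1) j x (frameOne σ x) (adU σ L j x)), areaForm]
  ring

/-- The part of the curvature of `ℒ_{j+1}` coming from `ℒ_j`. -/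
lemma curvature_prev {j : ℕ} (hj : 1 ≤ j) (hjm : j ≤ m) {x : Plane} (h : NonDeg σ L (j + 1) x)
    (a b : Plane) :
    metric (connForm L j (j + 1) x b (adU σ L (j + 1) x))
        (connForm L j (j + 1) x a (adV σ L (j + 1) x))
      = eps (j + 1) * fac σ L j x * areaForm σ x a b := by
  have hm : 1 ≤ m := by omega
  have h0 : j ∈ Finset.Icc 1 (2 * m) := by rw [Finset.mem_Icc]; omega
  have h1 : j + 1 ∈ Finset.Icc 1 (2 * m) := by rw [Finset.mem_Icc]; omega
  have hf := hσ.ad_frame hdiv hj (by omega) hm (h.mono (k := j) (by omega))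
  have hf' := hσ.ad_frame hdiv (by omega) (by omega) hm h
  have hs : √(fac σ L j x) * √(fac σ L j x) = fac σ L j x :=
    Real.mul_self_sqrt (hσ.fac_nonneg hdiv hj (by omega) x)
  have hfr := hf.metric_eq (hσ.connForm_mem h0 (j + 1) x b (adU σ L (j + 1) x))
    (connForm L j (j + 1) x a (adV σ L (j + 1) x))
  rw [hσ.connForm_adjoint h0 h1 (by omega) _ hf'.mem_left hf.mem_left,
    hσ.connForm_adjoint h0 h1 (by omega) _ hf'.mem_left hf.mem_right,
    hσ.connForm_adjoint h0 h1 (by omega) _ hf'.mem_right hf.mem_left,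
    hσ.connForm_adjoint h0 h1 (by omega) _ hf'.mem_right hf.mem_right] at hfr
  simp only [hσ.connForm_adU_succ hdiv hj hjm h, hσ.connForm_adV_succ hdiv hj hjm h,
    metric_add_right, metric_sub_right, metric_smul_right, hf'.left, hf'.right, hf'.ortho,
    metric_comm (adV σ L (j + 1) x) (adU σ L (j + 1) x)] at hfr
  have he := eps_mul_self j
  rw [eps_succ] at hfr ⊢
  rw [areaForm]
  linear_combination eps j * hfr - metric (connForm L j (j + 1) x b (adU σ L (j + 1) x))
        (connForm L j (j + 1) x a (adV σ L (j + 1) x)) * he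
      + (eps j * (-(thetaOne σ x a * thetaTwo σ x b) + thetaTwo σ x a * thetaOne σ x b)) *
        (√(fac σ L j x) * √(fac σ L j x) * he + hs)

/-- The structure equation for the connection form of `ℒ_j`. -/
lemma extDeriv_alpha {j : ℕ} (hj : 1 ≤ j) (hjm : j ≤ m) {x : Plane} (h : NonDeg σ L j x)
    (a b : Plane) : extDeriv (alpha σ L j) x a b
      = 2 * (fac₀ σ L (j - 1) x - fac₀ σ L j x) * areaForm σ x a b := by
  have hm : 1 ≤ m := by omega
  have h0 : j ∈ Finset.Icc 1 (2 * m) := by rw [Finset.mem_Icc]; omega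
  have h1 : j + 1 ∈ Finset.Icc 1 (2 * m) := by rw [Finset.mem_Icc]; omega
  obtain ⟨hu, hv⟩ := hσ.ad_locSec hdiv hj (by omega) hm h
  have hf := hσ.ad_frame hdiv hj (by omega) hm h
  have he := eps_mul_self j
  have hterm : ∀ i ∈ Finset.Icc 1 (2 * m), i ≠ j → ∀ c d,
      metric (orthProj (L i x) (fderiv ℝ (adU σ L j) x c))
        (orthProj (L i x) (fderiv ℝ (adV σ L j) x d))
      = metric (connForm L i j x c (adU σ L j x)) (connForm L i j x d (adV σ L j x)) := by
    intro i hi hij c d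
    rw [hσ.orthProj_fderiv hi h0 hij hu, hσ.orthProj_fderiv hi h0 hij hv]
  have hself : ∀ c d, metric (orthProj (L j x) (fderiv ℝ (adU σ L j) x c))
      (orthProj (L j x) (fderiv ℝ (adV σ L j) x d)) = 0 := by
    intro c d
    rw [(hσ.orthProj_fderiv_ad hdiv hj (by omega) hm h c).1,
      (hσ.orthProj_fderiv_ad hdiv hj (by omega) hm h d).2, metric_neg_right, metric_smul_left,
      metric_smul_right, metric_comm, hf.ortho]
    ring
  have hfar : ∀ i ∈ Finset.Icc 1 (2 * m), i ≠ j + 1 → i + 1 ≠ j → ∀ c d,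
      metric (orthProj (L i x) (fderiv ℝ (adU σ L j) x c))
        (orthProj (L i x) (fderiv ℝ (adV σ L j) x d)) = 0 := by
    intro i hi h2 h3 c d
    by_cases hij : i = j
    · subst hij; exact hself c d
    · rw [hterm i hi hij, hσ.connForm_eq_zero hi h0 (by omega), metric_zero_left]
  have hnext : ∀ c d, metric (orthProj (L (j + 1) x) (fderiv ℝ (adU σ L j) x c))
      (orthProj (L (j + 1) x) (fderiv ℝ (adV σ L j) x d))
      = -(eps j * fac₀ σ L j x * areaForm σ x d c) := by
    intro c d
    rw [hterm _ h1 (by omega), hσ.curvature_next hdiv hj hjm h, fac₀_of_pos hj]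
  rw [hσ.extDeriv_alpha_eq hdiv hj (by omega) hm h, hσ.metric_fderiv_eq_sum h0 h0 hu hv,
    hσ.metric_fderiv_eq_sum h0 h0 hu hv]
  rcases hj.eq_or_lt with rfl | hj2
  · rw [Finset.sum_eq_single 2 (fun i hi h2 => hfar i hi h2 (by rw [Finset.mem_Icc] at hi; omega) b a)
        (fun h => absurd h1 h),
      Finset.sum_eq_single 2 (fun i hi h2 => hfar i hi h2 (by rw [Finset.mem_Icc] at hi; omega) a b)
        (fun h => absurd h1 h)]
    have ht : ∀ {Y Z : Mat (2 * m)}, Y ∈ L 1 x → Z ∈ L 1 x → traceForm (σ x) Y Z = -metric Y Z :=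
      fun hY hZ => hσ.traceForm_isotropic h0 hY hZ
    have ma := hσ.fderiv_mem x a
    have mb := hσ.fderiv_mem x b
    have e1 := hnext b a
    have e2 := hnext a b
    simp only [Nat.reduceAdd] at e1 e2
    rw [e1, e2, normalTerm, normalTerm]
    simp only [ht ma hf.mem_left, ht hf.mem_left ma, ht ma hf.mem_right, ht hf.mem_right ma,
      ht mb hf.mem_left, ht hf.mem_left mb, ht mb hf.mem_right, ht hf.mem_right mb, ht ma mb,
      ht mb ma, ht hf.mem_left hf.mem_right, ht hf.mem_right hf.mem_left,
      metric_comm (adU σ L 1 x) (fderiv ℝ σ x a), metric_comm (adU σ L 1 x) (fderiv ℝ σ x b),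
      metric_comm (adV σ L 1 x) (fderiv ℝ σ x a), metric_comm (adV σ L 1 x) (fderiv ℝ σ x b),
      metric_comm (adV σ L 1 x) (adU σ L 1 x), hf.ortho, areaForm_swap x a b]
    have hθ₁ : ∀ v, thetaOne σ x v = metric (fderiv ℝ σ x v) (adU σ L 1 x) := fun v => rfl
    have hθ₂ : ∀ v, thetaTwo σ x v = metric (fderiv ℝ σ x v) (adV σ L 1 x) := fun v => rfl
    simp only [areaForm, ← hθ₁, ← hθ₂, fac₀, Nat.sub_self, if_true,
      metric_comm (fderiv ℝ σ x b) (fderiv ℝ σ x a)]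
    rw [show eps 1 = 1 from eps_of_odd odd_one]
    ring
  · obtain ⟨k, rfl⟩ := Nat.exists_eq_succ_of_ne_zero (by omega : j ≠ 0)
    rw [Nat.succ_eq_add_one] at *
    have hk : k ∈ Finset.Icc 1 (2 * m) := by rw [Finset.mem_Icc]; omega
    have hprev : ∀ c d, metric (orthProj (L k x) (fderiv ℝ (adU σ L (k + 1)) x c))
        (orthProj (L k x) (fderiv ℝ (adV σ L (k + 1)) x d))
        = eps (k + 1) * fac₀ σ L k x * areaForm σ x d c := by
      intro c d
      rw [hterm _ hk (by omega), hσ.curvature_prev hdiv (by omega) (by omega) h,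
        fac₀_of_pos (by omega)]
    rw [Finset.sum_eq_add_of_mem k (k + 1 + 1) hk h1 (by omega)
        (fun i hi h2 => hfar i hi h2.2 (by omega) b a),
      Finset.sum_eq_add_of_mem k (k + 1 + 1) hk h1 (by omega)
        (fun i hi h2 => hfar i hi h2.2 (by omega) a b), hnext, hnext, hprev, hprev]
    have h2 : ∀ v, traceForm (σ x) (fderiv ℝ σ x v) (adV σ L (k + 1) x) = 0 ∧
        traceForm (σ x) (adV σ L (k + 1) x) (fderiv ℝ σ x v) = 0 := fun v =>
      hσ.traceForm_tangent_left h0 (by omega) (by omega) (hσ.fderiv_mem x v) hf.mem_right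
    rw [normalTerm_comm_of_ortho (by
        rw [hσ.traceForm_isotropic (one_mem_Icc hm) (hσ.fderiv_mem x _) (hσ.fderiv_mem x _),
          hσ.traceForm_isotropic (one_mem_Icc hm) (hσ.fderiv_mem x _) (hσ.fderiv_mem x _),
          metric_comm]) (h2 b).1 (h2 b).2 (h2 a).1 (h2 a).2, areaForm_swap x a b,
      Nat.add_sub_cancel]
    linear_combination (2 * (fac₀ σ L k x - fac₀ σ L (k + 1) x) * areaForm σ x a b) * he

/-- The structure equations of the tangent frame. -/
lemma curl_theta (hm : 1 ≤ m) (x : Plane) :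
    extDeriv (thetaOne σ) x (frameOne σ x) (frameTwo σ x) = alpha σ L 1 x (frameOne σ x) ∧
    extDeriv (thetaTwo σ) x (frameOne σ x) (frameTwo σ x) = alpha σ L 1 x (frameTwo σ x) := by
  have hnd : NonDeg σ L 1 x := fun i h1 h2 => absurd h2 (by omega)
  obtain ⟨hu, hv⟩ := hσ.ad_locSec hdiv le_rfl (by omega) hm hnd
  obtain ⟨-, h1, -⟩ := hσ.metric_fderiv_ad hdiv le_rfl (by omega) hm hnd (frameOne σ x)
  obtain ⟨h2, -, h3⟩ := hσ.metric_fderiv_ad hdiv le_rfl (by omega) hm hnd (frameTwo σ x)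
  have e1 := fderiv_metric_fderiv hσ.smooth.contDiffAt hu.smooth (frameOne σ x) (frameTwo σ x)
  have e2 := fderiv_metric_fderiv hσ.smooth.contDiffAt hv.smooth (frameOne σ x) (frameTwo σ x)
  have he : eps 1 = 1 := eps_of_odd odd_one
  have hU : fderiv ℝ σ x (frameOne σ x) = adU σ L 1 x := rfl
  have hV : fderiv ℝ σ x (frameTwo σ x) = adV σ L 1 x := rfl
  rw [hU, hV, metric_comm _ (fderiv ℝ (adU σ L 1) x (frameOne σ x)),
    metric_comm _ (fderiv ℝ (adU σ L 1) x (frameTwo σ x)), h2] at e1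
  rw [hU, hV, metric_comm _ (fderiv ℝ (adV σ L 1) x (frameOne σ x)),
    metric_comm _ (fderiv ℝ (adV σ L 1) x (frameTwo σ x)), h1, h3] at e2
  constructor
  · refine Eq.trans e1 ?_
    rw [alpha, he]; ring
  · refine Eq.trans e2 ?_
    rw [alpha, he]; ring

end IsIsotropicPAlternating
end ParaHyp
end

noncomputable section
namespace ParaHyp

open Filter Topology

namespace IsIsotropicPAlternating

variable {m : ℕ} {σ : Plane → Mat (2 * m)} {L : ℕ → Plane → Submodule ℝ (Mat (2 * m))}
  (hσ : IsIsotropicPAlternating σ L) (hdiv : DivisorCondition σ L)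
include hσ hdiv

/-- The Cauchy-Riemann equations for the modulus of `η_{j+1}`. -/
lemma fderiv_sqrt_fac {j : ℕ} (hj : 1 ≤ j) (hjm : j ≤ m) {x : Plane} (h : NonDeg σ L (j + 1) x) :
    fderiv ℝ (fun y => √(fac σ L j y)) x (frameOne σ x) = √(fac σ L j x) *
      (alpha σ L (j + 1) x (frameTwo σ x) - alpha σ L j x (frameTwo σ x)
        - alpha σ L 1 x (frameTwo σ x)) ∧
    fderiv ℝ (fun y => √(fac σ L j y)) x (frameTwo σ x) = -(√(fac σ L j x) *
      (alpha σ L (j + 1) x (frameOne σ x) - alpha σ L j x (frameOne σ x)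
        - alpha σ L 1 x (frameOne σ x))) := by
  have hm : 1 ≤ m := by omega
  have h0 : j ∈ Finset.Icc 1 (2 * m) := by rw [Finset.mem_Icc]; omega
  have h1 : j + 1 ∈ Finset.Icc 1 (2 * m) := by rw [Finset.mem_Icc]; omega
  have hnd : NonDeg σ L j x := h.mono (by omega)
  obtain ⟨hu, hv⟩ := hσ.ad_locSec hdiv hj (by omega) hm hnd
  obtain ⟨hu', hv'⟩ := hσ.ad_locSec hdiv (j := j + 1) (by omega) (by omega) hm h
  have hf' := hσ.ad_frame hdiv (j := j + 1) (by omega) (by omega) hm h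
  have hev := hσ.nonDeg_eventually hdiv (by omega) h
  have he := eps_mul_self (j + 1)
  have hpos : 0 < fac σ L j x := lt_of_le_of_ne (hσ.fac_nonneg hdiv hj (by omega) x)
    (h j hj (by omega)).symm
  have hs : DifferentiableAt ℝ (fun y => √(fac σ L j y)) x :=
    (((hσ.contDiff_fac hdiv hj (by omega)).contDiffAt (x := x)).sqrt hpos.ne').differentiableAt
      (by simp)
  have hθ := fun v => hσ.contDiff_theta hm v
  have hd1 : ∀ v, DifferentiableAt ℝ (fun y => thetaOne σ y v) x := fun v =>
    (hθ v).1.contDiffAt.differentiableAt (by simp)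
  have hd2 : ∀ v, DifferentiableAt ℝ (fun y => thetaTwo σ y v) x := fun v =>
    (hθ v).2.contDiffAt.differentiableAt (by simp)
  have t1 := hσ.theta_frameOne hm x
  have t2 := hσ.theta_frameTwo hm x
  -- the components of `η_{j+1}` on the adapted frames
  have c1 : ∀ v, (fun y => metric (fderiv ℝ (adU σ L j) y v) (adU σ L (j + 1) y)) =ᶠ[𝓝 x]
      fun y => eps (j + 1) * (√(fac σ L j y) * thetaOne σ y v) := fun v => by
    filter_upwards [hev, hu.eventually] with y hy hu
    have hfy := hσ.ad_frame hdiv (j := j + 1) (by omega) (by omega) hm hy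
    rw [hσ.metric_fderiv_eq h1 h0 (by omega) hu v hfy.mem_left, hσ.connForm_adU_succ hdiv hj hjm hy,
      metric_smul_left, metric_add_left, metric_smul_left, metric_smul_left, hfy.left,
      metric_comm (adV σ L (j + 1) y), hfy.ortho]
    ring
  have c2 : ∀ v, (fun y => metric (fderiv ℝ (adU σ L j) y v) (adV σ L (j + 1) y)) =ᶠ[𝓝 x]
      fun y => eps (j + 1) * (√(fac σ L j y) * thetaTwo σ y v) := fun v => by
    filter_upwards [hev, hu.eventually] with y hy hu
    have hfy := hσ.ad_frame hdiv (j := j + 1) (by omega) (by omega) hm hy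
    rw [hσ.metric_fderiv_eq h1 h0 (by omega) hu v hfy.mem_right,
      hσ.connForm_adU_succ hdiv hj hjm hy, metric_smul_left, metric_add_left, metric_smul_left,
      metric_smul_left, hfy.right, hfy.ortho]
    ring
  have dmul : ∀ {f g : Plane → ℝ}, DifferentiableAt ℝ f x → DifferentiableAt ℝ g x → ∀ (c : ℝ) w,
      fderiv ℝ (fun y => c * (f y * g y)) x w = c * (f x * fderiv ℝ g x w + g x * fderiv ℝ f x w) := by
    intro f g hf hg c w
    rw [fderiv_const_mul (hf.fun_mul hg), fderiv_fun_mul hf hg]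
    simp
    ring
  obtain ⟨q1, q2⟩ := hσ.curl_theta hdiv hm x
  rw [extDeriv] at q1 q2
  have k1 := hσ.curl_connForm hj hjm hu hu' (frameOne σ x) (frameTwo σ x)
  have k2 := hσ.curl_connForm hj hjm hu hv' (frameOne σ x) (frameTwo σ x)
  rw [(c1 _).fderiv_eq, (c1 _).fderiv_eq, dmul hs (hd1 _), dmul hs (hd1 _), t1.1, t2.1] at k1
  rw [(c2 _).fderiv_eq, (c2 _).fderiv_eq, dmul hs (hd2 _), dmul hs (hd2 _), t1.2, t2.2] at k2
  simp only [(hσ.orthProj_fderiv_ad hdiv hj (by omega) hm hnd _).1,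
    (hσ.orthProj_fderiv_ad hdiv (by omega : 1 ≤ j + 1) (by omega) hm h _).1,
    (hσ.orthProj_fderiv_ad hdiv (by omega : 1 ≤ j + 1) (by omega) hm h _).2,
    hσ.connForm_smul h1 h0, hσ.connForm_adU_succ hdiv hj hjm h,
    hσ.connForm_adV_succ hdiv hj hjm h, t1, t2, metric_smul_left, metric_smul_right,
    metric_add_left, metric_sub_left, metric_neg_right, hf'.left, hf'.right, hf'.ortho,
    metric_comm (adV σ L (j + 1) x) (adU σ L (j + 1) x)] at k1 k2
  constructor
  · linear_combination eps (j + 1) * k2 - √(fac σ L j x) * q2 +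
      (-fderiv ℝ (fun y => √(fac σ L j y)) x (frameOne σ x) - √(fac σ L j x) *
      (fderiv ℝ (fun y => thetaTwo σ y (frameTwo σ x)) x (frameOne σ x) - fderiv ℝ (fun y => thetaTwo σ y (frameOne σ x)) x (frameTwo σ x)) + √(fac σ L j x) *
      (alpha σ L (j + 1) x (frameTwo σ x) - alpha σ L j x (frameTwo σ x))) * he
  · linear_combination -eps (j + 1) * k1 + √(fac σ L j x) * q1 -
      (fderiv ℝ (fun y => √(fac σ L j y)) x (frameTwo σ x) - √(fac σ L j x) *
      (fderiv ℝ (fun y => thetaOne σ y (frameTwo σ x)) x (frameOne σ x) - fderiv ℝ (fun y => thetaOne σ y (frameOne σ x)) x (frameTwo σ x)) + √(fac σ L j x) *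
      (alpha σ L (j + 1) x (frameOne σ x) - alpha σ L j x (frameOne σ x))) * he

lemma fderiv_log_fac {j : ℕ} (hj : 1 ≤ j) (hjm : j ≤ m) {x : Plane} (h : NonDeg σ L (j + 1) x) :
    fderiv ℝ (fun y => Real.log (fac σ L j y)) x (frameOne σ x) = 2 *
      (alpha σ L (j + 1) x (frameTwo σ x) - alpha σ L j x (frameTwo σ x)
        - alpha σ L 1 x (frameTwo σ x)) ∧
    fderiv ℝ (fun y => Real.log (fac σ L j y)) x (frameTwo σ x) = -(2 *
      (alpha σ L (j + 1) x (frameOne σ x) - alpha σ L j x (frameOne σ x)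
        - alpha σ L 1 x (frameOne σ x))) := by
  have hpos : 0 < fac σ L j x := lt_of_le_of_ne (hσ.fac_nonneg hdiv hj (by omega) x)
    (h j hj (by omega)).symm
  have hs : DifferentiableAt ℝ (fun y => √(fac σ L j y)) x :=
    (((hσ.contDiff_fac hdiv hj (by omega)).contDiffAt (x := x)).sqrt hpos.ne').differentiableAt
      (by simp)
  have hs0 : √(fac σ L j x) ≠ 0 := (Real.sqrt_pos.2 hpos).ne'
  have e : (fun y => Real.log (fac σ L j y)) = fun y => 2 * Real.log (√(fac σ L j y)) := by
    funext y
    rw [Real.log_sqrt (hσ.fac_nonneg hdiv hj (by omega) y)]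
    ring
  obtain ⟨h1, h2⟩ := hσ.fderiv_sqrt_fac hdiv hj hjm h
  have e2 : ∀ v, fderiv ℝ (fun y => Real.log (fac σ L j y)) x v
      = 2 * ((√(fac σ L j x))⁻¹ * fderiv ℝ (fun y => √(fac σ L j y)) x v) := by
    intro v
    rw [e, fderiv_const_mul (hs.log hs0), fderiv.log hs hs0]
    simp
  rw [e2, e2, h1, h2]
  constructor <;> field_simp

end IsIsotropicPAlternating
end ParaHyp
end

noncomputable section
namespace ParaHyp

open Filter Topology

lemma fderiv_fderiv_comm_real {f : Plane → ℝ} {x : Plane} (hf : ContDiffAt ℝ ∞ f x) (v w : Plane) :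
    fderiv ℝ (fun y => fderiv ℝ f y v) x w = fderiv ℝ (fun y => fderiv ℝ f y w) x v := by
  have hd : DifferentiableAt ℝ (fderiv ℝ f) x :=
    (hf.fderiv_right (m := 1) (by rw [one_add_one_eq_two]; exact two_le_smooth)).differentiableAt
      (by simp)
  have h := hf.isSymmSndFDerivAt (by simpa using two_le_smooth)
  rw [fderiv_clm_apply hd (differentiableAt_const _), fderiv_clm_apply hd (differentiableAt_const _)]
  simpa using (h.eq v w).symm

lemma differentiableAt_fderiv_real {f : Plane → ℝ} {x : Plane} (hf : ContDiffAt ℝ ∞ f x)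
    (v : Plane) : DifferentiableAt ℝ (fun y => fderiv ℝ f y v) x :=
  ((hf.fderiv_right (m := 1) (by rw [one_add_one_eq_two]; exact two_le_smooth)).differentiableAt
      (by simp)).clm_apply (differentiableAt_const _)

/-- The change of a connection form under a rotation by an improper orthogonal matrix. -/
lemma extDeriv_rotation {c s : Plane → ℝ} {β : Plane → Plane → ℝ} {x : Plane}
    (hc : ContDiffAt ℝ ∞ c x) (hs : ContDiffAt ℝ ∞ s x)
    (hcs : ∀ᶠ y in 𝓝 x, c y * c y + s y * s y = 1)
    (hβ : ∀ v, DifferentiableAt ℝ (fun y => β y v) x) (a b : Plane) :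
    extDeriv (fun y v => s y * fderiv ℝ c y v - c y * fderiv ℝ s y v - β y v) x a b
      = -extDeriv β x a b := by
  have dc : DifferentiableAt ℝ c x := hc.differentiableAt (by simp)
  have ds : DifferentiableAt ℝ s x := hs.differentiableAt (by simp)
  have hd : ∀ v w, fderiv ℝ (fun y => s y * fderiv ℝ c y v - c y * fderiv ℝ s y v - β y v) x w
      = s x * fderiv ℝ (fun y => fderiv ℝ c y v) x w + fderiv ℝ c x v * fderiv ℝ s x w
        - (c x * fderiv ℝ (fun y => fderiv ℝ s y v) x w + fderiv ℝ s x v * fderiv ℝ c x w)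
        - fderiv ℝ (fun y => β y v) x w := by
    intro v w
    have d1 := differentiableAt_fderiv_real hc v
    have d2 := differentiableAt_fderiv_real hs v
    rw [fderiv_fun_sub ((ds.fun_mul d1).fun_sub (dc.fun_mul d2)) (hβ v),
      fderiv_fun_sub (ds.fun_mul d1) (dc.fun_mul d2), fderiv_fun_mul ds d1, fderiv_fun_mul dc d2]
    rfl
  have hz : ∀ v, c x * fderiv ℝ c x v + s x * fderiv ℝ s x v = 0 := by
    intro v
    have e : (fun y => c y * c y + s y * s y) =ᶠ[𝓝 x] fun _ => (1 : ℝ) := hcs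
    have h1 := congrArg (fun φ : Plane →L[ℝ] ℝ => φ v) e.fderiv_eq
    rw [fderiv_fun_add (dc.fun_mul dc) (ds.fun_mul ds), fderiv_fun_mul dc dc,
      fderiv_fun_mul ds ds] at h1
    simp at h1
    linarith
  have h1 := hcs.self_of_nhds
  rw [extDeriv, extDeriv, hd, hd, fderiv_fderiv_comm_real hc a b, fderiv_fderiv_comm_real hs a b]
  have ha := hz a
  have hb := hz b
  linear_combination (2 * fderiv ℝ s x a * fderiv ℝ c x b - 2 * fderiv ℝ s x b * fderiv ℝ c x a) *
    (-h1) + 2 * (c x * fderiv ℝ s x a - s x * fderiv ℝ c x a) * hb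
      - 2 * (c x * fderiv ℝ s x b - s x * fderiv ℝ c x b) * ha

namespace IsIsotropicPAlternating

variable {m : ℕ} {σ : Plane → Mat (2 * m)} {L : ℕ → Plane → Submodule ℝ (Mat (2 * m))}
  (hσ : IsIsotropicPAlternating σ L)
include hσ

lemma connForm_middle_symm (hm : 1 ≤ m) {x : Plane} (v : Plane) {Y Z : Mat (2 * m)}
    (hY : Y ∈ L m x) (hZ : Z ∈ L m x) :
    metric (connForm L (m + 1) m x v Y) (paraCx (σ x) Z)
      = metric (connForm L (m + 1) m x v Z) (paraCx (σ x) Y) := by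
  have h0 : m ∈ Finset.Icc 1 (2 * m) := by rw [Finset.mem_Icc]; omega
  have h1 : m + 1 ∈ Finset.Icc 1 (2 * m) := by rw [Finset.mem_Icc]; omega
  have e1 : 2 * m + 1 - m = m + 1 := by omega
  have e2 : 2 * m + 1 - (m + 1) = m := by omega
  have hPZ := hσ.paraCx_mem h0 hZ
  have hc := hσ.connForm_paraCx h1 h0 (by omega) v hZ
  rw [e1] at hPZ hc
  rw [e2] at hc
  rw [hσ.connForm_adjoint h1 h0 (by omega) v hY hPZ, hc, ← metric_paraCx_left, metric_comm]

variable (hdiv : DivisorCondition σ L)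
include hdiv

/-- The adapted frame of `ℒ_{m+1}` in terms of the image under `P` of that of `ℒ_m`. -/
lemma ad_middle (hm : 1 ≤ m) {x : Plane} (h : NonDeg σ L (m + 1) x) :
    ∃ c s : ℝ, c = eps (m + 1) * metric (adU σ L (m + 1) x) (paraCx (σ x) (adU σ L m x)) ∧
      s = eps (m + 1) * metric (adU σ L (m + 1) x) (paraCx (σ x) (adV σ L m x)) ∧
      c * c + s * s = 1 ∧
      adU σ L (m + 1) x = c • paraCx (σ x) (adU σ L m x) + s • paraCx (σ x) (adV σ L m x) ∧
      adV σ L (m + 1) x = s • paraCx (σ x) (adU σ L m x) - c • paraCx (σ x) (adV σ L m x) := by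
  have h0 : m ∈ Finset.Icc 1 (2 * m) := by rw [Finset.mem_Icc]; omega
  have h1 : m + 1 ∈ Finset.Icc 1 (2 * m) := by rw [Finset.mem_Icc]; omega
  have hf := hσ.ad_frame hdiv hm (by omega) hm (h.mono (k := m) (by omega))
  have hf' := hσ.ad_frame hdiv (by omega) le_rfl hm h
  have hd := hσ.defPlane h1 x
  have e1 : 2 * m + 1 - m = m + 1 := by omega
  have mp := hσ.paraCx_mem h0 hf.mem_left
  have mq := hσ.paraCx_mem h0 hf.mem_right
  rw [e1] at mp mq
  have tu := hσ.le_tangent h0 x hf.mem_left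
  have tv := hσ.le_tangent h0 x hf.mem_right
  have hF : IsFrame (L (m + 1) x) (eps (m + 1)) (paraCx (σ x) (adU σ L m x))
      (paraCx (σ x) (adV σ L m x)) := by
    refine isFrame_of_ortho hd mp mq ?_ ?_ ?_
    · rw [metric_paraCx_paraCx (hσ.idem x) tu, hf.left, eps_succ]
    · rw [metric_paraCx_paraCx (hσ.idem x) tv, hf.right, eps_succ]
    · rw [metric_paraCx_paraCx (hσ.idem x) tv, hf.ortho, neg_zero]
  have hU := hF.orthProj_eq hd (adU σ L (m + 1) x)
  have hV := hF.orthProj_eq hd (adV σ L (m + 1) x)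
  rw [orthProj_of_mem hd hf'.mem_left] at hU
  rw [orthProj_of_mem hd hf'.mem_right] at hV
  have hUU := hF.metric_eq hf'.mem_left (adU σ L (m + 1) x)
  rw [hf'.left] at hUU
  have sym1 : metric (adV σ L (m + 1) x) (paraCx (σ x) (adU σ L m x))
      = metric (adU σ L (m + 1) x) (paraCx (σ x) (adV σ L m x)) := by
    rw [adU_succ hm, adV_succ hm, metric_smul_left, metric_smul_left,
      hσ.connForm_middle_symm hm _ hf.mem_left hf.mem_right]
  have sym2 : metric (adV σ L (m + 1) x) (paraCx (σ x) (adV σ L m x))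
      = -metric (adU σ L (m + 1) x) (paraCx (σ x) (adU σ L m x)) := by
    have h2 := hσ.ad_comm hdiv hm le_rfl (h.mono (k := m) (by omega))
    rw [adU_succ hm, adV_succ hm, metric_smul_left, metric_smul_left, ← h2.1,
      hσ.connForm_middle_symm hm _ hf.mem_left hf.mem_right, h2.2, metric_neg_left]
    ring
  have he := eps_mul_self (m + 1)
  refine ⟨_, _, rfl, rfl, ?_, hU, ?_⟩
  · linear_combination (metric (adU σ L (m + 1) x) (paraCx (σ x) (adU σ L m x)) * metric (adU σ L (m + 1) x) (paraCx (σ x) (adU σ L m x)) + metric (adU σ L (m + 1) x) (paraCx (σ x) (adV σ L m x)) * metric (adU σ L (m + 1) x) (paraCx (σ x) (adV σ L m x))) * he - hUU + he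
  · rw [sym1, sym2] at hV
    rw [sub_eq_add_neg, ← neg_smul, ← mul_neg]
    exact hV

/-- The structure equation for the connection form of `ℒ_{m+1}`. -/
lemma extDeriv_alpha_middle (hm : 1 ≤ m) {x : Plane} (h : NonDeg σ L (m + 1) x) (a b : Plane) :
    extDeriv (alpha σ L (m + 1)) x a b = -extDeriv (alpha σ L m) x a b := by
  have h0 : m ∈ Finset.Icc 1 (2 * m) := by rw [Finset.mem_Icc]; omega
  have h1 : m + 1 ∈ Finset.Icc 1 (2 * m) := by rw [Finset.mem_Icc]; omega
  have e1 : 2 * m + 1 - m = m + 1 := by omega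
  set c : Plane → ℝ := fun y =>
    eps (m + 1) * metric (adU σ L (m + 1) y) (paraCx (σ y) (adU σ L m y)) with hc
  set s : Plane → ℝ := fun y =>
    eps (m + 1) * metric (adU σ L (m + 1) y) (paraCx (σ y) (adV σ L m y)) with hs
  have hev := hσ.nonDeg_eventually hdiv (by omega) h
  have hmid : ∀ᶠ y in 𝓝 x, c y * c y + s y * s y = 1 ∧
      adU σ L (m + 1) y = c y • paraCx (σ y) (adU σ L m y) + s y • paraCx (σ y) (adV σ L m y) ∧
      adV σ L (m + 1) y = s y • paraCx (σ y) (adU σ L m y) - c y • paraCx (σ y) (adV σ L m y) := by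
    filter_upwards [hev] with y hy
    obtain ⟨c', s', rfl, rfl, h3⟩ := hσ.ad_middle hdiv hm hy
    exact h3
  have hsec : ∀ y, NonDeg σ L (m + 1) y → LocSec (L (m + 1)) (fun y => paraCx (σ y) (adU σ L m y)) y ∧
      LocSec (L (m + 1)) (fun y => paraCx (σ y) (adV σ L m y)) y := by
    intro y hy
    obtain ⟨hu, hv⟩ := hσ.ad_locSec hdiv hm (by omega) hm (hy.mono (k := m) (by omega))
    have h2 := hσ.locSec_paraCx h0 hu
    have h3 := hσ.locSec_paraCx h0 hv
    rw [e1] at h2 h3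
    exact ⟨h2, h3⟩
  have hcs : ∀ y, NonDeg σ L (m + 1) y → ContDiffAt ℝ ∞ c y ∧ ContDiffAt ℝ ∞ s y := by
    intro y hy
    obtain ⟨hu, -⟩ := hσ.ad_locSec hdiv (j := m + 1) (by omega) (by omega) hm hy
    exact ⟨contDiffAt_const.mul (contDiffAt_metric hu.smooth (hsec y hy).1.smooth),
      contDiffAt_const.mul (contDiffAt_metric hu.smooth (hsec y hy).2.smooth)⟩
  have key : ∀ᶠ y in 𝓝 x, ∀ v, alpha σ L (m + 1) y v
      = s y * fderiv ℝ c y v - c y * fderiv ℝ s y v - alpha σ L m y v := by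
    filter_upwards [hev, hmid.eventually_nhds] with y hy hmy v
    have hnd : NonDeg σ L m y := hy.mono (by omega)
    obtain ⟨hu, hv⟩ := hσ.ad_locSec hdiv hm (by omega) hm hnd
    have hf := hσ.ad_frame hdiv hm (by omega) hm hnd
    have tu := hσ.le_tangent h0 y hf.mem_left
    have tv := hσ.le_tangent h0 y hf.mem_right
    obtain ⟨hp, hq⟩ := hsec y hy
    obtain ⟨dc, ds⟩ := hcs y hy
    have dc := dc.differentiableAt (n := ∞) (by simp)
    have ds := ds.differentiableAt (n := ∞) (by simp)
    have hdU : fderiv ℝ (adU σ L (m + 1)) y v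
        = (fderiv ℝ c y v • paraCx (σ y) (adU σ L m y)
            + c y • fderiv ℝ (fun y => paraCx (σ y) (adU σ L m y)) y v)
          + (fderiv ℝ s y v • paraCx (σ y) (adV σ L m y)
            + s y • fderiv ℝ (fun y => paraCx (σ y) (adV σ L m y)) y v) := by
      rw [fderiv_congr_mat (hmy.mono fun z hz => hz.2.1) v,
        fderiv_add_mat (differentiableAt_smul_mat dc hp.diff) (differentiableAt_smul_mat ds hq.diff),
        fderiv_smul_mat dc hp.diff, fderiv_smul_mat ds hq.diff]
    have hP : ∀ {ν : Plane → Mat (2 * m)}, LocSec (L m) ν y → ∀ {Z}, Z ∈ L m y →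
        metric (fderiv ℝ (fun y => paraCx (σ y) (ν y)) y v) (paraCx (σ y) Z)
          = -metric (fderiv ℝ ν y v) Z := by
      intro ν hν Z hZ
      have tZ := hσ.le_tangent h0 y hZ
      rw [← metric_tanProj_left (hσ.idem y) (ParaHyp.paraCx_mem (hσ.idem y) tZ),
        tanProj_fderiv_paraCx (hσ.diff y) (Eventually.of_forall hσ.idem) hν.diff
          (hσ.le_tangent h0 y hν.mem_self), metric_paraCx_paraCx (hσ.idem y) tZ,
        metric_tanProj_left (hσ.idem y) tZ]
    obtain ⟨g1, g2, g3⟩ := hσ.metric_fderiv_ad hdiv hm (by omega) hm hnd v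
    have hPP : metric (paraCx (σ y) (adU σ L m y)) (paraCx (σ y) (adU σ L m y)) = -eps m := by
      rw [metric_paraCx_paraCx (hσ.idem y) tu, hf.left]
    have hQQ : metric (paraCx (σ y) (adV σ L m y)) (paraCx (σ y) (adV σ L m y)) = -eps m := by
      rw [metric_paraCx_paraCx (hσ.idem y) tv, hf.right]
    have hPQ : metric (paraCx (σ y) (adU σ L m y)) (paraCx (σ y) (adV σ L m y)) = 0 := by
      rw [metric_paraCx_paraCx (hσ.idem y) tv, hf.ortho, neg_zero]
    rw [alpha, alpha, hdU, hmy.self_of_nhds.2.2]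
    simp only [metric_add_left, metric_sub_right, metric_smul_left, metric_smul_right,
      hP hu hf.mem_left, hP hu hf.mem_right, hP hv hf.mem_left, hP hv hf.mem_right, g1, g2, g3, hPP,
      hQQ, hPQ, metric_comm (paraCx (σ y) (adV σ L m y)) (paraCx (σ y) (adU σ L m y)), eps_succ]
    have he := eps_mul_self m
    have h5 := hmy.self_of_nhds.1
    linear_combination (s y * fderiv ℝ c y v - c y * fderiv ℝ s y v) * he
      - eps m * metric (fderiv ℝ (adU σ L m) y v) (adV σ L m y) * h5
  rw [extDeriv_congr key]
  exact extDeriv_rotation (hcs x h).1 (hcs x h).2 (hmid.mono fun y hy => hy.1)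
    (hσ.differentiableAt_alpha hdiv hm (by omega) hm (h.mono (by omega))) a b

end IsIsotropicPAlternating
end ParaHyp
end

noncomputable section
namespace ParaHyp

open Filter Topology

lemma extDeriv_sum {ι : Type*} (S : Finset ι) (c : ι → ℝ) (β : ι → Plane → Plane → ℝ) {x : Plane}
    (hβ : ∀ i ∈ S, ∀ v, DifferentiableAt ℝ (fun y => β i y v) x) (a b : Plane) :
    extDeriv (fun y v => ∑ i ∈ S, c i * β i y v) x a b = ∑ i ∈ S, c i * extDeriv (β i) x a b := by
  have h : ∀ v w, fderiv ℝ (fun y => ∑ i ∈ S, c i * β i y v) x w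
      = ∑ i ∈ S, c i * fderiv ℝ (fun y => β i y v) x w := by
    intro v w
    rw [fderiv_fun_sum fun i hi => (hβ i hi v).const_mul _, sum_apply]
    refine Finset.sum_congr rfl fun i hi => ?_
    rw [fderiv_const_mul (hβ i hi v)]
    rfl
  rw [extDeriv, h, h, ← Finset.sum_sub_distrib]
  exact Finset.sum_congr rfl fun i _ => by rw [extDeriv]; ring

lemma extDeriv_combination {α β γ : Plane → Plane → ℝ} {x : Plane}
    (hα : ∀ v, DifferentiableAt ℝ (fun y => α y v) x)
    (hβ : ∀ v, DifferentiableAt ℝ (fun y => β y v) x)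
    (hγ : ∀ v, DifferentiableAt ℝ (fun y => γ y v) x) (a b : Plane) :
    extDeriv (fun y v => 2 * (α y v - 2 * β y v + γ y v)) x a b
      = 2 * (extDeriv α x a b - 2 * extDeriv β x a b + extDeriv γ x a b) := by
  have h : ∀ v w, fderiv ℝ (fun y => 2 * (α y v - 2 * β y v + γ y v)) x w
      = 2 * (fderiv ℝ (fun y => α y v) x w - 2 * fderiv ℝ (fun y => β y v) x w
        + fderiv ℝ (fun y => γ y v) x w) := by
    intro v w
    rw [fderiv_const_mul (((hα v).fun_sub ((hβ v).const_mul 2)).fun_add (hγ v)),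
      fderiv_fun_add ((hα v).fun_sub ((hβ v).const_mul 2)) (hγ v),
      fderiv_fun_sub (hα v) ((hβ v).const_mul 2), fderiv_const_mul (hβ v)]
    rfl
  rw [extDeriv, h, h, extDeriv, extDeriv, extDeriv]
  ring

lemma alpha_zero {n : ℕ} {σ : Plane → Mat n} {L : ℕ → Plane → Submodule ℝ (Mat n)} (x v : Plane) :
    alpha σ L 0 x v = 0 := by
  rw [alpha, show adV σ L 0 x = 0 from rfl, metric_zero_right, mul_zero]

namespace IsIsotropicPAlternating

variable {m : ℕ} {σ : Plane → Mat (2 * m)} {L : ℕ → Plane → Submodule ℝ (Mat (2 * m))}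
  (hσ : IsIsotropicPAlternating σ L)
include hσ

lemma alpha_expand (hm : 1 ≤ m) (j : ℕ) (x v : Plane) : alpha σ L j x v
    = thetaOne σ x v * alpha σ L j x (frameOne σ x)
      + thetaTwo σ x v * alpha σ L j x (frameTwo σ x) := by
  have h : fderiv ℝ (adU σ L j) x v = thetaOne σ x v • fderiv ℝ (adU σ L j) x (frameOne σ x)
      + thetaTwo σ x v • fderiv ℝ (adU σ L j) x (frameTwo σ x) := by
    conv_lhs => rw [(hσ.isTanFrame hm x).expand v]
    refine ((fderiv ℝ (adU σ L j) x).map_add _ _).trans ?_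
    exact congrArg₂ (· + ·) ((fderiv ℝ (adU σ L j) x).map_smul _ _)
      ((fderiv ℝ (adU σ L j) x).map_smul _ _)
  rw [alpha, alpha, alpha, h, metric_add_left, metric_smul_left, metric_smul_left]
  ring

variable (hdiv : DivisorCondition σ L)
include hdiv

lemma fderiv_log_fac₀ (hm : 1 ≤ m) {j : ℕ} (hjm : j ≤ m) {x : Plane} (h : NonDeg σ L (j + 1) x) :
    fderiv ℝ (fun y => Real.log (fac₀ σ L j y)) x (frameOne σ x) = 2 *
      (alpha σ L (j + 1) x (frameTwo σ x) - alpha σ L j x (frameTwo σ x)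
        - alpha σ L 1 x (frameTwo σ x)) ∧
    fderiv ℝ (fun y => Real.log (fac₀ σ L j y)) x (frameTwo σ x) = -(2 *
      (alpha σ L (j + 1) x (frameOne σ x) - alpha σ L j x (frameOne σ x)
        - alpha σ L 1 x (frameOne σ x))) := by
  rcases Nat.eq_zero_or_pos j with rfl | hj
  · simp [fac₀, alpha_zero]
  · simp only [fac₀_of_pos hj]
    exact hσ.fderiv_log_fac hdiv hj hjm h

lemma differentiableAt_alpha' (hm : 1 ≤ m) {j : ℕ} (hjm : j ≤ m + 1) {x : Plane}
    (h : NonDeg σ L j x) (v : Plane) : DifferentiableAt ℝ (fun y => alpha σ L j y v) x := by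
  rcases Nat.eq_zero_or_pos j with rfl | hj
  · simp only [alpha_zero]
    exact differentiableAt_const _
  · exact hσ.differentiableAt_alpha hdiv hj hjm hm h v

lemma fac₀_pos_of_ratio {j : ℕ} (hj : 1 ≤ j) (hjm : j ≤ m) {x : Plane} (h : 1 < ratio σ L j x) :
    0 < fac₀ σ L j x ∧ 0 < fac₀ σ L (j - 1) x ∧ fac₀ σ L (j - 1) x < fac₀ σ L j x ∧
      NonDeg σ L (j + 1) x := by
  have h1 := hσ.fac₀_nonneg hdiv (i := j - 1) (by omega) x
  have h2 : 0 < fac₀ σ L (j - 1) x := by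
    refine lt_of_le_of_ne h1 fun h0 => ?_
    rw [ratio, ← h0, div_zero] at h
    linarith
  have h3 : fac₀ σ L (j - 1) x < fac₀ σ L j x := by
    rw [ratio, one_lt_div h2] at h
    exact h
  refine ⟨h2.trans h3, h2, h3, fun i hi hij h0 => ?_⟩
  have : ∀ k, i ≤ k → k ≤ j → fac₀ σ L k x = 0 := by
    intro k hk
    induction k, hk using Nat.le_induction with
    | base => intro _; rw [fac₀_of_pos hi, h0]
    | succ k hk ih => intro hkj; exact hσ.fac₀_succ_eq_zero hdiv (by omega) (ih (by omega))
  linarith [this j (by omega) le_rfl]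

/-- At a maximum point of a suitable function no quotient of consecutive factors exceeds `1`. -/
lemma ratio_le_one_of_max (hm : 1 ≤ m) {p : Plane}
    (hp : ∀ x, ∑ J ∈ Finset.Icc 1 m, (J * ((2 * m + 2 : ℝ) - J)) * Real.log (max 1 (ratio σ L J x))
      ≤ ∑ J ∈ Finset.Icc 1 m, (J * ((2 * m + 2 : ℝ) - J)) * Real.log (max 1 (ratio σ L J p))) :
    ∀ J ∈ Finset.Icc 1 m, ratio σ L J p ≤ 1 := by
  classical
  by_contra! hcon
  obtain ⟨J₀, hJ₀, hJ₀'⟩ := hcon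
  set S := (Finset.Icc 1 m).filter fun J => 1 < ratio σ L J p with hS
  have hSsub : S ⊆ Finset.Icc 1 m := Finset.filter_subset _ _
  have hSm : ∀ J ∈ S, 1 ≤ J ∧ J ≤ m := fun J hJ => Finset.mem_Icc.1 (hSsub hJ)
  have hSr : ∀ J ∈ S, 1 < ratio σ L J p := fun J hJ => (Finset.mem_filter.1 hJ).2
  set lam : ℕ → ℝ := fun J => J * ((2 * m + 2 : ℝ) - J) with hlam
  have hlam0 : ∀ J ∈ Finset.Icc 1 m, 0 ≤ lam J := fun J hJ => by
    rw [Finset.mem_Icc] at hJ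
    have h2 : (J : ℝ) ≤ m := by exact_mod_cast hJ.2
    exact mul_nonneg (by positivity) (by linarith [(Nat.cast_nonneg m : (0 : ℝ) ≤ m)])
  have hev : ∀ᶠ y in 𝓝 p, ∀ J ∈ S, 1 < ratio σ L J y :=
    (eventually_all_finset S).2 fun J hJ =>
      (hσ.continuous_ratio hdiv (hSm J hJ).1 (hSm J hJ).2).continuousAt.eventually_const_lt (hSr J hJ)
  have hspec : ∀ᶠ y in 𝓝 p, ∀ J ∈ S, 0 < fac₀ σ L J y ∧ 0 < fac₀ σ L (J - 1) y ∧
      fac₀ σ L (J - 1) y < fac₀ σ L J y ∧ NonDeg σ L (J + 1) y :=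
    hev.mono fun y hy J hJ => hσ.fac₀_pos_of_ratio hdiv (hSm J hJ).1 (hSm J hJ).2 (hy J hJ)
  have hspecp := hspec.self_of_nhds
  set φ : Plane → ℝ := fun y => ∑ J ∈ S,
    lam J * (Real.log (fac₀ σ L J y) - Real.log (fac₀ σ L (J - 1) y)) with hφ
  have hlogr : ∀ y, (∀ J ∈ S, 1 < ratio σ L J y) →
      φ y = ∑ J ∈ S, lam J * Real.log (max 1 (ratio σ L J y)) := by
    intro y hy
    refine Finset.sum_congr rfl fun J hJ => ?_
    obtain ⟨h1, h2, -⟩ := hσ.fac₀_pos_of_ratio hdiv (hSm J hJ).1 (hSm J hJ).2 (hy J hJ)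
    rw [max_eq_right (hy J hJ).le, ratio, Real.log_div h1.ne' h2.ne']
  have hmax : IsLocalMax φ p := by
    filter_upwards [hev] with y hy
    rw [hlogr y hy, hlogr p hSr]
    calc ∑ J ∈ S, lam J * Real.log (max 1 (ratio σ L J y))
        ≤ ∑ J ∈ Finset.Icc 1 m, lam J * Real.log (max 1 (ratio σ L J y)) :=
          Finset.sum_le_sum_of_subset_of_nonneg hSsub fun J hJ _ =>
            mul_nonneg (hlam0 J hJ) (Real.log_nonneg (le_max_left _ _))
      _ ≤ ∑ J ∈ Finset.Icc 1 m, lam J * Real.log (max 1 (ratio σ L J p)) := hp y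
      _ = ∑ J ∈ S, lam J * Real.log (max 1 (ratio σ L J p)) := by
          refine (Finset.sum_subset hSsub fun J hJ hJS => ?_).symm
          have : ratio σ L J p ≤ 1 := by
            by_contra! h
            exact hJS (Finset.mem_filter.2 ⟨hJ, h⟩)
          rw [max_eq_left this, Real.log_one, mul_zero]
  have hlogsmooth : ∀ {J y}, J ≤ m → 0 < fac₀ σ L J y →
      ContDiffAt ℝ ∞ (fun y => Real.log (fac₀ σ L J y)) y := fun hJ h =>
    (hσ.contDiff_fac₀ hdiv (by omega)).contDiffAt.log h.ne'
  have hφs : ContDiffAt ℝ ∞ φ p := by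
    refine ContDiffAt.sum fun J hJ => contDiffAt_const.mul ((hlogsmooth (hSm J hJ).2 (hspecp J hJ).1).sub
      (hlogsmooth ?_ (hspecp J hJ).2.1))
    have := hSm J hJ; omega
  set Ξ : Plane → Plane → ℝ := fun y v => ∑ J ∈ S, lam J *
    (2 * (alpha σ L (J + 1) y v - 2 * alpha σ L J y v + alpha σ L (J - 1) y v)) with hΞ
  have hdφ : ∀ᶠ y in 𝓝 p, fderiv ℝ φ y (frameOne σ y) = Ξ y (frameTwo σ y) ∧
      fderiv ℝ φ y (frameTwo σ y) = -Ξ y (frameOne σ y) := by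
    filter_upwards [hspec] with y hy
    have hd : ∀ J ∈ S, DifferentiableAt ℝ (fun y => Real.log (fac₀ σ L J y)) y ∧
        DifferentiableAt ℝ (fun y => Real.log (fac₀ σ L (J - 1) y)) y := fun J hJ =>
      ⟨(hlogsmooth (hSm J hJ).2 (hy J hJ).1).differentiableAt (by simp),
        (hlogsmooth (by have := hSm J hJ; omega) (hy J hJ).2.1).differentiableAt (by simp)⟩
    have e : ∀ v, fderiv ℝ φ y v = ∑ J ∈ S, lam J *
        (fderiv ℝ (fun y => Real.log (fac₀ σ L J y)) y v
          - fderiv ℝ (fun y => Real.log (fac₀ σ L (J - 1) y)) y v) := by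
      intro v
      rw [hφ, fderiv_fun_sum fun J hJ => ((hd J hJ).1.fun_sub (hd J hJ).2).const_mul _,
        sum_apply]
      refine Finset.sum_congr rfl fun J hJ => ?_
      rw [fderiv_const_mul ((hd J hJ).1.fun_sub (hd J hJ).2), fderiv_fun_sub (hd J hJ).1 (hd J hJ).2]
      rfl
    have hl : ∀ J ∈ S, _ ∧ _ := fun J hJ =>
      hσ.fderiv_log_fac₀ hdiv hm (hSm J hJ).2 (hy J hJ).2.2.2
    have hl' : ∀ J ∈ S, _ ∧ _ := fun J hJ =>
      hσ.fderiv_log_fac₀ hdiv hm (j := J - 1) (by have := hSm J hJ; omega)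
        ((hy J hJ).2.2.2.mono (by omega))
    rw [e, e, hΞ, ← Finset.sum_neg_distrib]
    constructor
    · refine Finset.sum_congr rfl fun J hJ => ?_
      have hJ1 : J - 1 + 1 = J := Nat.sub_add_cancel (hSm J hJ).1
      have h2 := (hl' J hJ).1
      rw [hJ1] at h2
      rw [(hl J hJ).1, h2]
      ring
    · refine Finset.sum_congr rfl fun J hJ => ?_
      have hJ1 : J - 1 + 1 = J := Nat.sub_add_cancel (hSm J hJ).1
      have h2 := (hl' J hJ).2
      rw [hJ1] at h2
      rw [(hl J hJ).2, h2]
      ring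
  have hle := extDeriv_nonpos_of_isLocalMax hφs hmax (X₁ := frameOne σ) (X₂ := frameTwo σ)
    (θ₁ := thetaOne σ) (θ₂ := thetaTwo σ) (Ξ := Ξ)
    ((hσ.contDiff_frameOne hm).differentiable (by simp) p)
    ((hσ.contDiff_frameTwo hm).differentiable (by simp) p)
    (fun v => (hσ.contDiff_theta hm v).1.differentiable (by simp) p)
    (fun v => (hσ.contDiff_theta hm v).2.differentiable (by simp) p)
    (hσ.theta_frameOne hm p).1 (hσ.theta_frameTwo hm p).1
    (hσ.theta_frameOne hm p).2 (hσ.theta_frameTwo hm p).2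
    (Eventually.of_forall fun y v => by
      simp only [hΞ, Finset.mul_sum, ← Finset.sum_add_distrib]
      refine Finset.sum_congr rfl fun J _ => ?_
      rw [hσ.alpha_expand hm (J + 1) y v, hσ.alpha_expand hm J y v, hσ.alpha_expand hm (J - 1) y v]
      ring)
    (hdφ.mono fun y hy => hy.1) (hdφ.mono fun y hy => hy.2)
  have hda : ∀ J ∈ S, ∀ K, K ≤ J + 1 → ∀ v, DifferentiableAt ℝ (fun y => alpha σ L K y v) p :=
    fun J hJ K hK => hσ.differentiableAt_alpha' hdiv hm (by have := hSm J hJ; omega)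
      ((hspecp J hJ).2.2.2.mono hK)
  rw [hΞ, extDeriv_sum S lam (fun J y v =>
      2 * (alpha σ L (J + 1) y v - 2 * alpha σ L J y v + alpha σ L (J - 1) y v))
    (fun J hJ v => ((((hda J hJ _ le_rfl v).fun_sub ((hda J hJ _ (by omega) v).const_mul 2)).fun_add
      (hda J hJ _ (by omega) v)).const_mul 2))] at hle
  set x : ℕ → ℝ := fun K => if K = 0 then 0 else
    if K = m + 1 then fac₀ σ L (m - 1) p - fac₀ σ L m p else fac₀ σ L K p - fac₀ σ L (K - 1) p with hx
  have hxm : ∀ K, 1 ≤ K → K ≤ m → x K = fac₀ σ L K p - fac₀ σ L (K - 1) p := fun K h1 h2 => by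
    rw [hx]
    simp only
    rw [if_neg (by omega), if_neg (by omega)]
  have hx1 : x (m + 1) = -x m := by
    rw [hxm m hm le_rfl, hx]
    simp
  have harea : areaForm σ p (frameOne σ p) (frameTwo σ p) = 1 := by
    rw [areaForm, (hσ.theta_frameOne hm p).1, (hσ.theta_frameTwo hm p).1,
      (hσ.theta_frameOne hm p).2, (hσ.theta_frameTwo hm p).2]
    ring
  have hext : ∀ J ∈ S, ∀ K, K ≤ J + 1 →
      extDeriv (alpha σ L K) p (frameOne σ p) (frameTwo σ p) = -2 * x K := by
    intro J hJ K hK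
    have hnd : NonDeg σ L K p := (hspecp J hJ).2.2.2.mono hK
    have hJm := hSm J hJ
    rcases Nat.eq_zero_or_pos K with rfl | hK0
    · have : x 0 = 0 := by rw [hx]; simp
      rw [this, extDeriv]
      simp [alpha_zero]
    · by_cases hKm : K ≤ m
      · rw [hσ.extDeriv_alpha hdiv hK0 hKm hnd, harea, hxm K hK0 hKm]
        ring
      · have : K = m + 1 := by omega
        subst this
        rw [hσ.extDeriv_alpha_middle hdiv hm hnd, hx1,
          hσ.extDeriv_alpha hdiv hm le_rfl (hnd.mono (by omega)), harea, hxm m hm le_rfl]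
        ring
  have hsum : ∑ J ∈ S, lam J * extDeriv (fun y v =>
      2 * (alpha σ L (J + 1) y v - 2 * alpha σ L J y v + alpha σ L (J - 1) y v)) p
        (frameOne σ p) (frameTwo σ p)
      = 4 * ∑ J ∈ S, lam J * (2 * x J - x (J + 1) - x (J - 1)) := by
    rw [Finset.mul_sum]
    refine Finset.sum_congr rfl fun J hJ => ?_
    rw [extDeriv_combination (hda J hJ _ le_rfl) (hda J hJ _ (by omega)) (hda J hJ _ (by omega)),
      hext J hJ _ le_rfl, hext J hJ _ (by omega), hext J hJ _ (by omega)]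
    ring
  rw [hsum] at hle
  have hpos := toda_contradiction (m := m) (x := x) (by rw [hx]; simp) hx1 hSsub
    ⟨J₀, Finset.mem_filter.2 ⟨hJ₀, hJ₀'⟩⟩
    (fun J hJ => by
      rw [hxm J (hSm J hJ).1 (hSm J hJ).2]
      linarith [(hspecp J hJ).2.2.1])
    (fun J hJ hJS => by
      have hJm := Finset.mem_Icc.1 hJ
      rw [hxm J hJm.1 hJm.2]
      have h1 : ratio σ L J p ≤ 1 := by
        by_contra! h
        exact hJS (Finset.mem_filter.2 ⟨hJ, h⟩)
      rcases (hσ.fac₀_nonneg hdiv (i := J - 1) (by omega) p).eq_or_lt with h0 | h0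
      · have := hσ.fac₀_succ_eq_zero hdiv (i := J - 1) (by omega) h0.symm
        rw [Nat.sub_add_cancel hJm.1] at this
        rw [this, ← h0, sub_self]
      · rw [ratio, div_le_one h0] at h1
        linarith)
  linarith

/-- The conformal factors of a surface invariant under a cocompact group are bounded by `1 / 2`. -/
theorem fac_le_half (hm : 1 ≤ m) {Γ : Type*} [Group Γ] [MulAction Γ Plane] (hΓ : IsDeckAction Γ)
    (ρ : Γ →* Matrix.SpecialLinearGroup (Fin (2 * m + 1)) ℝ)
    (hρ : ∀ (γ : Γ) (x : Plane),
      σ (γ • x) = (ρ γ : Mat (2 * m)) * σ x * ((ρ γ)⁻¹ : Matrix.SpecialLinearGroup _ ℝ))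
    {i : ℕ} (hi : 1 ≤ i) (him : i + 1 ≤ 2 * m) (x : Plane) : fac σ L i x ≤ 1 / 2 := by
  have hinv : ∀ (γ : Γ) (J : ℕ), J ≤ m → ∀ x, ratio σ L J (γ • x) = ratio σ L J x := by
    intro γ J hJ x
    refine hσ.ratio_equivariant hdiv (A := (ρ γ : Mat (2 * m)))
      (B := ((ρ γ)⁻¹ : Matrix.SpecialLinearGroup _ ℝ)) ?_ ?_ (φ := fun x => γ • x) (hΓ.smooth γ)
      (fun x => hρ γ x) hJ x
    · rw [← Matrix.SpecialLinearGroup.coe_mul, mul_inv_cancel, Matrix.SpecialLinearGroup.coe_one]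
    · rw [← Matrix.SpecialLinearGroup.coe_mul, inv_mul_cancel, Matrix.SpecialLinearGroup.coe_one]
  set f : Plane → ℝ := fun x =>
    ∑ J ∈ Finset.Icc 1 m, (J * ((2 * m + 2 : ℝ) - J)) * Real.log (max 1 (ratio σ L J x)) with hf
  have hfc : Continuous f := by
    refine continuous_finsetSum _ fun J hJ => continuous_const.mul (Continuous.log ?_ fun x => ?_)
    · rw [Finset.mem_Icc] at hJ
      exact continuous_const.max (hσ.continuous_ratio hdiv hJ.1 hJ.2)
    · exact (lt_of_lt_of_le one_pos (le_max_left _ _)).ne'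
  obtain ⟨p, hp⟩ := exists_max_of_invariant hΓ.compact_quotient hfc fun γ x => by
    refine Finset.sum_congr rfl fun J hJ => ?_
    rw [hinv γ J (Finset.mem_Icc.1 hJ).2]
  have hfp := hσ.ratio_le_one_of_max hdiv hm hp
  have hw : ∀ J ∈ Finset.Icc 1 m, 0 < (J * ((2 * m + 2 : ℝ) - J)) := fun J hJ => by
    rw [Finset.mem_Icc] at hJ
    have h1 : (1 : ℝ) ≤ J := by exact_mod_cast hJ.1
    have h2 : (J : ℝ) ≤ m := by exact_mod_cast hJ.2
    exact mul_pos (by linarith) (by linarith)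
  have hratio : ∀ x, ∀ J ∈ Finset.Icc 1 m, ratio σ L J x ≤ 1 := by
    intro x
    have h0 : f p = 0 := Finset.sum_eq_zero fun J hJ => by
      rw [max_eq_left (hfp J hJ), Real.log_one, mul_zero]
    have hnn : ∀ J ∈ Finset.Icc 1 m,
        0 ≤ (J * ((2 * m + 2 : ℝ) - J)) * Real.log (max 1 (ratio σ L J x)) := fun J hJ =>
      mul_nonneg (hw J hJ).le (Real.log_nonneg (le_max_left _ _))
    have h1 : f x = 0 := le_antisymm (h0 ▸ hp x) (Finset.sum_nonneg hnn)
    intro J hJ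
    have h2 := (Finset.sum_eq_zero_iff_of_nonneg hnn).1 h1 J hJ
    by_contra! h3
    have := mul_pos (hw J hJ) (Real.log_pos (lt_of_lt_of_le h3 (le_max_right 1 _)))
    linarith
  have hfac₀ : ∀ J, J ≤ m → fac₀ σ L J x ≤ 1 / 2 := by
    intro J
    induction J with
    | zero => intro _; simp [fac₀]
    | succ J ih =>
      intro hJ
      refine le_trans ?_ (ih (by omega))
      have h1 := hratio x (J + 1) (Finset.mem_Icc.2 ⟨by omega, hJ⟩)
      rcases (hσ.fac₀_nonneg hdiv (i := J) (by omega) x).eq_or_lt with h0 | h0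
      · rw [hσ.fac₀_succ_eq_zero hdiv (by omega) h0.symm, ← h0]
      · rwa [ratio, Nat.add_sub_cancel, div_le_one h0] at h1
  rcases Nat.lt_or_ge m i with h | h
  · rw [← hσ.fac_dual hdiv hi him, ← fac₀_of_pos (σ := σ) (L := L) (i := 2 * m - i) (by omega)]
    exact hfac₀ _ (by omega)
  · rw [← fac₀_of_pos (σ := σ) (L := L) hi]
    exact hfac₀ _ h

end IsIsotropicPAlternating
end ParaHyp
end

noncomputable section
namespace ParaHyp

open Filter Topology MeasureTheory

/-! ### Traces in the tangent frame -/

/-- The Gram-Schmidt frame of the tangent bundle. -/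
def frm {n : ℕ} (σ : Plane → Mat n) (k : Fin 2) (x : Plane) : Plane :=
  if k = 0 then frameOne σ x else frameTwo σ x

lemma sum_frm {n : ℕ} {A : Type*} [AddCommMonoid A] (σ : Plane → Mat n) (f : Plane → A)
    (x : Plane) : ∑ k, f (frm σ k x) = f (frameOne σ x) + f (frameTwo σ x) := by
  rw [Fin.sum_univ_two]; rfl

lemma fderiv_lin_mat {n : ℕ} (A : Plane → Mat n) (x v w : Plane) (c d : ℝ) :
    fderiv ℝ A x (c • v + d • w) = c • fderiv ℝ A x v + d • fderiv ℝ A x w :=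
  ((fderiv ℝ A x).map_add _ _).trans
    (congrArg₂ (· + ·) ((fderiv ℝ A x).map_smul _ _) ((fderiv ℝ A x).map_smul _ _))

lemma differentiable_of_smooth_mat {n : ℕ} {A : Plane → Mat n} (hA : ContDiff ℝ ∞ A) (x : Plane) :
    DifferentiableAt ℝ A x := differentiableAt_mat hA.contDiffAt

/-- A function of a vector that is additive and homogeneous. -/
def IsLin (f : Plane → ℝ) : Prop := ∀ (c d : ℝ) (v w : Plane), f (c • v + d • w) = c * f v + d * f w

lemma isLin_metric_fderiv {n : ℕ} (A : Plane → Mat n) (x : Plane) (Z : Mat n) :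
    IsLin fun v => metric (fderiv ℝ A x v) Z := by
  intro c d v w
  simp only
  rw [fderiv_lin_mat, metric_add_left, metric_smul_left, metric_smul_left]

lemma IsLin.mul_const {f : Plane → ℝ} (hf : IsLin f) (a : ℝ) : IsLin fun v => f v * a := by
  intro c d v w
  simp only [hf c d v w]; ring

/-- Traces can be computed in coordinates or in an orthonormal frame. -/
lemma IsTanFrame.trace_eq {n : ℕ} {σ : Plane → Mat n} {x X₁ X₂ : Plane}
    (h : IsTanFrame σ x X₁ X₂) (hG : 0 < (gram σ x).det) {b : Plane → Plane → ℝ}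
    (h1 : ∀ w, IsLin fun v => b v w) (h2 : ∀ v, IsLin fun w => b v w) :
    ∑ i, ∑ j, (gram σ x)⁻¹ i j * b (bas i) (bas j) = b X₁ X₁ + b X₂ X₂ := by
  set t : Fin 2 → ℝ := fun i => metric (fderiv ℝ σ x (bas i)) (fderiv ℝ σ x X₁) with ht
  set s : Fin 2 → ℝ := fun i => metric (fderiv ℝ σ x (bas i)) (fderiv ℝ σ x X₂) with hs
  have hg : ∀ i j, gram σ x i j = t i * t j + s i * s j := fun i j =>
    h.metric_eq (bas i) (bas j)
  have hb : ∀ i j, b (bas i) (bas j) = t i * t j * b X₁ X₁ + t i * s j * b X₁ X₂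
      + s i * t j * b X₂ X₁ + s i * s j * b X₂ X₂ := by
    intro i j
    rw [h.expand (bas i), h.expand (bas j)]
    have e1 := h1 (t j • X₁ + s j • X₂) (t i) (s i) X₁ X₂
    have e2 := h2 X₁ (t j) (s j) X₁ X₂
    have e3 := h2 X₂ (t j) (s j) X₁ X₂
    simp only at e1 e2 e3
    simp only [ht, hs] at e1 e2 e3 ⊢
    rw [e1, e2, e3]
    ring
  have hdet : (gram σ x).det = (t 0 * s 1 - t 1 * s 0) ^ 2 := by
    rw [Matrix.det_fin_two, hg, hg, hg, hg]; ring
  rw [hdet] at hG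
  have hne : (t 0 * s 1 - t 1 * s 0) ≠ 0 := fun h0 => by rw [h0] at hG; norm_num at hG
  have hdet' : (gram σ x).det⁻¹ * (t 0 * s 1 - t 1 * s 0) ^ 2 = 1 := by
    rw [hdet]; exact inv_mul_cancel₀ (pow_ne_zero 2 hne)
  have i00 : (gram σ x)⁻¹ 0 0 = (gram σ x).det⁻¹ * gram σ x 1 1 := by
    rw [Matrix.inv_def, Matrix.adjugate_fin_two]; simp
  have i01 : (gram σ x)⁻¹ 0 1 = -((gram σ x).det⁻¹ * gram σ x 0 1) := by
    rw [Matrix.inv_def, Matrix.adjugate_fin_two]; simp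
  have i10 : (gram σ x)⁻¹ 1 0 = -((gram σ x).det⁻¹ * gram σ x 1 0) := by
    rw [Matrix.inv_def, Matrix.adjugate_fin_two]; simp
  have i11 : (gram σ x)⁻¹ 1 1 = (gram σ x).det⁻¹ * gram σ x 0 0 := by
    rw [Matrix.inv_def, Matrix.adjugate_fin_two]; simp
  simp only [Fin.sum_univ_two, i00, i01, i10, i11, hb]
  rw [hg 0 0, hg 0 1, hg 1 0, hg 1 1]
  linear_combination (b X₁ X₁ + b X₂ X₂) * hdet'

/-! ### Divergences -/

lemma integral_fderiv_eq_zero {f : Plane → ℝ} (hf : ContDiff ℝ ∞ f) (hc : HasCompactSupport f)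
    (v : Plane) : ∫ x, fderiv ℝ f x v = 0 := by
  have hd : Differentiable ℝ f := hf.differentiable (by simp)
  have hcont : Continuous fun x => fderiv ℝ f x v :=
    (hf.continuous_fderiv (by simp)).clm_apply continuous_const
  have hi : Integrable fun x => fderiv ℝ f x v :=
    hcont.integrable_of_hasCompactSupport (hc.fderiv_apply (𝕜 := ℝ) v)
  have := integral_mul_fderiv_eq_neg_fderiv_mul_of_integrable (μ := volume) (𝕜 := ℝ) (f := fun _ : Plane => (1 : ℝ))
    (g := f) (v := v) (by simp) (by simpa using hi)
    (by simpa using (hf.continuous.integrable_of_hasCompactSupport hc)) (fun _ _ => differentiableAt_const _)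
    (fun x _ => hd x)
  simpa using this

lemma integral_extDeriv_eq_zero {β : Plane → Plane → ℝ}
    (hs : ∀ v, ContDiff ℝ ∞ fun x => β x v) (hc : ∀ v, HasCompactSupport fun x => β x v)
    (a b : Plane) : ∫ x, extDeriv β x a b = 0 := by
  have hi : ∀ v w, Integrable fun x => fderiv ℝ (fun y => β y v) x w := fun v w =>
    (((hs v).continuous_fderiv (by simp)).clm_apply continuous_const).integrable_of_hasCompactSupport
      ((hc v).fderiv_apply (𝕜 := ℝ) w)
  simp only [extDeriv]
  rw [integral_sub (hi _ _) (hi _ _), integral_fderiv_eq_zero (hs _) (hc _),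
    integral_fderiv_eq_zero (hs _) (hc _), sub_zero]

namespace IsIsotropicPAlternating

variable {m : ℕ} {σ : Plane → Mat (2 * m)} {L : ℕ → Plane → Submodule ℝ (Mat (2 * m))}
  (hσ : IsIsotropicPAlternating σ L)
include hσ

lemma extDeriv_frame (hm : 1 ≤ m) {β : Plane → Plane → ℝ} {x : Plane} (hβ : ∀ y, IsLin (β y))
    (hd : ∀ v, DifferentiableAt ℝ (fun y => β y v) x) :
    √((gram σ x).det) * extDeriv β x (frameOne σ x) (frameTwo σ x)
      = extDeriv β x (bas 0) (bas 1) := by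
  have h0 := hσ.gram_zero_pos hm x
  have h1 := hσ.gram_det_pos hm x
  have hlin : ∀ (c d : ℝ) (v w u : Plane), fderiv ℝ (fun y => β y (c • v + d • w)) x u
      = c * fderiv ℝ (fun y => β y v) x u + d * fderiv ℝ (fun y => β y w) x u := by
    intro c d v w u
    have : (fun y => β y (c • v + d • w)) = fun y => c * β y v + d * β y w := by
      funext y; exact hβ y c d v w
    rw [this, fderiv_fun_add ((hd v).const_mul c) ((hd w).const_mul d), fderiv_const_mul (hd v),
      fderiv_const_mul (hd w)]
    rfl
  set p := (√(gram σ x 0 0))⁻¹ with hp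
  set q := (√(gram σ x 0 0 * (gram σ x).det))⁻¹ with hq
  have e1 : frameOne σ x = p • bas 0 + (0 : ℝ) • bas 1 := by rw [zero_smul, add_zero]; rfl
  have e2 : frameTwo σ x = (-(q * gram σ x 0 1)) • bas 0 + (q * gram σ x 0 0) • bas 1 := by
    rw [frameTwo, smul_sub, smul_smul, smul_smul, neg_smul]
    exact (neg_add_eq_sub _ _).symm
  have hpq : √((gram σ x).det) * (p * (q * gram σ x 0 0)) = 1 := by
    rw [hp, hq, Real.sqrt_mul h0.le]
    have s0 := (Real.sqrt_pos.2 h0).ne'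
    have s1 := (Real.sqrt_pos.2 h1).ne'
    have := Real.mul_self_sqrt h0.le
    field_simp
    rw [sq, this]
  rw [extDeriv, extDeriv, e1, e2, hlin, hlin]
  simp only [map_add, map_smul, smul_eq_mul]
  linear_combination (fderiv ℝ (fun y => β y (bas 1)) x (bas 0)
    - fderiv ℝ (fun y => β y (bas 0)) x (bas 1)) * hpq

/-- The surface is minimal. -/
lemma connForm_minimal (hm : 1 ≤ m) (hdiv : DivisorCondition σ L) (x : Plane) :
    connForm L 2 1 x (frameOne σ x) (fderiv ℝ σ x (frameOne σ x))
      + connForm L 2 1 x (frameTwo σ x) (fderiv ℝ σ x (frameTwo σ x)) = 0 := by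
  have h := (hσ.ad_comm hdiv le_rfl hm (x := x) (fun i h1 h2 => absurd h2 (by omega))).2
  have e1 : adU σ L 1 x = fderiv ℝ σ x (frameOne σ x) := rfl
  have e2 : adV σ L 1 x = fderiv ℝ σ x (frameTwo σ x) := rfl
  rw [e1, e2] at h
  exact eq_neg_iff_add_eq_zero.1 (by rw [h, neg_neg])

/-- First variation formula: tangential variations do not change the area to first order. -/
lemma integral_div_tangent (hm : 1 ≤ m) (hdiv : DivisorCondition σ L) {Z : Plane → Mat (2 * m)}
    (hZ : ContDiff ℝ ∞ Z) (hc : HasCompactSupport Z) (hT : ∀ x, Z x ∈ tangentSpace (σ x)) :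
    ∫ x, √((gram σ x).det) * ∑ k, metric (fderiv ℝ Z x (frm σ k x)) (fderiv ℝ σ x (frm σ k x)) = 0 := by
  have hnd : ∀ x, NonDeg σ L 1 x := fun x i h1 h2 => absurd h2 (by omega)
  set β : Plane → Plane → ℝ := fun x v => thetaTwo σ x v * metric (Z x) (adU σ L 1 x)
    - thetaOne σ x v * metric (Z x) (adV σ L 1 x) with hβ
  have hsec := fun x => hσ.ad_locSec hdiv le_rfl (by omega) hm (hnd x)
  have hU : ContDiff ℝ ∞ (adU σ L 1) := contDiff_iff_contDiffAt.2 fun x => (hsec x).1.smooth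
  have hV : ContDiff ℝ ∞ (adV σ L 1) := contDiff_iff_contDiffAt.2 fun x => (hsec x).2.smooth
  have hZU := contDiff_metric hZ hU
  have hZV := contDiff_metric hZ hV
  have hβs : ∀ v, ContDiff ℝ ∞ fun x => β x v := fun v =>
    ((hσ.contDiff_theta hm v).2.mul hZU).sub ((hσ.contDiff_theta hm v).1.mul hZV)
  have hβc : ∀ v, HasCompactSupport fun x => β x v := fun v => hc.mono fun x hx => by
    rw [Function.mem_support] at hx ⊢
    contrapose! hx
    simp [hβ, hx, metric_zero_left]
  have hβl : ∀ y, IsLin (β y) := by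
    intro y c d v w
    have l1 := isLin_metric_fderiv σ y (fderiv ℝ σ y (frameOne σ y)) c d v w
    have l2 := isLin_metric_fderiv σ y (fderiv ℝ σ y (frameTwo σ y)) c d v w
    simp only at l1 l2
    simp only [hβ, thetaOne, thetaTwo, l1, l2]
    ring
  rw [← integral_extDeriv_eq_zero hβs hβc (bas 0) (bas 1)]
  congr 1
  funext x
  rw [← hσ.extDeriv_frame hm hβl fun v => (hβs v).differentiable (by simp) x]
  congr 1
  obtain ⟨hu, hv⟩ := hsec x
  have dZU := hZU.differentiable (by simp) x
  have dZV := hZV.differentiable (by simp) x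
  have dθ1 := fun v => (hσ.contDiff_theta hm v).1.differentiable (by simp) x
  have dθ2 := fun v => (hσ.contDiff_theta hm v).2.differentiable (by simp) x
  have hdβ : ∀ v w, fderiv ℝ (fun y => β y v) x w
      = (thetaTwo σ x v * fderiv ℝ (fun y => metric (Z y) (adU σ L 1 y)) x w
          + metric (Z x) (adU σ L 1 x) * fderiv ℝ (fun y => thetaTwo σ y v) x w)
        - (thetaOne σ x v * fderiv ℝ (fun y => metric (Z y) (adV σ L 1 y)) x w
          + metric (Z x) (adV σ L 1 x) * fderiv ℝ (fun y => thetaOne σ y v) x w) := by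
    intro v w
    rw [fderiv_fun_sub ((dθ2 v).fun_mul dZU) ((dθ1 v).fun_mul dZV), fderiv_fun_mul (dθ2 v) dZU,
      fderiv_fun_mul (dθ1 v) dZV]
    rfl
  obtain ⟨q1, q2⟩ := hσ.curl_theta hdiv hm x
  have t1 := hσ.theta_frameOne hm x
  have t2 := hσ.theta_frameTwo hm x
  have dZ := differentiable_of_smooth_mat hZ x
  rw [extDeriv] at q1 q2
  rw [extDeriv, hdβ, hdβ, t1.1, t1.2, t2.1, t2.2, fderiv_metric dZ hu.diff (frameOne σ x),
    fderiv_metric dZ hv.diff (frameTwo σ x)]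
  have hone := one_mem_Icc hm
  have htwo : 2 ∈ Finset.Icc 1 (2 * m) := by rw [Finset.mem_Icc]; omega
  have hsplit : ∀ {ν : Plane → Mat (2 * m)}, LocSec (L 1) ν x → ∀ v,
      metric (Z x) (fderiv ℝ ν x v) = metric (Z x) (orthProj (L 1 x) (fderiv ℝ ν x v))
        + metric (Z x) (connForm L 2 1 x v (ν x)) := by
    intro ν hν v
    rw [← metric_tanProj_right (hσ.idem x) (hT x), hσ.tanProj_eq_sum, metric_sum_right,
      Finset.sum_eq_add_of_mem 1 2 hone htwo (by omega), hσ.orthProj_fderiv htwo hone (by omega) hν]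
    intro i hi h2
    rw [Finset.mem_Icc] at hi
    rw [hσ.orthProj_fderiv (Finset.mem_Icc.2 hi) hone (by omega) hν,
      hσ.connForm_eq_zero (Finset.mem_Icc.2 hi) hone (by omega), metric_zero_right]
  have hmin := congrArg (metric (Z x)) (hσ.connForm_minimal hm hdiv x)
  rw [metric_add_right, metric_zero_right] at hmin
  rw [hsplit hu (frameOne σ x), hsplit hv (frameTwo σ x), (hσ.orthProj_fderiv_ad hdiv le_rfl (by omega) hm (hnd x) _).1,
    (hσ.orthProj_fderiv_ad hdiv le_rfl (by omega) hm (hnd x) _).2, metric_neg_right,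
    metric_smul_right, metric_smul_right, sum_frm σ (fun v => metric (fderiv ℝ Z x v) (fderiv ℝ σ x v))]
  have e1 : adU σ L 1 x = fderiv ℝ σ x (frameOne σ x) := rfl
  have e2 : adV σ L 1 x = fderiv ℝ σ x (frameTwo σ x) := rfl
  rw [e1, e2]
  linear_combination -hmin - metric (Z x) (fderiv ℝ σ x (frameOne σ x)) * q2
    + metric (Z x) (fderiv ℝ σ x (frameTwo σ x)) * q1

variable (hdiv : DivisorCondition σ L)
include hdiv

/-- The composition of two consecutive forms `η` is trace-free. -/
lemma connForm_comp_sum {i : ℕ} (hi : 1 ≤ i) (him : i + 2 ≤ 2 * m) {x : Plane} {Y : Mat (2 * m)}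
    (hY : Y ∈ L i x) : ∑ k, connForm L (i + 2) (i + 1) x (frm σ k x)
      (connForm L (i + 1) i x (frm σ k x) Y) = 0 := by
  have hm : 1 ≤ m := by omega
  have hX := hσ.isTanFrame hm x
  have low : ∀ {i : ℕ}, 1 ≤ i → i + 1 ≤ m → ∀ {Y : Mat (2 * m)}, Y ∈ L i x →
      ∑ k, connForm L (i + 2) (i + 1) x (frm σ k x) (connForm L (i + 1) i x (frm σ k x) Y) = 0 := by
    intro i hi him Y hY
    have h1 : i + 1 ∈ Finset.Icc 1 (2 * m) := by rw [Finset.mem_Icc]; omega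
    rw [sum_frm σ (fun v => connForm L (i + 2) (i + 1) x v (connForm L (i + 1) i x v Y))]
    have hc := hσ.isConf_fac hdiv hi (by omega) x
    refine hσ.conf_sum_eq_zero (by omega) (by omega) hX (hσ.connForm_mem h1 i x _ Y)
      (hσ.connForm_mem h1 i x _ Y) ?_ (hσ.connForm_comm hi him _ _ hY)
      (hσ.isConf_fac hdiv (by omega) (by omega) x)
    rw [hc _ Y hY, hc _ Y hY, hX.left, hX.right]
  rcases Nat.lt_or_ge i m with h | h
  · exact low hi (by omega) hY
  · have h0 : i ∈ Finset.Icc 1 (2 * m) := by rw [Finset.mem_Icc]; omega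
    have h1 : i + 1 ∈ Finset.Icc 1 (2 * m) := by rw [Finset.mem_Icc]; omega
    have h2 : i + 2 ∈ Finset.Icc 1 (2 * m) := by rw [Finset.mem_Icc]; omega
    obtain ⟨j, hj⟩ : ∃ j, j + i + 1 = 2 * m := ⟨2 * m - i - 1, by omega⟩
    have j0 : j ∈ Finset.Icc 1 (2 * m) := by rw [Finset.mem_Icc]; omega
    have j1 : j + 1 ∈ Finset.Icc 1 (2 * m) := by rw [Finset.mem_Icc]; omega
    have j2 : j + 2 ∈ Finset.Icc 1 (2 * m) := by rw [Finset.mem_Icc]; omega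
    have a0 : 2 * m + 1 - j = i + 2 := by omega
    have a1 : 2 * m + 1 - (j + 1) = i + 1 := by omega
    have a2 : 2 * m + 1 - (j + 2) = i := by omega
    have a3 : 2 * m + 1 - (i + 2) = j := by omega
    have hd := hσ.defPlane h2 x
    refine eq_of_metric_eq hd (Submodule.sum_mem _ fun k _ => hσ.connForm_mem h2 _ _ _ _)
      (Submodule.zero_mem _) fun Z hZ => ?_
    have tZ := hσ.le_tangent h2 x hZ
    have hPZ := hσ.paraCx_mem h2 hZ
    rw [a3] at hPZ
    have hlow := low (by omega) (by omega) hPZ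
    have hk : ∀ k, metric (connForm L (i + 2) (i + 1) x (frm σ k x)
        (connForm L (i + 1) i x (frm σ k x) Y)) Z
        = metric Y (paraCx (σ x) (connForm L (j + 2) (j + 1) x (frm σ k x)
            (connForm L (j + 1) j x (frm σ k x) (paraCx (σ x) Z)))) := by
      intro k
      have m1 := hσ.connForm_mem h1 (i + 2) x (frm σ k x) Z
      have p1 := hσ.connForm_paraCx j1 j0 (by omega) (frm σ k x) hPZ
      have p2 := hσ.connForm_paraCx j2 j1 (by omega) (frm σ k x)
        (hσ.connForm_mem j1 j x (frm σ k x) (paraCx (σ x) Z))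
      rw [a0, a1, paraCx_paraCx (hσ.idem x) tZ] at p1
      rw [a1, a2] at p2
      rw [hσ.connForm_adjoint h2 h1 (by omega) _ (hσ.connForm_mem h1 i x _ Y) hZ,
        hσ.connForm_adjoint h1 h0 (by omega) _ hY m1, neg_neg, p1, p2]
    rw [metric_sum_left, Finset.sum_congr rfl fun k _ => hk k, ← metric_sum_right, ← map_sum, hlow,
      map_zero, metric_zero_right, metric_zero_left]

end IsIsotropicPAlternating
end ParaHyp
end

noncomputable section
namespace ParaHyp

open Filter Topology MeasureTheory

lemma fderiv_sum_mat {n : ℕ} {ι : Type*} (s : Finset ι) {A : ι → Plane → Mat n} {x : Plane}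
    (h : ∀ i ∈ s, DifferentiableAt ℝ (A i) x) (v : Plane) :
    fderiv ℝ (fun y => ∑ i ∈ s, A i y) x v = ∑ i ∈ s, fderiv ℝ (A i) x v := by
  classical
  suffices hs : DifferentiableAt ℝ (fun y => ∑ i ∈ s, A i y) x ∧
      fderiv ℝ (fun y => ∑ i ∈ s, A i y) x v = ∑ i ∈ s, fderiv ℝ (A i) x v from hs.2
  induction s using Finset.induction_on with
  | empty => simp only [Finset.sum_empty]; exact ⟨differentiableAt_const _, fderiv_const_mat _ _ _⟩
  | insert a s ha ih =>
    obtain ⟨h1, h2⟩ := ih fun i hi => h i (Finset.mem_insert_of_mem hi)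
    have h3 := h a (Finset.mem_insert_self _ _)
    simp only [Finset.sum_insert ha]
    exact ⟨differentiableAt_add_mat h3 h1, by rw [fderiv_add_mat h3 h1, h2]⟩

/-! ### The index form -/

/-- The curvature term of the index form. -/
def curvTerm {n : ℕ} (E Y Z : Mat n) : ℝ :=
  1 / 2 * (Y * Z * (E * E)).trace + 1 / 2 * (Z * Y * (E * E)).trace - (E * Y * (E * Z)).trace

/-- The index form of the area functional. -/
def indexForm {n : ℕ} (σ : Plane → Mat n) (ξ ζ : Plane → Mat n) (x : Plane) : ℝ :=
  ∑ k, (metric (tanProj (σ x) (fderiv ℝ ξ x (frm σ k x))) (tanProj (σ x) (fderiv ℝ ζ x (frm σ k x)))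
    - 2 * ∑ l, metric (fderiv ℝ ξ x (frm σ k x)) (fderiv ℝ σ x (frm σ l x))
      * metric (fderiv ℝ ζ x (frm σ k x)) (fderiv ℝ σ x (frm σ l x))
    + curvTerm (fderiv ℝ σ x (frm σ k x)) (ξ x) (ζ x))

lemma curvTerm_self {n : ℕ} {M E Y : Mat n} (hM : M ∈ paraHyp n) (hE : E ∈ tangentSpace M)
    (hY : Y ∈ tangentSpace M) (h1 : metric E E = 1) (h2 : metric E Y = 0) :
    curvTerm E Y Y = metric Y Y - 3 * omega M E Y ^ 2 := by
  have e1 : omega M E E = 0 := by have := omega_swap (M := M) (X := E) (Y := E); linarith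
  have e2 : omega M Y Y = 0 := by have := omega_swap (M := M) (X := Y) (Y := Y); linarith
  rw [curvTerm, trace_mul_four hM hY hY hE, trace_mul_four hM hE hY hE, traceForm_eq hE,
    traceForm_eq hE, traceForm_eq hY, traceForm_eq hY, metric_comm Y E, h1, h2, e1, e2,
    omega_swap (X := E) (Y := Y)]
  ring

lemma curvTerm_swap {n : ℕ} (E Y Z : Mat n) : curvTerm E Z Y = curvTerm E Y Z := by
  have : (E * Z * (E * Y)).trace = (E * Y * (E * Z)).trace := Matrix.trace_mul_comm _ _
  rw [curvTerm, curvTerm, this]; ring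

lemma indexForm_swap {n : ℕ} (σ ξ ζ : Plane → Mat n) (x : Plane) :
    indexForm σ ζ ξ x = indexForm σ ξ ζ x := by
  refine Finset.sum_congr rfl fun k _ => ?_
  rw [curvTerm_swap, metric_comm]
  simp only [mul_comm]

lemma curvTerm_add {n : ℕ} (E Y Y' Z : Mat n) :
    curvTerm E (Y + Y') Z = curvTerm E Y Z + curvTerm E Y' Z := by
  simp only [curvTerm, mul_add, add_mul, Matrix.trace_add]; ring

lemma indexForm_add {n : ℕ} {σ ξ ξ' ζ : Plane → Mat n} {x : Plane} (h : DifferentiableAt ℝ ξ x)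
    (h' : DifferentiableAt ℝ ξ' x) : indexForm σ (fun y => ξ y + ξ' y) ζ x
      = indexForm σ ξ ζ x + indexForm σ ξ' ζ x := by
  simp only [indexForm, fderiv_add_mat h h', tanProj_add, metric_add_left, curvTerm_add,
    Fin.sum_univ_two]
  ring

lemma indexForm_neg_right {n : ℕ} {σ ξ ζ : Plane → Mat n} {x : Plane} (h : DifferentiableAt ℝ ζ x) :
    indexForm σ ξ (fun y => -ζ y) x = -indexForm σ ξ ζ x := by
  have e : ∀ v, fderiv ℝ (fun y => -ζ y) x v = (-1 : ℝ) • fderiv ℝ ζ x v := by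
    intro v
    rw [← fderiv_const_smul_mat (-1) h]
    exact fderiv_congr_mat (Eventually.of_forall fun y => (neg_one_smul ℝ (ζ y)).symm) v
  have e2 : ∀ E Y Z : Mat n, curvTerm E Y (-Z) = -curvTerm E Y Z := by
    intro E Y Z
    simp only [curvTerm, mul_neg, neg_mul, Matrix.trace_neg]; ring
  simp only [indexForm, e, e2, tanProj_smul, metric_smul_left, metric_smul_right, Fin.sum_univ_two]
  ring

namespace IsIsotropicPAlternating

variable {m : ℕ} {σ : Plane → Mat (2 * m)} {L : ℕ → Plane → Submodule ℝ (Mat (2 * m))}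
  (hσ : IsIsotropicPAlternating σ L)
include hσ

lemma contDiff_frm (hm : 1 ≤ m) (k : Fin 2) : ContDiff ℝ ∞ (frm σ k) := by
  fin_cases k
  · exact hσ.contDiff_frameOne hm
  · exact hσ.contDiff_frameTwo hm

lemma metric_frm (hm : 1 ≤ m) (x : Plane) (k l : Fin 2) :
    metric (fderiv ℝ σ x (frm σ k x)) (fderiv ℝ σ x (frm σ l x)) = if k = l then 1 else 0 := by
  have h := hσ.isTanFrame hm x
  fin_cases k <;> fin_cases l
  · exact h.left
  · exact h.ortho
  · exact (metric_comm _ _).trans h.ortho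
  · exact h.right

lemma contDiff_fderiv_frm (hm : 1 ≤ m) {ξ : Plane → Mat (2 * m)} (hξ : ContDiff ℝ ∞ ξ) (k : Fin 2) :
    ContDiff ℝ ∞ fun x => fderiv ℝ ξ x (frm σ k x) :=
  contDiff_iff_contDiffAt.2 fun _ =>
    contDiffAt_fderiv_mat hξ.contDiffAt (hσ.contDiff_frm hm k).contDiffAt

lemma continuous_indexForm (hm : 1 ≤ m) {ξ ζ : Plane → Mat (2 * m)} (hξ : ContDiff ℝ ∞ ξ)
    (hζ : ContDiff ℝ ∞ ζ) : Continuous (indexForm σ ξ ζ) := by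
  have hE := fun k => (hσ.contDiff_fderiv_frm hm hσ.smooth k).continuous
  have hX := fun k => (hσ.contDiff_fderiv_frm hm hξ k).continuous
  have hZ := fun k => (hσ.contDiff_fderiv_frm hm hζ k).continuous
  have tp : ∀ {A : Plane → Mat (2 * m)}, Continuous A → Continuous fun x => tanProj (σ x) (A x) := by
    intro A hA
    have hs : Continuous σ := hσ.smooth.continuous
    unfold tanProj
    exact ((hs.mul hA).mul (continuous_const.sub hs)).add (((continuous_const.sub hs).mul hA).mul hs)
  have tr : ∀ {A : Plane → Mat (2 * m)}, Continuous A → Continuous fun x => (A x).trace :=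
    fun hA => (traceL (2 * m)).continuous.comp hA
  unfold indexForm curvTerm
  refine continuous_finsetSum _ fun k _ => ?_
  refine ((continuous_metric (tp (hX k)) (tp (hZ k))).sub (continuous_const.mul
    (continuous_finsetSum _ fun l _ => (continuous_metric (hX k) (hE l)).mul
      (continuous_metric (hZ k) (hE l))))).add ?_
  have c1 := hξ.continuous
  have c2 := hζ.continuous
  exact ((continuous_const.mul (tr ((c1.mul c2).mul ((hE k).mul (hE k))))).add
    (continuous_const.mul (tr ((c2.mul c1).mul ((hE k).mul (hE k)))))).sub
    (tr (((hE k).mul c1).mul ((hE k).mul c2)))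

/-- The components of the derivative of a section outside its own components. -/
lemma orthProj_fderiv_of_zero {ξ : Plane → Mat (2 * m)} (hξ : ContDiff ℝ ∞ ξ)
    (hT : ∀ x, ξ x ∈ tangentSpace (σ x)) {i : ℕ} (hi : i ∈ Finset.Icc 1 (2 * m))
    (h0 : ∀ x, orthProj (L i x) (ξ x) = 0) (x v : Plane) :
    orthProj (L i x) (fderiv ℝ ξ x v)
      = ∑ j ∈ Finset.Icc 1 (2 * m), connForm L i j x v (orthProj (L j x) (ξ x)) := by
  have hd := hσ.defPlane hi x
  have hsec := fun j hj => hσ.isSection_proj (i := j) hj hξ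
  have hsum : fderiv ℝ ξ x v
      = ∑ j ∈ Finset.Icc 1 (2 * m), fderiv ℝ (fun y => orthProj (L j y) (ξ y)) x v := by
    have e1 : ξ =ᶠ[𝓝 x] fun y => ∑ j ∈ Finset.Icc 1 (2 * m), orthProj (L j y) (ξ y) :=
      Eventually.of_forall fun y => (hσ.sum_orthProj (hT y)).symm
    rw [fderiv_congr_mat e1]
    exact fderiv_sum_mat _ (fun j hj => ((hsec j hj).locSec x).diff) v
  rw [hsum, orthProj_sum hd]
  refine Finset.sum_congr rfl fun j hj => ?_
  by_cases hij : i = j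
  · subst hij
    have hz : (fun y => orthProj (L i y) (ξ y)) = fun _ => 0 := funext h0
    rw [h0 x, hz, fderiv_const_mat, orthProj_zero hd]
    have := hσ.connForm_smul hi hi x v 0 0
    rw [zero_smul, zero_smul] at this
    exact this.symm
  · exact hσ.orthProj_fderiv hi hj hij ((hsec j hj).locSec x) v

end IsIsotropicPAlternating
end ParaHyp
end

noncomputable section
namespace ParaHyp

open Filter Topology MeasureTheory

namespace IsIsotropicPAlternating

variable {m : ℕ} {σ : Plane → Mat (2 * m)} {L : ℕ → Plane → Submodule ℝ (Mat (2 * m))}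
  (hσ : IsIsotropicPAlternating σ L)
include hσ

/-- The sum of the squares of the components in the tangent plane. -/
lemma sum_metric_frm_sq (hm : 1 ≤ m) (x : Plane) (Z : Mat (2 * m)) :
    ∑ l, metric Z (fderiv ℝ σ x (frm σ l x)) * metric Z (fderiv ℝ σ x (frm σ l x))
      = metric (orthProj (L 1 x) Z) (orthProj (L 1 x) Z) := by
  have h1 := one_mem_Icc hm
  have hd := hσ.defPlane h1 x
  have hX := hσ.isTanFrame hm x
  have he : eps 1 = 1 := eps_of_odd odd_one
  have hf : IsFrame (L 1 x) (eps 1) (fderiv ℝ σ x (frameOne σ x)) (fderiv ℝ σ x (frameTwo σ x)) :=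
    isFrame_of_ortho hd (hσ.fderiv_mem x _) (hσ.fderiv_mem x _) (by rw [he]; exact hX.left)
      (by rw [he]; exact hX.right) hX.ortho
  have := hf.metric_eq (orthProj_mem hd Z) (orthProj (L 1 x) Z)
  rw [metric_orthProj_left hd Z hf.mem_left, metric_orthProj_left hd Z hf.mem_right, he,
    one_mul] at this
  rw [this, sum_frm σ (fun v => metric Z (fderiv ℝ σ x v) * metric Z (fderiv ℝ σ x v))]

variable (hdiv : DivisorCondition σ L)
include hdiv

/-- The sum over the tangent frame of the squared norms of the off-diagonal components of the
connection in `ℒ_{j+1}`. -/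
lemma sum_off_diagonal {j : ℕ} (hj : 1 ≤ j) (hjm : j + 1 ≤ 2 * m) {x : Plane}
    (hfac : ∀ i, 1 ≤ i → i + 1 ≤ 2 * m → fac σ L i x ≤ 1 / 2) {s : ℝ}
    {Y : Mat (2 * m)} (hY : Y ∈ L j x) (hYs : 0 ≤ s * metric Y Y) {Z : Mat (2 * m)}
    (hZ : j + 2 ≤ 2 * m → Z ∈ L (j + 2) x) (hZs : 0 ≤ s * metric Z Z) {C : Fin 2 → Mat (2 * m)}
    (hC : j + 2 ≤ 2 * m → ∀ k, C k = connForm L (j + 1) (j + 2) x (frm σ k x) Z)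
    (hC' : ¬ j + 2 ≤ 2 * m → ∀ k, C k = 0) :
    -(s * metric Y Y + s * metric Z Z) ≤ ∑ k, s * metric
      (connForm L (j + 1) j x (frm σ k x) Y + C k) (connForm L (j + 1) j x (frm σ k x) Y + C k) := by
  have hm : 1 ≤ m := by omega
  have h0 : j ∈ Finset.Icc 1 (2 * m) := by rw [Finset.mem_Icc]; omega
  have h1 : j + 1 ∈ Finset.Icc 1 (2 * m) := by rw [Finset.mem_Icc]; omega
  have hone : ∀ k, metric (fderiv ℝ σ x (frm σ k x)) (fderiv ℝ σ x (frm σ k x)) = 1 := fun k => by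
    rw [hσ.metric_frm hm]; simp
  have hAA : ∀ k, metric (connForm L (j + 1) j x (frm σ k x) Y) (connForm L (j + 1) j x (frm σ k x) Y)
      = -fac σ L j x * metric Y Y := fun k => by
    rw [hσ.isConf_fac hdiv hj hjm x _ Y hY, hone, mul_one]
  have hl1 := mul_le_mul_of_nonneg_right (hfac j hj hjm) hYs
  by_cases h : j + 2 ≤ 2 * m
  · have h2 : j + 2 ∈ Finset.Icc 1 (2 * m) := by rw [Finset.mem_Icc]; omega
    have hZ := hZ h
    have hCC : ∀ k, metric (connForm L (j + 1) (j + 2) x (frm σ k x) Z)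
        (connForm L (j + 1) (j + 2) x (frm σ k x) Z) = -fac σ L (j + 1) x * metric Z Z := fun k => by
      rw [hσ.conf_adjoint (by omega) (by omega) (hσ.isConf_fac hdiv (by omega) (by omega) x) _ hZ,
        hone, mul_one]
    have hAC : ∑ k, metric (connForm L (j + 1) j x (frm σ k x) Y)
        (connForm L (j + 1) (j + 2) x (frm σ k x) Z) = 0 := by
      have e : ∀ k, metric (connForm L (j + 1) j x (frm σ k x) Y)
          (connForm L (j + 1) (j + 2) x (frm σ k x) Z)
          = -metric Z (connForm L (j + 2) (j + 1) x (frm σ k x)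
              (connForm L (j + 1) j x (frm σ k x) Y)) := fun k => by
        rw [metric_comm, hσ.connForm_adjoint h1 h2 (by omega) _ hZ (hσ.connForm_mem h1 j x _ Y)]
      rw [Finset.sum_congr rfl fun k _ => e k, Finset.sum_neg_distrib, ← metric_sum_right,
        hσ.connForm_comp_sum hdiv hj (by omega) hY, metric_zero_right, neg_zero]
    have hl2 := mul_le_mul_of_nonneg_right (hfac (j + 1) (by omega) (by omega)) hZs
    simp only [hC h]
    have e : ∑ k, s * metric
        (connForm L (j + 1) j x (frm σ k x) Y + connForm L (j + 1) (j + 2) x (frm σ k x) Z)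
        (connForm L (j + 1) j x (frm σ k x) Y + connForm L (j + 1) (j + 2) x (frm σ k x) Z)
        = -2 * (fac σ L j x * (s * metric Y Y)) - 2 * (fac σ L (j + 1) x * (s * metric Z Z)) := by
      rw [Fin.sum_univ_two] at hAC ⊢
      simp only [metric_add_left, metric_add_right, hAA, hCC,
        metric_comm (connForm L (j + 1) (j + 2) x _ Z) (connForm L (j + 1) j x _ Y)]
      linear_combination 2 * s * hAC
    rw [e]
    linarith
  · have h3 := fun k => hC' h k
    simp only [h3, add_zero, hAA, Fin.sum_univ_two]
    linarith [hZs]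

/-- The index form is definite on sections with components of one parity. -/
lemma indexForm_definite (hm : 1 ≤ m) (hfac : ∀ i, 1 ≤ i → i + 1 ≤ 2 * m → ∀ x, fac σ L i x ≤ 1 / 2)
    {s : ℝ} (hs : s = 1 ∨ s = -1) {ξ : Plane → Mat (2 * m)} (hξ : ContDiff ℝ ∞ ξ)
    (hT : ∀ x, ξ x ∈ tangentSpace (σ x))
    (hpar : ∀ i ∈ Finset.Icc 1 (2 * m), eps i = -s → ∀ x, orthProj (L i x) (ξ x) = 0)
    (h1 : ∀ x, orthProj (L 1 x) (ξ x) = 0) (x : Plane) :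
    0 ≤ s * indexForm σ ξ ξ x ∧
      (s * indexForm σ ξ ξ x = 0 → ∀ v, metric (fderiv ℝ ξ x v) (ξ x) = 0) := by
  classical
  have hss : s * s = 1 := by rcases hs with rfl | rfl <;> norm_num
  have heps : ∀ i, eps i = s ∨ eps i = -s := fun i => by
    rcases Nat.even_or_odd i with h | h
    · rw [eps_of_even h]; rcases hs with rfl | rfl <;> norm_num
    · rw [eps_of_odd h]; rcases hs with rfl | rfl <;> norm_num
  have one_mem := one_mem_Icc hm
  have hd := fun i (hi : i ∈ Finset.Icc 1 (2 * m)) => hσ.defPlane hi x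
  have hnn : ∀ i ∈ Finset.Icc 1 (2 * m), eps i = s → ∀ Y ∈ L i x, 0 ≤ s * metric Y Y :=
    fun i hi he Y hY => by have := (hd i hi).nonneg hY; rwa [he] at this
  -- the squared norms of the components
  set N : ℕ → ℝ := fun i => if i ∈ Finset.Icc 1 (2 * m) then
    s * metric (orthProj (L i x) (ξ x)) (orthProj (L i x) (ξ x)) else 0 with hN
  have hN_mem : ∀ i ∈ Finset.Icc 1 (2 * m),
      N i = s * metric (orthProj (L i x) (ξ x)) (orthProj (L i x) (ξ x)) := fun i hi => if_pos hi
  have hN0 : ∀ i, 0 ≤ N i := fun i => by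
    by_cases hi : i ∈ Finset.Icc 1 (2 * m)
    · rw [hN_mem i hi]
      rcases heps i with he | he
      · exact hnn i hi he _ (orthProj_mem (hd i hi) _)
      · rw [hpar i hi he x, metric_zero_left, mul_zero]
    · exact (if_neg hi).ge
  have hNsub : ∀ S : Finset ℕ, ∑ i ∈ S, N i ≤ ∑ i ∈ Finset.Icc 1 (2 * m), N i := fun S => by
    rw [← Finset.sum_filter_add_sum_filter_not S (· ∈ Finset.Icc 1 (2 * m)),
      Finset.sum_eq_zero (s := S.filter fun i => ¬ i ∈ Finset.Icc 1 (2 * m))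
        (fun i hi => if_neg (Finset.mem_filter.1 hi).2), add_zero]
    exact Finset.sum_le_sum_of_subset_of_nonneg (fun i hi => (Finset.mem_filter.1 hi).2)
      fun i _ _ => hN0 i
  have hNsum : ∑ i ∈ Finset.Icc 1 (2 * m), N i = s * metric (ξ x) (ξ x) := by
    rw [Finset.sum_congr rfl hN_mem, ← Finset.mul_sum, ← hσ.metric_tanProj_eq_sum,
      tanProj_of_mem (hσ.idem x) (hT x)]
  set T : ℕ → ℝ := fun i => ∑ k, s * metric (orthProj (L i x) (fderiv ℝ ξ x (frm σ k x)))
    (orthProj (L i x) (fderiv ℝ ξ x (frm σ k x))) with hTdef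
  set G : ℕ → ℝ := fun i => if eps i = s then T i else 0 with hG
  have hT0 : ∀ i ∈ Finset.Icc 1 (2 * m), eps i = s → 0 ≤ T i := fun i hi he =>
    Finset.sum_nonneg fun k _ => hnn i hi he _ (orthProj_mem (hd i hi) _)
  have hG0 : ∀ i ∈ Finset.Icc 1 (2 * m), 0 ≤ G i := fun i hi => by
    by_cases he : eps i = s
    · simp only [hG, he, if_true]; exact hT0 i hi he
    · simp only [hG, he, if_false]; exact le_rfl
  have hns : ∀ i, eps i = -s → G i = 0 := fun i he => by
    refine if_neg fun h => ?_
    rw [h] at he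
    rcases hs with rfl | rfl <;> norm_num at he
  have hTj : ∀ j ∈ Finset.Ico 1 (2 * m), G (j + 1) - (N j + N (j + 2)) ≤ T (j + 1) := by
    intro j hj
    rw [Finset.mem_Ico] at hj
    have hj0 : j ∈ Finset.Icc 1 (2 * m) := by rw [Finset.mem_Icc]; omega
    have hj1 : j + 1 ∈ Finset.Icc 1 (2 * m) := by rw [Finset.mem_Icc]; omega
    rcases heps (j + 1) with he | he
    · have : G (j + 1) = T (j + 1) := if_pos he
      linarith [hN0 j, hN0 (j + 2)]
    · rw [hns _ he, zero_sub]
      set Z : Mat (2 * m) := if j + 2 ≤ 2 * m then orthProj (L (j + 2) x) (ξ x) else 0 with hZ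
      have hNZ : N (j + 2) = s * metric Z Z := by
        by_cases h : j + 2 ≤ 2 * m
        · rw [hN_mem _ (by rw [Finset.mem_Icc]; omega), hZ, if_pos h]
        · rw [hZ, if_neg h, metric_zero_left, mul_zero]
          exact if_neg (by rw [Finset.mem_Icc]; omega)
      have key := hσ.sum_off_diagonal hdiv hj.1 (by omega) (fun i h2 h3 => hfac i h2 h3 x) (s := s)
        (orthProj_mem (hd j hj0) (ξ x)) (by rw [← hN_mem j hj0]; exact hN0 j) (Z := Z)
        (fun h => by rw [hZ, if_pos h]; exact orthProj_mem (hd _ (by rw [Finset.mem_Icc]; omega)) _)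
        (by rw [← hNZ]; exact hN0 _)
        (C := fun k => if j + 2 ≤ 2 * m then connForm L (j + 1) (j + 2) x (frm σ k x) Z else 0)
        (fun h k => if_pos h) (fun h k => if_neg h)
      rw [← hN_mem j hj0, ← hNZ] at key
      refine key.trans (le_of_eq ?_)
      refine Finset.sum_congr rfl fun k _ => ?_
      have hp : orthProj (L (j + 1) x) (fderiv ℝ ξ x (frm σ k x))
          = connForm L (j + 1) j x (frm σ k x) (orthProj (L j x) (ξ x))
            + if j + 2 ≤ 2 * m then connForm L (j + 1) (j + 2) x (frm σ k x) Z else 0 := by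
        have hzero : ∀ i ∈ Finset.Icc 1 (2 * m), i ≠ j → i ≠ j + 2 →
            connForm L (j + 1) i x (frm σ k x) (orthProj (L i x) (ξ x)) = 0 := by
          intro i hi h2 h3
          by_cases h4 : i = j + 1
          · rw [h4, hpar (j + 1) hj1 he x]
            have := hσ.connForm_smul hj1 hj1 x (frm σ k x) 0 0
            rw [zero_smul, zero_smul] at this
            exact this
          · exact hσ.connForm_eq_zero hj1 hi (by omega) _ _ _
        rw [hσ.orthProj_fderiv_of_zero hξ hT hj1 (hpar _ hj1 he)]
        by_cases h : j + 2 ≤ 2 * m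
        · rw [if_pos h, hZ, if_pos h, Finset.sum_eq_add_of_mem j (j + 2) hj0
            (by rw [Finset.mem_Icc]; omega) (by omega) fun i hi h2 => hzero i hi h2.1 h2.2]
        · rw [if_neg h, add_zero, Finset.sum_eq_single j (fun i hi h2 => hzero i hi h2
            (by rw [Finset.mem_Icc] at hi; omega)) fun h => absurd hj0 h]
      rw [hp]
  -- the terms with the tangent plane
  set c : ℝ := ∑ k, metric (orthProj (L 1 x) (fderiv ℝ ξ x (frm σ k x)))
    (orthProj (L 1 x) (fderiv ℝ ξ x (frm σ k x))) with hc
  set W : ℝ := ∑ k, omega (σ x) (fderiv ℝ σ x (frm σ k x)) (ξ x) ^ 2 with hW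
  have hc0 : 0 ≤ c := Finset.sum_nonneg fun k _ => by
    have := (hd 1 one_mem).nonneg (orthProj_mem (hd 1 one_mem) (fderiv ℝ ξ x (frm σ k x)))
    rwa [show eps 1 = 1 from eps_of_odd odd_one, one_mul] at this
  have hW0 : 0 ≤ W := Finset.sum_nonneg fun k _ => sq_nonneg _
  have hT1 : T 1 = s * c := by rw [hc, Finset.mul_sum]
  have e1 : eps 1 = 1 := eps_of_odd odd_one
  have hfirst : G 1 ≤ T 1 - 2 * s * c - 3 * s * W := by
    rcases hs with rfl | rfl
    · have h2m : 2 * m ∈ Finset.Icc 1 (2 * m) := by rw [Finset.mem_Icc]; omega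
      have hW1 : W = 0 := Finset.sum_eq_zero fun k _ => by
        have hP := hσ.paraCx_mem one_mem (hσ.fderiv_mem x (frm σ k x))
        rw [show 2 * m + 1 - 1 = 2 * m by omega] at hP
        have h2 := metric_orthProj_left (hd _ h2m) (ξ x) hP
        rw [hpar _ h2m (eps_of_even (even_two_mul m)) x, metric_zero_left] at h2
        rw [omega, ← neg_neg (metric _ _), ← metric_paraCx_left, metric_comm, ← h2]
        norm_num
      have hc1 : c = 0 := Finset.sum_eq_zero fun k _ => by
        rw [hσ.orthProj_fderiv_of_zero hξ hT one_mem h1, Finset.sum_eq_zero, metric_zero_left]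
        intro i hi
        have hi' := Finset.mem_Icc.1 hi
        have hz : ∀ i ∈ Finset.Icc 1 (2 * m), orthProj (L i x) (ξ x) = 0 →
            connForm L 1 i x (frm σ k x) (orthProj (L i x) (ξ x)) = 0 := by
          intro i hi h
          have := hσ.connForm_smul one_mem hi x (frm σ k x) 0 0
          rw [zero_smul, zero_smul] at this
          rw [h]
          exact this
        by_cases hi3 : 3 ≤ i
        · exact hσ.connForm_eq_zero one_mem hi (by omega) _ _ _
        · rcases (by omega : i = 1 ∨ i = 2) with rfl | rfl
          · exact hz _ hi (h1 x)
          · exact hz _ hi (hpar _ hi (eps_of_even even_two) x)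
      have hG1 : G 1 = T 1 := if_pos e1
      rw [hG1, hW1, hc1]
      norm_num
    · rw [hns 1 (by rw [e1]; norm_num), hT1]
      linarith
  have hindex : s * indexForm σ ξ ξ x = ∑ i ∈ Finset.Icc 1 (2 * m), T i - 2 * s * c
      + 2 * ∑ i ∈ Finset.Icc 1 (2 * m), N i - 3 * s * W := by
    have a1 : ∑ i ∈ Finset.Icc 1 (2 * m), T i
        = ∑ k, s * metric (tanProj (σ x) (fderiv ℝ ξ x (frm σ k x)))
            (tanProj (σ x) (fderiv ℝ ξ x (frm σ k x))) := by
      rw [hTdef, Finset.sum_comm]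
      refine Finset.sum_congr rfl fun k _ => ?_
      rw [hσ.metric_tanProj_eq_sum, Finset.mul_sum]
    have a2 : ∀ k, curvTerm (fderiv ℝ σ x (frm σ k x)) (ξ x) (ξ x)
        = metric (ξ x) (ξ x) - 3 * omega (σ x) (fderiv ℝ σ x (frm σ k x)) (ξ x) ^ 2 := fun k =>
      curvTerm_self (hσ.mem x) (hσ.le_tangent one_mem x (hσ.fderiv_mem x _)) (hT x)
        (by rw [hσ.metric_frm hm, if_pos rfl])
        (by rw [metric_comm, ← metric_orthProj_left (hd 1 one_mem) (ξ x) (hσ.fderiv_mem x _), h1 x,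
          metric_zero_left])
    rw [hNsum, a1, hc, hW, indexForm]
    simp only [hσ.sum_metric_frm_sq hm, a2, Fin.sum_univ_two]
    ring
  have hIcc : ∀ f : ℕ → ℝ, ∑ i ∈ Finset.Icc 1 (2 * m), f i
      = f 1 + ∑ j ∈ Finset.Ico 1 (2 * m), f (j + 1) := fun f => by
    rw [Finset.sum_Ico_add' f 1 (2 * m) 1, ← Finset.Ico_succ_right_eq_Icc,
      Finset.sum_eq_sum_Ico_succ_bot (by simp; omega)]
    rfl
  have hmain : ∑ i ∈ Finset.Icc 1 (2 * m), G i ≤ s * indexForm σ ξ ξ x := by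
    have b1 := Finset.sum_le_sum hTj
    rw [Finset.sum_sub_distrib, Finset.sum_add_distrib] at b1
    have b2 := hNsub (Finset.Ico 1 (2 * m))
    have b3 : ∑ j ∈ Finset.Ico 1 (2 * m), N (j + 2) ≤ ∑ i ∈ Finset.Icc 1 (2 * m), N i := by
      rw [Finset.sum_Ico_add' N 1 (2 * m) 2]
      exact hNsub _
    rw [hindex, hIcc T, hIcc G]
    linarith
  refine ⟨(Finset.sum_nonneg hG0).trans hmain, fun h0 v => ?_⟩
  have hGz := (Finset.sum_eq_zero_iff_of_nonneg hG0).1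
    (le_antisymm (hmain.trans h0.le) (Finset.sum_nonneg hG0))
  have hk : ∀ k, metric (fderiv ℝ ξ x (frm σ k x)) (ξ x) = 0 := by
    intro k
    rw [← metric_tanProj_left (hσ.idem x) (hT x), ← tanProj_of_mem (hσ.idem x) (hT x),
      hσ.metric_tanProj_eq_sum]
    refine Finset.sum_eq_zero fun i hi => ?_
    rcases heps i with he | he
    · have h2 := hGz i hi
      simp only [hG, he, if_true] at h2
      have h3 := (Finset.sum_eq_zero_iff_of_nonneg fun k _ =>
        hnn i hi he _ (orthProj_mem (hd i hi) (fderiv ℝ ξ x (frm σ k x)))).1 h2 k (Finset.mem_univ _)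
      have h4 := (hd i hi).eq_zero (orthProj_mem (hd i hi) (fderiv ℝ ξ x (frm σ k x)))
        ((mul_eq_zero.1 h3).resolve_left fun h => by rw [h] at hss; norm_num at hss)
      rw [h4, metric_zero_left]
    · rw [hpar i hi he x, metric_zero_right]
  have hX := (hσ.isTanFrame hm x).expand v
  have hl := isLin_metric_fderiv ξ x (ξ x)
  rw [hX]
  refine (hl _ _ _ _).trans ?_
  have k0 : metric (fderiv ℝ ξ x (frameOne σ x)) (ξ x) = 0 := hk 0
  have k1 : metric (fderiv ℝ ξ x (frameTwo σ x)) (ξ x) = 0 := hk 1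
  simp only [k0, k1]
  ring

end IsIsotropicPAlternating
end ParaHyp
end

noncomputable section
namespace ParaHyp

open Filter Topology MeasureTheory

lemma indexForm_eq_zero {n : ℕ} {σ ξ ζ : Plane → Mat n} {x : Plane} (h : ξ =ᶠ[𝓝 x] fun _ => 0) :
    indexForm σ ξ ζ x = 0 := by
  have e : ∀ v, fderiv ℝ ξ x v = 0 := fun v => by rw [fderiv_congr_mat h, fderiv_const_mat]
  have h0 : ξ x = 0 := h.self_of_nhds
  have ht : tanProj (σ x) 0 = 0 := by simp [tanProj]
  simp [indexForm, e, h0, ht, metric_zero_left, curvTerm]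

lemma hasCompactSupport_indexForm {n : ℕ} {σ ξ : Plane → Mat n} (ζ : Plane → Mat n)
    (h : HasCompactSupport ξ) : HasCompactSupport (indexForm σ ξ ζ) :=
  h.mono' fun x hx => by
    by_contra h0
    exact hx (indexForm_eq_zero (notMem_tsupport_iff_eventuallyEq.1 h0))

/-- Differentiation under the integral sign over a compact set. -/
lemma hasDerivAt_setIntegral {Φ : ℝ × Plane → ℝ} {U : Set (ℝ × Plane)} (hU : IsOpen U)
    (hΦ : ContDiffOn ℝ ∞ Φ U) {K : Set Plane} (hK : IsCompact K) {δ : ℝ}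
    (hKU : Set.Ioo (-δ) δ ×ˢ K ⊆ U) {t : ℝ} (ht : t ∈ Set.Ioo (-δ) δ) :
    HasDerivAt (fun t => ∫ x in K, Φ (t, x)) (∫ x in K, fderiv ℝ Φ (t, x) (1, 0)) t := by
  obtain ⟨r, hr, hrs⟩ := Metric.nhds_basis_closedBall.mem_iff.1 (isOpen_Ioo.mem_nhds ht)
  have hsub : Metric.closedBall t r ×ˢ K ⊆ U := (Set.prod_mono hrs le_rfl).trans hKU
  have hD : ContinuousOn (fun p => fderiv ℝ Φ p (1, 0)) U :=
    (hΦ.continuousOn_fderiv_of_isOpen hU (by simp)).clm_apply continuousOn_const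
  obtain ⟨C, hC⟩ := ((isCompact_closedBall t r).prod hK).exists_bound_of_continuousOn (hD.mono hsub)
  have hslice : ∀ {Ψ : ℝ × Plane → ℝ}, ContinuousOn Ψ U → ∀ s ∈ Metric.closedBall t r,
      ContinuousOn (fun x => Ψ (s, x)) K := fun hΨ s hs =>
    hΨ.comp (continuous_const.prodMk continuous_id).continuousOn fun x hx => hsub ⟨hs, hx⟩
  have htr : t ∈ Metric.closedBall t r := Metric.mem_closedBall_self hr.le
  refine (hasDerivAt_integral_of_dominated_loc_of_deriv_le (μ := volume.restrict K)
    (F' := fun s x => fderiv ℝ Φ (s, x) (1, 0)) (bound := fun _ => C)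
    (Metric.ball_mem_nhds t hr) ?_ ?_ ?_ ?_ ?_ ?_).2
  · filter_upwards [Metric.closedBall_mem_nhds t hr] with s hs
    exact (hslice hΦ.continuousOn s hs).aestronglyMeasurable hK.measurableSet
  · exact (hslice hΦ.continuousOn t htr).integrableOn_compact hK
  · exact (hslice hD t htr).aestronglyMeasurable hK.measurableSet
  · filter_upwards [ae_restrict_mem hK.measurableSet] with x hx s hs
    exact hC (s, x) ⟨Metric.ball_subset_closedBall hs, hx⟩
  · have : IsFiniteMeasure (volume.restrict K) := ⟨by simpa using hK.measure_lt_top⟩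
    exact integrable_const C
  · filter_upwards [ae_restrict_mem hK.measurableSet] with x hx s hs
    have hp : (s, x) ∈ U := hsub ⟨Metric.ball_subset_closedBall hs, hx⟩
    have h1 : DifferentiableAt ℝ Φ (s, x) :=
      (hΦ.contDiffAt (hU.mem_nhds hp)).differentiableAt (by simp)
    have h2 : HasDerivAt (fun s : ℝ => (s, x)) ((1 : ℝ), (0 : Plane)) s :=
      (hasDerivAt_id s).prodMk (hasDerivAt_const s x)
    exact h1.hasFDerivAt.comp_hasDerivAt s h2

/-- Integrals over a compact set of smooth functions are twice differentiable. -/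
lemma contDiffAt_setIntegral {Φ : ℝ × Plane → ℝ} {U : Set (ℝ × Plane)} (hU : IsOpen U)
    (hΦ : ContDiffOn ℝ ∞ Φ U) {K : Set Plane} (hK : IsCompact K) {δ : ℝ} (hδ : 0 < δ)
    (hKU : Set.Ioo (-δ) δ ×ˢ K ⊆ U) :
    ContDiffAt ℝ 2 (fun t => ∫ x in K, Φ (t, x)) 0 ∧
      iteratedDeriv 2 (fun t => ∫ x in K, Φ (t, x)) 0
        = ∫ x in K, fderiv ℝ (fun p => fderiv ℝ Φ p (1, 0)) (0, x) (1, 0) := by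
  have hD : ∀ {Ψ : ℝ × Plane → ℝ}, ContDiffOn ℝ ∞ Ψ U →
      ContDiffOn ℝ ∞ (fun p => fderiv ℝ Ψ p (1, 0)) U := fun hΨ =>
    (hΨ.fderiv_of_isOpen hU (by simp)).clm_apply contDiffOn_const
  set A : ℝ → ℝ := fun t => ∫ x in K, Φ (t, x)
  set B : ℝ → ℝ := fun t => ∫ x in K, fderiv ℝ Φ (t, x) (1, 0)
  set C : ℝ → ℝ := fun t => ∫ x in K, fderiv ℝ (fun p => fderiv ℝ Φ p (1, 0)) (t, x) (1, 0)
  have hA : ∀ t ∈ Set.Ioo (-δ) δ, HasDerivAt A (B t) t := fun t ht =>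
    hasDerivAt_setIntegral hU hΦ hK hKU ht
  have hB : ∀ t ∈ Set.Ioo (-δ) δ, HasDerivAt B (C t) t := fun t ht =>
    hasDerivAt_setIntegral hU (hD hΦ) hK hKU ht
  have hC : ContinuousOn C (Set.Ioo (-δ) δ) := fun t ht =>
    (hasDerivAt_setIntegral hU (hD (hD hΦ)) hK hKU ht).continuousAt.continuousWithinAt
  have ho : IsOpen (Set.Ioo (-δ) δ) := isOpen_Ioo
  have h0 : (0 : ℝ) ∈ Set.Ioo (-δ) δ := ⟨by linarith, hδ⟩
  have hB1 : ContDiffOn ℝ 1 B (Set.Ioo (-δ) δ) := by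
    have := (contDiffOn_succ_iff_deriv_of_isOpen (𝕜 := ℝ) (f := B) (n := 0) ho).2
      ⟨fun t ht => (hB t ht).differentiableAt.differentiableWithinAt, by simp,
        contDiffOn_zero.2 (hC.congr fun t ht => (hB t ht).deriv)⟩
    simpa using this
  have hA2 : ContDiffOn ℝ 2 A (Set.Ioo (-δ) δ) := by
    have := (contDiffOn_succ_iff_deriv_of_isOpen (𝕜 := ℝ) (f := A) (n := 1) ho).2
      ⟨fun t ht => (hA t ht).differentiableAt.differentiableWithinAt, by simp,
        hB1.congr fun t ht => (hA t ht).deriv⟩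
    rwa [one_add_one_eq_two] at this
  refine ⟨hA2.contDiffAt (ho.mem_nhds h0), ?_⟩
  have e : deriv A =ᶠ[𝓝 0] B := by
    filter_upwards [ho.mem_nhds h0] with t ht
    exact (hA t ht).deriv
  rw [iteratedDeriv_succ, iteratedDeriv_one, e.deriv_eq, (hB 0 h0).deriv]

namespace IsIsotropicPAlternating

variable {m : ℕ} {σ : Plane → Mat (2 * m)} {L : ℕ → Plane → Submodule ℝ (Mat (2 * m))}
  (hσ : IsIsotropicPAlternating σ L)
include hσ

lemma eq_zero_of_metric_fderiv {s : ℝ} (hs : s = 1 ∨ s = -1) {ξ : Plane → Mat (2 * m)}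
    (hξ : ContDiff ℝ ∞ ξ) (hc : HasCompactSupport ξ) (hT : ∀ x, ξ x ∈ tangentSpace (σ x))
    (hpar : ∀ i ∈ Finset.Icc 1 (2 * m), eps i = -s → ∀ x, orthProj (L i x) (ξ x) = 0)
    (h : ∀ x v, metric (fderiv ℝ ξ x v) (ξ x) = 0) : ξ = 0 := by
  have hd := hξ.differentiable (by simp)
  have hconst : ∀ x y, metric (ξ x) (ξ x) = metric (ξ y) (ξ y) := by
    refine is_const_of_fderiv_eq_zero (𝕜 := ℝ) (f := fun x => metric (ξ x) (ξ x))
      ((contDiff_metric hξ hξ).differentiable (by simp)) fun x => ?_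
    ext v
    rw [fderiv_metric (hd x) (hd x), metric_comm (ξ x), h]
    simp
  obtain ⟨y, hy⟩ : ∃ y, y ∉ tsupport ξ := by
    by_contra! hall
    have hcomp : IsCompact (tsupport ξ) := hc
    exact hcomp.ne_univ (Set.eq_univ_of_forall hall)
  have hy0 : ξ y = 0 := image_eq_zero_of_notMem_tsupport hy
  funext x
  have h0 : s * metric (ξ x) (ξ x) = 0 := by
    rw [hconst x y, hy0, metric_zero_left, mul_zero]
  rw [← tanProj_of_mem (hσ.idem x) (hT x), hσ.metric_tanProj_eq_sum, Finset.mul_sum] at h0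
  have hz : ∀ i ∈ Finset.Icc 1 (2 * m), orthProj (L i x) (ξ x) = 0 := by
    have hcase : ∀ i, eps i = s ∨ eps i = -s := fun i => by
      rcases Nat.even_or_odd i with h | h
      · rw [eps_of_even h]; rcases hs with rfl | rfl <;> norm_num
      · rw [eps_of_odd h]; rcases hs with rfl | rfl <;> norm_num
    intro i hi
    rcases hcase i with he | he
    · have hnn : ∀ i ∈ Finset.Icc 1 (2 * m),
          0 ≤ s * metric (orthProj (L i x) (ξ x)) (orthProj (L i x) (ξ x)) := by
        intro i hi
        rcases hcase i with he | he
        · have := (hσ.defPlane hi x).nonneg (orthProj_mem (hσ.defPlane hi x) (ξ x))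
          rwa [he] at this
        · rw [hpar i hi he x, metric_zero_left, mul_zero]
      have h2 := (Finset.sum_eq_zero_iff_of_nonneg hnn).1 h0 i hi
      refine (hσ.defPlane hi x).eq_zero (orthProj_mem (hσ.defPlane hi x) _)
        ((mul_eq_zero.1 h2).resolve_left ?_)
      rcases hs with rfl | rfl <;> norm_num
    · exact hpar i hi he x
  rw [← hσ.sum_orthProj (hT x), Finset.sum_eq_zero hz]
  rfl

end IsIsotropicPAlternating
end ParaHyp
end

noncomputable section
namespace ParaHyp

open Filter Topology MeasureTheory

section SecondDerivatives

variable {G : Type*} [NormedAddCommGroup G] [NormedSpace ℝ G] {p : G}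

lemma contDiffAt_fderiv_real {f : G → ℝ} (hf : ContDiffAt ℝ ∞ f p) (w : G) :
    ContDiffAt ℝ ∞ (fun y => fderiv ℝ f y w) p :=
  (hf.fderiv_right (by simp)).clm_apply contDiffAt_const

lemma second_deriv_sqrt {q : G → ℝ} (hq : ∀ᶠ y in 𝓝 p, ContDiffAt ℝ ∞ q y) (h1 : q p = 1) (w : G) :
    fderiv ℝ (fun y => fderiv ℝ (fun z => √(q z)) y w) p w
      = 1 / 2 * fderiv ℝ (fun y => fderiv ℝ q y w) p w - 1 / 4 * fderiv ℝ q p w ^ 2 := by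
  have hqp := hq.self_of_nhds
  have hpos : ∀ᶠ y in 𝓝 p, 0 < q y := hqp.continuousAt.eventually_const_lt (by rw [h1]; norm_num)
  have hds : ∀ y, ContDiffAt ℝ ∞ q y → 0 < q y →
      fderiv ℝ (fun z => √(q z)) y w = 1 / 2 * ((√(q y))⁻¹ * fderiv ℝ q y w) := by
    intro y hy h0
    rw [fderiv_sqrt (hy.differentiableAt (by simp)) h0.ne']
    simp only [smul_apply, smul_eq_mul]
    field_simp
  have e : (fun y => fderiv ℝ (fun z => √(q z)) y w) =ᶠ[𝓝 p]
      fun y => 1 / 2 * ((√(q y))⁻¹ * fderiv ℝ q y w) := by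
    filter_upwards [hq, hpos] with y hy h0 using hds y hy h0
  have hsd : DifferentiableAt ℝ (fun z => √(q z)) p :=
    (hqp.sqrt (by rw [h1]; norm_num)).differentiableAt (by simp)
  have hs1 : √(q p) = 1 := by rw [h1, Real.sqrt_one]
  have hid : DifferentiableAt ℝ (fun z => (√(q z))⁻¹) p := hsd.fun_inv (by rw [hs1]; norm_num)
  have hdd := (contDiffAt_fderiv_real hqp w).differentiableAt (n := ∞) (by simp)
  have hinv : fderiv ℝ (fun z => (√(q z))⁻¹) p w = -(1 / 2 * fderiv ℝ q p w) := by
    have h3 := (hasDerivAt_inv (x := √(q p)) (by rw [hs1]; norm_num)).comp_hasFDerivAt p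
      hsd.hasFDerivAt
    refine (congrArg (fun φ : G →L[ℝ] ℝ => φ w) h3.fderiv).trans ?_
    simp only [smul_apply, smul_eq_mul]
    rw [hds p hqp hpos.self_of_nhds, hs1]
    norm_num
  rw [e.fderiv_eq, fderiv_const_mul (hid.fun_mul hdd), fderiv_fun_mul hid hdd]
  simp only [smul_apply, add_apply, smul_eq_mul, hinv, hs1]
  ring

lemma second_deriv_mul {f g : G → ℝ} (hf : ∀ᶠ y in 𝓝 p, ContDiffAt ℝ ∞ f y)
    (hg : ∀ᶠ y in 𝓝 p, ContDiffAt ℝ ∞ g y) (w : G) :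
    fderiv ℝ (fun y => fderiv ℝ (fun z => f z * g z) y w) p w
      = f p * fderiv ℝ (fun y => fderiv ℝ g y w) p w + 2 * fderiv ℝ f p w * fderiv ℝ g p w
        + g p * fderiv ℝ (fun y => fderiv ℝ f y w) p w := by
  have e : (fun y => fderiv ℝ (fun z => f z * g z) y w) =ᶠ[𝓝 p]
      fun y => f y * fderiv ℝ g y w + g y * fderiv ℝ f y w := by
    filter_upwards [hf, hg] with y hy hy'
    rw [fderiv_fun_mul (hy.differentiableAt (by simp)) (hy'.differentiableAt (by simp))]
    rfl
  have df := hf.self_of_nhds.differentiableAt (n := ∞) (by simp)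
  have dg := hg.self_of_nhds.differentiableAt (n := ∞) (by simp)
  have ddf := (contDiffAt_fderiv_real hf.self_of_nhds w).differentiableAt (n := ∞) (by simp)
  have ddg := (contDiffAt_fderiv_real hg.self_of_nhds w).differentiableAt (n := ∞) (by simp)
  rw [e.fderiv_eq, fderiv_fun_add (df.fun_mul ddg) (dg.fun_mul ddf), fderiv_fun_mul df ddg,
    fderiv_fun_mul dg ddf]
  simp only [smul_apply, add_apply, smul_eq_mul]
  ring

lemma second_deriv_sub {f g : G → ℝ} (hf : ∀ᶠ y in 𝓝 p, ContDiffAt ℝ ∞ f y)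
    (hg : ∀ᶠ y in 𝓝 p, ContDiffAt ℝ ∞ g y) (w : G) :
    fderiv ℝ (fun y => fderiv ℝ (fun z => f z - g z) y w) p w
      = fderiv ℝ (fun y => fderiv ℝ f y w) p w - fderiv ℝ (fun y => fderiv ℝ g y w) p w := by
  have e : (fun y => fderiv ℝ (fun z => f z - g z) y w) =ᶠ[𝓝 p]
      fun y => fderiv ℝ f y w - fderiv ℝ g y w := by
    filter_upwards [hf, hg] with y hy hy'
    rw [fderiv_fun_sub (hy.differentiableAt (by simp)) (hy'.differentiableAt (by simp))]
    rfl
  rw [e.fderiv_eq, fderiv_fun_sub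
    ((contDiffAt_fderiv_real hf.self_of_nhds w).differentiableAt (n := ∞) (by simp))
    ((contDiffAt_fderiv_real hg.self_of_nhds w).differentiableAt (n := ∞) (by simp))]
  rfl

lemma second_deriv_metric {n : ℕ} {A B : G → Mat n} (hA : ∀ᶠ y in 𝓝 p, ContDiffAt ℝ ∞ A y)
    (hB : ∀ᶠ y in 𝓝 p, ContDiffAt ℝ ∞ B y) (w : G) :
    fderiv ℝ (fun y => fderiv ℝ (fun z => metric (A z) (B z)) y w) p w
      = metric (fderiv ℝ (fun y => fderiv ℝ A y w) p w) (B p)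
        + 2 * metric (fderiv ℝ A p w) (fderiv ℝ B p w)
        + metric (A p) (fderiv ℝ (fun y => fderiv ℝ B y w) p w) := by
  have e : (fun y => fderiv ℝ (fun z => metric (A z) (B z)) y w) =ᶠ[𝓝 p]
      fun y => metric (fderiv ℝ A y w) (B y) + metric (A y) (fderiv ℝ B y w) := by
    filter_upwards [hA, hB] with y hy hy'
    rw [fderiv_metric (differentiableAt_mat hy) (differentiableAt_mat hy')]
  have a0 := hA.self_of_nhds
  have b0 := hB.self_of_nhds
  have a1 := contDiffAt_fderiv_mat a0 (X := fun _ => w) contDiffAt_const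
  have b1 := contDiffAt_fderiv_mat b0 (X := fun _ => w) contDiffAt_const
  rw [e.fderiv_eq, fderiv_fun_add ((contDiffAt_metric a1 b0).differentiableAt (by simp))
    ((contDiffAt_metric a0 b1).differentiableAt (by simp)), add_apply,
    fderiv_metric (differentiableAt_mat a1) (differentiableAt_mat b0),
    fderiv_metric (differentiableAt_mat a0) (differentiableAt_mat b1)]
  ring

/-- The second derivative of the area density of an orthonormal pair. -/
lemma second_deriv_area {n : ℕ} {A B : G → Mat n} (hA : ∀ᶠ y in 𝓝 p, ContDiffAt ℝ ∞ A y)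
    (hB : ∀ᶠ y in 𝓝 p, ContDiffAt ℝ ∞ B y) (hAA : metric (A p) (A p) = 1)
    (hBB : metric (B p) (B p) = 1) (hAB : metric (A p) (B p) = 0) (w : G)
    (htr : metric (fderiv ℝ A p w) (A p) + metric (fderiv ℝ B p w) (B p) = 0)
    (hsymm : metric (fderiv ℝ A p w) (B p) = metric (fderiv ℝ B p w) (A p)) :
    fderiv ℝ (fun y => fderiv ℝ (fun z => √(metric (A z) (A z) * metric (B z) (B z)
        - metric (A z) (B z) * metric (A z) (B z))) y w) p w
      = metric (fderiv ℝ A p w) (fderiv ℝ A p w) + metric (fderiv ℝ B p w) (fderiv ℝ B p w)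
        + metric (fderiv ℝ (fun y => fderiv ℝ A y w) p w) (A p)
        + metric (fderiv ℝ (fun y => fderiv ℝ B y w) p w) (B p)
        - 2 * (metric (fderiv ℝ A p w) (A p) ^ 2 + metric (fderiv ℝ A p w) (B p) ^ 2
          + metric (fderiv ℝ B p w) (A p) ^ 2 + metric (fderiv ℝ B p w) (B p) ^ 2) := by
  have hm : ∀ {C D : G → Mat n}, (∀ᶠ y in 𝓝 p, ContDiffAt ℝ ∞ C y) →
      (∀ᶠ y in 𝓝 p, ContDiffAt ℝ ∞ D y) →
      ∀ᶠ y in 𝓝 p, ContDiffAt ℝ ∞ (fun z => metric (C z) (D z)) y := fun hC hD => by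
    filter_upwards [hC, hD] with y h1 h2 using contDiffAt_metric h1 h2
  have hmul : ∀ {f g : G → ℝ}, (∀ᶠ y in 𝓝 p, ContDiffAt ℝ ∞ f y) →
      (∀ᶠ y in 𝓝 p, ContDiffAt ℝ ∞ g y) → ∀ᶠ y in 𝓝 p, ContDiffAt ℝ ∞ (fun z => f z * g z) y :=
    fun hf hg => by filter_upwards [hf, hg] with y h1 h2 using h1.mul h2
  have q1 := hmul (hm hA hA) (hm hB hB)
  have q2 := hmul (hm hA hB) (hm hA hB)
  have dA := differentiableAt_mat hA.self_of_nhds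
  have dB := differentiableAt_mat hB.self_of_nhds
  have dAA := (hm hA hA).self_of_nhds.differentiableAt (n := ∞) (by simp)
  have dBB := (hm hB hB).self_of_nhds.differentiableAt (n := ∞) (by simp)
  have dAB := (hm hA hB).self_of_nhds.differentiableAt (n := ∞) (by simp)
  rw [second_deriv_sqrt (by filter_upwards [q1, q2] with y h1 h2 using h1.sub h2)
      (by rw [hAA, hBB, hAB]; norm_num), second_deriv_sub q1 q2,
    second_deriv_mul (hm hA hA) (hm hB hB), second_deriv_mul (hm hA hB) (hm hA hB),
    second_deriv_metric hA hA, second_deriv_metric hB hB, second_deriv_metric hA hB,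
    fderiv_fun_sub (dAA.fun_mul dBB) (dAB.fun_mul dAB), fderiv_fun_mul dAA dBB,
    fderiv_fun_mul dAB dAB]
  simp only [smul_apply, add_apply, smul_eq_mul,
    sub_apply, fderiv_metric dA dA, fderiv_metric dB dB, fderiv_metric dA dB,
    hAA, hBB, hAB, metric_comm (A p), metric_comm (B p) (fderiv ℝ _ p w)]
  rw [← hsymm]
  linear_combination (-(metric (fderiv ℝ A p w) (A p) + metric (fderiv ℝ B p w) (B p))+ 2 * metric (fderiv ℝ A p w) (A p) + 2 * metric (fderiv ℝ B p w) (B p)) * htr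

end SecondDerivatives

/-- Slices of a map of two variables. -/
lemma fderiv_slice {n : ℕ} {f : ℝ × Plane → Mat n} {t : ℝ} {x : Plane}
    (hf : DifferentiableAt ℝ f (t, x)) (v : Plane) :
    fderiv ℝ (fun y => f (t, y)) x v = fderiv ℝ f (t, x) (0, v) := by
  have h1 : HasFDerivAt (fun y : Plane => (t, y)) (ContinuousLinearMap.inr ℝ ℝ Plane) x :=
    (hasFDerivAt_const t x).prodMk (hasFDerivAt_id x)
  exact congrArg (fun ψ : Plane →L[ℝ] Mat n => ψ v) (hf.hasFDerivAt.comp x h1).fderiv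

lemma hasDerivAt_slice {n : ℕ} {f : ℝ × Plane → Mat n} {t : ℝ} {x : Plane}
    (hf : DifferentiableAt ℝ f (t, x)) :
    HasDerivAt (fun s => f (s, x)) (fderiv ℝ f (t, x) (1, 0)) t := by
  have h2 : HasDerivAt (fun s : ℝ => (s, x)) ((1 : ℝ), (0 : Plane)) t :=
    (hasDerivAt_id t).prodMk (hasDerivAt_const t x)
  exact hf.hasFDerivAt.comp_hasDerivAt t h2

end ParaHyp
end

noncomputable section
namespace ParaHyp

open Filter Topology MeasureTheory

lemma contDiff_tanProj {n : ℕ} {A B : Plane → Mat n} (hA : ContDiff ℝ ∞ A) (hB : ContDiff ℝ ∞ B) :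
    ContDiff ℝ ∞ fun y => tanProj (A y) (B y) :=
  contDiff_iff_contDiffAt.2 fun _ => contDiffAt_tanProj hA.contDiffAt hB.contDiffAt

/-- The non-tangential part of the acceleration of a variation. -/
lemma sub_tanProj_of_acceleration {n : ℕ} {M X W : Mat n} (h : M * M = M)
    (hW : W * M + 2 • (X * X) + M * W = W) :
    W - tanProj M W = (1 - 2 • M) * (2 • (X * X)) := by
  have h1 : M * W * M = -(2 • (M * (X * X))) := by
    have := congrArg (fun Z => M * Z) hW
    simp only [mul_add, ← mul_assoc, h] at this
    rw [eq_neg_iff_add_eq_zero, ← mul_smul_comm]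
    exact add_eq_right.1 this
  rw [tanProj_apply, h1]
  nth_rewrite 1 [← hW]
  simp only [sub_mul, one_mul, smul_mul_assoc, mul_smul_comm]
  abel

lemma metric_fderiv_acceleration {n : ℕ} {σ ξ W : Plane → Mat n} (hσ : ContDiff ℝ ∞ σ)
    (hM : ∀ x, σ x ∈ paraHyp n) (hW : ContDiff ℝ ∞ W) (hT : ∀ x, ξ x ∈ tangentSpace (σ x))
    (h : ∀ x, W x * σ x + 2 • (ξ x * ξ x) + σ x * W x = W x) (x v : Plane) :
    metric (fderiv ℝ W x v) (fderiv ℝ σ x v)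
      = metric (fderiv ℝ (fun y => tanProj (σ y) (W y)) x v) (fderiv ℝ σ x v)
        + 2 * (ξ x * ξ x * (fderiv ℝ σ x v * fderiv ℝ σ x v)).trace := by
  have hi : ∀ y, σ y * σ y = σ y := fun y => paraHyp_mul_self (hM y)
  have dσ := differentiable_of_smooth_mat hσ
  have hν : ContDiff ℝ ∞ fun y => fderiv ℝ σ y v := contDiff_iff_contDiffAt.2 fun _ =>
    contDiffAt_fderiv_mat hσ.contDiffAt contDiffAt_const
  have dν := differentiable_of_smooth_mat hν x
  have hνT : ∀ y, fderiv ℝ σ y v ∈ tangentSpace (σ y) := fun y =>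
    fderiv_mem_tangentSpace (dσ y) (Eventually.of_forall hi) v
  have dW := differentiable_of_smooth_mat hW x
  have dZ := differentiable_of_smooth_mat (contDiff_tanProj hσ hW) x
  have dN : DifferentiableAt ℝ (fun y => W y - tanProj (σ y) (W y)) x := dW.fun_sub dZ
  have h0 : (fun y => metric (W y - tanProj (σ y) (W y)) (fderiv ℝ σ y v)) = fun _ => 0 := by
    funext y
    rw [metric_sub_left, metric_tanProj_left (hi y) (hνT y), sub_self]
  have h1 := fderiv_metric dN dν v
  rw [h0, fderiv_sub_mat dW dZ, metric_sub_left] at h1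
  have h2 : metric (W x - tanProj (σ x) (W x)) (fderiv ℝ (fun y => fderiv ℝ σ y v) x v)
      = metric (W x - tanProj (σ x) (W x)) (fderiv ℝ (fun y => fderiv ℝ σ y v) x v
        - tanProj (σ x) (fderiv ℝ (fun y => fderiv ℝ σ y v) x v)) := by
    rw [metric_sub_right, metric_comm _ (tanProj _ _), metric_tanProj,
      tanProj_sub, tanProj_of_mem (hi x) (tanProj_mem (hi x) _), sub_self, metric_zero_right,
      sub_zero]
  rw [h2, fderiv_sub_tanProj (dσ x) dν (hi x) (Eventually.of_forall hνT),
    sub_tanProj_of_acceleration (hi x) (h x), metric_reflect (hi x), ← two_smul ℕ] at h1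
  · have e : metric (2 • (ξ x * ξ x)) (2 • (fderiv ℝ σ x v * fderiv ℝ σ x v))
        = -2 * (ξ x * ξ x * (fderiv ℝ σ x v * fderiv ℝ σ x v)).trace := by
      simp only [metric, two_smul, mul_add, add_mul, Matrix.trace_add]; ring
    rw [e] at h1
    simp only [fderiv_fun_const, Pi.zero_apply, zero_apply] at h1
    linarith
  · rw [mul_smul_comm, smul_mul_assoc, commute_mul_tangent (hT x) (hT x)]

namespace IsIsotropicPAlternating

variable {m : ℕ} {σ : Plane → Mat (2 * m)} {L : ℕ → Plane → Submodule ℝ (Mat (2 * m))}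
  (hσ : IsIsotropicPAlternating σ L)
include hσ

lemma metric_fderiv_normal (hm : 1 ≤ m) {ξ : Plane → Mat (2 * m)} (hξ : ContDiff ℝ ∞ ξ)
    (hT : ∀ x, ξ x ∈ tangentSpace (σ x)) (hN : ∀ x v, metric (ξ x) (fderiv ℝ σ x v) = 0)
    (x v w : Plane) : metric (fderiv ℝ ξ x v) (fderiv ℝ σ x w)
      = -metric (ξ x) (connForm L 2 1 x v (fderiv ℝ σ x w)) := by
  have hone := one_mem_Icc hm
  have htwo : 2 ∈ Finset.Icc 1 (2 * m) := by rw [Finset.mem_Icc]; omega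
  have hν := hσ.locSec_fderiv x w
  have h1 := fderiv_metric (differentiable_of_smooth_mat hξ x) hν.diff v
  rw [show (fun y => metric (ξ y) (fderiv ℝ σ y w)) = fun _ => 0 from funext fun y => hN y w] at h1
  simp only [fderiv_fun_const, Pi.zero_apply, zero_apply] at h1
  have h2 : metric (ξ x) (fderiv ℝ (fun y => fderiv ℝ σ y w) x v)
      = metric (ξ x) (connForm L 2 1 x v (fderiv ℝ σ x w)) := by
    rw [← metric_tanProj_right (hσ.idem x) (hT x), hσ.tanProj_eq_sum, metric_sum_right,
      Finset.sum_eq_single 2, hσ.orthProj_fderiv htwo hone (by omega) hν]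
    · intro i hi h2
      rcases eq_or_ne i 1 with rfl | h3
      · have := orthProj_mem (hσ.defPlane hone x) (fderiv ℝ (fun y => fderiv ℝ σ y w) x v)
        obtain ⟨u, hu⟩ := (hσ.frenet.tangent x).le this
        exact (congrArg (metric (ξ x)) hu.symm).trans (hN x u)
      · rw [Finset.mem_Icc] at hi
        rw [hσ.orthProj_fderiv (Finset.mem_Icc.2 hi) hone (by omega) hν,
          hσ.connForm_eq_zero (Finset.mem_Icc.2 hi) hone (by omega), metric_zero_right]
    · exact fun h => absurd htwo h
  linarith

/-- The area of a pair of tangent vectors of a nearby surface, in coordinates and in the frame. -/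
lemma sqrt_gram_frm (hm : 1 ≤ m) (x : Plane) {A : Plane → Mat (2 * m)}
    (hA : ∀ (c d : ℝ) (v w : Plane), A (c • v + d • w) = c • A v + d • A w) :
    √(metric (A (bas 0)) (A (bas 0)) * metric (A (bas 1)) (A (bas 1))
        - metric (A (bas 0)) (A (bas 1)) * metric (A (bas 1)) (A (bas 0)))
      = √((gram σ x).det) * √(metric (A (frameOne σ x)) (A (frameOne σ x))
          * metric (A (frameTwo σ x)) (A (frameTwo σ x))
        - metric (A (frameOne σ x)) (A (frameTwo σ x))
          * metric (A (frameOne σ x)) (A (frameTwo σ x))) := by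
  have h0 := hσ.gram_zero_pos hm x
  have h1 := hσ.gram_det_pos hm x
  set p := (√(gram σ x 0 0))⁻¹ with hp
  set q := (√(gram σ x 0 0 * (gram σ x).det))⁻¹ with hq
  have e1 : frameOne σ x = p • bas 0 + (0 : ℝ) • bas 1 := by rw [zero_smul, add_zero]; rfl
  have e2 : frameTwo σ x = (-(q * gram σ x 0 1)) • bas 0 + (q * gram σ x 0 0) • bas 1 := by
    rw [frameTwo, smul_sub, smul_smul, smul_smul, neg_smul]
    exact (neg_add_eq_sub _ _).symm
  have hpq : (gram σ x).det * (p * (q * gram σ x 0 0)) ^ 2 = 1 := by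
    rw [hp, hq, mul_pow, mul_pow, inv_pow, inv_pow, Real.sq_sqrt h0.le,
      Real.sq_sqrt (mul_pos h0 h1).le]
    field_simp
  rw [← Real.sqrt_mul h1.le, e1, e2, hA, hA]
  congr 1
  simp only [metric_add_left, metric_add_right, metric_smul_left, metric_smul_right,
    metric_comm (A (bas 1)) (A (bas 0))]
  linear_combination (-(metric (A (bas 0)) (A (bas 0)) * metric (A (bas 1)) (A (bas 1))
        - metric (A (bas 0)) (A (bas 1)) * metric (A (bas 0)) (A (bas 1)))) * hpq

end IsIsotropicPAlternating

end ParaHyp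
end

noncomputable section
namespace ParaHyp

open Filter Topology MeasureTheory

/-- The velocity `∂_t F` of a family of surfaces. -/
def velocity {n : ℕ} (F : ℝ → Plane → Mat n) (p : ℝ × Plane) : Mat n :=
  fderiv ℝ (Function.uncurry F) p (1, 0)

/-- The acceleration `∂_t ^ 2 F` of a family of surfaces. -/
def acceleration {n : ℕ} (F : ℝ → Plane → Mat n) (p : ℝ × Plane) : Mat n :=
  fderiv ℝ (velocity F) p (1, 0)

namespace IsVariation

variable {n : ℕ} {σ : Plane → Mat n} {F : ℝ → Plane → Mat n} {ε : ℝ} {K : Set Plane}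
  (hV : IsVariation σ F ε K)
include hV

lemma contDiffAt {t : ℝ} (ht : t ∈ Set.Ioo (-ε) ε) (x : Plane) :
    ContDiffAt ℝ ∞ (Function.uncurry F) (t, x) :=
  hV.smooth.contDiffAt ((isOpen_Ioo.prod isOpen_univ).mem_nhds ⟨ht, Set.mem_univ x⟩)

lemma zero_mem : (0 : ℝ) ∈ Set.Ioo (-ε) ε := ⟨neg_lt_zero.2 hV.pos, hV.pos⟩

lemma eventually (x : Plane) : ∀ᶠ p : ℝ × Plane in 𝓝 (0, x), p.1 ∈ Set.Ioo (-ε) ε :=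
  continuous_fst.continuousAt.eventually_mem (isOpen_Ioo.mem_nhds hV.zero_mem)

lemma contDiffAt_velocity {t : ℝ} (ht : t ∈ Set.Ioo (-ε) ε) (x : Plane) :
    ContDiffAt ℝ ∞ (velocity F) (t, x) :=
  contDiffAt_fderiv_mat (hV.contDiffAt ht x) contDiffAt_const

lemma contDiffAt_acceleration {t : ℝ} (ht : t ∈ Set.Ioo (-ε) ε) (x : Plane) :
    ContDiffAt ℝ ∞ (acceleration F) (t, x) :=
  contDiffAt_fderiv_mat (hV.contDiffAt_velocity ht x) contDiffAt_const

lemma contDiff_velocity : ContDiff ℝ ∞ fun x => velocity F (0, x) :=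
  contDiff_iff_contDiffAt.2 fun x => (hV.contDiffAt_velocity hV.zero_mem x).comp x
    (contDiffAt_const.prodMk contDiffAt_id)

lemma contDiff_acceleration : ContDiff ℝ ∞ fun x => acceleration F (0, x) :=
  contDiff_iff_contDiffAt.2 fun x => (hV.contDiffAt_acceleration hV.zero_mem x).comp x
    (contDiffAt_const.prodMk contDiffAt_id)

lemma variationField_eq : variationField F = fun x => velocity F (0, x) := by
  funext x
  exact (hasDerivAt_slice (differentiableAt_mat (hV.contDiffAt hV.zero_mem x))).deriv

lemma velocity_eq_zero {t : ℝ} (ht : t ∈ Set.Ioo (-ε) ε) {x : Plane} (hx : x ∉ K) :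
    velocity F (t, x) = 0 := by
  have h1 := hasDerivAt_slice (differentiableAt_mat (hV.contDiffAt ht x))
  have h2 : (fun s => Function.uncurry F (s, x)) =ᶠ[𝓝 t] fun _ => σ x := by
    filter_upwards [isOpen_Ioo.mem_nhds ht] with s hs using hV.eq_off s hs x hx
  exact h1.unique ((hasDerivAt_const t (σ x)).congr_of_eventuallyEq h2)

lemma acceleration_eq_zero {x : Plane} (hx : x ∉ K) : acceleration F (0, x) = 0 := by
  have h1 := hasDerivAt_slice (differentiableAt_mat (hV.contDiffAt_velocity hV.zero_mem x))
  have h2 : (fun s => velocity F (s, x)) =ᶠ[𝓝 0] fun _ => 0 := by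
    filter_upwards [isOpen_Ioo.mem_nhds hV.zero_mem] with s hs using hV.velocity_eq_zero hs hx
  exact h1.unique ((hasDerivAt_const (0 : ℝ) (0 : Mat n)).congr_of_eventuallyEq h2)

lemma acceleration_relation (x : Plane) :
    acceleration F (0, x) * σ x + 2 • (velocity F (0, x) * velocity F (0, x))
      + σ x * acceleration F (0, x) = acceleration F (0, x) := by
  have h1 : ∀ᶠ p in 𝓝 ((0 : ℝ), x), velocity F p * Function.uncurry F p
      + Function.uncurry F p * velocity F p = velocity F p := by
    filter_upwards [hV.eventually x, (hV.eventually x).eventually_nhds] with p hp hpe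
    have hd := differentiableAt_mat (hV.contDiffAt hp p.2)
    have h2 : (fun q => Function.uncurry F q * Function.uncurry F q) =ᶠ[𝓝 p] Function.uncurry F := by
      filter_upwards [hpe] with q hq using paraHyp_mul_self (hV.mem q.1 hq q.2)
    have := fderiv_congr_mat h2 (1, 0)
    rw [fderiv_mul_mat hd hd] at this
    exact this
  have hd := differentiableAt_mat (hV.contDiffAt hV.zero_mem x)
  have hv := differentiableAt_mat (hV.contDiffAt_velocity hV.zero_mem x)
  have := fderiv_congr_mat h1 (1, 0)
  rw [fderiv_add_mat (hv.fun_mul hd) (hd.fun_mul hv), fderiv_mul_mat hv hd,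
    fderiv_mul_mat hd hv] at this
  have h0 : Function.uncurry F (0, x) = σ x := congrFun hV.zero x
  rw [h0] at this
  refine Eq.trans ?_ this
  rw [two_smul]
  change _ = acceleration F (0, x) * σ x + velocity F (0, x) * velocity F (0, x)
    + (velocity F (0, x) * velocity F (0, x) + σ x * acceleration F (0, x))
  abel

lemma gram_det_eq {t : ℝ} (ht : t ∈ Set.Ioo (-ε) ε) (x : Plane) : (gram (F t) x).det
    = metric (fderiv ℝ (Function.uncurry F) (t, x) (0, bas 0)) (fderiv ℝ (Function.uncurry F) (t, x) (0, bas 0))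
        * metric (fderiv ℝ (Function.uncurry F) (t, x) (0, bas 1)) (fderiv ℝ (Function.uncurry F) (t, x) (0, bas 1))
      - metric (fderiv ℝ (Function.uncurry F) (t, x) (0, bas 0)) (fderiv ℝ (Function.uncurry F) (t, x) (0, bas 1))
        * metric (fderiv ℝ (Function.uncurry F) (t, x) (0, bas 1)) (fderiv ℝ (Function.uncurry F) (t, x) (0, bas 0)) := by
  have h := fun v => fderiv_slice (differentiableAt_mat (hV.contDiffAt ht x)) v
  rw [Matrix.det_fin_two]
  simp only [gram_apply]
  rw [← h, ← h]
  rfl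

lemma contDiffOn_gram_det : ContDiffOn ℝ ∞ (fun p : ℝ × Plane => (gram (F p.1) p.2).det)
    (Set.Ioo (-ε) ε ×ˢ Set.univ) := by
  have h : ∀ i j, ∀ p ∈ Set.Ioo (-ε) ε ×ˢ (Set.univ : Set Plane), ContDiffAt ℝ ∞ (fun q : ℝ × Plane =>
      metric (fderiv ℝ (Function.uncurry F) q (0, bas i)) (fderiv ℝ (Function.uncurry F) q (0, bas j))) p :=
    fun i j p hp => contDiffAt_metric
      (contDiffAt_fderiv_mat (hV.contDiffAt hp.1 p.2) contDiffAt_const)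
      (contDiffAt_fderiv_mat (hV.contDiffAt hp.1 p.2) contDiffAt_const)
  refine ContDiffOn.congr (fun p hp => ContDiffAt.contDiffWithinAt
    (((h 0 0 p hp).mul (h 1 1 p hp)).sub ((h 0 1 p hp).mul (h 1 0 p hp))))
    fun p hp => hV.gram_det_eq hp.1 p.2

end IsVariation

namespace IsIsotropicPAlternating

variable {m : ℕ} {σ : Plane → Mat (2 * m)} {L : ℕ → Plane → Submodule ℝ (Mat (2 * m))}
  (hσ : IsIsotropicPAlternating σ L)
include hσ

lemma metric_fderiv_self (hm : 1 ≤ m) {ξ : Plane → Mat (2 * m)} (hξ : ContDiff ℝ ∞ ξ)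
    (hT : ∀ x, ξ x ∈ tangentSpace (σ x)) (x v : Plane) :
    metric (fderiv ℝ ξ x v) (fderiv ℝ ξ x v)
      = metric (tanProj (σ x) (fderiv ℝ ξ x v)) (tanProj (σ x) (fderiv ℝ ξ x v))
        - (fderiv ℝ σ x v * ξ x * (fderiv ℝ σ x v * ξ x)).trace
        - (ξ x * ξ x * (fderiv ℝ σ x v * fderiv ℝ σ x v)).trace := by
  have ht : fderiv ℝ σ x v ∈ tangentSpace (σ x) :=
    hσ.le_tangent (one_mem_Icc hm) x (hσ.fderiv_mem x v)
  have dξ := differentiable_of_smooth_mat hξ x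
  rw [metric_fderiv_split (hσ.diff x) (Eventually.of_forall hσ.mem) dξ dξ (Eventually.of_forall hT)
    (Eventually.of_forall hT), ← metric_anticomm (hσ.mem x) ht (hT x) ht (hT x), sub_sub,
    sub_eq_add_neg, add_right_inj, metric]
  have c1 : (fderiv ℝ σ x v * ξ x * (ξ x * fderiv ℝ σ x v)).trace
      = (ξ x * ξ x * (fderiv ℝ σ x v * fderiv ℝ σ x v)).trace := by
    rw [← mul_assoc, Matrix.trace_mul_comm, mul_assoc (fderiv ℝ σ x v), ← mul_assoc,
      Matrix.trace_mul_comm]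
  have c2 : (ξ x * fderiv ℝ σ x v * (fderiv ℝ σ x v * ξ x)).trace
      = (ξ x * ξ x * (fderiv ℝ σ x v * fderiv ℝ σ x v)).trace := by
    rw [← mul_assoc, Matrix.trace_mul_comm, mul_assoc (ξ x), ← mul_assoc]
  have c3 : (ξ x * fderiv ℝ σ x v * (ξ x * fderiv ℝ σ x v)).trace
      = (fderiv ℝ σ x v * ξ x * (fderiv ℝ σ x v * ξ x)).trace := by
    rw [mul_assoc, Matrix.trace_mul_comm]; simp only [mul_assoc]
  simp only [mul_add, add_mul, Matrix.trace_add, c1, c2, c3]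
  ring

lemma second_deriv_density (hm : 1 ≤ m) (hdiv : DivisorCondition σ L)
    {F : ℝ → Plane → Mat (2 * m)} {ε : ℝ} {K : Set Plane} (hV : IsVariation σ F ε K)
    (hT : ∀ x, velocity F (0, x) ∈ tangentSpace (σ x))
    (hN : ∀ x v, metric (velocity F (0, x)) (fderiv ℝ σ x v) = 0) (x : Plane) :
    fderiv ℝ (fun p => fderiv ℝ (fun q : ℝ × Plane => √((gram (F q.1) q.2).det)) p (1, 0)) (0, x) (1, 0)
      = √((gram σ x).det) * (indexForm σ (fun y => velocity F (0, y)) (fun y => velocity F (0, y)) x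
        + ∑ k, metric (fderiv ℝ (fun y => tanProj (σ y) (acceleration F (0, y))) x (frm σ k x))
            (fderiv ℝ σ x (frm σ k x))) := by
  set f := Function.uncurry F with hf
  set ξ : Plane → Mat (2 * m) := fun y => velocity F (0, y) with hξ
  have hξs : ContDiff ℝ ∞ ξ := hV.contDiff_velocity
  set Q : Plane → ℝ × Plane → Mat (2 * m) := fun X p => fderiv ℝ f p (0, X) with hQ
  have hsm : ∀ᶠ p in 𝓝 ((0 : ℝ), x), ContDiffAt ℝ ∞ f p := by
    filter_upwards [hV.eventually x] with p hp using hV.contDiffAt hp p.2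
  have hQs : ∀ X, ∀ᶠ p in 𝓝 ((0 : ℝ), x), ContDiffAt ℝ ∞ (Q X) p := fun X => by
    filter_upwards [hsm] with p hp using contDiffAt_fderiv_mat hp contDiffAt_const
  have hQ0 : ∀ X, Q X (0, x) = fderiv ℝ σ x X := fun X => by
    have := fderiv_slice (differentiableAt_mat (hV.contDiffAt hV.zero_mem x)) X
    exact this.symm.trans (fderiv_congr_mat (Eventually.of_forall fun y => congrFun hV.zero y) X)
  have hQ1 : ∀ X, ∀ᶠ p in 𝓝 ((0 : ℝ), x), fderiv ℝ (Q X) p (1, 0) = fderiv ℝ (velocity F) p (0, X) :=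
    fun X => by
      filter_upwards [hsm] with p hp using fderiv_fderiv_comm hp (0, X) (1, 0)
  have hQ1' : ∀ X, fderiv ℝ (Q X) (0, x) (1, 0) = fderiv ℝ ξ x X := fun X =>
    (hQ1 X).self_of_nhds.trans
      (fderiv_slice (differentiableAt_mat (hV.contDiffAt_velocity hV.zero_mem x)) X).symm
  have hQ2 : ∀ X, fderiv ℝ (fun p => fderiv ℝ (Q X) p (1, 0)) (0, x) (1, 0)
      = fderiv ℝ (fun y => acceleration F (0, y)) x X := fun X =>
    (fderiv_congr_mat (hQ1 X) (1, 0)).trans ((fderiv_fderiv_comm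
      (hV.contDiffAt_velocity hV.zero_mem x) (0, X) (1, 0)).trans
      (fderiv_slice (differentiableAt_mat (hV.contDiffAt_acceleration hV.zero_mem x)) X).symm)
  have hlin : ∀ (p : ℝ × Plane) (c d : ℝ) (v w : Plane),
      Q (c • v + d • w) p = c • Q v p + d • Q w p := fun p c d v w => by
    have e : ((0 : ℝ), c • v + d • w) = c • ((0 : ℝ), v) + d • ((0 : ℝ), w) := by simp
    have := ((fderiv ℝ f p).map_add (c • ((0 : ℝ), v)) (d • ((0 : ℝ), w))).trans
      (congrArg₂ (· + ·) ((fderiv ℝ f p).map_smul c _) ((fderiv ℝ f p).map_smul d _))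
    rw [← e] at this
    exact this
  have heq : ∀ᶠ p in 𝓝 ((0 : ℝ), x), √((gram (F p.1) p.2).det) = √((gram σ x).det) *
      √(metric (Q (frameOne σ x) p) (Q (frameOne σ x) p) * metric (Q (frameTwo σ x) p) (Q (frameTwo σ x) p)
        - metric (Q (frameOne σ x) p) (Q (frameTwo σ x) p)
          * metric (Q (frameOne σ x) p) (Q (frameTwo σ x) p)) := by
    filter_upwards [hV.eventually x] with p hp
    rw [hV.gram_det_eq hp p.2]
    exact hσ.sqrt_gram_frm hm x (A := fun v => Q v p) (hlin p)
  have hfr := hσ.isTanFrame hm x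
  have hnorm := fun v w => hσ.metric_fderiv_normal hm hξs hT hN x v w
  have harea := second_deriv_area (hQs (frameOne σ x)) (hQs (frameTwo σ x)) (w := ((1 : ℝ), (0 : Plane)))
    (by rw [hQ0]; exact hfr.left) (by rw [hQ0]; exact hfr.right) (by rw [hQ0, hQ0]; exact hfr.ortho)
    (by
      have := congrArg (metric (ξ x)) (hσ.connForm_minimal hm hdiv x)
      rw [metric_add_right, metric_zero_right] at this
      rw [hQ1', hQ1', hQ0, hQ0, hnorm, hnorm]; linarith)
    (by rw [hQ1', hQ1', hQ0, hQ0, hnorm, hnorm, hσ.connForm_tangent_comm hm])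
  set S : ℝ × Plane → ℝ := fun p => √(metric (Q (frameOne σ x) p) (Q (frameOne σ x) p)
      * metric (Q (frameTwo σ x) p) (Q (frameTwo σ x) p)
        - metric (Q (frameOne σ x) p) (Q (frameTwo σ x) p)
          * metric (Q (frameOne σ x) p) (Q (frameTwo σ x) p)) with hS
  have e1 : (fun p => fderiv ℝ (fun q : ℝ × Plane => √((gram (F q.1) q.2).det)) p (1, 0))
      =ᶠ[𝓝 (0, x)] fun p => √((gram σ x).det) * fderiv ℝ S p (1, 0) := by
    filter_upwards [heq.eventually_nhds] with p hp
    have : (fun q : ℝ × Plane => √((gram (F q.1) q.2).det)) =ᶠ[𝓝 p] √((gram σ x).det) • S := hp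
    rw [this.fderiv_eq, fderiv_const_smul_field]
    rfl
  have e2 : fderiv ℝ (fun p => √((gram σ x).det) * fderiv ℝ S p (1, 0)) (0, x) (1, 0)
      = √((gram σ x).det) * fderiv ℝ (fun p => fderiv ℝ S p (1, 0)) (0, x) (1, 0) :=
    by
      have : (fun p => √((gram σ x).det) * fderiv ℝ S p (1, 0))
          = √((gram σ x).det) • fun p => fderiv ℝ S p (1, 0) := rfl
      rw [this, fderiv_const_smul_field]
      rfl
  rw [e1.fderiv_eq, e2, harea]
  congr 1
  have hacc := fun v => metric_fderiv_acceleration hσ.smooth hσ.mem hV.contDiff_acceleration hT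
    hV.acceleration_relation x v
  have hsplit := fun v => hσ.metric_fderiv_self hm hξs hT x v
  simp only [hQ2, hQ1', hQ0, indexForm, Fin.sum_univ_two, curvTerm]
  rw [hacc, hacc, hsplit, hsplit]
  simp only [frm, if_true, one_ne_zero, if_false, sq]
  ring

/-- The second variation formula. -/
lemma second_variation (hm : 1 ≤ m) (hdiv : DivisorCondition σ L)
    {F : ℝ → Plane → Mat (2 * m)} {ε : ℝ} {K : Set Plane} (hV : IsVariation σ F ε K)
    (hT : ∀ x, variationField F x ∈ tangentSpace (σ x))
    (hN : ∀ x v, metric (variationField F x) (fderiv ℝ σ x v) = 0) :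
    ContDiff ℝ ∞ (variationField F) ∧ HasCompactSupport (variationField F) ∧
    ContDiffAt ℝ 2 (fun t => areaOn K (F t)) 0 ∧ iteratedDeriv 2 (fun t => areaOn K (F t)) 0
      = ∫ x, √((gram σ x).det) * indexForm σ (variationField F) (variationField F) x := by
  rw [hV.variationField_eq] at hT hN ⊢
  have hO : IsOpen (Set.Ioo (-ε) ε ×ˢ (Set.univ : Set Plane)) := isOpen_Ioo.prod isOpen_univ
  have hdet := hV.contDiffOn_gram_det
  set U : Set (ℝ × Plane) := (Set.Ioo (-ε) ε ×ˢ (Set.univ : Set Plane)) ∩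
    (fun p : ℝ × Plane => (gram (F p.1) p.2).det) ⁻¹' Set.Ioi 0 with hU
  have hUo : IsOpen U := hdet.continuousOn.isOpen_inter_preimage hO isOpen_Ioi
  have hΦ : ContDiffOn ℝ ∞ (fun p : ℝ × Plane => √((gram (F p.1) p.2).det)) U :=
    (hdet.mono Set.inter_subset_left).sqrt fun p hp => ne_of_gt hp.2
  obtain ⟨u, v, hu, -, h0u, hKv, huv⟩ := generalized_tube_lemma (s := {(0 : ℝ)}) isCompact_singleton
    hV.compact hUo (by
      rintro ⟨t, x⟩ ⟨ht, -⟩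
      rw [Set.mem_singleton_iff] at ht
      subst ht
      refine ⟨⟨hV.zero_mem, trivial⟩, ?_⟩
      change 0 < (gram (F 0) x).det
      rw [hV.zero]
      exact hσ.gram_det_pos hm x)
  obtain ⟨δ, hδ, hδu⟩ := Metric.isOpen_iff.1 hu 0 (h0u rfl)
  rw [Real.ball_eq_Ioo, zero_sub, zero_add] at hδu
  obtain ⟨h1, h2⟩ := contDiffAt_setIntegral hUo hΦ hV.compact hδ ((Set.prod_mono hδu hKv).trans huv)
  have hsupp : HasCompactSupport fun x => velocity F (0, x) :=
    HasCompactSupport.intro hV.compact fun x hx => hV.velocity_eq_zero hV.zero_mem hx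
  refine ⟨hV.contDiff_velocity, hsupp, h1, h2.trans ?_⟩
  have hZ := contDiff_tanProj hσ.smooth hV.contDiff_acceleration
  have hZc : HasCompactSupport fun y => tanProj (σ y) (acceleration F (0, y)) :=
    HasCompactSupport.intro hV.compact fun x hx => by
      rw [hV.acceleration_eq_zero hx]; simp [tanProj]
  have hdetc := hσ.contDiff_gram_det.continuous.sqrt
  have hI := hσ.continuous_indexForm hm hV.contDiff_velocity hV.contDiff_velocity
  have hZk : Continuous fun x => ∑ k, metric (fderiv ℝ (fun y => tanProj (σ y) (acceleration F (0, y))) x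
      (frm σ k x)) (fderiv ℝ σ x (frm σ k x)) :=
    continuous_finsetSum _ fun k _ => (contDiff_metric (hσ.contDiff_fderiv_frm hm hZ k)
      (hσ.contDiff_fderiv_frm hm hσ.smooth k)).continuous
  simp only [hσ.second_deriv_density hm hdiv hV hT hN, mul_add]
  have hz : ∀ {A : Plane → Mat (2 * m)}, (∀ x ∉ K, A x = 0) → ∀ x ∉ K, A =ᶠ[𝓝 x] fun _ => 0 :=
    fun hA x hx => by
      filter_upwards [hV.compact.isClosed.isOpen_compl.mem_nhds hx] with y hy using hA y hy
  have hz0 : ∀ x ∉ K, √((gram σ x).det) * indexForm σ (fun y => velocity F (0, y))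
      (fun y => velocity F (0, y)) x = 0 := fun x hx => by
    rw [indexForm_eq_zero (hz (fun y hy => hV.velocity_eq_zero hV.zero_mem hy) x hx), mul_zero]
  have hz1 : ∀ x ∉ K, √((gram σ x).det) * ∑ k, metric (fderiv ℝ (fun y => tanProj (σ y)
      (acceleration F (0, y))) x (frm σ k x)) (fderiv ℝ σ x (frm σ k x)) = 0 := fun x hx => by
    have := hz (A := fun y => tanProj (σ y) (acceleration F (0, y)))
      (fun y hy => by rw [hV.acceleration_eq_zero hy]; simp [tanProj]) x hx
    simp only [fderiv_congr_mat this, fderiv_const_mat, metric_zero_left, Finset.sum_const_zero,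
      mul_zero]
  refine (integral_add ((hdetc.mul hI).continuousOn.integrableOn_compact hV.compact)
    ((hdetc.mul hZk).continuousOn.integrableOn_compact hV.compact)).trans ?_
  simp only [Pi.mul_apply]
  rw [setIntegral_eq_integral_of_forall_compl_eq_zero hz0,
    setIntegral_eq_integral_of_forall_compl_eq_zero hz1,
    hσ.integral_div_tangent hm hdiv hZ hZc fun x => tanProj_mem (hσ.idem x) _, add_zero]

end IsIsotropicPAlternating

end ParaHyp
end

noncomputable section
namespace ParaHyp

open Filter Topology MeasureTheory

namespace IsIsotropicPAlternating

variable {m : ℕ} {σ : Plane → Mat (2 * m)} {L : ℕ → Plane → Submodule ℝ (Mat (2 * m))}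
  (hσ : IsIsotropicPAlternating σ L)
include hσ

lemma orthProj_eq_zero_of_mem_iSup {x : Plane} {S : Finset ℕ} {f : ℕ → ℕ}
    (hS : ∀ k ∈ S, f k ∈ Finset.Icc 1 (2 * m)) {Z : Mat (2 * m)} (hZ : Z ∈ ⨆ k ∈ S, L (f k) x)
    {i : ℕ} (hi : i ∈ Finset.Icc 1 (2 * m)) (h : ∀ k ∈ S, i ≠ f k) : orthProj (L i x) Z = 0 := by
  have hd := hσ.defPlane hi x
  have hle : ⨆ k ∈ S, L (f k) x ≤ LinearMap.ker
      (⟨⟨orthProj (L i x), orthProj_add hd⟩, orthProj_smul hd⟩ : Mat (2 * m) →ₗ[ℝ] Mat (2 * m)) :=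
    iSup₂_le fun k hk Y hY => hσ.orthProj_ortho hi (hS k hk) (h k hk) x hY
  exact hle hZ

lemma mem_tangentSpace_of_mem_iSup {x : Plane} {S : Finset ℕ} {f : ℕ → ℕ}
    (hS : ∀ k ∈ S, f k ∈ Finset.Icc 1 (2 * m)) {Z : Mat (2 * m)} (hZ : Z ∈ ⨆ k ∈ S, L (f k) x) :
    Z ∈ tangentSpace (σ x) :=
  (iSup₂_le fun k hk => hσ.le_tangent (hS k hk) x : ⨆ k ∈ S, L (f k) x ≤ tangentSpace (σ x)) hZ

lemma metric_fderiv_eq_zero (hm : 1 ≤ m) {x : Plane} {Z : Mat (2 * m)}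
    (h : orthProj (L 1 x) Z = 0) (v : Plane) : metric Z (fderiv ℝ σ x v) = 0 := by
  rw [← metric_orthProj_left (hσ.defPlane (one_mem_Icc hm) x) Z (hσ.fderiv_mem x v), h,
    metric_zero_left]

/-- The index form is definite on the sections with components of one parity. -/
lemma integral_indexForm (hm : 1 ≤ m)
    (hdiv : DivisorCondition σ L)
    (hfac : ∀ i, 1 ≤ i → i + 1 ≤ 2 * m → ∀ x, fac σ L i x ≤ 1 / 2)
    {s : ℝ} (hs : s = 1 ∨ s = -1) {ξ : Plane → Mat (2 * m)} (hξ : ContDiff ℝ ∞ ξ)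
    (hc : HasCompactSupport ξ) (hT : ∀ x, ξ x ∈ tangentSpace (σ x))
    (hpar : ∀ i ∈ Finset.Icc 1 (2 * m), eps i = -s → ∀ x, orthProj (L i x) (ξ x) = 0)
    (h1 : ∀ x, orthProj (L 1 x) (ξ x) = 0) :
    0 ≤ s * ∫ x, √((gram σ x).det) * indexForm σ ξ ξ x ∧
      (ξ ≠ 0 → 0 < s * ∫ x, √((gram σ x).det) * indexForm σ ξ ξ x) := by
  have hdef := fun x => hσ.indexForm_definite hdiv hm hfac hs hξ hT hpar h1 x
  have hpos := fun x => Real.sqrt_pos.2 (hσ.gram_det_pos hm x)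
  have e : s * ∫ x, √((gram σ x).det) * indexForm σ ξ ξ x
      = ∫ x, √((gram σ x).det) * (s * indexForm σ ξ ξ x) := by
    rw [← integral_const_mul]
    exact integral_congr_ae (Eventually.of_forall fun x => by ring)
  have hnn : 0 ≤ fun x => √((gram σ x).det) * (s * indexForm σ ξ ξ x) := fun x =>
    mul_nonneg (hpos x).le (hdef x).1
  rw [e]
  refine ⟨integral_nonneg hnn, fun h0 => ?_⟩
  obtain ⟨x, hx⟩ : ∃ x, s * indexForm σ ξ ξ x ≠ 0 := by
    by_contra! hall
    exact h0 (hσ.eq_zero_of_metric_fderiv hs hξ hc hT hpar fun x => (hdef x).2 (hall x))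
  exact (hσ.contDiff_gram_det.continuous.sqrt.mul (continuous_const.mul
    (hσ.continuous_indexForm hm hξ hξ))).integral_pos_of_hasCompactSupport_nonneg_nonzero
    ((hasCompactSupport_indexForm ξ hc).mul_left (f := fun _ => s)).mul_left hnn
    (mul_ne_zero (hpos x).ne' hx)

lemma area_second_deriv (hm : 1 ≤ m) (hdiv : DivisorCondition σ L)
    (hfac : ∀ i, 1 ≤ i → i + 1 ≤ 2 * m → ∀ x, fac σ L i x ≤ 1 / 2)
    {s : ℝ} (hs : s = 1 ∨ s = -1) {F : ℝ → Plane → Mat (2 * m)} {ε : ℝ} {K : Set Plane}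
    (hV : IsVariation σ F ε K) {S : Finset ℕ} {f : ℕ → ℕ}
    (hS : ∀ k ∈ S, f k ∈ Finset.Icc 2 (2 * m) ∧ eps (f k) = s)
    (hF : ∀ x, variationField F x ∈ ⨆ k ∈ S, L (f k) x) (h0 : variationField F ≠ 0) :
    ContDiffAt ℝ 2 (fun t => areaOn K (F t)) 0 ∧
      0 < s * iteratedDeriv 2 (fun t => areaOn K (F t)) 0 := by
  have hS' : ∀ k ∈ S, f k ∈ Finset.Icc 1 (2 * m) := fun k hk =>
    Finset.Icc_subset_Icc_left (by norm_num) (hS k hk).1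
  have hT := fun x => hσ.mem_tangentSpace_of_mem_iSup hS' (hF x)
  have h1 : ∀ x, orthProj (L 1 x) (variationField F x) = 0 := fun x =>
    hσ.orthProj_eq_zero_of_mem_iSup hS' (hF x) (one_mem_Icc hm) fun k hk h => by
      have := Finset.mem_Icc.1 (hS k hk).1
      omega
  obtain ⟨a1, a2, a3, a4⟩ := hσ.second_variation hm hdiv hV hT fun x => hσ.metric_fderiv_eq_zero hm (h1 x)
  refine ⟨a3, ?_⟩
  rw [a4]
  refine (hσ.integral_indexForm hm hdiv hfac hs a1 a2 hT (fun i hi he x => ?_) h1).2 h0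
  refine hσ.orthProj_eq_zero_of_mem_iSup hS' (hF x) hi fun k hk h => ?_
  rw [h, (hS k hk).2] at he
  rcases hs with rfl | rfl <;> norm_num at he

end IsIsotropicPAlternating

end ParaHyp
end

noncomputable section
namespace ParaHyp

open Filter Topology MeasureTheory

lemma metric_curvature {n : ℕ} {M E Y Z : Mat n} (hM : M ∈ paraHyp n) (hE : E ∈ tangentSpace M)
    (hY : Y ∈ tangentSpace M) : metric (curvature M E Y E) Z = curvTerm E Y Z := by
  have c1 : (Y * (E * (E * Z))).trace = (Z * (Y * (E * E))).trace := by
    rw [← mul_assoc E, ← mul_assoc, Matrix.trace_mul_comm]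
  have c2 : (E * (E * (Y * Z))).trace = (Y * (Z * (E * E))).trace := by
    rw [← mul_assoc E, Matrix.trace_mul_comm]; simp only [mul_assoc]
  rw [curvature_eq hM hE hY hE, metric, curvTerm]
  simp only [sub_mul, mul_sub, Matrix.trace_sub, mul_assoc, c1, c2]
  ring

namespace IsIsotropicPAlternating

variable {m : ℕ} {σ : Plane → Mat (2 * m)} {L : ℕ → Plane → Submodule ℝ (Mat (2 * m))}
  (hσ : IsIsotropicPAlternating σ L)
include hσ

lemma contDiff_gram_inv (hm : 1 ≤ m) (i j : Fin 2) : ContDiff ℝ ∞ fun x => (gram σ x)⁻¹ i j := by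
  have hd : ContDiff ℝ ∞ fun x => ((gram σ x).det)⁻¹ :=
    hσ.contDiff_gram_det.inv fun x => (hσ.gram_det_pos hm x).ne'
  have e : (fun x => (gram σ x)⁻¹ i j) = fun x => ((gram σ x).det)⁻¹ * (gram σ x).adjugate i j := by
    funext x
    rw [Matrix.inv_def, Matrix.smul_apply, Ring.inverse_eq_inv', smul_eq_mul]
  rw [e]
  refine hd.mul ?_
  simp only [Matrix.adjugate_fin_two]
  have h := hσ.contDiff_gram
  fin_cases i <;> fin_cases j
  · exact h 1 1
  · exact (h 0 1).neg
  · exact (h 1 0).neg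
  · exact h 0 0

lemma contDiff_coordField (i : Fin 2) : ContDiff ℝ ∞ (coordField σ i) :=
  contDiff_iff_contDiffAt.2 fun _ => contDiffAt_fderiv_mat hσ.smooth.contDiffAt contDiffAt_const

lemma contDiff_normalPart (hm : 1 ≤ m) {Z : Plane → Mat (2 * m)} (hZ : ContDiff ℝ ∞ Z) :
    ContDiff ℝ ∞ fun x => normalPart σ x (Z x) := by
  unfold normalPart
  exact hZ.sub (ContDiff.sum fun i _ => ContDiff.sum fun j _ =>
    ((hσ.contDiff_gram_inv hm i j).mul (contDiff_metric hZ (hσ.contDiff_coordField i))).smul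
      (hσ.contDiff_coordField j))

lemma contDiff_normalCov (hm : 1 ≤ m) {ξ : Plane → Mat (2 * m)} (hξ : ContDiff ℝ ∞ ξ) (i : Fin 2) :
    ContDiff ℝ ∞ (normalCov σ ξ i) :=
  hσ.contDiff_normalPart hm (contDiff_tanProj hσ.smooth (contDiff_iff_contDiffAt.2 fun _ =>
    contDiffAt_fderiv_mat hξ.contDiffAt contDiffAt_const))

omit hσ in
lemma metric_normalPart_normal {x : Plane} {Y : Mat (2 * m)} (hY : IsNormalAt σ x Y)
    (Z : Mat (2 * m)) : metric (normalPart σ x Z) Y = metric Z Y := by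
  have h : ∀ j, metric (coordField σ j x) Y = 0 := fun j => (metric_comm _ _).trans (hY.2 _)
  rw [normalPart, metric_sub_left, metric_sum_left]
  simp only [metric_sum_left, metric_smul_left, h, mul_zero, Finset.sum_const_zero, sub_zero]

lemma metric_normalCov_normal {ξ : Plane → Mat (2 * m)} {x : Plane} {Y : Mat (2 * m)}
    (hY : IsNormalAt σ x Y) (i : Fin 2) :
    metric (normalCov σ ξ i x) Y = metric (fderiv ℝ ξ x (bas i)) Y := by
  rw [normalCov, metric_normalPart_normal hY]
  exact metric_tanProj_left (hσ.idem x) hY.1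

lemma trace_frm (hm : 1 ≤ m) {b : Plane → Plane → ℝ} (x : Plane)
    (h1 : ∀ w, IsLin fun v => b v w) (h2 : ∀ v, IsLin fun w => b v w) :
    ∑ i, ∑ j, (gram σ x)⁻¹ i j * b (bas i) (bas j) = ∑ k, b (frm σ k x) (frm σ k x) :=
  ((hσ.isTanFrame hm x).trace_eq (hσ.gram_det_pos hm x) h1 h2).trans
    (sum_frm σ (fun v => b v v) x).symm

omit hσ in
lemma isLin_metric_fderiv_right (A : Plane → Mat (2 * m)) (x : Plane) (Z : Mat (2 * m)) :
    IsLin fun v => metric Z (fderiv ℝ A x v) := by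
  simp only [metric_comm Z]
  exact isLin_metric_fderiv A x Z

lemma metric_normalPart_eq (hm : 1 ≤ m) (x : Plane) (Z W : Mat (2 * m)) :
    metric (normalPart σ x (tanProj (σ x) Z)) W = metric (tanProj (σ x) Z) (tanProj (σ x) W)
      - ∑ l, metric Z (fderiv ℝ σ x (frm σ l x)) * metric W (fderiv ℝ σ x (frm σ l x)) := by
  have ht : ∀ v, fderiv ℝ σ x v ∈ tangentSpace (σ x) := fun v =>
    hσ.le_tangent (one_mem_Icc hm) x (hσ.fderiv_mem x v)
  have h1 := hσ.trace_frm hm x (b := fun v w => metric Z (fderiv ℝ σ x v) * metric W (fderiv ℝ σ x w))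
    (fun w => (isLin_metric_fderiv_right σ x Z).mul_const _)
    (fun v c d w w' => by
      have := isLin_metric_fderiv_right σ x W c d w w'
      simp only at this ⊢
      rw [this]; ring)
  rw [← h1, normalPart, metric_sub_left, metric_sum_left, metric_tanProj (M := σ x) Z (tanProj (σ x) W),
    tanProj_of_mem (hσ.idem x) (tanProj_mem (hσ.idem x) W), ← metric_tanProj]
  congr 1
  refine Finset.sum_congr rfl fun i _ => ?_
  rw [metric_sum_left]
  refine Finset.sum_congr rfl fun j _ => ?_
  rw [metric_smul_left, metric_comm (coordField σ j x) W,
    metric_tanProj_left (Y := coordField σ i x) (hσ.idem x) (ht _), mul_assoc]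
  rfl

/-- Up to a divergence the Jacobi operator is the negative of the index form. -/
lemma metric_jacobiOp (hm : 1 ≤ m) {ξ ζ : Plane → Mat (2 * m)} (hξ : ContDiff ℝ ∞ ξ)
    (hζ : ContDiff ℝ ∞ ζ) (hN : ∀ x, IsNormalAt σ x (ξ x)) (hM : ∀ x, IsNormalAt σ x (ζ x)) (x : Plane) :
    √((gram σ x).det) * metric (jacobiOp σ ξ x) (ζ x)
      = ∑ i, ∑ j, fderiv ℝ (fun y => √((gram σ y).det) * (gram σ y)⁻¹ i j
          * metric (normalCov σ ξ j y) (ζ y)) x (bas i)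
        - √((gram σ x).det) * indexForm σ ξ ζ x := by
  have ht : ∀ v, fderiv ℝ σ x v ∈ tangentSpace (σ x) := fun v =>
    hσ.le_tangent (one_mem_Icc hm) x (hσ.fderiv_mem x v)
  have hpos := Real.sqrt_pos.2 (hσ.gram_det_pos hm x)
  have hc : ∀ i j, ContDiff ℝ ∞ fun y => √((gram σ y).det) * (gram σ y)⁻¹ i j := fun i j =>
    (hσ.contDiff_gram_det.sqrt fun y => (hσ.gram_det_pos hm y).ne').mul (hσ.contDiff_gram_inv hm i j)
  have hcov := fun j => hσ.contDiff_normalCov hm hξ j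
  have dζ := differentiable_of_smooth_mat hζ x
  have hdiff : ∀ {η : Plane → Mat (2 * m)}, ContDiff ℝ ∞ η → (∀ y, IsNormalAt σ y (η y)) → ∀ i j,
      metric (secondFF σ x i j) (η x) = -metric (fderiv ℝ η x (bas i)) (fderiv ℝ σ x (bas j)) := by
    intro η hη hn i j
    have h1 := fderiv_metric (differentiable_of_smooth_mat hη x)
      (differentiable_of_smooth_mat (hσ.contDiff_coordField j) x) (bas i)
    rw [show (fun y => metric (η y) (coordField σ j y)) = fun _ => 0 from
      funext fun y => (hn y).2 _] at h1
    simp only [fderiv_fun_const, Pi.zero_apply, zero_apply] at h1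
    rw [secondFF, hσ.metric_normalCov_normal (hn x), metric_comm]
    have h2 : coordField σ j x = fderiv ℝ σ x (bas j) := rfl
    rw [h2] at h1
    linarith
  have t1 : √((gram σ x).det) * metric (normalLaplacian σ ξ x) (ζ x)
      = ∑ i, ∑ j, fderiv ℝ (fun y => √((gram σ y).det) * (gram σ y)⁻¹ i j
          * metric (normalCov σ ξ j y) (ζ y)) x (bas i)
        - √((gram σ x).det) * ∑ i, ∑ j, (gram σ x)⁻¹ i j
          * metric (normalCov σ ξ j x) (fderiv ℝ ζ x (bas i)) := by
    rw [normalLaplacian, metric_smul_left, ← mul_assoc, mul_inv_cancel₀ hpos.ne', one_mul,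
      metric_sum_left, Finset.mul_sum, ← Finset.sum_sub_distrib]
    refine Finset.sum_congr rfl fun i _ => ?_
    rw [metric_sum_left, Finset.mul_sum, ← Finset.sum_sub_distrib]
    refine Finset.sum_congr rfl fun j _ => ?_
    have dA := differentiable_of_smooth_mat
      (A := fun y => (√((gram σ y).det) * (gram σ y)⁻¹ i j) • normalCov σ ξ j y)
      ((hc i j).smul (hcov j)) x
    have e : (fun y => √((gram σ y).det) * (gram σ y)⁻¹ i j * metric (normalCov σ ξ j y) (ζ y))
        = fun y => metric ((√((gram σ y).det) * (gram σ y)⁻¹ i j) • normalCov σ ξ j y) (ζ y) :=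
      funext fun y => (metric_smul_left _ _ _).symm
    rw [hσ.metric_normalCov_normal (hM x), e, fderiv_metric dA dζ, metric_smul_left]
    ring
  have t2 : ∑ i, ∑ j, (gram σ x)⁻¹ i j * metric (normalCov σ ξ j x) (fderiv ℝ ζ x (bas i))
      = ∑ k, (metric (tanProj (σ x) (fderiv ℝ ξ x (frm σ k x)))
          (tanProj (σ x) (fderiv ℝ ζ x (frm σ k x)))
        - ∑ l, metric (fderiv ℝ ξ x (frm σ k x)) (fderiv ℝ σ x (frm σ l x))
          * metric (fderiv ℝ ζ x (frm σ k x)) (fderiv ℝ σ x (frm σ l x))) := by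
    have h1 := hσ.trace_frm hm x
      (b := fun v w => metric (normalPart σ x (tanProj (σ x) (fderiv ℝ ξ x w))) (fderiv ℝ ζ x v))
      (fun w => isLin_metric_fderiv_right ζ x _) (fun v c d w w' => by
        simp only
        rw [hσ.metric_normalPart_eq hm, hσ.metric_normalPart_eq hm, hσ.metric_normalPart_eq hm]
        simp only [fderiv_lin_mat, tanProj_add, tanProj_smul, metric_add_left, metric_smul_left,
          Fin.sum_univ_two]
        ring)
    simp only [hσ.metric_normalPart_eq hm] at h1
    rw [← h1]
    refine Finset.sum_congr rfl fun i _ => Finset.sum_congr rfl fun j _ => ?_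
    rw [← hσ.metric_normalPart_eq hm]
    rfl
  have t3 : metric (∑ i, ∑ j, ∑ k, ∑ l, ((gram σ x)⁻¹ i k * (gram σ x)⁻¹ j l
        * metric (secondFF σ x i j) (ξ x)) • secondFF σ x k l) (ζ x)
      = ∑ k, ∑ l, metric (fderiv ℝ ξ x (frm σ k x)) (fderiv ℝ σ x (frm σ l x))
          * metric (fderiv ℝ ζ x (frm σ k x)) (fderiv ℝ σ x (frm σ l x)) := by
    have h1 := fun v v' => hσ.trace_frm hm x
      (b := fun w w' => metric (fderiv ℝ ξ x v) (fderiv ℝ σ x w) * metric (fderiv ℝ ζ x v') (fderiv ℝ σ x w'))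
      (fun w => (isLin_metric_fderiv_right σ x _).mul_const _)
      (fun w c d u u' => by
        have := isLin_metric_fderiv_right σ x (fderiv ℝ ζ x v') c d u u'
        simp only at this ⊢
        rw [this]; ring)
    have h2 := hσ.trace_frm hm x
      (b := fun v v' => ∑ l, metric (fderiv ℝ ξ x v) (fderiv ℝ σ x (frm σ l x))
        * metric (fderiv ℝ ζ x v') (fderiv ℝ σ x (frm σ l x)))
      (fun w c d u u' => by
        simp only [fderiv_lin_mat, metric_add_left, metric_smul_left, Fin.sum_univ_two]; ring)
      (fun w c d u u' => by
        simp only [fderiv_lin_mat, metric_add_left, metric_smul_left, Fin.sum_univ_two]; ring)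
    rw [← h2]
    simp only [← h1, metric_add_left, metric_smul_left, hdiff hξ hN, hdiff hζ hM,
      Fin.sum_univ_two]
    ring
  have t4 : metric (normalPart σ x (∑ i, ∑ j, (gram σ x)⁻¹ i j •
        curvature (σ x) (coordField σ i x) (ξ x) (coordField σ j x))) (ζ x)
      = ∑ k, curvTerm (fderiv ℝ σ x (frm σ k x)) (ξ x) (ζ x) := by
    rw [metric_normalPart_normal (hM x)]
    simp only [metric_sum_left, metric_smul_left]
    have h1 := hσ.trace_frm hm x
      (b := fun v w => metric (curvature (σ x) (fderiv ℝ σ x v) (ξ x) (fderiv ℝ σ x w)) (ζ x))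
      (fun w c d u u' => by
        simp only [curvature_eq (hσ.mem x) (ht _) (hN x).1 (ht _)]
        simp only [fderiv_lin_mat, add_mul, mul_add, sub_mul, mul_sub, smul_mul_assoc,
          mul_smul_comm, metric_add_left, metric_sub_left, metric_smul_left]
        ring)
      (fun w c d u u' => by
        simp only [curvature_eq (hσ.mem x) (ht _) (hN x).1 (ht _)]
        simp only [fderiv_lin_mat, add_mul, mul_add, sub_mul, mul_sub, smul_mul_assoc,
          mul_smul_comm, metric_add_left, metric_sub_left, metric_smul_left]
        ring)
    refine h1.trans (Finset.sum_congr rfl fun k _ => ?_)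
    exact metric_curvature (hσ.mem x) (ht _) (hN x).1
  rw [jacobiOp, metric_sub_left, metric_add_left, t3, t4, mul_sub, mul_add, t1, t2, indexForm]
  simp only [Fin.sum_univ_two]
  ring

end IsIsotropicPAlternating

end ParaHyp
end

noncomputable section
namespace ParaHyp

open Filter Topology MeasureTheory

namespace IsIsotropicPAlternating

variable {m : ℕ} {σ : Plane → Mat (2 * m)} {L : ℕ → Plane → Submodule ℝ (Mat (2 * m))}
  (hσ : IsIsotropicPAlternating σ L)
include hσ

lemma integrable_indexForm (hm : 1 ≤ m) {ξ ζ : Plane → Mat (2 * m)} (hξ : ContDiff ℝ ∞ ξ)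
    (hζ : ContDiff ℝ ∞ ζ) (hc : HasCompactSupport ξ) :
    Integrable fun x => √((gram σ x).det) * indexForm σ ξ ζ x :=
  (hσ.contDiff_gram_det.continuous.sqrt.mul
    (hσ.continuous_indexForm hm hξ hζ)).integrable_of_hasCompactSupport
    (hasCompactSupport_indexForm ζ hc).mul_left

lemma integral_jacobiOp (hm : 1 ≤ m) {ξ ζ : Plane → Mat (2 * m)} (hξ : ContDiff ℝ ∞ ξ)
    (hζ : ContDiff ℝ ∞ ζ) (hN : ∀ x, IsNormalAt σ x (ξ x)) (hM : ∀ x, IsNormalAt σ x (ζ x))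
    (hc : HasCompactSupport ξ) (hc' : HasCompactSupport ζ) :
    ∫ x, √((gram σ x).det) * metric (jacobiOp σ ξ x) (ζ x)
      = -∫ x, √((gram σ x).det) * indexForm σ ξ ζ x := by
  have hs : ∀ i j, ContDiff ℝ ∞ fun y => √((gram σ y).det) * (gram σ y)⁻¹ i j
      * metric (normalCov σ ξ j y) (ζ y) := fun i j =>
    ((hσ.contDiff_gram_det.sqrt fun y => (hσ.gram_det_pos hm y).ne').mul
      (hσ.contDiff_gram_inv hm i j)).mul (contDiff_metric (hσ.contDiff_normalCov hm hξ j) hζ)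
  have hcs : ∀ i j, HasCompactSupport fun y => √((gram σ y).det) * (gram σ y)⁻¹ i j
      * metric (normalCov σ ξ j y) (ζ y) := fun i j => hc'.mono fun x hx => by
    rw [Function.mem_support] at hx ⊢
    contrapose! hx
    rw [hx, metric_zero_right, mul_zero]
  have hi : ∀ i j v, Integrable fun x => fderiv ℝ (fun y => √((gram σ y).det) * (gram σ y)⁻¹ i j
      * metric (normalCov σ ξ j y) (ζ y)) x v := fun i j v =>
    (((hs i j).continuous_fderiv (by simp)).clm_apply continuous_const).integrable_of_hasCompactSupport
      ((hcs i j).fderiv_apply (𝕜 := ℝ) v)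
  simp only [hσ.metric_jacobiOp hm hξ hζ hN hM]
  rw [integral_sub (integrable_finsetSum _ fun i _ => integrable_finsetSum _ fun j _ => hi i j _)
    (hσ.integrable_indexForm hm hξ hζ hc),
    integral_finsetSum _ fun i _ => integrable_finsetSum _ fun j _ => hi i j _]
  simp only [integral_finsetSum _ fun j _ => hi _ j _, integral_fderiv_eq_zero (hs _ _) (hcs _ _),
    Finset.sum_const_zero, zero_sub]

/-- Compactly supported Jacobi fields vanish. -/
lemma jacobiField_eq_zero (hm : 1 ≤ m) (hdiv : DivisorCondition σ L)
    (hfac : ∀ i, 1 ≤ i → i + 1 ≤ 2 * m → ∀ x, fac σ L i x ≤ 1 / 2) {ξ : Plane → Mat (2 * m)}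
    (h : IsJacobiField σ ξ) (hc : HasCompactSupport ξ) : ξ = 0 := by
  have h1 : ∀ x, orthProj (L 1 x) (ξ x) = 0 := fun x =>
    orthProj_eq_zero (hσ.defPlane (one_mem_Icc hm) x) fun Y hY => by
      obtain ⟨v, rfl⟩ := (hσ.frenet.tangent x).le hY
      exact (h.normal x).2 v
  set part : Finset ℕ → Plane → Mat (2 * m) := fun S x => ∑ i ∈ S, orthProj (L i x) (ξ x) with hpart
  have hsm : ∀ S ⊆ Finset.Icc 1 (2 * m), ContDiff ℝ ∞ (part S) := fun S hS =>
    ContDiff.sum fun i hi => hσ.contDiff_proj (hS hi) h.smooth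
  have hT : ∀ S ⊆ Finset.Icc 1 (2 * m), ∀ x, part S x ∈ tangentSpace (σ x) := fun S hS x =>
    Submodule.sum_mem _ fun i hi => hσ.le_tangent (hS hi) x (orthProj_mem (hσ.defPlane (hS hi) x) _)
  have hcs : ∀ S ⊆ Finset.Icc 1 (2 * m), HasCompactSupport (part S) := fun S hS =>
    hc.mono fun x hx => by
      rw [Function.mem_support] at hx ⊢
      contrapose! hx
      exact Finset.sum_eq_zero fun i hi => by rw [hx, orthProj_zero (hσ.defPlane (hS hi) x)]
  have hz : ∀ S ⊆ Finset.Icc 1 (2 * m), ∀ i ∈ Finset.Icc 1 (2 * m), i ∉ S ∨ i = 1 → ∀ x,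
      orthProj (L i x) (part S x) = 0 := fun S hS i hi hiS x => by
    rw [hpart, orthProj_sum (hσ.defPlane hi x)]
    refine Finset.sum_eq_zero fun j hj => ?_
    rcases eq_or_ne i j with rfl | hij
    · rcases hiS with hiS | rfl
      · exact absurd hj hiS
      · rw [h1, orthProj_zero (hσ.defPlane hi x)]
    · exact hσ.orthProj_ortho hi (hS hj) hij x (orthProj_mem (hσ.defPlane (hS hj) x) _)
  set O := (Finset.Icc 1 (2 * m)).filter Odd with hO
  set E := (Finset.Icc 1 (2 * m)).filter (fun i => ¬ Odd i) with hE
  have sO : O ⊆ Finset.Icc 1 (2 * m) := Finset.filter_subset _ _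
  have sE : E ⊆ Finset.Icc 1 (2 * m) := Finset.filter_subset _ _
  have hsum : ξ = fun x => part O x + part E x := by
    funext x
    rw [hpart, hO, hE, Finset.sum_filter_add_sum_filter_not, hσ.sum_orthProj (h.normal x).1]
  have hpO := hσ.integral_indexForm hm hdiv hfac (Or.inl rfl) (hsm O sO) (hcs O sO) (hT O sO)
    (fun i hi he => hz O sO i hi (Or.inl fun hiO => by
      rw [eps_of_odd (Finset.mem_filter.1 hiO).2] at he; norm_num at he))
    (hz O sO 1 (one_mem_Icc hm) (Or.inr rfl))
  have hpE := hσ.integral_indexForm hm hdiv hfac (Or.inr rfl) (hsm E sE) (hcs E sE) (hT E sE)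
    (fun i hi he => hz E sE i hi (Or.inl fun hiE => by
      rw [eps_of_even (Nat.not_odd_iff_even.1 (Finset.mem_filter.1 hiE).2)] at he; norm_num at he))
    (hz E sE 1 (one_mem_Icc hm) (Or.inr rfl))
  have dO := differentiable_of_smooth_mat (hsm O sO)
  have dE := differentiable_of_smooth_mat (hsm E sE)
  have hζ : ContDiff ℝ ∞ fun x => part O x + -part E x := (hsm O sO).add (hsm E sE).neg
  have hζN : ∀ x, IsNormalAt σ x (part O x + -part E x) := fun x =>
    ⟨Submodule.add_mem _ (hT O sO x) (Submodule.neg_mem _ (hT E sE x)), fun v =>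
      hσ.metric_fderiv_eq_zero hm (by
        have hd := hσ.defPlane (one_mem_Icc hm) x
        rw [orthProj_add hd, orthProj_neg hd, hz O sO 1 (one_mem_Icc hm) (Or.inr rfl),
          hz E sE 1 (one_mem_Icc hm) (Or.inr rfl), neg_zero, add_zero]) v⟩
  have hζc : HasCompactSupport fun x => part O x + -part E x :=
    (hcs O sO).add (hcs E sE).neg
  have hJ := hσ.integral_jacobiOp hm h.smooth hζ h.normal hζN hc hζc
  simp only [h.jacobi, metric_zero_left, mul_zero, integral_zero] at hJ
  have hB : ∀ x, indexForm σ ξ (fun x => part O x + -part E x) x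
      = indexForm σ (part O) (part O) x - indexForm σ (part E) (part E) x := fun x => by
    have e1 : ∀ η : Plane → Mat (2 * m), indexForm σ η (fun x => part O x + -part E x) x
        = indexForm σ η (part O) x - indexForm σ η (part E) x := fun η => by
      rw [indexForm_swap, indexForm_add (dO x) (dE x).fun_neg, indexForm_swap,
        indexForm_swap σ η (fun y => -part E y), indexForm_neg_right (dE x), sub_eq_add_neg]
    rw [hsum, indexForm_add (dO x) (dE x), e1, e1, indexForm_swap σ (part O) (part E)]
    ring
  simp only [hB, mul_sub] at hJ
  rw [integral_sub (hσ.integrable_indexForm hm (hsm O sO) (hsm O sO) (hcs O sO))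
    (hσ.integrable_indexForm hm (hsm E sE) (hsm E sE) (hcs E sE))] at hJ
  have zO : part O = 0 := by
    by_contra h0
    have := hpO.2 h0
    have := hpE.1
    linarith
  have zE : part E = 0 := by
    by_contra h0
    have := hpE.2 h0
    have := hpO.1
    linarith
  rw [hsum, zO, zE]
  funext x
  simp

end IsIsotropicPAlternating

end ParaHyp
end

theorem mainTheorem9 (m : ℕ) (hm : 1 ≤ m)
    (Γ : Type*) [Group Γ] [MulAction Γ ParaHyp.Plane] (hΓ : ParaHyp.IsDeckAction Γ)
    (hgenus : 2 ≤ ParaHyp.genus Γ)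
    (σ : ParaHyp.Plane → ParaHyp.Mat (2 * m))
    (L : ℕ → ParaHyp.Plane → Submodule ℝ (ParaHyp.Mat (2 * m)))
    (hσ : ParaHyp.IsIsotropicPAlternating σ L)
    (ρ : Γ →* Matrix.SpecialLinearGroup (Fin (2 * m + 1)) ℝ)
    (hρ : ∀ (γ : Γ) (x : ParaHyp.Plane),
      σ (γ • x) = (ρ γ : ParaHyp.Mat (2 * m)) * σ x * ((ρ γ)⁻¹ : Matrix.SpecialLinearGroup _ ℝ))
    (hcodim : ¬ ParaHyp.IsInCodimFour σ)
    (hdiv : ParaHyp.DivisorCondition σ L) :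
    (∀ (F : ℝ → ParaHyp.Plane → ParaHyp.Mat (2 * m)) (ε : ℝ) (K : Set ParaHyp.Plane),
      ParaHyp.IsVariation σ F ε K →
      ((∀ x, ParaHyp.variationField F x ∈ ParaHyp.normalPos m L x) →
        ParaHyp.variationField F ≠ 0 →
        ContDiffAt ℝ 2 (fun t => ParaHyp.areaOn K (F t)) 0 ∧
          0 < iteratedDeriv 2 (fun t => ParaHyp.areaOn K (F t)) 0) ∧
      ((∀ x, ParaHyp.variationField F x ∈ ParaHyp.normalNeg m L x) →
        ParaHyp.variationField F ≠ 0 →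
        ContDiffAt ℝ 2 (fun t => ParaHyp.areaOn K (F t)) 0 ∧
          iteratedDeriv 2 (fun t => ParaHyp.areaOn K (F t)) 0 < 0)) ∧
    (∀ ξ : ParaHyp.Plane → ParaHyp.Mat (2 * m),
      ParaHyp.IsJacobiField σ ξ → HasCompactSupport ξ → ξ = 0) := by
  have hfac := fun i (hi : 1 ≤ i) (him : i + 1 ≤ 2 * m) x =>
    hσ.fac_le_half hdiv hm hΓ ρ hρ hi him x
  refine ⟨fun F ε K hV => ⟨fun hF h0 => ?_, fun hF h0 => ?_⟩, fun ξ hξ hc =>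
    hσ.jacobiField_eq_zero hm hdiv hfac hξ hc⟩
  · have h := hσ.area_second_deriv hm hdiv hfac (Or.inl rfl) hV (f := fun k => 2 * k - 1)
      (fun k hk => by
        rw [Finset.mem_Icc] at hk ⊢
        exact ⟨by omega, ParaHyp.eps_of_odd ⟨k - 1, by omega⟩⟩) hF h0
    rwa [one_mul] at h
  · have h := hσ.area_second_deriv hm hdiv hfac (Or.inr rfl) hV (f := fun k => 2 * k)
      (fun k hk => by
        rw [Finset.mem_Icc] at hk ⊢
        exact ⟨by omega, ParaHyp.eps_of_even ⟨k, by omega⟩⟩) hF h0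
    exact ⟨h.1, by linarith [h.2]⟩
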